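/- **Theorem (Existence of a dgLa for YM and GR about Minkowski).** Everything is over $\mathbb C$. Identify $\mathbb C^4$ with the $2\times 2$ matrices $k=\begin{pmatrix} a&b\\ c&d\end{pmatrix}$, set $k^+=k$, $k^-=k^T$, $\epsilon=\begin{pmatrix}0&1\\-1&0\end{pmatrix}$. For a half-integer $h\ge 1$ let $\Gamma_{\pm h}$ be the complex, depending on $k$, $$0\to S^{2h}\mathbb C^2\to S^{2h-1}\mathbb C^2\otimes\mathbb C^2\to S^{2h-2}\mathbb C^2\to 0$$ in degrees $1,2,3$, where the first map is the splitting $z^{\otimes 2h}\mapsto z^{\otimes(2h-1)}\otimes z$ followed by $\mathbb 1\otimes k^{\mp}\epsilon$, and the second is the splitting of $S^{2h-1}\mathbb C^2$ into $S^{2h-2}\mathbb C^2\otimes\mathbb C^2$ followed by $\mathbb 1\otimes(x\otimes y\mapsto x^T\epsilon k^{\pm}\epsilon y)$. The Lorentz group $SL(2,\mathbb C)\times SL(2,\mathbb C)$ acts on momenta by $(A,B)\cdot k=AkB^T$, on the symmetric tensors in $\Gamma_{h}$ through $A$ and on the factor $\mathbb C^2$ in degree 2 through $B$, and with $A,B$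 exchanged for $\Gamma_{-h}$. Let $h=1$ (YM) or $h=2$ (GR). For $h=1$ let $\mathfrak u$ be a finite-dimensional non-Abelian Lie algebra. Set $\Gamma=(\Gamma_{-1}\oplus\Gamma_1)\otimes\mathfrak u$ for YM and $\Gamma=\Gamma_{-2}\oplus\Gamma_2$ for GR, and let $\mathfrak h_k=\mathfrak h_k^-\oplus\mathfrak h_k^+$ be the homology of $\Gamma$ at $k$. Then there exists a dgLa $\mathfrak g$ with the following properties. 1. *Momentum grading.* $\mathfrak g=\bigoplus_{k\in\mathbb C^4}\mathfrak g_k$ (algebraic direct sum), compatible with the $\mathbb Z$-grading, with $d\mathfrak g_k\subset\mathfrak g_k$ and $[\mathfrak g_{k_1},\mathfrak g_{k_2}]\subset\mathfrak g_{k_1+k_2}$. There are a finite-dimensional graded vector space $V$ and graded isomorphisms $\mathfrak g_k\simeq V$ for which the differential and the bracket $\mathfrak g_{k_1}\otimes\mathfrak g_{k_2}\to\mathfrak g_{k_1+k_2}$ are arrays with entries in $\mathbb C[k]$ and $\mathbb C[k_1,k_2]$ respectively. 2. *Homology.* There are isomorphisms, one for every $k\ne0$, between $\mathfrak h_k$ and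 the homology of $\mathfrak g_k\simeq V$, such that every $k\neq 0$ has a Zariski open neighborhood in $\mathbb C^4-0$ on which the isomorphism is induced by a homotopy equivalence, that is, by maps $R:\Gamma\to V$, $L:V\to\Gamma$ of degree $0$ and $u\in\mathrm{End}(\Gamma)$, $u'\in\mathrm{End}(V)$ of degree $-1$ with $R,L$ chain maps, $LR=\mathbb 1-du-ud$, $RL=\mathbb 1-d'u'-u'd'$ ($d'$ the differential on $V$), given by four matrices whose entries are regular rational functions of $k$. 3. *Minimal model brackets.* Consider the homotopies $H$ on $\mathfrak g$ of degree $-1$ with $H^2=0$, $HdH=H$, $dHd=d$, $H\mathfrak g_k\subset\mathfrak g_k$; such $H$ exist. For $n\ge2$ the minimal model bracket is the signed sum over all trivalent trees with $n$ labelled inputs and one output, with $[-,-]$ at the nodes, $H$ on internal lines, and on inputs and output the maps $i$, $p$ of the contraction of $\mathfrak g$ to its homology induced by $H$. Let $k_1,\dots,k_n$ and $k_1+\dots+k_n$ be nonzero and suppose that all internal lines are off-shell: for all $J\subset\{1,\dots,n\}$ with $1<|J|<n$ the homology of $\mathfrak g_{k_J}$ vanishes, where $k_J=\sum_{i\in J}k_i$.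 Then through the isomorphisms in 2 the bracket is a map $$\mathfrak h^1_{k_1}\otimes\cdots\otimes\mathfrak h^1_{k_n}\to\mathfrak h^2_{k_1+\dots+k_n}$$ independent of $H$, and: - It is homogeneous of degree $3-2n$: since $\mathfrak h_{\lambda k}=\mathfrak h_k$ for $\lambda\in\mathbb C^\times$, the bracket at $(\lambda k_1,\dots,\lambda k_n)$ can be compared with the one at $(k_1,\dots,k_n)$, and it is $\lambda^{3-2n}$ times it. - For $n=2$ it is Lorentz invariant, with $\mathfrak u$ the trivial representation. For YM the $n=2$ bracket is an antisymmetric map times the Lie bracket of $\mathfrak u$. - For $n=2$ and $\sigma=\pm$ the maps $\mathfrak h^{1,-\sigma}\otimes\mathfrak h^{1,\sigma}\to\mathfrak h^{2,\sigma}$ do not identically vanish. In particular the bracket of $\mathfrak g$ is not trivial. -/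

import Mathlib

open scoped Matrix

noncomputable section

namespace TreeAmp

/-! ## Complexes, homology, homotopy equivalences -/

section Complexes

variable {C C' : Type*} [AddCommGroup C] [Module ℂ C] [AddCommGroup C'] [Module ℂ C']

/-- The homology `ker d / (im d ∩ ker d)` of an endomorphism `d` (used for differentials). -/
abbrev Homology (d : C →ₗ[ℂ] C) : Type _ :=
  LinearMap.ker d ⧸ (LinearMap.range d).comap (LinearMap.ker d).subtype

/-- The homology class of a cocycle. -/
def cls (d : C →ₗ[ℂ] C) (z : C) (hz : z ∈ LinearMap.ker d) : Homology d :=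
  Submodule.Quotient.mk ⟨z, hz⟩

/-- The part of the homology given by the classes of the cocycles in the subspace `S`. -/
def homologyPart (d : C →ₗ[ℂ] C) (S : Submodule ℂ C) : Submodule ℂ (Homology d) :=
  (S.comap (LinearMap.ker d).subtype).map
    ((LinearMap.range d).comap (LinearMap.ker d).subtype).mkQ

/-- `(R, L, u, u')` is a homotopy equivalence between the graded complexes `(C, d)` and
`(C', d')`: `R`, `L` are chain maps of degree `0` and `u`, `u'` have degree `-1`, with
`L R = 1 - d u - u d` and `R L = 1 - d' u' - u' d'`. -/
structure IsHomotopyEquivalence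
    (gr : ℤ → Submodule ℂ C) (d : C →ₗ[ℂ] C)
    (gr' : ℤ → Submodule ℂ C') (d' : C' →ₗ[ℂ] C')
    (R : C →ₗ[ℂ] C') (L : C' →ₗ[ℂ] C) (u : C →ₗ[ℂ] C) (u' : C' →ₗ[ℂ] C') : Prop where
  R_mem : ∀ (i : ℤ) (x : C), x ∈ gr i → R x ∈ gr' i
  L_mem : ∀ (i : ℤ) (x : C'), x ∈ gr' i → L x ∈ gr i
  u_mem : ∀ (i : ℤ) (x : C), x ∈ gr i → u x ∈ gr (i - 1)
  u'_mem : ∀ (i : ℤ) (x : C'), x ∈ gr' i → u' x ∈ gr' (i - 1)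
  R_chain : R ∘ₗ d = d' ∘ₗ R
  L_chain : L ∘ₗ d' = d ∘ₗ L
  LR : L ∘ₗ R = LinearMap.id - d ∘ₗ u - u ∘ₗ d
  RL : R ∘ₗ L = LinearMap.id - d' ∘ₗ u' - u' ∘ₗ d'

end Complexes

/-! ## Differential graded Lie algebras with a momentum grading -/

/-- A differential graded Lie algebra structure (over `ℂ`, `ℤ`-graded) on `L`. -/
structure DGLA (L : Type*) [AddCommGroup L] [Module ℂ L] where
  gr : ℤ → Submodule ℂ L
  isInternal : DirectSum.IsInternal gr
  d : L →ₗ[ℂ] L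
  bracket : L →ₗ[ℂ] L →ₗ[ℂ] L
  d_mem : ∀ (i : ℤ) (x : L), x ∈ gr i → d x ∈ gr (i + 1)
  bracket_mem : ∀ (i j : ℤ) (x y : L), x ∈ gr i → y ∈ gr j → bracket x y ∈ gr (i + j)
  d_d : ∀ x : L, d (d x) = 0
  antisymm : ∀ (i j : ℤ) (x y : L), x ∈ gr i → y ∈ gr j →
    bracket x y = -((i * j).negOnePow • bracket y x)
  jacobi : ∀ (i j l : ℤ) (x y z : L), x ∈ gr i → y ∈ gr j → z ∈ gr l →
    bracket x (bracket y z) + (i * (j + l)).negOnePow • bracket y (bracket z x)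
      + (l * (i + j)).negOnePow • bracket z (bracket x y) = 0
  leibniz : ∀ (i : ℤ) (x y : L), x ∈ gr i →
    d (bracket x y) = bracket (d x) y + i.negOnePow • bracket x (d y)

/-- A grading of a dgLa by an Abelian group `K` of momenta, compatible with the `ℤ`-grading,
the differential and the bracket. -/
structure MomentumGrading {L : Type*} [AddCommGroup L] [Module ℂ L] (A : DGLA L)
    (K : Type*) [AddCommGroup K] [DecidableEq K] where
  comp : K → Submodule ℂ L
  isInternal : DirectSum.IsInternal comp
  graded : ∀ k : K, comp k = ⨆ i : ℤ, comp k ⊓ A.gr i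
  d_mem : ∀ (k : K) (x : L), x ∈ comp k → A.d x ∈ comp k
  bracket_mem : ∀ (k₁ k₂ : K) (x y : L), x ∈ comp k₁ → y ∈ comp k₂ →
    A.bracket x y ∈ comp (k₁ + k₂)

/-! ## Minimal model brackets as sums of trivalent trees -/

/-- Planar trivalent trees with inputs labelled by elements of `Fin n` (the output is the root).
`node (node (leaf 0) (leaf 1)) (leaf 2)` stands for the parenthesization `((0 1) 2)`. -/
inductive PlanarTree (n : ℕ) : Type
  | leaf (j : Fin n) : PlanarTree n
  | node (l r : PlanarTree n) : PlanarTree n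

namespace PlanarTree

/-- The input labels, read from left to right. -/
def leaves {n : ℕ} : PlanarTree n → List (Fin n)
  | leaf j => [j]
  | node l r => leaves l ++ leaves r

/-- The leftmost input label. -/
def firstLeaf {n : ℕ} : PlanarTree n → Fin n
  | leaf j => j
  | node l _ => firstLeaf l

/-- At every node, the leftmost label of the left branch is smaller than the leftmost label of
the right branch (equivalently, the smallest label below the node lies in its left branch).
Every tree with distinct labels has exactly one planar embedding with this property. -/
def Normal {n : ℕ} : PlanarTree n → Prop
  | leaf _ => True
  | node l r => firstLeaf l < firstLeaf r ∧ Normal l ∧ Normal r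

/-- The trees `T_n` in which each of the `n` inputs occurs exactly once, each represented by its
normal planar embedding. -/
def treeSet (n : ℕ) : Set (PlanarTree n) :=
  {P | P.leaves.Perm (List.finRange n) ∧ P.Normal}

lemma leaves_length_pos {n : ℕ} (P : PlanarTree n) : 0 < P.leaves.length := by
  induction P with
  | leaf j => simp [leaves]
  | node l r hl hr => simp only [leaves, List.length_append]; omega

lemma finite_leaves_le (n m : ℕ) : {P : PlanarTree n | P.leaves.length ≤ m}.Finite := by
  induction m with
  | zero =>
    refine Set.Finite.subset Set.finite_empty ?_
    intro P hP
    have := leaves_length_pos P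
    simp only [Set.mem_ofPred_eq] at hP
    omega
  | succ m ih =>
    refine Set.Finite.subset
      ((Set.finite_range (leaf : Fin n → PlanarTree n)).union (Set.Finite.image2 node ih ih)) ?_
    intro P hP
    cases P with
    | leaf j => exact Or.inl ⟨j, rfl⟩
    | node l r =>
      right
      have h1 := leaves_length_pos l
      have h2 := leaves_length_pos r
      simp only [Set.mem_ofPred_eq, leaves, List.length_append] at hP
      exact ⟨l, by simp only [Set.mem_ofPred_eq]; omega, r, by simp only [Set.mem_ofPred_eq]; omega,
        rfl⟩

lemma finite_treeSet (n : ℕ) : (treeSet n).Finite := by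
  refine (finite_leaves_le n n).subset ?_
  rintro P ⟨hP, -⟩
  simp [hP.length_eq]

/-- The degree of the decorated line leaving `P` upwards, for inputs of degrees `e`:
the inputs are decorated by `i` (degree `0`) and the internal lines by `h` (degree `-1`). -/
def lineDeg {n : ℕ} (e : Fin n → ℤ) : PlanarTree n → ℤ
  | leaf j => e j
  | node l r => lineDeg e l + lineDeg e r - 1

end PlanarTree

/-- The signature of sorting a list of labels, where only the labels of even degree count. -/
def permSign {n : ℕ} (e : Fin n → ℤ) : List (Fin n) → ℤˣ
  | [] => 1
  | a :: w =>
    (w.map fun b => if b < a ∧ Even (e a) ∧ Even (e b) then (-1 : ℤˣ) else 1).prod * permSign e w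

/-- The sign `(-1)^(e_{n-1} + e_{n-3} + e_{n-5} + …)` for inputs numbered `1, …, n`;
the input with number `j + 1` is `j : Fin n`. -/
def globalSign {n : ℕ} (e : Fin n → ℤ) : ℤˣ :=
  (∑ j : Fin n, if Even (n - (j : ℕ)) then e j else 0).negOnePow

section MinimalModel

variable {L : Type*} [AddCommGroup L] [Module ℂ L] {A : DGLA L}
  {K : Type*} [AddCommGroup K] [DecidableEq K]

/-- A momentum-conserving homotopy `h` for the differential of the dgLa, with `d h d = d`. -/
structure Homotopy (M : MomentumGrading A K) where
  h : L →ₗ[ℂ] L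
  h_mem : ∀ (i : ℤ) (x : L), x ∈ A.gr i → h x ∈ A.gr (i - 1)
  h_mom : ∀ (k : K) (x : L), x ∈ M.comp k → h x ∈ M.comp k
  h_h : ∀ x : L, h (h x) = 0
  hdh : ∀ x : L, h (A.d (h x)) = h x
  dhd : ∀ x : L, A.d (h (A.d x)) = A.d x

namespace Homotopy

variable {M : MomentumGrading A K} (H : Homotopy M)

/-- The projection `π = 1 - d h - h d`. -/
def pi : L →ₗ[ℂ] L := LinearMap.id - A.d ∘ₗ H.h - H.h ∘ₗ A.d

lemma d_pi (x : L) : A.d (H.pi x) = 0 := by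
  simp [pi, A.d_d, H.dhd]

lemma pi_d (x : L) : H.pi (A.d x) = 0 := by
  simp [pi, A.d_d, H.dhd]

/-- The map `i` of the contraction to the homology that is induced by `h`. -/
def incl : Homology A.d →ₗ[ℂ] L :=
  Submodule.liftQ _ (H.pi ∘ₗ (LinearMap.ker A.d).subtype) (by
    rintro ⟨x, hx⟩ ⟨y, hy⟩
    simp only [Submodule.subtype_apply] at hy
    simp [← hy, H.pi_d])

/-- The map `p` of the contraction to the homology that is induced by `h`. -/
def proj : L →ₗ[ℂ] Homology A.d :=
  Submodule.mkQ _ ∘ₗ LinearMap.codRestrict (LinearMap.ker A.d) H.pi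
    (fun x => LinearMap.mem_ker.2 (H.d_pi x))

/-- The node decoration `⟦x, y⟧ = (-1)^x [x, y]` for `x` of degree `i`. -/
def nodeBracket (A : DGLA L) (i : ℤ) (x y : L) : L := i.negOnePow • A.bracket x y

/-- The value carried by the decorated line that leaves `P` upwards, as an internal line if `P`
is not a leaf, for the inputs `x j` of degree `e j`. -/
def line {n : ℕ} (e : Fin n → ℤ) (x : Fin n → Homology A.d) : PlanarTree n → L
  | .leaf j => H.incl (x j)
  | .node l r => H.h (nodeBracket A (l.lineDeg e) (line e x l) (line e x r))

/-- The value of the decorated tree without the signs that depend on the order of the inputs. -/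
def treeValue {n : ℕ} (e : Fin n → ℤ) (x : Fin n → Homology A.d) :
    PlanarTree n → Homology A.d
  | .leaf _ => 0
  | .node l r => H.proj (nodeBracket A (l.lineDeg e) (H.line e x l) (H.line e x r))

/-- The contribution `m_{P,h}` of a tree to the minimal model bracket. -/
def treeMap {n : ℕ} (e : Fin n → ℤ) (x : Fin n → Homology A.d) (P : PlanarTree n) :
    Homology A.d :=
  (globalSign e * permSign e P.leaves) • H.treeValue e x P

/-- The minimal model bracket `{x_1, …, x_n}_h` (`n ≥ 2`) of homology classes `x_j` of degrees
`e j`: the sum over all trivalent trees. -/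
def minimalModelBracket {n : ℕ} (e : Fin n → ℤ) (x : Fin n → Homology A.d) : Homology A.d :=
  ∑ P ∈ (PlanarTree.finite_treeSet n).toFinset, H.treeMap e x P

end Homotopy

/-- A momentum `k` is off-shell if the homology of `𝔤_k` vanishes. -/
def OffShell (M : MomentumGrading A K) (k : K) : Prop :=
  homologyPart A.d (M.comp k) = ⊥

/-- All internal lines are off-shell. -/
def InternalOffShell (M : MomentumGrading A K) {n : ℕ} (k : Fin n → K) : Prop :=
  ∀ J : Finset (Fin n), 1 < J.card → J.card < n → OffShell M (∑ j ∈ J, k j)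

end MinimalModel

/-! ## Momentum space `ℂ⁴`, polynomial and regular rational families -/

/-- Momentum space `ℂ⁴`: the matrices `k = (a b; c d)`. -/
abbrev Mom : Type := Matrix (Fin 2) (Fin 2) ℂ

/-- The value at `k` of a polynomial in the four entries of `k`. -/
def polyEval (P : MvPolynomial (Fin 2 × Fin 2) ℂ) (k : Mom) : ℂ :=
  MvPolynomial.eval (fun s => k s.1 s.2) P

/-- The value at `(k₁, k₂)` of a polynomial in the eight entries of `k₁`, `k₂`. -/
def polyEval₂ (P : MvPolynomial ((Fin 2 × Fin 2) ⊕ (Fin 2 × Fin 2)) ℂ) (k₁ k₂ : Mom) : ℂ :=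
  MvPolynomial.eval (Sum.elim (fun s => k₁ s.1 s.2) (fun s => k₂ s.1 s.2)) P

def IsZariskiOpen (O : Set Mom) : Prop :=
  ∃ S : Set (MvPolynomial (Fin 2 × Fin 2) ℂ), O = {k | ∃ P ∈ S, polyEval P k ≠ 0}

section Families

variable {V W : Type*} [AddCommGroup V] [Module ℂ V] [AddCommGroup W] [Module ℂ W]

/-- The matrix of `T k` (in any bases) has entries in `ℂ[k]`. -/
def IsPolynomial (T : Mom → V →ₗ[ℂ] W) : Prop :=
  ∀ (v : V) (φ : W →ₗ[ℂ] ℂ), ∃ P : MvPolynomial (Fin 2 × Fin 2) ℂ,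
    ∀ k : Mom, φ (T k v) = polyEval P k

/-- The array of `T k₁ k₂` (in any basis) has entries in `ℂ[k₁, k₂]`. -/
def IsPolynomial₂ (T : Mom → Mom → V →ₗ[ℂ] V →ₗ[ℂ] V) : Prop :=
  ∀ (v w : V) (φ : V →ₗ[ℂ] ℂ),
    ∃ P : MvPolynomial ((Fin 2 × Fin 2) ⊕ (Fin 2 × Fin 2)) ℂ,
      ∀ k₁ k₂ : Mom, φ (T k₁ k₂ v w) = polyEval₂ P k₁ k₂

/-- The matrix of `T k` (in any bases) has entries that are rational functions of `k` without
poles on `O`. -/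
def IsRegularOn (O : Set Mom) (T : Mom → V →ₗ[ℂ] W) : Prop :=
  ∀ (v : V) (φ : W →ₗ[ℂ] ℂ), ∃ P Q : MvPolynomial (Fin 2 × Fin 2) ℂ,
    ∀ k ∈ O, polyEval Q k ≠ 0 ∧ φ (T k v) = polyEval P k / polyEval Q k

end Families

/-! ## The Lorentz equivariant complexes -/

/-- The matrix `ε`. -/
def eps : Mom := !![0, 1; -1, 0]

/-- `k^+ = k` and `k^- = kᵀ`. -/
def signedMom (σ : ℤˣ) (k : Mom) : Mom := if σ = 1 then k else kᵀ

/-- Basis indices of `Γ_{±h}`, with `N = 2h ≥ 1`: the three summands are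
`S^N ℂ²`, `ℂ² ⊗ S^(N-1) ℂ²` and `S^(N-2) ℂ²` (which is zero for `N = 1`), in degrees `1, 2, 3`.
A symmetric tensor in `S^m ℂ²` is given by its components `t_j`, `0 ≤ j ≤ m`, where `t_j` is the
common value of the tensor components with `m - j` indices `0` and `j` indices `1`. -/
abbrev GammaIdx (N : ℕ) : Type := Fin (N + 1) ⊕ (Fin 2 × Fin N) ⊕ Fin (N - 1)

/-- The homological degree. -/
def gammaDeg {N : ℕ} : GammaIdx N → ℤ
  | Sum.inl _ => 1
  | Sum.inr (Sum.inl _) => 2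
  | Sum.inr (Sum.inr _) => 3

/-- The matrix of the differential of `Γ_{σh}`, `N = 2h`, at momentum `k`. In components the
splitting `S^m ℂ² → S^(m-1) ℂ² ⊗ ℂ²`, `z^{⊗ m} ↦ z^{⊗ (m-1)} ⊗ z`, is
`t ↦ (t_{j + γ})_{j, γ}`. The first differential is splitting followed by `k^∓ ε` on the factor
`ℂ²`; the second is splitting followed by the contraction
`x ⊗ y ↦ xᵀ ε k^± ε y`, with `x` from the splitting and `y` the original factor `ℂ²`. -/
def gammaMatrix (N : ℕ) (σ : ℤˣ) (k : Mom) : GammaIdx N → GammaIdx N → ℂ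
  | Sum.inr (Sum.inl (β, j)), Sum.inl i =>
      ∑ γ : Fin 2, if (i : ℕ) = j + γ then (signedMom (-σ) k * eps) β γ else 0
  | Sum.inr (Sum.inr j), Sum.inr (Sum.inl (y, l)) =>
      ∑ x : Fin 2, if (l : ℕ) = j + x then (eps * signedMom σ k * eps) x y else 0
  | _, _ => 0

/-- The matrix of `S^m A` acting on the components `t_j` of symmetric tensors:
`(S^m A t)_i = ∑_J (∏_l A_{I_l J_l}) t_{|J|}` where `I = (1,…,1,0,…,0)` has `i` entries `1`, the
sum is over all `J ∈ {0,1}^m`, and `|J|` is the number of entries `1` of `J`. -/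
def symPow (m : ℕ) (A : Mom) (i j : ℕ) : ℂ :=
  ∑ J : Fin m → Fin 2, if ∑ l, (J l : ℕ) = j then
    ∏ l : Fin m, A (if (l : ℕ) < i then 1 else 0) (J l) else 0

/-- The action of `A` on the symmetric tensors and of `B` on the factor `ℂ²` in degree `2`. -/
def lorentzMatrix (N : ℕ) (A B : Mom) : GammaIdx N → GammaIdx N → ℂ
  | Sum.inl i, Sum.inl i' => symPow N A i i'
  | Sum.inr (Sum.inl (β, j)), Sum.inr (Sum.inl (β', j')) => B β β' * symPow (N - 1) A j j'
  | Sum.inr (Sum.inr j), Sum.inr (Sum.inr j') => symPow (N - 2) A j j'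
  | _, _ => 0

section Gamma

variable (N : ℕ) (U : Type*) [AddCommGroup U] [Module ℂ U]

/-- A scalar matrix acting on families with coefficients in `U`. -/
def coeffMap {ι : Type*} [Fintype ι] (M : ι → ι → ℂ) : (ι → U) →ₗ[ℂ] (ι → U) :=
  LinearMap.pi fun i => ∑ j, M i j • LinearMap.proj j

/-- The underlying space of `Γ_{σh} ⊗ U`, with `N = 2h`: coefficients in `U` relative to the
basis of `Γ_{σh}`. -/
abbrev GammaSpace : Type _ := GammaIdx N → U

/-- The differential of `Γ_{σh} ⊗ U` at momentum `k`. -/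
def gammaD (σ : ℤˣ) (k : Mom) : GammaSpace N U →ₗ[ℂ] GammaSpace N U :=
  coeffMap U (gammaMatrix N σ k)

/-- The underlying space of `(Γ_{-h} ⊕ Γ_h) ⊗ U`; the summands are labelled by `σ = ±1`. -/
abbrev PairSpace : Type _ := ℤˣ → GammaSpace N U

/-- The differential of `(Γ_{-h} ⊕ Γ_h) ⊗ U` at momentum `k`. -/
def pairD (k : Mom) : PairSpace N U →ₗ[ℂ] PairSpace N U :=
  LinearMap.pi fun σ => gammaD N U σ k ∘ₗ LinearMap.proj σ

/-- The elements of `(Γ_{-h} ⊕ Γ_h) ⊗ U` of homological degree `i`. -/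
def pairGr (i : ℤ) : Submodule ℂ (PairSpace N U) where
  carrier := {w | ∀ (σ : ℤˣ) (a : GammaIdx N), gammaDeg a ≠ i → w σ a = 0}
  add_mem' := fun hv hw σ a h => by simp [hv σ a h, hw σ a h]
  zero_mem' := fun _ _ _ => rfl
  smul_mem' := fun c _ hw σ a h => by simp [hw σ a h]

/-- The (complex, spin) Lorentz group `SL(2,ℂ) × SL(2,ℂ)`. -/
abbrev Lorentz : Type :=
  Matrix.SpecialLinearGroup (Fin 2) ℂ × Matrix.SpecialLinearGroup (Fin 2) ℂ

/-- The Lorentz action `k ↦ A k Bᵀ` on momenta. -/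
def lorentzMom (g : Lorentz) (k : Mom) : Mom := (g.1 : Mom) * k * (g.2 : Mom)ᵀ

/-- The Lorentz action on `(Γ_{-h} ⊕ Γ_h) ⊗ U`, trivial on `U`: the left factor acts on the
symmetric tensors of `Γ_h` and on the factor `ℂ²` of `Γ_{-h}`, the right factor on the others. -/
def lorentzPair (g : Lorentz) : PairSpace N U →ₗ[ℂ] PairSpace N U :=
  LinearMap.pi fun σ =>
    coeffMap U (if σ = 1 then lorentzMatrix N g.1 g.2 else lorentzMatrix N g.2 g.1)
      ∘ₗ LinearMap.proj σ

variable {N U}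

/-- The element `z ⊗ a` of `(Γ_{-h} ⊕ Γ_h) ⊗ U`. -/
def pureTensor (z : PairSpace N ℂ) (a : U) : PairSpace N U := fun σ b => z σ b • a

end Gamma

/-! ## The dgLa in question -/

/-- A dgLa with a `ℂ⁴` momentum grading, all of whose momentum components `𝔤_k` are identified
with one finite-dimensional graded vector space `V`, such that the differential and the bracket
are arrays with polynomial entries. -/
structure PolynomialDGLA where
  L : Type
  [instAddL : AddCommGroup L]
  [instModL : Module ℂ L]
  A : DGLA L
  M : MomentumGrading A Mom
  V : Type
  [instAddV : AddCommGroup V]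
  [instModV : Module ℂ V]
  [instFin : FiniteDimensional ℂ V]
  grV : ℤ → Submodule ℂ V
  isInternalV : DirectSum.IsInternal grV
  e : ∀ k : Mom, V ≃ₗ[ℂ] M.comp k
  e_mem : ∀ (k : Mom) (i : ℤ) (v : V), v ∈ grV i ↔ (e k v : L) ∈ A.gr i
  dV : Mom → V →ₗ[ℂ] V
  bracketV : Mom → Mom → V →ₗ[ℂ] V →ₗ[ℂ] V
  d_eq : ∀ (k : Mom) (v : V), A.d (e k v) = e k (dV k v)
  bracket_eq : ∀ (k₁ k₂ : Mom) (v w : V),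
    A.bracket (e k₁ v) (e k₂ w) = e (k₁ + k₂) (bracketV k₁ k₂ v w)
  dV_poly : IsPolynomial dV
  bracketV_poly : IsPolynomial₂ bracketV

attribute [instance] PolynomialDGLA.instAddL PolynomialDGLA.instModL PolynomialDGLA.instAddV
  PolynomialDGLA.instModV PolynomialDGLA.instFin

section Properties

variable {N : ℕ} {U : Type*} [AddCommGroup U] [Module ℂ U] (X : PolynomialDGLA)
  (Φ : ∀ k : Mom, Homology (pairD N U k) →ₗ[ℂ] Homology X.A.d)

/-- For every `k ≠ 0`, `Φ k` is an isomorphism from the homology of `(Γ_{-h} ⊕ Γ_h) ⊗ U` at `k`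
onto the homology `𝔥_k` of `𝔤_k`. -/
def IsHomologyIso : Prop :=
  ∀ k : Mom, k ≠ 0 → Function.Injective (Φ k) ∧
    LinearMap.range (Φ k) = homologyPart X.A.d (X.M.comp k)

/-- Every `k₀ ≠ 0` has a Zariski open neighborhood `O ⊆ ℂ⁴ - 0` on which `Φ` is induced by a
homotopy equivalence given by four matrices with regular rational entries. -/
def IsLocallyRegular : Prop :=
  ∀ k₀ : Mom, k₀ ≠ 0 → ∃ O : Set Mom, IsZariskiOpen O ∧ k₀ ∈ O ∧ (0 : Mom) ∉ O ∧
    ∃ (R : Mom → PairSpace N U →ₗ[ℂ] X.V) (L : Mom → X.V →ₗ[ℂ] PairSpace N U)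
      (u : Mom → PairSpace N U →ₗ[ℂ] PairSpace N U) (u' : Mom → X.V →ₗ[ℂ] X.V),
      IsRegularOn O R ∧ IsRegularOn O L ∧ IsRegularOn O u ∧ IsRegularOn O u' ∧
      ∀ k ∈ O,
        IsHomotopyEquivalence (pairGr N U) (pairD N U k) X.grV (X.dV k) (R k) (L k) (u k) (u' k) ∧
        ∀ (z : PairSpace N U) (hz : z ∈ LinearMap.ker (pairD N U k)),
          ∃ hz' : (X.e k (R k z) : X.L) ∈ LinearMap.ker X.A.d,
            Φ k (cls (pairD N U k) z hz) = cls X.A.d (X.e k (R k z)) hz'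

/-- The minimal model bracket, transported through `Φ` and viewed as a map
`𝔥¹_{k_1} ⊗ ⋯ ⊗ 𝔥¹_{k_n} → 𝔥²_{k_1 + ⋯ + k_n}`, sends the classes of the degree one cocycles
`z_1, …, z_n` to the class of the degree two cocycle `y`, whichever homotopy is used. -/
def BracketIs {n : ℕ} (k : Fin n → Mom) (z : Fin n → PairSpace N U) (y : PairSpace N U) : Prop :=
  (∀ j, z j ∈ pairGr N U 1) ∧ y ∈ pairGr N U 2 ∧
  ∃ (hz : ∀ j, z j ∈ LinearMap.ker (pairD N U (k j)))
    (hy : y ∈ LinearMap.ker (pairD N U (∑ j, k j))),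
    ∀ H : Homotopy X.M,
      H.minimalModelBracket (fun _ => 1) (fun j => Φ (k j) (cls (pairD N U (k j)) (z j) (hz j)))
        = Φ (∑ j, k j) (cls (pairD N U (∑ j, k j)) y hy)

/-- The external momenta `k_1, …, k_n` and `k_1 + ⋯ + k_n` are nonzero, and all internal lines
are off-shell. -/
def Admissible {n : ℕ} (k : Fin n → Mom) : Prop :=
  (∀ j, k j ≠ 0) ∧ ∑ j, k j ≠ 0 ∧ InternalOffShell X.M k

/-- Momentum-conserving homotopies exist, and at admissible momenta the minimal model bracket is
a map `𝔥¹_{k_1} ⊗ ⋯ ⊗ 𝔥¹_{k_n} → 𝔥²_{k_1 + ⋯ + k_n}` that does not depend on the homotopy. -/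
def BracketWellDefined : Prop :=
  Nonempty (Homotopy X.M) ∧
  ∀ n : ℕ, 2 ≤ n → ∀ k : Fin n → Mom, Admissible X k → ∀ z : Fin n → PairSpace N U,
    (∀ j, z j ∈ pairGr N U 1) → (∀ j, z j ∈ LinearMap.ker (pairD N U (k j))) →
      ∃ y, BracketIs X Φ k z y

/-- The minimal model brackets are homogeneous of degree `3 - 2n`, using that cocycles and
coboundaries are the same at `k` and at `λ k`. -/
def BracketHomogeneous : Prop :=
  ∀ n : ℕ, 2 ≤ n → ∀ k : Fin n → Mom, Admissible X k → ∀ c : ℂ, c ≠ 0 →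
    ∀ (z : Fin n → PairSpace N U) (y : PairSpace N U), BracketIs X Φ k z y →
      BracketIs X Φ (fun j => c • k j) z (c ^ (3 - 2 * (n : ℤ)) • y)

/-- The minimal model bracket with two inputs is Lorentz invariant. -/
def BracketLorentzInvariant : Prop :=
  ∀ k : Fin 2 → Mom, Admissible X k → ∀ (g : Lorentz)
    (z : Fin 2 → PairSpace N U) (y : PairSpace N U), BracketIs X Φ k z y →
      BracketIs X Φ (fun j => lorentzMom g (k j)) (fun j => lorentzPair N U g (z j))
        (lorentzPair N U g y)

/-- For `σ = ±` the maps `𝔥^{1,-σ} ⊗ 𝔥^{1,σ} → 𝔥^{2,σ}` given by the minimal model bracket with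
two inputs do not identically vanish. -/
def BracketMixedNonvanishing : Prop :=
  ∀ σ : ℤˣ, ∃ (k : Fin 2 → Mom) (z : Fin 2 → PairSpace N U) (y : PairSpace N U),
    Admissible X k ∧ BracketIs X Φ k z y ∧ z 0 σ = 0 ∧ z 1 (-σ) = 0 ∧
    y σ ∉ LinearMap.range (gammaD N U σ (∑ j, k j))

/-- All the properties that are common to the two theories. -/
structure IsFieldTheoryModel : Prop where
  homologyIso : IsHomologyIso X Φ
  locallyRegular : IsLocallyRegular X Φ
  wellDefined : BracketWellDefined X Φ
  homogeneous : BracketHomogeneous X Φ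
  lorentzInvariant : BracketLorentzInvariant X Φ
  mixedNonvanishing : BracketMixedNonvanishing X Φ
  bracket_ne_zero : ∃ x y : X.L, X.A.bracket x y ≠ 0

end Properties

/-- The minimal model bracket with two inputs is an antisymmetric map `b` times the Lie bracket
of `𝔲`: the bracket of the classes of `z₁ ⊗ x₁` and `z₂ ⊗ x₂` is the class of
`b(z₁, z₂) ⊗ [x₁, x₂]`, and `b(z₂, z₁) = - b(z₁, z₂)` in homology. -/
def BracketProportionalToLie {N : ℕ} {𝔲 : Type*} [LieRing 𝔲] [LieAlgebra ℂ 𝔲]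
    (X : PolynomialDGLA)
    (Φ : ∀ k : Mom, Homology (pairD N 𝔲 k) →ₗ[ℂ] Homology X.A.d) : Prop :=
  ∃ b : Mom → Mom → PairSpace N ℂ →ₗ[ℂ] PairSpace N ℂ →ₗ[ℂ] PairSpace N ℂ,
    ∀ k₁ k₂ : Mom, k₁ ≠ 0 → k₂ ≠ 0 → k₁ + k₂ ≠ 0 →
      ∀ z₁ z₂ : PairSpace N ℂ, z₁ ∈ pairGr N ℂ 1 → z₂ ∈ pairGr N ℂ 1 →
        z₁ ∈ LinearMap.ker (pairD N ℂ k₁) → z₂ ∈ LinearMap.ker (pairD N ℂ k₂) →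
          (∀ x₁ x₂ : 𝔲, BracketIs X Φ ![k₁, k₂] ![pureTensor z₁ x₁, pureTensor z₂ x₂]
            (pureTensor (b k₁ k₂ z₁ z₂) ⁅x₁, x₂⁆)) ∧
          b k₂ k₁ z₂ z₁ + b k₁ k₂ z₁ z₂ ∈ LinearMap.range (pairD N ℂ (k₁ + k₂))

end TreeAmp

end

/-!
A momentum graded dgLa as required is the same as polynomial data on one fibre `V`, a differential
`d k` and brackets `V ⊗ V → V` that depend on the momenta (`FiberDGLA`). Both theories are given in
first order form, and their fibres are made of forms on `ℂ⁴`, on which the exterior derivative at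
momentum `k` is the wedge product with a one-form `oneForm k`. That complex is acyclic for `k ≠ 0`,
by contraction with a vector dual to `k` (`contract_wedge_add`). The complex `Γ_1` sits in the
self-dual two-forms, the three-forms and the volume forms (`psiPlus`), and `Γ_{-1}` likewise
(`psiMinus`).

* General relativity: forms with values in the Lie algebra of translations and rotations, that is,
  vielbein and connection, form a dgLa (`LieAction`) whose differential is the bracket with the
  vielbein of Minkowski spacetime. Splitting symmetric tensors embeds `Γ_{-2} ⊕ Γ_2` as the Weyl
  curvatures. They are exactly the sums of self-dual and anti-self-dual rotation valued forms that
  satisfy the Bianchi identity, hence an ideal (`gravityPsi_ideal`), and `gravity` is the quotient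
  by it.
* Yang-Mills theory: pairs of a form (the gauge field) and an element of `Γ_1` (an auxiliary
  self-dual two-form) form a commutative dg algebra, in which `Γ_{-1}` is an ideal. The quotient
  `yangMills`, tensored with the Lie algebra, is the dgLa.

Homology: the ambient complex is acyclic for gravity, and for Yang-Mills it has the homology of
`Γ_1`. In the quotient the connecting homomorphism therefore gives a polynomial chain map to the
Lorentz equivariant complex that is a quasi-isomorphism for `k ≠ 0` (`Presentation.quasiIso`). Its
mapping cone has a contraction at each `k₀ ≠ 0`, and correcting it by the inverse of a matrix that
is the identity at `k₀` gives the regular homotopy equivalences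
(`exists_regular_homotopyEquivalence`).

Minimal model brackets: if the internal lines are off-shell, the sums over trees with inputs in
`J`, for all `J ≠ {1, …, n}`, solve the Maurer-Cartan equation in formal parameters with square zero
(`isPerturbiner_treeSum`), and the bracket is, up to a sign, the class of the obstruction to
extending this solution to the top order. Any two solutions whose starting values have the same
homology classes are gauge equivalent (`IsPerturbiner.obstruction_unique`), so the bracket can be
computed from any solution (`FieldTheoryData.bracketIs_iff`). It is therefore independent of the
homotopy, and a linear map of the fibre that covers a transformation of the momenta and rescales
differential and bracket carries brackets to brackets (`FieldTheoryData.IsSymmetry.bracketIs`). The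
dilations, which rescale the gravitational connection and the auxiliary two-form but neither the
vielbein nor the gauge field, give the homogeneity, and the Lorentz group acts on all forms
compatibly with the embeddings. Products of explicit plane waves show that the brackets with two
inputs do not vanish.
-/

noncomputable section

set_option linter.unusedSectionVars false

/-! ### Graded vector spaces and contractions -/

namespace TreeAmp

section Graded

variable {V : Type*} [AddCommGroup V] [Module ℂ V]

theorem isInternal_of_projections {ι : Type*} [DecidableEq ι] (gr : ι → Submodule ℂ V)
    (p : ι → V →ₗ[ℂ] V) (h_id : ∀ i, ∀ x ∈ gr i, p i x = x)
    (h_ne : ∀ i j, i ≠ j → ∀ x ∈ gr j, p i x = 0) (h_top : ∀ x, x ∈ ⨆ i, gr i) :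
    DirectSum.IsInternal gr := by
  constructor
  · refine (injective_iff_map_eq_zero (DirectSum.coeAddMonoidHom gr)).2 fun f hf => ?_
    have key : ∀ (g : DirectSum ι fun i => gr i) (i : ι),
        p i (DirectSum.coeAddMonoidHom gr g) = g i := by
      intro g i
      induction g using DirectSum.induction_on with
      | zero => simp
      | of j x =>
        rw [DirectSum.coeAddMonoidHom_of]
        by_cases hij : j = i
        · subst hij
          rw [h_id _ _ x.2, DirectSum.of_eq_same]
        · rw [h_ne i j (Ne.symm hij) _ x.2, DirectSum.of_eq_of_ne _ _ _ (Ne.symm hij)]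
          rfl
      | add a b ha hb => rw [map_add, map_add, ha, hb]; rfl
    ext i
    rw [← key f i, hf]
    simp
  · intro x
    have : x ∈ LinearMap.range (DirectSum.coeLinearMap gr) := by
      rw [DirectSum.range_coeLinearMap]
      exact h_top x
    exact this

/-- An internal direct sum, as an isomorphism from the external one. -/
def gradedEquiv {ι : Type*} [DecidableEq ι] {gr : ι → Submodule ℂ V}
    (h : DirectSum.IsInternal gr) : (DirectSum ι fun i => gr i) ≃ₗ[ℂ] V :=
  LinearEquiv.ofBijective (DirectSum.coeLinearMap gr) (show Function.Bijective _ from h)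

/-- The projection onto a homogeneous component of an internal direct sum. -/
def gradedProj {ι : Type*} [DecidableEq ι] {gr : ι → Submodule ℂ V}
    (h : DirectSum.IsInternal gr) (i : ι) : V →ₗ[ℂ] V :=
  (gr i).subtype ∘ₗ DirectSum.component ℂ ι (fun i => gr i) i ∘ₗ
    (gradedEquiv h).symm.toLinearMap

section

variable {ι : Type*} [DecidableEq ι] {gr : ι → Submodule ℂ V} (h : DirectSum.IsInternal gr)

theorem gradedProj_mem (i : ι) (x : V) : gradedProj h i x ∈ gr i := by
  simp [gradedProj]

theorem gradedEquiv_symm_of_mem {i : ι} {x : V} (hx : x ∈ gr i) :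
    (gradedEquiv h).symm x =
      DirectSum.lof ℂ ι (fun i => gr i) i ⟨x, hx⟩ := by
  rw [LinearEquiv.symm_apply_eq]
  exact (DirectSum.coeLinearMap_lof gr i ⟨x, hx⟩).symm

theorem gradedProj_of_mem {i : ι} {x : V} (hx : x ∈ gr i) : gradedProj h i x = x := by
  simp only [gradedProj, LinearMap.comp_apply, LinearEquiv.coe_coe,
    gradedEquiv_symm_of_mem h hx, DirectSum.component.lof_self]
  rfl

theorem gradedProj_of_mem_ne {i j : ι} (hij : i ≠ j) {x : V} (hx : x ∈ gr j) :
    gradedProj h i x = 0 := by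
  simp only [gradedProj, LinearMap.comp_apply, LinearEquiv.coe_coe,
    gradedEquiv_symm_of_mem h hx, DirectSum.component.of, dif_neg (Ne.symm hij), map_zero]

include h in
theorem gradedInduction {p : V → Prop} (x : V) (hmem : ∀ i, ∀ x ∈ gr i, p x) (h0 : p 0)
    (hadd : ∀ x y, p x → p y → p (x + y)) : p x := by
  have hx : x ∈ ⨆ i, gr i := by rw [h.submodule_iSup_eq_top]; trivial
  exact Submodule.iSup_induction gr (motive := p) hx hmem h0 hadd

include h in
/-- Uniqueness of the homogeneous components. -/
theorem mem_of_gradedProj_eq {i : ι} {x : V} (hx : ∀ j, j ≠ i → gradedProj h j x = 0) :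
    x ∈ gr i := by
  have : x - gradedProj h i x = 0 := by
    have key : ∀ j, gradedProj h j (x - gradedProj h i x) = 0 := by
      intro j
      by_cases hj : j = i
      · subst hj
        rw [map_sub, gradedProj_of_mem h (gradedProj_mem h j x), sub_self]
      · rw [map_sub, hx j hj, gradedProj_of_mem_ne h hj (gradedProj_mem h i x), sub_zero]
    have h2 : (gradedEquiv h).symm
        (x - gradedProj h i x) = 0 := by
      refine DFinsupp.ext fun j => Subtype.ext ?_
      exact key j
    exact (LinearEquiv.map_eq_zero_iff _).1 h2
  rw [sub_eq_zero] at this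
  rw [this]
  exact gradedProj_mem h i x

end

section

variable {W : Type*} [AddCommGroup W] [Module ℂ W]

/-- The part of a linear map that shifts degrees by `s`. -/
def homogeneousPart {gr : ℤ → Submodule ℂ V} (h : DirectSum.IsInternal gr)
    {gr' : ℤ → Submodule ℂ W} (h' : DirectSum.IsInternal gr') (s : ℤ) (f : V →ₗ[ℂ] W) :
    V →ₗ[ℂ] W :=
  DirectSum.toModule ℂ ℤ W (fun i => gradedProj h' (i + s) ∘ₗ f ∘ₗ (gr i).subtype) ∘ₗ
    (gradedEquiv h).symm.toLinearMap

theorem homogeneousPart_of_mem {gr : ℤ → Submodule ℂ V} (h : DirectSum.IsInternal gr)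
    {gr' : ℤ → Submodule ℂ W} (h' : DirectSum.IsInternal gr') (s : ℤ) (f : V →ₗ[ℂ] W)
    {i : ℤ} {x : V} (hx : x ∈ gr i) :
    homogeneousPart h h' s f x = gradedProj h' (i + s) (f x) := by
  simp [homogeneousPart, gradedEquiv_symm_of_mem h hx]

end

/-- Every linear endomorphism of a vector space has a generalized inverse. -/
theorem exists_generalizedInverse (d : V →ₗ[ℂ] V) : ∃ g : V →ₗ[ℂ] V, d ∘ₗ g ∘ₗ d = d := by
  obtain ⟨s, hs⟩ := d.rangeRestrict.exists_rightInverse_of_surjective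
    (LinearMap.range_rangeRestrict d)
  obtain ⟨p, hp⟩ := (LinearMap.range d).subtype.exists_leftInverse_of_injective
    (Submodule.ker_subtype _)
  refine ⟨s ∘ₗ p, ?_⟩
  ext x
  have h1 : p (d x) = d.rangeRestrict x := LinearMap.congr_fun hp (d.rangeRestrict x)
  have h2 : d.rangeRestrict (s (d.rangeRestrict x)) = d.rangeRestrict x :=
    LinearMap.congr_fun hs _
  simp only [LinearMap.comp_apply, h1]
  exact congrArg Subtype.val h2

/-- A differential on a graded vector space admits a homotopy of degree `-1` satisfying all side
conditions. -/
theorem exists_gradedHomotopy {gr : ℤ → Submodule ℂ V} (h : DirectSum.IsInternal gr)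
    (d : V →ₗ[ℂ] V) (d_mem : ∀ i, ∀ x ∈ gr i, d x ∈ gr (i + 1)) (d_d : ∀ x, d (d x) = 0) :
    ∃ u : V →ₗ[ℂ] V, (∀ i, ∀ x ∈ gr i, u x ∈ gr (i - 1)) ∧ (∀ x, u (u x) = 0) ∧
      (∀ x, u (d (u x)) = u x) ∧ ∀ x, d (u (d x)) = d x := by
  obtain ⟨g, hg⟩ := exists_generalizedInverse d
  have hg' : ∀ x, d (g (d x)) = d x := fun x => LinearMap.congr_fun hg x
  have dproj : ∀ (i : ℤ) (x : V), d (gradedProj h i x) = gradedProj h (i + 1) (d x) := by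
    intro i x
    refine gradedInduction h (p := fun x => d (gradedProj h i x) = gradedProj h (i + 1) (d x)) x
      ?_ (by simp) fun x y hx hy => by simp only [map_add, hx, hy]
    intro j x hx
    by_cases hij : i = j
    · subst hij
      rw [gradedProj_of_mem h hx, gradedProj_of_mem h (d_mem _ _ hx)]
    · rw [gradedProj_of_mem_ne h hij hx, gradedProj_of_mem_ne h _ (d_mem _ _ hx), map_zero]
      omega
  set g₁ : V →ₗ[ℂ] V := homogeneousPart h h (-1) g with hg₁
  have g₁_mem : ∀ i, ∀ x ∈ gr i, g₁ x ∈ gr (i - 1) := by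
    intro i x hx
    rw [hg₁, homogeneousPart_of_mem h h _ _ hx]
    exact gradedProj_mem h _ _
  have dgd : ∀ x, d (g₁ (d x)) = d x := by
    intro x
    refine gradedInduction h (p := fun x => d (g₁ (d x)) = d x) x
      ?_ (by simp) fun x y hx hy => by simp only [map_add, hx, hy]
    intro i x hx
    rw [hg₁, homogeneousPart_of_mem h h _ _ (d_mem _ _ hx), dproj, hg']
    exact gradedProj_of_mem h (by simpa using d_mem _ _ hx)
  set g₂ : V →ₗ[ℂ] V := g₁ ∘ₗ d ∘ₗ g₁ with hg₂
  have g₂_mem : ∀ i, ∀ x ∈ gr i, g₂ x ∈ gr (i - 1) := by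
    intro i x hx
    have := g₁_mem _ _ (d_mem _ _ (g₁_mem _ _ hx))
    simpa [hg₂] using this
  have dgd₂ : ∀ x, d (g₂ (d x)) = d x := fun x => by simp [hg₂, dgd]
  have gdg₂ : ∀ x, g₂ (d (g₂ x)) = g₂ x := fun x => by simp [hg₂, dgd]
  refine ⟨g₂ - g₂ ∘ₗ g₂ ∘ₗ d, ?_, ?_, ?_, ?_⟩
  · intro i x hx
    have h2 := g₂_mem _ _ (g₂_mem _ _ (d_mem _ _ hx))
    have h3 : i + 1 - 1 - 1 = i - 1 := by ring
    rw [h3] at h2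
    exact Submodule.sub_mem _ (g₂_mem _ _ hx) h2
  · intro x; simp [gdg₂]
  · intro x; simp [gdg₂, d_d]
  · intro x; simp [d_d, dgd₂]

/-- An acyclic graded complex has a contraction of degree `-1`. -/
theorem exists_gradedContraction {gr : ℤ → Submodule ℂ V} (h : DirectSum.IsInternal gr)
    (d : V →ₗ[ℂ] V) (d_mem : ∀ i, ∀ x ∈ gr i, d x ∈ gr (i + 1)) (d_d : ∀ x, d (d x) = 0)
    (exact : ∀ x, d x = 0 → ∃ y, d y = x) :
    ∃ u : V →ₗ[ℂ] V, (∀ i, ∀ x ∈ gr i, u x ∈ gr (i - 1)) ∧ ∀ x, d (u x) + u (d x) = x := by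
  obtain ⟨u, u_mem, huu, hdh, dhd⟩ := exists_gradedHomotopy h d d_mem d_d
  refine ⟨u, u_mem, fun x => ?_⟩
  -- `π = 1 - d u - u d` has closed, hence exact, values, while `d u = 1` on exact elements
  -- and `u π = 0`.
  obtain ⟨y, hy⟩ := exact (x - d (u x) - u (d x)) (by simp [d_d, dhd])
  have h3 : d (u (d y)) = d y := dhd y
  have h4 : u (x - d (u x) - u (d x)) = 0 := by simp [hdh, huu]
  rw [hy, h4, map_zero, sub_sub] at h3
  exact (sub_eq_zero.1 h3.symm).symm

end Graded

end TreeAmp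

/-! ### The dgLa assembled from one fibre -/

namespace TreeAmp

/-- A dgLa with momentum grading, written on a single fibre `V`: every momentum component is a copy
of `V`, the differential depends on the momentum, and the bracket on the two incoming momenta. The
Jacobi identity is stated as the derivation property of the bracket. -/
structure FiberDGLA (V : Type) [AddCommGroup V] [Module ℂ V] where
  gr : ℤ → Submodule ℂ V
  isInternal : DirectSum.IsInternal gr
  d : Mom → V →ₗ[ℂ] V
  br : Mom → Mom → V →ₗ[ℂ] V →ₗ[ℂ] V
  d_mem : ∀ k i, ∀ x ∈ gr i, d k x ∈ gr (i + 1)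
  br_mem : ∀ k l i j, ∀ x ∈ gr i, ∀ y ∈ gr j, br k l x y ∈ gr (i + j)
  d_d : ∀ k x, d k (d k x) = 0
  antisymm : ∀ k l i j, ∀ x ∈ gr i, ∀ y ∈ gr j,
    br k l x y = -((i * j).negOnePow • br l k y x)
  jacobi : ∀ k l m i j n, ∀ x ∈ gr i, ∀ y ∈ gr j, ∀ z ∈ gr n,
    br k (l + m) x (br l m y z) =
      br (k + l) m (br k l x y) z + (i * j).negOnePow • br l (k + m) y (br k m x z)
  leibniz : ∀ k l i, ∀ x ∈ gr i, ∀ y,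
    d (k + l) (br k l x y) = br k l (d k x) y + i.negOnePow • br k l x (d l y)
  d_poly : IsPolynomial d
  br_poly : IsPolynomial₂ br

theorem map_negOnePow_smul {V W : Type*} [AddCommGroup V] [Module ℂ V] [AddCommGroup W]
    [Module ℂ W] (f : V →ₗ[ℂ] W) (u : ℤˣ) (x : V) : f (u • x) = u • f x := by
  rw [Units.smul_def, Units.smul_def, map_zsmul]

namespace FiberDGLA

variable {V : Type} [AddCommGroup V] [Module ℂ V] (F : FiberDGLA V)

/-- The finitely supported families all of whose members have degree `i`. -/
def totalGr (i : ℤ) : Submodule ℂ (Mom →₀ V) where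
  carrier := {f | ∀ k, f k ∈ F.gr i}
  add_mem' := fun hf hg k => by simpa using add_mem (hf k) (hg k)
  zero_mem' := fun k => by simp
  smul_mem' := fun c f hf k => by simpa using Submodule.smul_mem _ c (hf k)

theorem single_mem_totalGr {i : ℤ} {k : Mom} {x : V} :
    Finsupp.single k x ∈ F.totalGr i ↔ x ∈ F.gr i := by
  constructor
  · intro h
    simpa using h k
  · intro h l
    rw [Finsupp.single_apply]
    split_ifs
    · exact h
    · exact zero_mem _

/-- Induction on elements of given degree. -/
theorem totalGr_induction {i : ℤ} {p : (Mom →₀ V) → Prop} (f : Mom →₀ V) (hf : f ∈ F.totalGr i)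
    (h0 : p 0) (hs : ∀ k, ∀ x ∈ F.gr i, p (Finsupp.single k x))
    (ha : ∀ f g, p f → p g → p (f + g)) : p f := by
  rw [← Finsupp.sum_single f]
  exact Finset.sum_induction _ p ha h0 fun k _ => hs k _ (hf k)

theorem totalGr_isInternal : DirectSum.IsInternal F.totalGr := by
  refine isInternal_of_projections _
    (fun i => Finsupp.mapRange.linearMap (gradedProj F.isInternal i)) ?_ ?_ ?_
  · intro i f hf
    ext1 k
    simp [gradedProj_of_mem F.isInternal (hf k)]
  · intro i j hij f hf
    ext1 k
    simp [gradedProj_of_mem_ne F.isInternal hij (hf k)]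
  · intro f
    induction f using Finsupp.induction_linear with
    | zero => exact zero_mem _
    | add f g hf hg => exact add_mem hf hg
    | single k x =>
      refine gradedInduction F.isInternal (p := fun x => Finsupp.single k x ∈ ⨆ i, F.totalGr i) x
        ?_ ?_ ?_
      · intro i x hx
        exact Submodule.mem_iSup_of_mem i (F.single_mem_totalGr.2 hx)
      · simp
      · intro x y hx hy
        rw [Finsupp.single_add]
        exact add_mem hx hy

/-- The differential on the sum over all momenta. -/
def totalD : (Mom →₀ V) →ₗ[ℂ] (Mom →₀ V) :=
  Finsupp.lsum ℂ fun k => Finsupp.lsingle k ∘ₗ F.d k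

@[simp] theorem totalD_single (k : Mom) (x : V) :
    F.totalD (Finsupp.single k x) = Finsupp.single k (F.d k x) := by
  simp [totalD]

/-- The bracket on the sum over all momenta. -/
def totalBr : (Mom →₀ V) →ₗ[ℂ] (Mom →₀ V) →ₗ[ℂ] (Mom →₀ V) :=
  Finsupp.lsum ℂ fun k => LinearMap.flip (Finsupp.lsum ℂ fun l =>
    ((F.br k l).compr₂ (Finsupp.lsingle (k + l))).flip)

@[simp] theorem totalBr_single (k l : Mom) (x y : V) :
    F.totalBr (Finsupp.single k x) (Finsupp.single l y) =
      Finsupp.single (k + l) (F.br k l x y) := by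
  simp [totalBr]

theorem totalBr_mem {i j : ℤ} {f g : Mom →₀ V} (hf : f ∈ F.totalGr i) (hg : g ∈ F.totalGr j) :
    F.totalBr f g ∈ F.totalGr (i + j) := by
  refine F.totalGr_induction (p := fun f => F.totalBr f g ∈ F.totalGr (i + j)) f hf (by simp) ?_
    fun f f' h h' => by rw [map_add]; exact add_mem h h'
  intro k x hx
  refine F.totalGr_induction (p := fun g => F.totalBr (Finsupp.single k x) g ∈ F.totalGr (i + j))
    g hg (by simp) ?_ fun f f' h h' => by rw [map_add]; exact add_mem h h'
  intro l y hy
  rw [totalBr_single, single_mem_totalGr]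
  exact F.br_mem k l i j x hx y hy

theorem totalBr_antisymm (i j : ℤ) (f g : Mom →₀ V) (hf : f ∈ F.totalGr i)
    (hg : g ∈ F.totalGr j) :
    F.totalBr f g = -((i * j).negOnePow • F.totalBr g f) := by
  refine F.totalGr_induction
    (p := fun f => F.totalBr f g = -((i * j).negOnePow • F.totalBr g f)) f hf (by simp) ?_
    fun f f' h h' => by simp only [map_add, LinearMap.add_apply, h, h', smul_add, neg_add]
  intro k x hx
  refine F.totalGr_induction (p := fun g => F.totalBr (Finsupp.single k x) g =
    -((i * j).negOnePow • F.totalBr g (Finsupp.single k x))) g hg (by simp) ?_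
    fun f f' h h' => by simp only [map_add, LinearMap.add_apply, h, h', smul_add, neg_add]
  intro l y hy
  rw [totalBr_single, totalBr_single, F.antisymm k l i j x hx y hy, Finsupp.single_neg,
    add_comm l k]
  congr 1
  exact map_negOnePow_smul (Finsupp.lsingle (k + l)) _ _

/-- The dgLa assembled from its fibre. -/
def dgla : DGLA (Mom →₀ V) where
  gr := F.totalGr
  isInternal := F.totalGr_isInternal
  d := F.totalD
  bracket := F.totalBr
  d_mem i f hf := by
    refine F.totalGr_induction (p := fun f => F.totalD f ∈ F.totalGr (i + 1)) f hf (by simp) ?_ ?_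
    · intro k x hx
      rw [totalD_single, single_mem_totalGr]
      exact F.d_mem k i x hx
    · intro f g hf hg
      rw [map_add]
      exact add_mem hf hg
  bracket_mem _ _ _ _ hf hg := F.totalBr_mem hf hg
  d_d f := by
    induction f using Finsupp.induction_linear with
    | zero => simp
    | add f g hf hg => rw [map_add, map_add, hf, hg, add_zero]
    | single k x => simp [F.d_d]
  antisymm := F.totalBr_antisymm
  jacobi i j n f g h hf hg hh := by
    have der : F.totalBr f (F.totalBr g h) = F.totalBr (F.totalBr f g) h +
        (i * j).negOnePow • F.totalBr g (F.totalBr f h) := by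
      refine F.totalGr_induction (p := fun f => F.totalBr f (F.totalBr g h) =
        F.totalBr (F.totalBr f g) h + (i * j).negOnePow • F.totalBr g (F.totalBr f h)) f hf
        (by simp) ?_ fun f f' h h' => by
          simp only [map_add, LinearMap.add_apply, h, h', smul_add]; abel
      intro k x hx
      refine F.totalGr_induction (p := fun g => F.totalBr (Finsupp.single k x) (F.totalBr g h) =
        F.totalBr (F.totalBr (Finsupp.single k x) g) h +
        (i * j).negOnePow • F.totalBr g (F.totalBr (Finsupp.single k x) h)) g hg
        (by simp) ?_ fun f f' h h' => by
          simp only [map_add, LinearMap.add_apply, h, h', smul_add]; abel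
      intro l y hy
      refine F.totalGr_induction (p := fun h => F.totalBr (Finsupp.single k x)
        (F.totalBr (Finsupp.single l y) h) =
        F.totalBr (F.totalBr (Finsupp.single k x) (Finsupp.single l y)) h +
        (i * j).negOnePow • F.totalBr (Finsupp.single l y) (F.totalBr (Finsupp.single k x) h)) h hh
        (by simp) ?_ fun f f' h h' => by
          simp only [map_add, h, h', smul_add]; abel
      intro m z hz
      simp only [totalBr_single]
      rw [F.jacobi k l m i j n x hx y hy z hz, Finsupp.single_add,
        ← add_assoc, add_left_comm l k m, ← add_assoc]
      congr 1
      exact map_negOnePow_smul (Finsupp.lsingle (k + l + m)) _ _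
    -- the cyclic form follows from the derivation form and antisymmetry
    rw [der, F.totalBr_antisymm i n f h hf hh,
      F.totalBr_antisymm (i + j) n _ h (F.totalBr_mem hf hg) hh, map_neg,
      map_negOnePow_smul, smul_neg, smul_smul, ← Int.negOnePow_add, ← mul_add, mul_comm n]
    abel
  leibniz i f g hf := by
    refine F.totalGr_induction (p := fun f => F.totalD (F.totalBr f g) =
      F.totalBr (F.totalD f) g + i.negOnePow • F.totalBr f (F.totalD g)) f hf (by simp) ?_
      fun f f' h h' => by simp only [map_add, LinearMap.add_apply, h, h', smul_add]; abel
    intro k x hx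
    induction g using Finsupp.induction_linear with
    | zero => simp
    | add f g h h' => simp only [map_add, h, h', smul_add]; abel
    | single l y =>
      simp only [totalD_single, totalBr_single]
      rw [F.leibniz k l i x hx y, Finsupp.single_add]
      congr 1
      exact map_negOnePow_smul (Finsupp.lsingle (k + l)) _ _

/-- The momentum grading of the dgLa assembled from its fibre. -/
def momentumGrading : MomentumGrading F.dgla Mom where
  comp k := LinearMap.range (Finsupp.lsingle (R := ℂ) (M := V) k)
  isInternal := by
    refine isInternal_of_projections _
      (fun k => Finsupp.lsingle k ∘ₗ Finsupp.lapply (R := ℂ) (M := V) k) ?_ ?_ ?_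
    · rintro k _ ⟨x, rfl⟩
      simp
    · rintro k l hkl _ ⟨x, rfl⟩
      simp [Finsupp.single_eq_of_ne hkl]
    · intro f
      rw [Finsupp.iSup_lsingle_range]
      trivial
  graded k := by
    refine le_antisymm ?_ (iSup_le fun i => inf_le_left)
    rintro _ ⟨x, rfl⟩
    refine gradedInduction F.isInternal (p := fun x => Finsupp.lsingle (R := ℂ) k x ∈
      ⨆ i, LinearMap.range (Finsupp.lsingle (R := ℂ) (M := V) k) ⊓ F.dgla.gr i) x ?_ ?_ ?_
    · intro i x hx
      exact Submodule.mem_iSup_of_mem i ⟨⟨x, rfl⟩, F.single_mem_totalGr.2 hx⟩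
    · simp
    · intro x y hx hy
      rw [map_add]
      exact add_mem hx hy
  d_mem := by
    rintro k _ ⟨x, rfl⟩
    exact ⟨F.d k x, (F.totalD_single k x).symm⟩
  bracket_mem := by
    rintro k l _ _ ⟨x, rfl⟩ ⟨y, rfl⟩
    exact ⟨F.br k l x y, (F.totalBr_single k l x y).symm⟩

/-- The polynomial dgLa assembled from its fibre. -/
def toPolynomialDGLA [FiniteDimensional ℂ V] : PolynomialDGLA where
  L := Mom →₀ V
  A := F.dgla
  M := F.momentumGrading
  V := V
  grV := F.gr
  isInternalV := F.isInternal
  e k := LinearEquiv.ofInjective (Finsupp.lsingle k) (Finsupp.single_injective k)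
  e_mem _ _ _ := F.single_mem_totalGr.symm
  dV := F.d
  bracketV := F.br
  d_eq k v := F.totalD_single k v
  bracket_eq k l v w := F.totalBr_single k l v w
  dV_poly := F.d_poly
  bracketV_poly := F.br_poly

end FiberDGLA
end TreeAmp

/-! ### Regular homotopy equivalences from quasi-isomorphisms -/

namespace TreeAmp

section Families

variable {V W V' W' : Type*} [AddCommGroup V] [Module ℂ V] [AddCommGroup W] [Module ℂ W]
  [AddCommGroup V'] [Module ℂ V'] [AddCommGroup W'] [Module ℂ W']

theorem IsPolynomial.comp_const {T : Mom → V →ₗ[ℂ] W} (h : IsPolynomial T) (A : W →ₗ[ℂ] W')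
    (B : V' →ₗ[ℂ] V) : IsPolynomial fun k => A ∘ₗ T k ∘ₗ B :=
  fun v φ => h (B v) (φ ∘ₗ A)

theorem IsPolynomial.add {S T : Mom → V →ₗ[ℂ] W} (hS : IsPolynomial S) (hT : IsPolynomial T) :
    IsPolynomial fun k => S k + T k := by
  intro v φ
  obtain ⟨P, hP⟩ := hS v φ
  obtain ⟨Q, hQ⟩ := hT v φ
  exact ⟨P + Q, fun k => by simp [hP, hQ, polyEval]⟩

theorem IsPolynomial.neg {T : Mom → V →ₗ[ℂ] W} (hT : IsPolynomial T) :
    IsPolynomial fun k => -T k := by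
  intro v φ
  obtain ⟨Q, hQ⟩ := hT v φ
  exact ⟨-Q, fun k => by simp [hQ, polyEval]⟩

theorem IsPolynomial.isRegularOn {T : Mom → V →ₗ[ℂ] W} (hT : IsPolynomial T) (O : Set Mom) :
    IsRegularOn O T := by
  intro v φ
  obtain ⟨P, hP⟩ := hT v φ
  exact ⟨P, 1, fun k _ => by simp [hP, polyEval]⟩

theorem IsRegularOn.comp_const {O : Set Mom} {T : Mom → V →ₗ[ℂ] W} (h : IsRegularOn O T)
    (A : W →ₗ[ℂ] W') (B : V' →ₗ[ℂ] V) : IsRegularOn O fun k => A ∘ₗ T k ∘ₗ B :=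
  fun v φ => h (B v) (φ ∘ₗ A)

/-- Evaluation at a momentum, as a ring homomorphism. -/
def polyEvalHom (k : Mom) : MvPolynomial (Fin 2 × Fin 2) ℂ →+* ℂ :=
  MvPolynomial.eval fun s => k s.1 s.2

theorem polyEvalHom_apply (k : Mom) (P : MvPolynomial (Fin 2 × Fin 2) ℂ) :
    polyEvalHom k P = polyEval P k := rfl

theorem isPolynomial_toLin {ι : Type*} [Fintype ι] [DecidableEq ι] (b : Module.Basis ι ℂ V)
    (M : Matrix ι ι (MvPolynomial (Fin 2 × Fin 2) ℂ)) :
    IsPolynomial fun k => Matrix.toLin b b (M.map (polyEvalHom k)) := by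
  intro v φ
  refine ⟨∑ i, ∑ j, MvPolynomial.C (b.repr v j * φ (b i)) * M i j, fun k => ?_⟩
  rw [← polyEvalHom_apply, Matrix.toLin_apply]
  simp only [map_sum, map_smul, map_mul, smul_eq_mul, Matrix.mulVec, dotProduct, Finset.sum_mul,
    Matrix.map_apply]
  refine Finset.sum_congr rfl fun i _ => Finset.sum_congr rfl fun j _ => ?_
  simp only [polyEvalHom, MvPolynomial.eval_C]
  ring

/-- A polynomial family of endomorphisms that is the identity at `k₀` has a regular inverse away
from the zeros of its determinant. -/
theorem exists_regular_inverse [FiniteDimensional ℂ V] {T : Mom → V →ₗ[ℂ] V}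
    (hT : IsPolynomial T) {k₀ : Mom} (h₀ : T k₀ = LinearMap.id) :
    ∃ (D : MvPolynomial (Fin 2 × Fin 2) ℂ) (S : Mom → V →ₗ[ℂ] V), polyEval D k₀ ≠ 0 ∧
      (∀ k, polyEval D k ≠ 0 → T k ∘ₗ S k = LinearMap.id ∧ S k ∘ₗ T k = LinearMap.id) ∧
      ∀ O : Set Mom, (∀ k ∈ O, polyEval D k ≠ 0) → IsRegularOn O S := by
  classical
  let b := Module.finBasis ℂ V
  choose M hM using fun i j => hT (b j) (b.coord i)
  have hT' : ∀ k, T k = Matrix.toLin b b ((Matrix.of M).map (polyEvalHom k)) := by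
    intro k
    rw [← Matrix.toLin_toMatrix b b (T k)]
    congr 1
    ext i j
    rw [LinearMap.toMatrix_apply]
    exact hM i j k
  have hdet : ∀ k, polyEval (Matrix.of M).det k = ((Matrix.of M).map (polyEvalHom k)).det := by
    intro k
    rw [← polyEvalHom_apply, RingHom.map_det]
    rfl
  refine ⟨(Matrix.of M).det, fun k => (polyEval (Matrix.of M).det k)⁻¹ •
    Matrix.toLin b b ((Matrix.of M).adjugate.map (polyEvalHom k)), ?_, ?_, ?_⟩
  · rw [hdet, ← LinearMap.det_toLin b, ← hT', h₀, LinearMap.det_id]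
    exact one_ne_zero
  · intro k hk
    have hadj : (Matrix.of M).adjugate.map (polyEvalHom k) =
        ((Matrix.of M).map (polyEvalHom k)).adjugate :=
      (RingHom.map_adjugate (polyEvalHom k) (Matrix.of M))
    beta_reduce
    rw [hT' k, hadj]
    constructor
    · rw [LinearMap.comp_smul, ← Matrix.toLin_mul, Matrix.mul_adjugate, ← hdet, map_smul,
        smul_smul, inv_mul_cancel₀ hk, one_smul, Matrix.toLin_one]
    · rw [LinearMap.smul_comp, ← Matrix.toLin_mul, Matrix.adjugate_mul, ← hdet, map_smul,
        smul_smul, inv_mul_cancel₀ hk, one_smul, Matrix.toLin_one]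
  · intro O hO v φ
    obtain ⟨P, hP⟩ := isPolynomial_toLin b (Matrix.of M).adjugate v φ
    refine ⟨P, (Matrix.of M).det, fun k hk => ⟨hO k hk, ?_⟩⟩
    rw [LinearMap.smul_apply, map_smul, hP, smul_eq_mul, div_eq_inv_mul]

end Families

section Cone

variable {V C : Type*} [AddCommGroup V] [Module ℂ V] [AddCommGroup C] [Module ℂ C]

theorem prod_isInternal {gr : ℤ → Submodule ℂ V} (h : DirectSum.IsInternal gr)
    {gr' : ℤ → Submodule ℂ C} (h' : DirectSum.IsInternal gr') :
    DirectSum.IsInternal fun i => (gr (i + 1)).prod (gr' i) := by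
  refine isInternal_of_projections _
    (fun i => LinearMap.prodMap (gradedProj h (i + 1)) (gradedProj h' i)) ?_ ?_ ?_
  · rintro i ⟨x, y⟩ ⟨hx, hy⟩
    simp [gradedProj_of_mem h hx, gradedProj_of_mem h' hy]
  · rintro i j hij ⟨x, y⟩ ⟨hx, hy⟩
    have hij' : i + 1 ≠ j + 1 := by omega
    simp [gradedProj_of_mem_ne h hij' hx, gradedProj_of_mem_ne h' hij hy]
  · rintro ⟨x, y⟩
    have h1 : ((x, 0) : V × C) ∈ ⨆ i, (gr (i + 1)).prod (gr' i) := by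
      refine gradedInduction h (p := fun x => ((x, 0) : V × C) ∈ _) x ?_ (zero_mem _) ?_
      · intro i x hx
        refine Submodule.mem_iSup_of_mem (i - 1) ⟨?_, zero_mem _⟩
        simpa using hx
      · intro x x' hx hx'
        simpa using add_mem hx hx'
    have h2 : ((0, y) : V × C) ∈ ⨆ i, (gr (i + 1)).prod (gr' i) := by
      refine gradedInduction h' (p := fun y => ((0, y) : V × C) ∈ _) y ?_ (zero_mem _) ?_
      · intro i x hx
        exact Submodule.mem_iSup_of_mem i ⟨zero_mem _, hx⟩
      · intro x x' hx hx'
        simpa using add_mem hx hx'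
    simpa using add_mem h1 h2

/-- The differential of the mapping cone of a chain map `L : V → C`. -/
def coneD (d' : V →ₗ[ℂ] V) (d : C →ₗ[ℂ] C) (L : V →ₗ[ℂ] C) : (V × C) →ₗ[ℂ] (V × C) :=
  LinearMap.prod (-(d' ∘ₗ LinearMap.fst ℂ V C))
    (L ∘ₗ LinearMap.fst ℂ V C + d ∘ₗ LinearMap.snd ℂ V C)

@[simp] theorem coneD_apply (d' : V →ₗ[ℂ] V) (d : C →ₗ[ℂ] C) (L : V →ₗ[ℂ] C) (x : V × C) :
    coneD d' d L x = (-d' x.1, L x.1 + d x.2) := rfl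

/-- `L` induces an isomorphism on homology, stated on representatives. -/
structure IsQuasiIso (d' : V →ₗ[ℂ] V) (d : C →ₗ[ℂ] C) (L : V →ₗ[ℂ] C) : Prop where
  inj : ∀ x w, d' x = 0 → L x = d w → ∃ y, d' y = x
  surj : ∀ z, d z = 0 → ∃ x w, d' x = 0 ∧ L x = z + d w

theorem coneD_exact {d' : V →ₗ[ℂ] V} {d : C →ₗ[ℂ] C} {L : V →ₗ[ℂ] C}
    (hL : ∀ x, L (d' x) = d (L x)) (h : IsQuasiIso d' d L) (x : V × C)
    (hx : coneD d' d L x = 0) : ∃ y, coneD d' d L y = x := by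
  obtain ⟨v, c⟩ := x
  simp only [coneD_apply, Prod.mk_eq_zero, neg_eq_zero] at hx
  obtain ⟨y, hy⟩ := h.inj v (-c) hx.1 (by rw [map_neg]; exact eq_neg_of_add_eq_zero_left hx.2)
  obtain ⟨t, w, ht, hw⟩ := h.surj (c + L y) (by
    rw [map_add, ← hL, hy, add_comm]; exact hx.2)
  refine ⟨(t - y, -w), ?_⟩
  simp only [coneD_apply, map_sub, ht, hy, hw, map_neg]
  ext
  · simp
  · simp only
    abel

/-- A polynomial chain map that is a quasi-isomorphism at `k₀ ≠ 0` is part of a homotopy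
equivalence with regular rational entries near `k₀`. The mapping cone at `k₀` has a contraction
`K₀`; with `D` the differential of the cone at `k`, the map `D K₀ + K₀ D` is invertible for `k`
near `k₀`, and composing `K₀` with its inverse contracts the cone at `k`. The blocks of this
contraction are the required maps. -/
theorem exists_regular_homotopyEquivalence [FiniteDimensional ℂ V] [FiniteDimensional ℂ C]
    {grV : ℤ → Submodule ℂ V} (hV : DirectSum.IsInternal grV)
    {grC : ℤ → Submodule ℂ C} (hC : DirectSum.IsInternal grC)
    {dV : Mom → V →ₗ[ℂ] V} {dC : Mom → C →ₗ[ℂ] C} {L : Mom → V →ₗ[ℂ] C}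
    (dV_poly : IsPolynomial dV) (dC_poly : IsPolynomial dC) (L_poly : IsPolynomial L)
    (dV_mem : ∀ k i, ∀ x ∈ grV i, dV k x ∈ grV (i + 1))
    (dC_mem : ∀ k i, ∀ x ∈ grC i, dC k x ∈ grC (i + 1))
    (L_mem : ∀ k i, ∀ x ∈ grV i, L k x ∈ grC i)
    (dV_dV : ∀ k x, dV k (dV k x) = 0) (dC_dC : ∀ k x, dC k (dC k x) = 0)
    (L_d : ∀ k x, L k (dV k x) = dC k (L k x)) {k₀ : Mom} (hk₀ : k₀ ≠ 0)
    (hq : IsQuasiIso (dV k₀) (dC k₀) (L k₀)) :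
    ∃ O : Set Mom, IsZariskiOpen O ∧ k₀ ∈ O ∧ (0 : Mom) ∉ O ∧
      ∃ (R : Mom → C →ₗ[ℂ] V) (u : Mom → C →ₗ[ℂ] C) (u' : Mom → V →ₗ[ℂ] V),
        IsRegularOn O R ∧ IsRegularOn O L ∧ IsRegularOn O u ∧ IsRegularOn O u' ∧
        ∀ k ∈ O, IsHomotopyEquivalence grC (dC k) grV (dV k) (R k) (L k) (u k) (u' k) := by
  have hZ := prod_isInternal hV hC
  have cone_mem : ∀ k i, ∀ x ∈ (grV (i + 1)).prod (grC i),
      coneD (dV k) (dC k) (L k) x ∈ (grV (i + 1 + 1)).prod (grC (i + 1)) := by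
    rintro k i ⟨x, y⟩ ⟨hx, hy⟩
    exact ⟨neg_mem (dV_mem k _ _ hx), add_mem (L_mem k _ _ hx) (dC_mem k _ _ hy)⟩
  have cone_cone : ∀ k x, coneD (dV k) (dC k) (L k) (coneD (dV k) (dC k) (L k) x) = 0 := by
    intro k x
    simp [dV_dV, dC_dC, L_d]
  obtain ⟨K₀, K₀_mem, hK₀⟩ := exists_gradedContraction hZ (coneD (dV k₀) (dC k₀) (L k₀))
    (cone_mem k₀) (cone_cone k₀) (coneD_exact (L_d k₀) hq)
  have cone_poly : IsPolynomial fun k => coneD (dV k) (dC k) (L k) := by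
    have h1 := (dV_poly.neg).comp_const (LinearMap.inl ℂ V C) (LinearMap.fst ℂ V C)
    have h2 := L_poly.comp_const (LinearMap.inr ℂ V C) (LinearMap.fst ℂ V C)
    have h3 := dC_poly.comp_const (LinearMap.inr ℂ V C) (LinearMap.snd ℂ V C)
    convert h1.add (h2.add h3) using 2 with k
    ext x <;> simp
  set Q : Mom → (V × C) →ₗ[ℂ] (V × C) := fun k =>
    coneD (dV k) (dC k) (L k) ∘ₗ K₀ + K₀ ∘ₗ coneD (dV k) (dC k) (L k) with hQ
  have Q_poly : IsPolynomial Q :=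
    (cone_poly.comp_const LinearMap.id K₀).add (cone_poly.comp_const K₀ LinearMap.id)
  obtain ⟨D, S, hD, hS, S_reg⟩ := exists_regular_inverse Q_poly (k₀ := k₀)
    (LinearMap.ext hK₀)
  -- the coordinate function `X s` removes the origin from the neighbourhood
  obtain ⟨s, hs⟩ : ∃ s : Fin 2 × Fin 2, k₀ s.1 s.2 ≠ 0 := by
    by_contra! h
    exact hk₀ (by ext i j; exact h (i, j))
  set O : Set Mom := {k | polyEval (D * MvPolynomial.X s) k ≠ 0} with hO
  have mem_O : ∀ k, k ∈ O ↔ polyEval D k ≠ 0 ∧ k s.1 s.2 ≠ 0 := by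
    intro k
    simp [hO, polyEval]
  have SO : IsRegularOn O S := S_reg O fun k hk => ((mem_O k).1 hk).1
  refine ⟨O, ⟨{D * MvPolynomial.X s}, by simp [hO]⟩, (mem_O k₀).2 ⟨hD, hs⟩,
    fun h => ((mem_O 0).1 h).2 rfl,
    fun k => LinearMap.fst ℂ V C ∘ₗ K₀ ∘ₗ S k ∘ₗ LinearMap.inr ℂ V C,
    fun k => LinearMap.snd ℂ V C ∘ₗ K₀ ∘ₗ S k ∘ₗ LinearMap.inr ℂ V C,
    fun k => -(LinearMap.fst ℂ V C ∘ₗ K₀ ∘ₗ S k ∘ₗ LinearMap.inl ℂ V C),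
    SO.comp_const (LinearMap.fst ℂ V C ∘ₗ K₀) _, L_poly.isRegularOn O,
    SO.comp_const (LinearMap.snd ℂ V C ∘ₗ K₀) _,
    SO.comp_const (-(LinearMap.fst ℂ V C ∘ₗ K₀)) (LinearMap.inl ℂ V C), ?_⟩
  intro k hk
  obtain ⟨h1, h2⟩ := hS k ((mem_O k).1 hk).1
  have QS : ∀ x, Q k (S k x) = x := LinearMap.congr_fun h1
  have SQ : ∀ x, S k (Q k x) = x := LinearMap.congr_fun h2
  have Q_apply : ∀ x, Q k x = coneD (dV k) (dC k) (L k) (K₀ x) +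
    K₀ (coneD (dV k) (dC k) (L k) x) := fun x => rfl
  have Q_cone : ∀ x, Q k (coneD (dV k) (dC k) (L k) x) = coneD (dV k) (dC k) (L k) (Q k x) := by
    intro x
    rw [Q_apply, Q_apply, cone_cone, map_zero, add_zero, map_add, cone_cone, zero_add]
  have S_cone : ∀ x, S k (coneD (dV k) (dC k) (L k) x) = coneD (dV k) (dC k) (L k) (S k x) := by
    intro x
    rw [← SQ (coneD (dV k) (dC k) (L k) (S k x)), Q_cone, QS]
  have contr : ∀ x, coneD (dV k) (dC k) (L k) (K₀ (S k x)) +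
      K₀ (S k (coneD (dV k) (dC k) (L k) x)) = x := by
    intro x
    rw [S_cone, ← Q_apply, QS]
  have Q_mem : ∀ i, ∀ x ∈ (grV (i + 1)).prod (grC i), Q k x ∈ (grV (i + 1)).prod (grC i) := by
    intro i x hx
    have a1 := cone_mem k _ _ (K₀_mem i x hx)
    have a2 := K₀_mem _ _ (cone_mem k i x hx)
    rw [show i - 1 + 1 = i by ring] at a1
    rw [show i + 1 - 1 = i by ring] at a2
    exact add_mem a1 a2
  have Q_proj : ∀ i x, Q k (gradedProj hZ i x) = gradedProj hZ i (Q k x) := by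
    intro i x
    refine gradedInduction hZ (p := fun x => Q k (gradedProj hZ i x) = gradedProj hZ i (Q k x)) x
      ?_ (by simp) fun x y hx hy => by simp only [map_add, hx, hy]
    intro j x hx
    by_cases hij : i = j
    · subst hij
      rw [gradedProj_of_mem hZ hx, gradedProj_of_mem hZ (Q_mem _ _ hx)]
    · rw [gradedProj_of_mem_ne hZ hij hx, gradedProj_of_mem_ne hZ hij (Q_mem _ _ hx), map_zero]
  have S_mem : ∀ i, ∀ x ∈ (grV (i + 1)).prod (grC i), S k x ∈ (grV (i + 1)).prod (grC i) := by
    intro i x hx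
    refine mem_of_gradedProj_eq hZ fun j hj => ?_
    rw [← SQ (gradedProj hZ j (S k x)), Q_proj, QS, gradedProj_of_mem_ne hZ hj hx, map_zero]
  have K_mem : ∀ i, ∀ x ∈ (grV (i + 1)).prod (grC i),
      K₀ (S k x) ∈ (grV (i - 1 + 1)).prod (grC (i - 1)) :=
    fun i x hx => K₀_mem _ _ (S_mem i x hx)
  have onC : ∀ c : C, _ := fun c => contr (0, c)
  have onV : ∀ v : V, _ := fun v => contr (v, 0)
  simp only [coneD_apply, map_zero, neg_zero, zero_add, add_zero, Prod.ext_iff, Prod.fst_add,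
    Prod.snd_add] at onC onV
  have split : ∀ x : V × C, K₀ (S k x) = K₀ (S k (x.1, 0)) + K₀ (S k (0, x.2)) := by
    intro x
    rw [← map_add, ← map_add]
    simp
  constructor
  · intro i x hx
    have := (K_mem i (0, x) ⟨zero_mem _, hx⟩).1
    rwa [show i - 1 + 1 = i by ring] at this
  · exact L_mem k
  · intro i x hx
    exact (K_mem i (0, x) ⟨zero_mem _, hx⟩).2
  · intro i x hx
    have hx' : ((x, 0) : V × C) ∈ (grV (i - 1 + 1)).prod (grC (i - 1)) :=
      ⟨by simpa using hx, zero_mem _⟩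
    have := (K_mem (i - 1) _ hx').1
    rw [show i - 1 - 1 + 1 = i - 1 by ring] at this
    exact neg_mem this
  · ext c
    have := (onC c).1
    simp only [LinearMap.comp_apply, LinearMap.inr_apply, LinearMap.fst_apply]
    rw [add_comm] at this
    exact add_neg_eq_zero.1 this
  · exact LinearMap.ext (L_d k)
  · ext c
    have := (onC c).2
    simp only [LinearMap.comp_apply, LinearMap.inr_apply, LinearMap.fst_apply, LinearMap.sub_apply,
      LinearMap.snd_apply, LinearMap.id_apply]
    rw [sub_sub, eq_sub_iff_add_eq, ← add_assoc]
    exact this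
  · ext v
    have := (onV v).1
    rw [split (-(dV k v), L k v), show ((-(dV k v), 0) : V × C) = -(dV k v, 0) by simp,
      map_neg, map_neg, Prod.fst_add, Prod.fst_neg] at this
    simp only [LinearMap.comp_apply, LinearMap.inr_apply, LinearMap.fst_apply, LinearMap.sub_apply,
      LinearMap.neg_apply, LinearMap.inl_apply, LinearMap.id_apply, map_neg, sub_neg_eq_add]
    nth_rw 2 [← this]
    abel

end Cone

end TreeAmp

/-! ### Multilinear Maurer-Cartan elements -/

namespace TreeAmp

section Perturbiner

variable {L : Type*} [AddCommGroup L] [Module ℂ L] {A : DGLA L}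

namespace DGLA

theorem bracket_symm_one {x y : L} (hx : x ∈ A.gr 1) (hy : y ∈ A.gr 1) :
    A.bracket x y = A.bracket y x := by
  rw [A.antisymm 1 1 x y hx hy]
  simp [Units.smul_def]

theorem jacobi_one {x y z : L} (hx : x ∈ A.gr 1) (hy : y ∈ A.gr 1) (hz : z ∈ A.gr 1) :
    A.bracket x (A.bracket y z) + A.bracket y (A.bracket z x) + A.bracket z (A.bracket x y) = 0 := by
  have := A.jacobi 1 1 1 x y z hx hy hz
  simpa [Int.negOnePow_even 2 (by decide)] using this

theorem bracket_bracket_zero {x y b : L} (hx : x ∈ A.gr 1) (hy : y ∈ A.gr 1) (hb : b ∈ A.gr 0) :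
    A.bracket (A.bracket x y) b =
      A.bracket (A.bracket y b) x + A.bracket (A.bracket x b) y := by
  have h := A.jacobi 1 1 0 x y b hx hy hb
  have h1 := A.antisymm 1 1 x _ hx (by simpa using A.bracket_mem 1 0 y b hy hb)
  have h2 := A.antisymm 0 1 b x hb hx
  have h3 := A.antisymm 1 1 y _ hy (by simpa using A.bracket_mem 1 0 x b hx hb)
  have h4 := A.antisymm 0 2 b _ hb (by simpa using A.bracket_mem 1 1 x y hx hy)
  simp [Units.smul_def] at h h1 h2 h3 h4
  rw [h1, h2, map_neg, h3, h4, neg_neg, ← sub_eq_add_neg, sub_eq_zero] at h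
  exact h.symm

end DGLA

section Bracket

variable (A) {n : ℕ}

/-- The bracket of a family indexed by sets of inputs with itself, in the component `J`. -/
def selfBracket (a : Finset (Fin n) → L) (J : Finset (Fin n)) : L :=
  ∑ I ∈ J.powerset, A.bracket (a I) (a (J \ I))

end Bracket

variable {n : ℕ}

theorem sum_powerset_compl {α : Type*} [AddCommMonoid α] (J : Finset (Fin n))
    (f : Finset (Fin n) → Finset (Fin n) → α) :
    ∑ I ∈ J.powerset, f I (J \ I) = ∑ I ∈ J.powerset, f (J \ I) I := by
  refine Finset.sum_nbij' (fun I => J \ I) (fun I => J \ I) ?_ ?_ ?_ ?_ ?_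
  · intro I hI
    simp
  · intro I hI
    simp
  · intro I hI
    simpa using Finset.mem_powerset.1 hI
  · intro I hI
    simpa using Finset.mem_powerset.1 hI
  · intro I hI
    simp only [Finset.sdiff_sdiff_eq_self (Finset.mem_powerset.1 hI)]

/-- The component of the Maurer-Cartan equation in `J`. -/
def MCAt (A : DGLA L) (a : Finset (Fin n) → L) (J : Finset (Fin n)) : Prop :=
  A.d (a J) = -((1 / 2 : ℂ) • selfBracket A a J)

theorem sum_rotate {α : Type*} [AddCommMonoid α] (J : Finset (Fin n))
    (f : Finset (Fin n) → Finset (Fin n) → Finset (Fin n) → α) :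
    ∑ I ∈ J.powerset, ∑ I' ∈ (J \ I).powerset, f I I' ((J \ I) \ I') =
      ∑ I ∈ J.powerset, ∑ I' ∈ (J \ I).powerset, f I' ((J \ I) \ I') I := by
  rw [Finset.sum_sigma', Finset.sum_sigma']
  refine Finset.sum_nbij' (fun p => ⟨(J \ p.1) \ p.2, p.1⟩) (fun p => ⟨p.2, (J \ p.1) \ p.2⟩)
    ?_ ?_ ?_ ?_ ?_
  all_goals
    rintro ⟨I, I'⟩ h
    simp only [Finset.mem_sigma, Finset.mem_powerset] at h ⊢
    obtain ⟨h1, h2⟩ := h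
  · constructor
    · exact Finset.sdiff_subset.trans Finset.sdiff_subset
    · intro x hx
      have := h1 hx
      simp [hx, this]
  · constructor
    · exact h2.trans Finset.sdiff_subset
    · intro x hx
      simp only [Finset.mem_sdiff] at hx ⊢
      tauto
  · congr 1
    ext x
    have a1 := @h1 x
    have a2 := @h2 x
    simp only [Finset.mem_sdiff] at *
    tauto
  · congr 1
    ext x
    have a1 := @h1 x
    have a2 := @h2 x
    simp only [Finset.mem_sdiff] at *
    tauto
  · congr 1
    ext x
    have a1 := @h1 x
    have a2 := @h2 x
    simp only [Finset.mem_sdiff] at *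
    tauto

/-- If the Maurer-Cartan equation holds in all proper subsets, then the obstruction to solving it
is closed, by the Jacobi identity. -/
theorem d_selfBracket {a : Finset (Fin n) → L} (h0 : a ∅ = 0) (h1 : ∀ J, a J ∈ A.gr 1)
    {J : Finset (Fin n)} (hJ : ∀ I, I ⊂ J → MCAt A a I) : A.d (selfBracket A a J) = 0 := by
  have dmem : ∀ I, A.d (a I) ∈ A.gr 2 := fun I => A.d_mem 1 _ (h1 I)
  have e1 : A.d (selfBracket A a J) =
      ∑ I ∈ J.powerset, (-A.bracket (a (J \ I)) (A.d (a I)) - A.bracket (a I) (A.d (a (J \ I)))) := by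
    rw [selfBracket, map_sum]
    refine Finset.sum_congr rfl fun I _ => ?_
    rw [A.leibniz 1 _ _ (h1 I), A.antisymm 2 1 _ _ (dmem I) (h1 _)]
    simp [Int.negOnePow_even 2 (by decide), Units.smul_def, sub_eq_add_neg]
  have e2 : ∑ I ∈ J.powerset, A.bracket (a I) (A.d (a (J \ I))) =
      -((1 / 2 : ℂ) • ∑ I ∈ J.powerset, ∑ I' ∈ (J \ I).powerset,
        A.bracket (a I) (A.bracket (a I') (a ((J \ I) \ I')))) := by
    rw [Finset.smul_sum, ← Finset.sum_neg_distrib]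
    refine Finset.sum_congr rfl fun I hI => ?_
    rw [Finset.mem_powerset] at hI
    rcases I.eq_empty_or_nonempty with rfl | hne
    · simp [h0]
    · rw [hJ (J \ I) (Finset.sdiff_ssubset hI hne), selfBracket, map_neg, map_smul, map_sum]
  have e3 : ∑ I ∈ J.powerset, ∑ I' ∈ (J \ I).powerset,
      A.bracket (a I) (A.bracket (a I') (a ((J \ I) \ I'))) = 0 := by
    set f : Finset (Fin n) → Finset (Fin n) → Finset (Fin n) → L :=
      fun I I' I'' => A.bracket (a I) (A.bracket (a I') (a I'')) with hf
    have r1 := sum_rotate J f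
    have r2 := sum_rotate J fun I I' I'' => f I' I'' I
    have s : ∑ I ∈ J.powerset, ∑ I' ∈ (J \ I).powerset, (f I I' ((J \ I) \ I') +
        f I' ((J \ I) \ I') I + f ((J \ I) \ I') I I') = 0 :=
      Finset.sum_eq_zero fun I _ => Finset.sum_eq_zero fun I' _ =>
        DGLA.jacobi_one (h1 _) (h1 _) (h1 _)
    simp only [Finset.sum_add_distrib] at s
    rw [← r2, ← r1] at s
    have : (3 : ℂ) • ∑ I ∈ J.powerset, ∑ I' ∈ (J \ I).powerset, f I I' ((J \ I) \ I') = 0 := by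
      rw [← s]; module
    exact (smul_eq_zero.1 this).resolve_left (by norm_num)
  rw [e1, Finset.sum_sub_distrib, Finset.sum_neg_distrib,
    ← sum_powerset_compl J fun I I' => A.bracket (a I) (A.d (a I')), e2, e3]
  simp

section Gauge

/-- The infinitesimal gauge transformation by `t_J β`, where `t_J` is the formal parameter of the
inputs in `J`, applied to the family `a`. As `t_J² = 0`, the infinitesimal transformation is the
finite one. -/
def gaugeShift (A : DGLA L) (a : Finset (Fin n) → L) (J : Finset (Fin n)) (β : L)
    (I : Finset (Fin n)) : L :=
  if J ⊆ I then A.bracket (a (I \ J)) β + (if I = J then A.d β else 0) else 0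

variable {a : Finset (Fin n) → L} (h1 : ∀ J, a J ∈ A.gr 1)
  {J : Finset (Fin n)} {β : L} (hβ : β ∈ A.gr 0)

include h1 hβ in
theorem gaugeShift_mem (I : Finset (Fin n)) : gaugeShift A a J β I ∈ A.gr 1 := by
  have e1 : A.bracket (a (I \ J)) β ∈ A.gr 1 := by simpa using A.bracket_mem 1 0 _ _ (h1 (I \ J)) hβ
  have e2 : A.d β ∈ A.gr 1 := by simpa using A.d_mem 0 _ hβ
  unfold gaugeShift
  split_ifs
  · exact add_mem e1 e2
  · exact add_mem e1 (zero_mem _)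
  · exact zero_mem _

include h1 hβ in
/-- A gauge transformation preserves the Maurer-Cartan equation: the changes of `d a` and of
`[a, a] / 2` cancel. -/
theorem selfBracket_gauge (hJ : J.Nonempty)
    (hmc : ∀ I, I ≠ Finset.univ → MCAt A a I) (K : Finset (Fin n)) :
    (1 / 2 : ℂ) • selfBracket A (fun I => a I + gaugeShift A a J β I) K =
      (1 / 2 : ℂ) • selfBracket A a K - A.d (gaugeShift A a J β K) := by
  set δ := gaugeShift A a J β with hδ
  have δ_mem : ∀ I, δ I ∈ A.gr 1 := gaugeShift_mem h1 hβ
  have dβ : A.d β ∈ A.gr 1 := by simpa using A.d_mem 0 _ hβ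
  have δ_not : ∀ I, ¬ J ⊆ I → δ I = 0 := fun I hI => if_neg hI
  have e1 : selfBracket A (fun I => a I + δ I) K = selfBracket A a K +
      (2 : ℂ) • ∑ I ∈ K.powerset, A.bracket (δ I) (a (K \ I)) := by
    have quad : ∀ I, A.bracket (δ I) (δ (K \ I)) = 0 := by
      intro I
      by_cases hI : J ⊆ I
      · rw [δ_not (K \ I), map_zero]
        intro h
        obtain ⟨j, hj⟩ := hJ
        exact (Finset.mem_sdiff.1 (h hj)).2 (hI hj)
      · rw [δ_not I hI, map_zero, LinearMap.zero_apply]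
    simp only [selfBracket, map_add, LinearMap.add_apply, quad, add_zero, Finset.sum_add_distrib]
    have : ∑ I ∈ K.powerset, A.bracket (a I) (δ (K \ I)) =
        ∑ I ∈ K.powerset, A.bracket (δ I) (a (K \ I)) := by
      rw [sum_powerset_compl K fun I I' => A.bracket (a I) (δ I')]
      exact Finset.sum_congr rfl fun I _ => DGLA.bracket_symm_one (h1 _) (δ_mem _)
    rw [this]
    module
  rw [e1]
  by_cases hK : J ⊆ K
  · set M := K \ J with hM
    have e2 : ∑ I ∈ K.powerset, A.bracket (δ I) (a (K \ I)) =
        ∑ I ∈ M.powerset, A.bracket (δ (J ∪ I)) (a (M \ I)) := by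
      symm
      refine Finset.sum_of_injOn (fun I => J ∪ I) ?_ ?_ ?_ ?_
      · intro I hI I' hI' h
        simp only [Finset.coe_powerset, Set.mem_preimage, Set.mem_powerset_iff,
          Finset.coe_subset] at hI hI'
        ext x
        have a1 := @hI x
        have a2 := @hI' x
        have a3 := Finset.ext_iff.1 h x
        simp only [hM, Finset.mem_sdiff, Finset.mem_union] at a1 a2 a3
        tauto
      · intro I hI
        simp only [Finset.coe_powerset, Set.mem_preimage, Set.mem_powerset_iff,
          Finset.coe_subset] at hI ⊢
        exact Finset.union_subset hK (hI.trans Finset.sdiff_subset)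
      · intro I hI hI'
        rw [Finset.mem_powerset] at hI
        rw [δ_not, map_zero, LinearMap.zero_apply]
        intro h
        apply hI'
        refine ⟨I \ J, ?_, Finset.union_sdiff_of_subset h⟩
        simp only [Finset.coe_powerset, Set.mem_preimage, Set.mem_powerset_iff,
          Finset.coe_subset]
        exact Finset.sdiff_subset_sdiff hI le_rfl
      · intro I hI
        congr 2
        ext x
        simp only [hM, Finset.mem_sdiff, Finset.mem_union]
        tauto
    have e3 : ∀ I ∈ M.powerset, A.bracket (δ (J ∪ I)) (a (M \ I)) =
        A.bracket (A.bracket (a I) β) (a (M \ I)) +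
          if I = ∅ then A.bracket (A.d β) (a M) else 0 := by
      intro I hI
      rw [Finset.mem_powerset] at hI
      have d1 : (J ∪ I) \ J = I := by
        ext x
        have a1 := @hI x
        simp only [hM, Finset.mem_sdiff, Finset.mem_union] at a1 ⊢
        tauto
      have d2 : J ∪ I = J ↔ I = ∅ := by
        constructor
        · intro h
          rw [← d1, h, Finset.sdiff_self]
        · rintro rfl
          simp
      rw [hδ, gaugeShift, if_pos Finset.subset_union_left, d1, map_add, LinearMap.add_apply]
      congr 1
      by_cases hI0 : I = ∅
      · subst hI0
        simp
      · rw [if_neg (fun h => hI0 (d2.1 h)), if_neg hI0, map_zero, LinearMap.zero_apply]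
    have e4 : A.bracket (selfBracket A a M) β =
        (2 : ℂ) • ∑ I ∈ M.powerset, A.bracket (A.bracket (a I) β) (a (M \ I)) := by
      rw [selfBracket, map_sum, LinearMap.sum_apply]
      rw [Finset.sum_congr rfl fun I _ => DGLA.bracket_bracket_zero (h1 I) (h1 (M \ I)) hβ]
      rw [Finset.sum_add_distrib,
        ← sum_powerset_compl M fun I I' => A.bracket (A.bracket (a I) β) (a I')]
      module
    have hMuniv : M ≠ Finset.univ := by
      obtain ⟨j, hj⟩ := hJ
      intro h
      have : j ∈ M := h ▸ Finset.mem_univ j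
      exact (Finset.mem_sdiff.1 this).2 hj
    have e5 : A.d (δ K) = -((1 / 2 : ℂ) • A.bracket (selfBracket A a M) β) -
        A.bracket (A.d β) (a M) := by
      have ddβ : A.d (if K = J then A.d β else 0) = 0 := by
        split_ifs
        · exact A.d_d β
        · exact map_zero _
      rw [hδ, gaugeShift, if_pos hK, map_add, ddβ, add_zero, ← hM, A.leibniz 1 _ _ (h1 M),
        hmc M hMuniv, map_neg, map_smul, LinearMap.neg_apply, LinearMap.smul_apply,
        DGLA.bracket_symm_one (h1 M) dβ]
      simp [Units.smul_def, sub_eq_add_neg]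
    rw [e2, Finset.sum_congr rfl e3, Finset.sum_add_distrib, Finset.sum_ite_eq' _ ∅,
      if_pos (Finset.empty_mem_powerset _), e5, e4]
    module
  · rw [δ_not K hK, Finset.sum_eq_zero]
    · simp
    · intro I hI
      rw [δ_not I fun h => hK (h.trans (Finset.mem_powerset.1 hI)), map_zero, LinearMap.zero_apply]

end Gauge

section Momentum

variable {K : Type*} [AddCommGroup K] [DecidableEq K] (M : MomentumGrading A K)

/-- A solution of the Maurer-Cartan equation in the formal parameters `t_1, …, t_n`, `t_j² = 0`, up
to the order `t_1 ⋯ t_n`: a family `a J` of elements of degree one and momentum `∑_{j ∈ J} k j`,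
the coefficients of `∏_{j ∈ J} t_j`. The value at the full set is irrelevant. -/
structure IsPerturbiner (k : Fin n → K) (a : Finset (Fin n) → L) : Prop where
  empty : a ∅ = 0
  deg : ∀ J, a J ∈ A.gr 1
  mom : ∀ J, a J ∈ M.comp (∑ j ∈ J, k j)
  mc : ∀ J, J ≠ Finset.univ → MCAt A a J

/-- The obstruction to extending a solution to the order `t_1 ⋯ t_n`. -/
def obstruction (A : DGLA L) (a : Finset (Fin n) → L) : L :=
  (1 / 2 : ℂ) • selfBracket A a Finset.univ

variable {M} {k : Fin n → K} {a b : Finset (Fin n) → L}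

theorem IsPerturbiner.d_obstruction (ha : IsPerturbiner M k a) : A.d (obstruction A a) = 0 := by
  rw [obstruction, map_smul,
    d_selfBracket ha.empty ha.deg fun I hI => ha.mc I hI.ne, smul_zero]

theorem IsPerturbiner.gauge (ha : IsPerturbiner M k a) {J : Finset (Fin n)} (hJ : J.Nonempty)
    {β : L} (hβ : β ∈ A.gr 0) (hβ' : β ∈ M.comp (∑ j ∈ J, k j)) :
    IsPerturbiner M k fun I => a I + gaugeShift A a J β I := by
  refine ⟨?_, ?_, ?_, ?_⟩
  · have : ¬ J ⊆ ∅ := by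
      rw [Finset.subset_empty]
      exact hJ.ne_empty
    simp [ha.empty, gaugeShift, this]
  · exact fun I => add_mem (ha.deg I) (gaugeShift_mem ha.deg hβ I)
  · intro I
    refine add_mem (ha.mom I) ?_
    unfold gaugeShift
    split_ifs with h1 h2
    · subst h2
      refine add_mem ?_ (M.d_mem _ _ hβ')
      simp [ha.empty]
    · rw [add_zero, ← Finset.sum_sdiff h1]
      exact M.bracket_mem _ _ _ _ (ha.mom _) hβ'
    · exact zero_mem _
  · intro I hI
    have := selfBracket_gauge ha.deg hβ hJ ha.mc I
    rw [MCAt, this, map_add, ha.mc I hI]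
    abel

theorem Homotopy.eq_d_h (H : Homotopy M) {k : K} (hk : OffShell M k) {x : L} (hx : x ∈ M.comp k)
    (hd : A.d x = 0) : A.d (H.h x) = x := by
  have hmem : cls A.d x hd ∈ homologyPart A.d (M.comp k) := ⟨⟨x, hd⟩, hx, rfl⟩
  rw [hk, Submodule.mem_bot] at hmem
  replace hmem := (Submodule.Quotient.mk_eq_zero _).1 hmem
  obtain ⟨y, hy⟩ := hmem
  change A.d y = x at hy
  rw [← hy, H.dhd]

/-- The class of the obstruction depends only on the homology classes of the inputs: two solutions
are related by a sequence of gauge transformations, one for each set of inputs. -/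
theorem IsPerturbiner.obstruction_unique (H : Homotopy M) (hoff : InternalOffShell M k)
    (ha : IsPerturbiner M k a) (hb : IsPerturbiner M k b)
    (hab : ∀ j, ∃ w, a {j} - b {j} = A.d w) :
    ∃ w, obstruction A a - obstruction A b = A.d w := by
  -- `T` is the set of those components in which the solutions may still differ
  suffices h : ∀ (T : Finset (Finset (Fin n))) (b : Finset (Fin n) → L), IsPerturbiner M k b →
      (∀ j, ∃ w, a {j} - b {j} = A.d w) → (∀ I ∈ T, I.Nonempty ∧ I ≠ Finset.univ) →
      (∀ I ∈ T, ∀ J, I ⊆ J → J ≠ Finset.univ → J ∈ T) →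
      (∀ I, I ∉ T → I ≠ Finset.univ → a I = b I) →
      ∃ w, obstruction A a - obstruction A b = A.d w by
    refine h (Finset.univ.filter fun I => I.Nonempty ∧ I ≠ Finset.univ) b hb hab ?_ ?_ ?_
    · intro I hI
      simpa using hI
    · intro I hI J hIJ hJ
      simp only [Finset.mem_filter, Finset.mem_univ, true_and] at hI ⊢
      exact ⟨hI.1.mono hIJ, hJ⟩
    · intro I hI hI'
      simp only [Finset.mem_filter, Finset.mem_univ, true_and, not_and, not_not] at hI
      rcases I.eq_empty_or_nonempty with rfl | hne
      · rw [ha.empty, hb.empty]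
      · exact absurd (hI hne) hI'
  intro T
  induction T using Finset.strongInduction with
  | H T ih =>
  intro b hb hab hT hup hagree
  rcases T.eq_empty_or_nonempty with rfl | hne
  · refine ⟨0, ?_⟩
    have : selfBracket A a Finset.univ = selfBracket A b Finset.univ := by
      refine Finset.sum_congr rfl fun I _ => ?_
      by_cases hI : I = Finset.univ
      · subst hI
        simp [ha.empty, hb.empty]
      by_cases hI' : Finset.univ \ I = Finset.univ
      · have : I = ∅ := by
          have := Finset.sdiff_sdiff_eq_self (Finset.subset_univ I)
          rw [hI'] at this
          simpa using this.symm
        subst this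
        simp [ha.empty, hb.empty]
      · rw [hagree I (by simp) hI, hagree _ (by simp) hI']
    simp [obstruction, this]
  · obtain ⟨J, hJT, hJmin⟩ := T.exists_min_image Finset.card hne
    obtain ⟨hJne, hJuniv⟩ := hT J hJT
    have hsub : ∀ I, I ⊂ J → a I = b I := by
      intro I hI
      refine hagree I (fun h => ?_) ?_
      · exact absurd (hJmin I h) (not_le.2 (Finset.card_lt_card hI))
      · rintro rfl
        exact hI.2 (Finset.subset_univ J)
    have hex : A.d (H.h (a J - b J)) = a J - b J := by
      by_cases hcard : J.card = 1
      · obtain ⟨j, rfl⟩ := Finset.card_eq_one.1 hcard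
        obtain ⟨w, hw⟩ := hab j
        rw [hw, H.dhd]
      · have hcard' : 1 < J.card := by
          have := hJne.card_pos
          omega
        have hlt : J.card < n := by
          simpa using Finset.card_lt_univ_of_notMem (s := J)
            (Classical.not_forall.1 fun h => hJuniv (Finset.eq_univ_iff_forall.2 h)).choose_spec
        refine H.eq_d_h (hoff J hcard' hlt) (sub_mem (ha.mom J) (hb.mom J)) ?_
        rw [map_sub, ha.mc J hJuniv, hb.mc J hJuniv]
        have : selfBracket A a J = selfBracket A b J := by
          refine Finset.sum_congr rfl fun I hI => ?_
          rw [Finset.mem_powerset] at hI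
          by_cases hIJ : I = J
          · subst hIJ
            simp [ha.empty, hb.empty]
          by_cases hI0 : I = ∅
          · subst hI0
            simp [ha.empty, hb.empty]
          · rw [hsub I (hI.ssubset_of_ne hIJ),
              hsub _ (Finset.sdiff_ssubset hI (Finset.nonempty_iff_ne_empty.2 hI0))]
        rw [this, sub_self]
    set β := H.h (a J - b J) with hβ
    have β_mem : β ∈ A.gr 0 := by
      rw [hβ, show (0 : ℤ) = 1 - 1 by norm_num]
      exact H.h_mem 1 _ (sub_mem (ha.deg J) (hb.deg J))
    have β_mom : β ∈ M.comp (∑ j ∈ J, k j) := H.h_mom _ _ (sub_mem (ha.mom J) (hb.mom J))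
    have hb' := hb.gauge hJne β_mem β_mom
    have shift_J : b J + gaugeShift A b J β J = a J := by
      simp [gaugeShift, hb.empty, hex]
    obtain ⟨w, hw⟩ := ih (T.erase J) (Finset.erase_ssubset hJT) _ hb' (by
        intro j
        by_cases hj : J ⊆ {j}
        · have : J = {j} := (Finset.subset_singleton_iff.1 hj).resolve_left hJne.ne_empty
          refine ⟨0, ?_⟩
          rw [← this, shift_J]
          simp
        · simpa [gaugeShift, hj] using hab j)
      (fun I hI => hT I (Finset.mem_of_mem_erase hI)) (by
        intro I hI I' hII' hI'
        refine Finset.mem_erase.2 ⟨?_, hup I (Finset.mem_of_mem_erase hI) I' hII' hI'⟩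
        rintro rfl
        have h1 := hJmin I (Finset.mem_of_mem_erase hI)
        exact (Finset.mem_erase.1 hI).1 (Finset.eq_of_subset_of_card_le hII' h1)) (by
        intro I hI hI'
        by_cases hIJ : I = J
        · rw [hIJ, shift_J]
        · have hIT : I ∉ T := fun h => hI (Finset.mem_erase.2 ⟨hIJ, h⟩)
          rw [hagree I hIT hI']
          have : ¬ J ⊆ I := fun h => hIT (hup J hJT I h hI')
          simp [gaugeShift, this])
    have := selfBracket_gauge hb.deg β_mem hJne hb.mc Finset.univ
    refine ⟨w - gaugeShift A b J β Finset.univ, ?_⟩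
    rw [map_sub, ← hw, obstruction, obstruction, obstruction, this]
    abel

end Momentum

end Perturbiner

end TreeAmp

/-! ### Sums over trees -/

namespace TreeAmp

section Trees

namespace PlanarTree

variable {n : ℕ}

theorem firstLeaf_mem (P : PlanarTree n) : P.firstLeaf ∈ P.leaves := by
  induction P with
  | leaf j => simp [firstLeaf, leaves]
  | node l r hl hr => simp [firstLeaf, leaves, hl]

theorem Normal.firstLeaf_le {P : PlanarTree n} (h : P.Normal) : ∀ j ∈ P.leaves, P.firstLeaf ≤ j := by
  induction P with
  | leaf j => simp [firstLeaf, leaves]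
  | node l r hl hr =>
    obtain ⟨h1, h2, h3⟩ := h
    intro j hj
    rw [leaves, List.mem_append] at hj
    rcases hj with hj | hj
    · exact hl h2 j hj
    · exact h1.le.trans (hr h3 j hj)

/-- The trees whose inputs are the elements of `J`, each occurring once, in normal planar
embedding. -/
def treesOn (J : Finset (Fin n)) : Finset (PlanarTree n) :=
  ((finite_leaves_le n n).subset
    (t := {P | P.leaves.Nodup ∧ P.leaves.toFinset = J ∧ P.Normal}) (by
      rintro P ⟨h, -, -⟩
      simpa using h.length_le_card)).toFinset

theorem mem_treesOn {J : Finset (Fin n)} {P : PlanarTree n} :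
    P ∈ treesOn J ↔ P.leaves.Nodup ∧ P.leaves.toFinset = J ∧ P.Normal := by
  simp [treesOn]

theorem treesOn_empty : treesOn (∅ : Finset (Fin n)) = ∅ := by
  ext P
  have := firstLeaf_mem P
  simp only [mem_treesOn, List.toFinset_eq_empty_iff]
  constructor
  · rintro ⟨-, h, -⟩
    simp [h] at this
  · simp

theorem treesOn_singleton (j : Fin n) : treesOn {j} = {leaf j} := by
  ext P
  rw [mem_treesOn, Finset.mem_singleton]
  constructor
  · rintro ⟨h1, h2, -⟩
    have hc : P.leaves.length = 1 := by
      rw [← List.toFinset_card_of_nodup h1, h2]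
      simp
    cases P with
    | leaf i => simpa [leaves] using h2
    | node l r =>
      have := leaves_length_pos l
      have := leaves_length_pos r
      simp only [leaves, List.length_append] at hc
      omega
  · rintro rfl
    simp [leaves, Normal]

theorem treeSet_eq (n : ℕ) : (finite_treeSet n).toFinset = treesOn Finset.univ := by
  ext P
  rw [Set.Finite.mem_toFinset, mem_treesOn]
  constructor
  · rintro ⟨h1, h2⟩
    refine ⟨h1.nodup_iff.2 (List.nodup_finRange n), ?_, h2⟩
    ext j
    simp [h1.mem_iff]
  · rintro ⟨h1, h2, h3⟩
    refine ⟨List.perm_of_nodup_nodup_toFinset_eq h1 (List.nodup_finRange n) ?_, h3⟩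
    rw [h2]
    ext j
    simp

/-- Some element of `I` is smaller than all elements of `I'`. -/
def Precedes (I I' : Finset (Fin n)) : Prop := ∃ i ∈ I, ∀ j ∈ I', i < j

instance (I I' : Finset (Fin n)) : Decidable (Precedes I I') := by
  unfold Precedes
  infer_instance

theorem precedes_compl {I J : Finset (Fin n)} (hJ : J.Nonempty) (hI : I ⊆ J) :
    ¬ Precedes I (J \ I) ↔ Precedes (J \ I) I := by
  constructor
  · intro h
    simp only [Precedes, not_exists, not_and, not_forall, not_lt] at h
    have hmin := J.min'_mem hJ
    by_cases hm : J.min' hJ ∈ I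
    · obtain ⟨j, hj, hj'⟩ := h _ hm
      have hjJ := (Finset.mem_sdiff.1 hj).1
      have : j = J.min' hJ := le_antisymm hj' (J.min'_le j hjJ)
      exact absurd (this ▸ hm) (Finset.mem_sdiff.1 hj).2
    · refine ⟨J.min' hJ, Finset.mem_sdiff.2 ⟨hmin, hm⟩, fun j hj => ?_⟩
      refine lt_of_le_of_ne (J.min'_le j (hI hj)) ?_
      rintro h'
      exact hm (h' ▸ hj)
  · rintro ⟨i, hi, h⟩ ⟨j, hj, h'⟩
    exact absurd (h j hj) (not_lt.2 (h' i hi).le)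

/-- The recursive structure of the sum over trees: a tree with at least two inputs consists of a
left and a right subtree, the smallest input being on the left. -/
theorem sum_treesOn {α : Type*} [AddCommMonoid α] {J : Finset (Fin n)} (hJ : 1 < J.card)
    (f : PlanarTree n → α) :
    ∑ P ∈ treesOn J, f P = ∑ I ∈ J.powerset.filter (fun I => Precedes I (J \ I)),
      ∑ l ∈ treesOn I, ∑ r ∈ treesOn (J \ I), f (node l r) := by
  have h1 : ∀ I, ∑ l ∈ treesOn I, ∑ r ∈ treesOn (J \ I), f (node l r) =
      ∑ p ∈ treesOn I ×ˢ treesOn (J \ I), f (node p.1 p.2) := fun I => by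
    rw [Finset.sum_product]
  simp only [h1]
  rw [Finset.sum_sigma']
  symm
  refine Finset.sum_bij (fun p _ => node p.2.1 p.2.2) ?_ ?_ ?_ ?_
  · rintro ⟨I, l, r⟩ h
    simp only [Finset.mem_sigma, Finset.mem_filter, Finset.mem_powerset, Finset.mem_product,
      mem_treesOn] at h
    obtain ⟨⟨hI, i, hi, hprec⟩, ⟨l1, l2, l3⟩, r1, r2, r3⟩ := h
    rw [mem_treesOn]
    simp only [leaves, Normal]
    refine ⟨List.nodup_append'.2 ⟨l1, r1, ?_⟩, ?_, ?_, l3, r3⟩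
    · intro x hx hx'
      rw [← List.mem_toFinset, l2] at hx
      rw [← List.mem_toFinset, r2] at hx'
      exact (Finset.mem_sdiff.1 hx').2 hx
    · rw [List.toFinset_append, l2, r2, Finset.union_sdiff_of_subset hI]
    · have a1 : l.firstLeaf ≤ i := l3.firstLeaf_le i (by rw [← List.mem_toFinset, l2]; exact hi)
      have a2 : i < r.firstLeaf :=
        hprec _ (by rw [← r2, List.mem_toFinset]; exact firstLeaf_mem r)
      exact a1.trans_lt a2
  · rintro ⟨I, l, r⟩ h ⟨I', l', r'⟩ h' heq
    simp only [Finset.mem_sigma, Finset.mem_product, mem_treesOn] at h h'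
    simp only [node.injEq] at heq
    obtain ⟨rfl, rfl⟩ := heq
    have : I = I' := by rw [← h.2.1.2.1, ← h'.2.1.2.1]
    subst this
    rfl
  · intro P hP
    rw [mem_treesOn] at hP
    obtain ⟨p1, p2, p3⟩ := hP
    cases P with
    | leaf j =>
      rw [← p2] at hJ
      simp [leaves] at hJ
    | node l r =>
      simp only [leaves, Normal] at p1 p2 p3
      rw [List.nodup_append'] at p1
      have hr : J \ l.leaves.toFinset = r.leaves.toFinset := by
        rw [← p2, List.toFinset_append, Finset.union_sdiff_cancel_left]
        rw [Finset.disjoint_left]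
        intro x hx hx'
        exact p1.2.2 (List.mem_toFinset.1 hx) (List.mem_toFinset.1 hx')
      refine ⟨⟨l.leaves.toFinset, l, r⟩, ?_, rfl⟩
      simp only [Finset.mem_sigma, Finset.mem_filter, Finset.mem_powerset, Finset.mem_product,
        mem_treesOn, hr]
      refine ⟨⟨?_, l.firstLeaf, by simpa using firstLeaf_mem l, ?_⟩, ⟨p1.1, by trivial, p3.2.1⟩,
        p1.2.1, by trivial, p3.2.2⟩
      · rw [← p2, List.toFinset_append]
        exact Finset.subset_union_left
      · intro j hj
        exact p3.1.trans_le (p3.2.2.firstLeaf_le j (by simpa using hj))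
  · intros
    rfl

theorem lineDeg_one (P : PlanarTree n) : P.lineDeg (fun _ => 1) = 1 := by
  induction P with
  | leaf j => rfl
  | node l r hl hr => simp [lineDeg, hl, hr]

end PlanarTree

theorem permSign_one {n : ℕ} (w : List (Fin n)) : permSign (fun _ => 1) w = 1 := by
  induction w with
  | nil => rfl
  | cons a w ih => simp [permSign, ih]

variable {L : Type*} [AddCommGroup L] [Module ℂ L] {A : DGLA L}
  {K : Type*} [AddCommGroup K] [DecidableEq K] {M : MomentumGrading A K} {n : ℕ}

/-- If `a` has degree one, the terms of `[a, a]` come in equal pairs. -/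
theorem half_selfBracket {a : Finset (Fin n) → L} (h1 : ∀ J, a J ∈ A.gr 1) {J : Finset (Fin n)}
    (hJ : J.Nonempty) :
    (1 / 2 : ℂ) • selfBracket A a J =
      ∑ I ∈ J.powerset.filter (fun I => PlanarTree.Precedes I (J \ I)),
        A.bracket (a I) (a (J \ I)) := by
  have e : ∑ I ∈ J.powerset.filter (fun I => ¬ PlanarTree.Precedes I (J \ I)),
      A.bracket (a I) (a (J \ I)) =
      ∑ I ∈ J.powerset.filter (fun I => PlanarTree.Precedes I (J \ I)),
        A.bracket (a I) (a (J \ I)) := by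
    rw [Finset.sum_filter, Finset.sum_filter,
      sum_powerset_compl J fun I I' => if ¬ PlanarTree.Precedes I I' then
        A.bracket (a I) (a I') else 0]
    refine Finset.sum_congr rfl fun I hI => ?_
    rw [Finset.mem_powerset] at hI
    have h := PlanarTree.precedes_compl hJ (Finset.sdiff_subset : J \ I ⊆ J)
    rw [Finset.sdiff_sdiff_eq_self hI] at h
    simp only [h]
    split_ifs
    · exact DGLA.bracket_symm_one (h1 _) (h1 _)
    · rfl
  rw [selfBracket, ← Finset.sum_filter_add_sum_filter_not J.powerset
    (fun I => PlanarTree.Precedes I (J \ I)), e]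
  module

namespace Homotopy

variable (H : Homotopy M)

/-- The sum of the values of the lines above all trees with inputs `J`. -/
def treeSum (x : Fin n → Homology A.d) (J : Finset (Fin n)) : L :=
  ∑ P ∈ PlanarTree.treesOn J, H.line (fun _ => 1) x P

theorem treeSum_empty (x : Fin n → Homology A.d) : H.treeSum x ∅ = 0 := by
  simp [treeSum, PlanarTree.treesOn_empty]

theorem treeSum_singleton (x : Fin n → Homology A.d) (j : Fin n) :
    H.treeSum x {j} = H.incl (x j) := by
  simp [treeSum, PlanarTree.treesOn_singleton, line]

theorem nodeBracket_one (x y : L) : nodeBracket A 1 x y = -A.bracket x y := by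
  simp [nodeBracket, Units.smul_def]

theorem sum_nodeBracket (x : Fin n → Homology A.d) (I I' : Finset (Fin n)) :
    ∑ l ∈ PlanarTree.treesOn I, ∑ r ∈ PlanarTree.treesOn I',
      nodeBracket A (l.lineDeg fun _ => 1) (H.line (fun _ => 1) x l) (H.line (fun _ => 1) x r) =
      -A.bracket (H.treeSum x I) (H.treeSum x I') := by
  simp only [PlanarTree.lineDeg_one, nodeBracket_one, treeSum, map_sum, LinearMap.sum_apply,
    Finset.sum_neg_distrib]
  congr 1
  exact Finset.sum_comm

variable {x : Fin n → Homology A.d}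

theorem treeSum_of_one_lt {J : Finset (Fin n)} (hJ : 1 < J.card) :
    H.treeSum x J = -H.h (∑ I ∈ J.powerset.filter (fun I => PlanarTree.Precedes I (J \ I)),
      A.bracket (H.treeSum x I) (H.treeSum x (J \ I))) := by
  rw [treeSum, PlanarTree.sum_treesOn hJ, ← map_neg, ← Finset.sum_neg_distrib, map_sum]
  refine Finset.sum_congr rfl fun I _ => ?_
  rw [← H.sum_nodeBracket, map_sum]
  refine Finset.sum_congr rfl fun l _ => ?_
  rw [map_sum]
  rfl

theorem minimalModelBracket_eq (hn : 2 ≤ n) :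
    H.minimalModelBracket (fun _ => 1) x = -((globalSign fun _ : Fin n => (1 : ℤ)) •
      H.proj (∑ I ∈ Finset.univ.powerset.filter
        (fun I => PlanarTree.Precedes I (Finset.univ \ I)),
        A.bracket (H.treeSum x I) (H.treeSum x (Finset.univ \ I)))) := by
  rw [minimalModelBracket, PlanarTree.treeSet_eq,
    PlanarTree.sum_treesOn (by rw [Finset.card_univ, Fintype.card_fin]; exact hn),
    ← smul_neg, ← map_neg, ← Finset.sum_neg_distrib,
    map_sum, Finset.smul_sum]
  refine Finset.sum_congr rfl fun I _ => ?_
  rw [← H.sum_nodeBracket, map_sum, Finset.smul_sum]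
  refine Finset.sum_congr rfl fun l _ => ?_
  rw [map_sum, Finset.smul_sum]
  refine Finset.sum_congr rfl fun r _ => ?_
  simp [treeMap, permSign_one, treeValue]

variable {k : Fin n → K} (hx : ∀ j, H.incl (x j) ∈ A.gr 1) (hx' : ∀ j, H.incl (x j) ∈ M.comp (k j))

include hx in
theorem treeSum_mem (J : Finset (Fin n)) : H.treeSum x J ∈ A.gr 1 := by
  induction J using Finset.strongInduction with
  | H J ih =>
  rcases J.eq_empty_or_nonempty with rfl | hne
  · rw [treeSum_empty]
    exact zero_mem _
  by_cases hcard : J.card = 1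
  · obtain ⟨j, rfl⟩ := Finset.card_eq_one.1 hcard
    rw [treeSum_singleton]
    exact hx j
  · have h1 : 1 < J.card := by
      have := hne.card_pos
      omega
    rw [H.treeSum_of_one_lt h1]
    refine neg_mem ?_
    rw [show (1 : ℤ) = 1 + 1 - 1 by norm_num]
    refine H.h_mem _ _ (sum_mem fun I hI => ?_)
    simp only [Finset.mem_filter, Finset.mem_powerset] at hI
    by_cases hIJ : I = J
    · subst hIJ
      simp [treeSum_empty]
    by_cases hI0 : I = ∅
    · subst hI0
      simp [treeSum_empty]
    · exact A.bracket_mem _ _ _ _ (ih I (hI.1.ssubset_of_ne hIJ))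
        (ih _ (Finset.sdiff_ssubset hI.1 (Finset.nonempty_iff_ne_empty.2 hI0)))

include hx' in
theorem treeSum_mom (J : Finset (Fin n)) : H.treeSum x J ∈ M.comp (∑ j ∈ J, k j) := by
  induction J using Finset.strongInduction with
  | H J ih =>
  rcases J.eq_empty_or_nonempty with rfl | hne
  · rw [treeSum_empty]
    exact zero_mem _
  by_cases hcard : J.card = 1
  · obtain ⟨j, rfl⟩ := Finset.card_eq_one.1 hcard
    rw [treeSum_singleton, Finset.sum_singleton]
    exact hx' j
  · have h1 : 1 < J.card := by
      have := hne.card_pos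
      omega
    rw [H.treeSum_of_one_lt h1]
    refine neg_mem (H.h_mom _ _ (sum_mem fun I hI => ?_))
    simp only [Finset.mem_filter, Finset.mem_powerset] at hI
    by_cases hIJ : I = J
    · subst hIJ
      simp [treeSum_empty]
    by_cases hI0 : I = ∅
    · subst hI0
      simp [treeSum_empty]
    · rw [← Finset.sum_sdiff hI.1, add_comm]
      exact M.bracket_mem _ _ _ _ (ih I (hI.1.ssubset_of_ne hIJ))
        (ih _ (Finset.sdiff_ssubset hI.1 (Finset.nonempty_iff_ne_empty.2 hI0)))

theorem d_incl (y : Homology A.d) : A.d (H.incl y) = 0 := by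
  obtain ⟨⟨z, hz⟩, rfl⟩ := Submodule.Quotient.mk_surjective _ y
  exact H.d_pi z

include hx hx' in
/-- The sum over trees solves the Maurer-Cartan equation if the internal lines are off-shell. -/
theorem isPerturbiner_treeSum (hoff : InternalOffShell M k) :
    IsPerturbiner M k (H.treeSum x) := by
  refine ⟨H.treeSum_empty x, H.treeSum_mem hx, H.treeSum_mom hx', fun J => ?_⟩
  induction J using Finset.strongInduction with
  | H J ih =>
  intro hJ
  rcases J.eq_empty_or_nonempty with rfl | hne
  · simp [MCAt, treeSum_empty, selfBracket]
  by_cases hcard : J.card = 1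
  · obtain ⟨j, rfl⟩ := Finset.card_eq_one.1 hcard
    have : selfBracket A (H.treeSum x) {j} = 0 := by
      refine Finset.sum_eq_zero fun I hI => ?_
      rcases Finset.subset_singleton_iff.1 (Finset.mem_powerset.1 hI) with rfl | rfl
      · simp [treeSum_empty]
      · simp [treeSum_empty]
    rw [MCAt, this, treeSum_singleton, d_incl]
    simp
  · have h1 : 1 < J.card := by
      have := hne.card_pos
      omega
    have hlt : J.card < n := by
      simpa using Finset.card_lt_univ_of_notMem (s := J)
        (Classical.not_forall.1 fun h => hJ (Finset.eq_univ_iff_forall.2 h)).choose_spec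
    rw [MCAt, H.treeSum_of_one_lt h1, map_neg, ← half_selfBracket (H.treeSum_mem hx) hne]
    congr 1
    refine H.eq_d_h (hoff J h1 hlt) ?_ ?_
    · refine Submodule.smul_mem _ _ (sum_mem fun I hI => ?_)
      rw [← Finset.sum_sdiff (Finset.mem_powerset.1 hI), add_comm]
      exact M.bracket_mem _ _ _ _ (H.treeSum_mom hx' _) (H.treeSum_mom hx' _)
    · rw [map_smul, d_selfBracket (H.treeSum_empty x) (H.treeSum_mem hx) fun I hI =>
        ih I hI (fun h => hI.2 (h ▸ Finset.subset_univ J)), smul_zero]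

theorem proj_of_closed {y : L} (hy : y ∈ LinearMap.ker A.d) : H.proj y = cls A.d y hy := by
  refine (Submodule.Quotient.eq _).2 ⟨-H.h y, ?_⟩
  simp [pi, LinearMap.mem_ker.1 hy]

theorem incl_cls {y : L} (hy : y ∈ LinearMap.ker A.d) : H.incl (cls A.d y hy) = y - A.d (H.h y) := by
  have : H.incl (cls A.d y hy) = H.pi y := rfl
  simp [this, pi, LinearMap.mem_ker.1 hy]

/-- The minimal model bracket of degree one classes can be computed from any solution of the
Maurer-Cartan equation that starts with representatives of the classes. -/
theorem minimalModelBracket_eq_obstruction (hn : 2 ≤ n) (hoff : InternalOffShell M k)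
    {a : Finset (Fin n) → L} (ha : IsPerturbiner M k a) (hd : ∀ j, a {j} ∈ LinearMap.ker A.d)
    (hxa : ∀ j, x j = cls A.d (a {j}) (hd j)) :
    H.minimalModelBracket (fun _ => 1) x =
      cls A.d (-((globalSign fun _ : Fin n => (1 : ℤ)) • obstruction A a))
        (neg_mem (Submodule.smul_of_tower_mem _ _ ha.d_obstruction)) := by
  have hin : ∀ j, H.incl (x j) = a {j} - A.d (H.h (a {j})) := fun j => by
    rw [hxa j, H.incl_cls]
  have hmem : ∀ j, A.d (H.h (a {j})) ∈ A.gr 1 := fun j => by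
    rw [show (1 : ℤ) = 1 - 1 + 1 by norm_num]
    exact A.d_mem _ _ (H.h_mem _ _ (ha.deg _))
  have hmom : ∀ j, A.d (H.h (a {j})) ∈ M.comp (k j) := fun j => by
    have := ha.mom {j}
    rw [Finset.sum_singleton] at this
    exact M.d_mem _ _ (H.h_mom _ _ this)
  have hx : ∀ j, H.incl (x j) ∈ A.gr 1 := fun j => by
    rw [hin]
    exact sub_mem (ha.deg _) (hmem j)
  have hx' : ∀ j, H.incl (x j) ∈ M.comp (k j) := fun j => by
    rw [hin]
    refine sub_mem ?_ (hmom j)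
    simpa using ha.mom {j}
  have ht := H.isPerturbiner_treeSum hx hx' hoff
  obtain ⟨w, hw⟩ := ht.obstruction_unique H hoff ha fun j =>
    ⟨-H.h (a {j}), by rw [treeSum_singleton, hin, map_neg]; abel⟩
  have huniv : (Finset.univ : Finset (Fin n)).Nonempty := ⟨⟨0, by omega⟩, Finset.mem_univ _⟩
  rw [H.minimalModelBracket_eq hn, ← half_selfBracket (H.treeSum_mem hx) huniv]
  have hc : H.proj (obstruction A (H.treeSum x)) = cls A.d (obstruction A a) ha.d_obstruction := by
    rw [H.proj_of_closed ht.d_obstruction]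
    exact (Submodule.Quotient.eq _).2 ⟨w, hw.symm⟩
  change -(_ • H.proj (obstruction A (H.treeSum x))) = _
  rw [hc, Units.smul_def]
  rfl

end Homotopy

end Trees

end TreeAmp

/-! ### Homology and the Lorentz equivariant complexes -/

namespace TreeAmp

section HomologyMap

variable {C C' : Type*} [AddCommGroup C] [Module ℂ C] [AddCommGroup C'] [Module ℂ C']

/-- The map on homology induced by a chain map. -/
def homologyMap {d : C →ₗ[ℂ] C} {d' : C' →ₗ[ℂ] C'} (f : C →ₗ[ℂ] C')
    (hf : ∀ x, f (d x) = d' (f x)) : Homology d →ₗ[ℂ] Homology d' :=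
  Submodule.mapQ _ _ (f.restrict (p := LinearMap.ker d) (q := LinearMap.ker d') fun x hx => by
    rw [LinearMap.mem_ker] at hx ⊢
    rw [← hf, hx, map_zero]) (by
      rintro ⟨x, hx⟩ ⟨y, hy⟩
      refine ⟨f y, ?_⟩
      rw [← hf, hy]
      rfl)

theorem cls_eq_cls {d : C →ₗ[ℂ] C} {x y : C} (hx : x ∈ LinearMap.ker d)
    (hy : y ∈ LinearMap.ker d) : cls d x hx = cls d y hy ↔ ∃ w, d w = x - y := by
  unfold cls
  rw [Submodule.Quotient.eq]
  rfl

theorem cls_eq_zero {d : C →ₗ[ℂ] C} {x : C} (hx : x ∈ LinearMap.ker d) :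
    cls d x hx = 0 ↔ ∃ w, d w = x := by
  unfold cls
  rw [Submodule.Quotient.mk_eq_zero]
  rfl

theorem exists_cls (d : C →ₗ[ℂ] C) (x : Homology d) : ∃ y, ∃ hy, x = cls d y hy := by
  obtain ⟨⟨y, hy⟩, rfl⟩ := Submodule.Quotient.mk_surjective _ x
  exact ⟨y, hy, rfl⟩

end HomologyMap

section Pair

variable (N : ℕ) (U : Type*) [AddCommGroup U] [Module ℂ U]

theorem coeffMap_apply {ι : Type*} [Fintype ι] (M : ι → ι → ℂ) (x : ι → U) (i : ι) :
    coeffMap U M x i = ∑ j, M i j • x j := by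
  simp [coeffMap]

theorem pairD_apply (k : Mom) (w : PairSpace N U) (σ : ℤˣ) (a : GammaIdx N) :
    pairD N U k w σ a = ∑ b, gammaMatrix N σ k a b • w σ b := by
  simp [pairD, gammaD, coeffMap_apply]

theorem pairD_smul (c : ℂ) (k : Mom) : pairD N U (c • k) = c • pairD N U k := by
  have hs : ∀ σ : ℤˣ, signedMom σ (c • k) = c • signedMom σ k := by
    intro σ
    unfold signedMom
    split_ifs <;> simp
  have : ∀ σ a b, gammaMatrix N σ (c • k) a b = c * gammaMatrix N σ k a b := by
    intro σ a b
    rcases a with a | ⟨β, a⟩ | a <;> rcases b with b | ⟨β', b⟩ | b <;>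
      simp [gammaMatrix, hs, mul_add]
  refine LinearMap.ext fun w => ?_
  funext σ a
  rw [LinearMap.smul_apply, Pi.smul_apply, Pi.smul_apply, pairD_apply, pairD_apply, Finset.smul_sum]
  simp only [this, mul_smul]

/-- The projection of `(Γ_{-h} ⊕ Γ_h) ⊗ U` onto the elements of degree `i`. -/
def pairProj (i : ℤ) : PairSpace N U →ₗ[ℂ] PairSpace N U :=
  LinearMap.pi fun σ => LinearMap.pi fun a =>
    if gammaDeg a = i then LinearMap.proj a ∘ₗ LinearMap.proj σ else 0

theorem pairProj_apply (i : ℤ) (w : PairSpace N U) (σ : ℤˣ) (a : GammaIdx N) :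
    pairProj N U i w σ a = if gammaDeg a = i then w σ a else 0 := by
  simp only [pairProj, LinearMap.pi_apply]
  split_ifs <;> rfl

theorem pairGr_isInternal : DirectSum.IsInternal (pairGr N U) := by
  refine isInternal_of_projections _ (pairProj N U) ?_ ?_ ?_
  · intro i w hw
    funext σ a
    rw [pairProj_apply]
    split_ifs with h
    · rfl
    · exact (hw σ a h).symm
  · intro i j hij w hw
    funext σ a
    rw [pairProj_apply]
    split_ifs with h
    · exact hw σ a (h ▸ hij)
    · rfl
  · intro w
    have : w = pairProj N U 1 w + pairProj N U 2 w + pairProj N U 3 w := by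
      funext σ a
      simp only [Pi.add_apply, pairProj_apply]
      rcases a with a | ⟨b, a⟩ | a <;> simp [gammaDeg]
    rw [this]
    have h : ∀ i, pairProj N U i w ∈ pairGr N U i := fun i σ a ha => by
      rw [pairProj_apply, if_neg ha]
    exact add_mem (add_mem (Submodule.mem_iSup_of_mem 1 (h 1)) (Submodule.mem_iSup_of_mem 2 (h 2)))
      (Submodule.mem_iSup_of_mem 3 (h 3))

theorem pairD_mem (k : Mom) (i : ℤ) (w : PairSpace N U) (hw : w ∈ pairGr N U i) :
    pairD N U k w ∈ pairGr N U (i + 1) := by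
  intro σ a ha
  rw [pairD_apply]
  refine Finset.sum_eq_zero fun b _ => ?_
  by_cases hb : gammaDeg b = i
  · rcases a with a | ⟨β, a⟩ | a <;> rcases b with b | ⟨β', b⟩ | b <;>
      first
        | simp [gammaMatrix]; done
        | (exfalso; apply ha; rw [← hb]; rfl)
  · rw [hw σ b hb, smul_zero]

theorem pairD_poly : IsPolynomial (pairD N U) := by
  classical
  intro w φ
  -- every component of `φ (pairD k w)` is linear in `k`
  have key : ∀ k : Mom, φ (pairD N U k w) =
      ∑ s : Fin 2 × Fin 2, k s.1 s.2 * φ (pairD N U (Matrix.single s.1 s.2 1) w) := by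
    intro k
    have hadd : ∀ k l : Mom, pairD N U (k + l) w = pairD N U k w + pairD N U l w := by
      intro k l
      have hs : ∀ σ : ℤˣ, signedMom σ (k + l) = signedMom σ k + signedMom σ l := by
        intro σ
        unfold signedMom
        split_ifs <;> simp
      funext σ a
      simp only [Pi.add_apply, pairD_apply, ← Finset.sum_add_distrib, ← add_smul]
      refine Finset.sum_congr rfl fun b _ => ?_
      congr 1
      rcases a with a | ⟨β, a⟩ | a <;> rcases b with b | ⟨β', b⟩ | b <;>
        simp only [gammaMatrix, hs, Matrix.add_mul, Matrix.mul_add, Matrix.add_apply, add_zero,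
          ← Finset.sum_add_distrib] <;>
        refine Finset.sum_congr rfl fun γ _ => ?_ <;> split_ifs <;> simp
    have hk : k = ∑ s : Fin 2 × Fin 2, k s.1 s.2 • Matrix.single s.1 s.2 (1 : ℂ) := by
      rw [Fintype.sum_prod_type]
      conv_lhs => rw [Matrix.matrix_eq_sum_single k]
      simp [Matrix.smul_single]
    have hsum : ∀ (S : Finset (Fin 2 × Fin 2)) (f : Fin 2 × Fin 2 → Mom),
        pairD N U (∑ s ∈ S, f s) w = ∑ s ∈ S, pairD N U (f s) w := by
      intro S f
      refine map_sum (AddMonoidHom.mk' (fun k => pairD N U k w) hadd) f S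
    conv_lhs => rw [hk, hsum, map_sum]
    refine Finset.sum_congr rfl fun s _ => ?_
    rw [pairD_smul, LinearMap.smul_apply, map_smul, smul_eq_mul]
  refine ⟨∑ s : Fin 2 × Fin 2, MvPolynomial.X s *
    MvPolynomial.C (φ (pairD N U (Matrix.single s.1 s.2 1) w)), fun k => ?_⟩
  rw [key, polyEval, map_sum]
  simp

theorem sum_ite_val {α : Type*} [AddCommMonoid α] {n : ℕ} (f : Fin n → α) (m : ℕ) (hm : m < n) :
    (∑ i : Fin n, if (i : ℕ) = m then f i else 0) = f ⟨m, hm⟩ := by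
  rw [Finset.sum_eq_single_of_mem ⟨m, hm⟩ (Finset.mem_univ _)]
  · simp
  · intro i _ hi
    rw [if_neg]
    rintro rfl
    exact hi rfl

theorem pairD_deg_one (k : Mom) (w : PairSpace N U) (σ : ℤˣ) (i : Fin (N + 1)) :
    pairD N U k w σ (Sum.inl i) = 0 := by
  rw [pairD_apply]
  refine Finset.sum_eq_zero fun b _ => ?_
  rcases b with b | ⟨β', b⟩ | b <;> simp [gammaMatrix]

theorem pairD_deg_two (k : Mom) (w : PairSpace N U) (σ : ℤˣ) (β : Fin 2) (j : Fin N) :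
    pairD N U k w σ (Sum.inr (Sum.inl (β, j))) =
      (signedMom (-σ) k * eps) β 0 • w σ (Sum.inl ⟨j, by omega⟩) +
      (signedMom (-σ) k * eps) β 1 • w σ (Sum.inl ⟨j + 1, by omega⟩) := by
  rw [pairD_apply]
  simp only [Fintype.sum_sum_type, gammaMatrix, zero_smul, Finset.sum_const_zero, add_zero,
    Fin.sum_univ_two, add_smul, ite_smul, Finset.sum_add_distrib, Fin.val_zero, Fin.val_one]
  rw [sum_ite_val (fun i => (signedMom (-σ) k * eps) β 0 • w σ (Sum.inl i)),
    sum_ite_val (fun i => (signedMom (-σ) k * eps) β 1 • w σ (Sum.inl i))]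

theorem pairD_deg_three (k : Mom) (w : PairSpace N U) (σ : ℤˣ) (j : Fin (N - 1)) :
    pairD N U k w σ (Sum.inr (Sum.inr j)) = ∑ y : Fin 2,
      ((eps * signedMom σ k * eps) 0 y • w σ (Sum.inr (Sum.inl (y, ⟨j, by omega⟩))) +
      (eps * signedMom σ k * eps) 1 y • w σ (Sum.inr (Sum.inl (y, ⟨j + 1, by omega⟩)))) := by
  rw [pairD_apply]
  simp only [Fintype.sum_sum_type, gammaMatrix, zero_smul, Finset.sum_const_zero, add_zero,
    Fin.sum_univ_two, add_smul, ite_smul, Finset.sum_add_distrib, Fin.val_zero, Fin.val_one,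
    Fintype.sum_prod_type, zero_add]
  have h : ∀ x y : Fin 2, ∀ m, (hm : m < N) → (∑ l : Fin N, if (l : ℕ) = m then
      (eps * signedMom σ k * eps) x y • w σ (Sum.inr (Sum.inl (y, l))) else 0) =
      (eps * signedMom σ k * eps) x y • w σ (Sum.inr (Sum.inl (y, ⟨m, hm⟩))) := by
    intro x y m hm
    exact sum_ite_val
      (fun l => (eps * signedMom σ k * eps) x y • w σ (Sum.inr (Sum.inl (y, l)))) m hm
  rw [h 0 0 j (by omega), h 0 1 j (by omega), h 1 0 (j + 1) (by omega), h 1 1 (j + 1) (by omega)]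

theorem eps_entries : eps 0 0 = 0 ∧ eps 0 1 = 1 ∧ eps 1 0 = -1 ∧ eps 1 1 = 0 := by
  simp [eps]

theorem signedMom_one (k : Mom) : signedMom 1 k = k := if_pos rfl

theorem signedMom_neg_one (k : Mom) : signedMom (-1) k = kᵀ := if_neg (by decide)

theorem pairD_pairD (k : Mom) (w : PairSpace N U) : pairD N U k (pairD N U k w) = 0 := by
  obtain ⟨e00, e01, e10, e11⟩ := eps_entries
  funext σ a
  rcases a with a | ⟨β, a⟩ | a
  · exact pairD_deg_one N U k _ σ a
  · rw [pairD_deg_two, pairD_deg_one, pairD_deg_one]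
    simp
  · rw [pairD_deg_three]
    simp only [Fin.sum_univ_two, pairD_deg_two]
    rcases Int.units_eq_one_or σ with rfl | rfl <;>
      simp only [neg_neg, signedMom_one, signedMom_neg_one, Matrix.mul_apply, Fin.sum_univ_two, e00,
        e01, e10, e11, Matrix.transpose_apply, Pi.zero_apply] <;>
      module

theorem lorentzPair_apply (g : Lorentz) (w : PairSpace N U) (σ : ℤˣ) (a : GammaIdx N) :
    lorentzPair N U g w σ a =
      ∑ b, (if σ = 1 then lorentzMatrix N g.1 g.2 else lorentzMatrix N g.2 g.1) a b • w σ b := by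
  simp only [lorentzPair, LinearMap.pi_apply, LinearMap.comp_apply, coeffMap_apply,
    LinearMap.proj_apply]

theorem lorentzPair_mem (g : Lorentz) (i : ℤ) (w : PairSpace N U) (hw : w ∈ pairGr N U i) :
    lorentzPair N U g w ∈ pairGr N U i := by
  intro σ a ha
  rw [lorentzPair_apply]
  refine Finset.sum_eq_zero fun b _ => ?_
  by_cases hb : gammaDeg b = i
  · have : ∀ A B : Mom, lorentzMatrix N A B a b = 0 := by
      intro A B
      rcases a with a | ⟨β, a⟩ | a <;> rcases b with b | ⟨β', b⟩ | b <;>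
        first
          | rfl
          | (exfalso; apply ha; rw [← hb]; rfl)
    split_ifs <;> simp [this]
  · rw [hw σ b hb, smul_zero]

end Pair

end TreeAmp

/-! ### Field theory models from data on one fibre -/

namespace TreeAmp

/-- A dgLa written on one fibre, together with a chain map `toGamma` to the Lorentz equivariant
complex, polynomial in the momentum and a quasi-isomorphism for nonzero momenta. -/
structure FieldTheoryData (N : ℕ) (U : Type*) [AddCommGroup U] [Module ℂ U] (V : Type)
    [AddCommGroup V] [Module ℂ V] extends FiberDGLA V where
  toGamma : Mom → V →ₗ[ℂ] PairSpace N U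
  toGamma_poly : IsPolynomial toGamma
  toGamma_mem : ∀ k i, ∀ x ∈ gr i, toGamma k x ∈ pairGr N U i
  toGamma_d : ∀ k x, toGamma k (d k x) = pairD N U k (toGamma k x)
  quasiIso : ∀ k, k ≠ 0 → IsQuasiIso (d k) (pairD N U k) (toGamma k)

namespace FieldTheoryData

variable {N : ℕ} {U : Type*} [AddCommGroup U] [Module ℂ U] {V : Type}
  [AddCommGroup V] [Module ℂ V] [FiniteDimensional ℂ V]
  (F : FieldTheoryData N U V)

/-- The dgLa. -/
abbrev X : PolynomialDGLA := F.toPolynomialDGLA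

/-- The inclusion of the fibre at momentum `k`. -/
def incl (k : Mom) : V →ₗ[ℂ] F.X.L := (Finsupp.lsingle k : V →ₗ[ℂ] (Mom →₀ V))

theorem d_at (k : Mom) (v : V) : F.X.A.d (F.incl k v) = F.incl k (F.d k v) := F.totalD_single k v

theorem bracket_at (k l : Mom) (v w : V) :
    F.X.A.bracket (F.incl k v) (F.incl l w) = F.incl (k + l) (F.br k l v w) := F.totalBr_single k l v w

theorem at_mem_gr {k : Mom} {v : V} {i : ℤ} : (F.incl k v) ∈ F.X.A.gr i ↔ v ∈ F.gr i :=
  F.single_mem_totalGr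

theorem at_mem_comp (k : Mom) (v : V) : F.incl k v ∈ F.X.M.comp k := ⟨v, rfl⟩

theorem exists_at_of_mem {k : Mom} {x : F.X.L} (hx : x ∈ F.X.M.comp k) : ∃ v, x = F.incl k v := by
  obtain ⟨v, rfl⟩ := hx
  exact ⟨v, rfl⟩

theorem at_closed {k : Mom} {v : V} : F.incl k v ∈ LinearMap.ker F.X.A.d ↔ F.d k v = 0 := by
  rw [LinearMap.mem_ker, d_at]
  exact Finsupp.single_eq_zero

theorem at_exact {k : Mom} {v : V} : (∃ x, F.X.A.d x = F.incl k v) ↔ ∃ w, F.d k w = v := by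
  constructor
  · rintro ⟨x, hx⟩
    refine ⟨(show Mom →₀ V from x) k, ?_⟩
    have key : ∀ f : Mom →₀ V, F.totalD f k = F.d k (f k) := by
      intro f
      induction f using Finsupp.induction_linear with
      | zero => simp
      | add f g hf hg => rw [map_add, Finsupp.add_apply, hf, hg, Finsupp.add_apply, map_add]
      | single l v =>
        rw [F.totalD_single, Finsupp.single_apply, Finsupp.single_apply]
        split_ifs with h
        · rw [h]
        · simp
    rw [← key]
    exact (DFunLike.congr_fun (show F.totalD x = Finsupp.single k v from hx) k).trans (by simp)
  · rintro ⟨w, rfl⟩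
    exact ⟨F.incl k w, F.d_at k w⟩

variable [FiniteDimensional ℂ U]

theorem exists_homotopyEquivalence (k : Mom) (hk : k ≠ 0) :
    ∃ O : Set Mom, IsZariskiOpen O ∧ k ∈ O ∧ (0 : Mom) ∉ O ∧
      ∃ (R : Mom → PairSpace N U →ₗ[ℂ] V) (u : Mom → PairSpace N U →ₗ[ℂ] PairSpace N U)
        (u' : Mom → V →ₗ[ℂ] V),
        IsRegularOn O R ∧ IsRegularOn O F.toGamma ∧ IsRegularOn O u ∧ IsRegularOn O u' ∧
        ∀ k ∈ O, IsHomotopyEquivalence (pairGr N U) (pairD N U k) F.gr (F.d k) (R k) (F.toGamma k)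
          (u k) (u' k) :=
  exists_regular_homotopyEquivalence F.isInternal (pairGr_isInternal N U) F.d_poly
    (pairD_poly N U) F.toGamma_poly F.d_mem (pairD_mem N U) F.toGamma_mem F.d_d
    (pairD_pairD N U) F.toGamma_d hk (F.quasiIso k hk)

theorem exists_pointwise (k : Mom) (hk : k ≠ 0) :
    ∃ (R : PairSpace N U →ₗ[ℂ] V) (u : PairSpace N U →ₗ[ℂ] PairSpace N U) (u' : V →ₗ[ℂ] V),
      IsHomotopyEquivalence (pairGr N U) (pairD N U k) F.gr (F.d k) R (F.toGamma k) u u' := by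
  obtain ⟨O, -, hkO, -, R, u, u', -, -, -, -, h⟩ := F.exists_homotopyEquivalence k hk
  exact ⟨R k, u k, u' k, h k hkO⟩

/-- A homotopy inverse of `toGamma k`, for `k ≠ 0`. -/
def ofGamma (k : Mom) (hk : k ≠ 0) : PairSpace N U →ₗ[ℂ] V :=
  (F.exists_pointwise k hk).choose

theorem ofGamma_d (k : Mom) (hk : k ≠ 0) (z : PairSpace N U) :
    F.ofGamma k hk (pairD N U k z) = F.d k (F.ofGamma k hk z) :=
  LinearMap.congr_fun (F.exists_pointwise k hk).choose_spec.choose_spec.choose_spec.R_chain z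

theorem ofGamma_mem (k : Mom) (hk : k ≠ 0) (i : ℤ) (z : PairSpace N U) (hz : z ∈ pairGr N U i) :
    F.ofGamma k hk z ∈ F.gr i :=
  (F.exists_pointwise k hk).choose_spec.choose_spec.choose_spec.R_mem i z hz

theorem toGamma_ofGamma (k : Mom) (hk : k ≠ 0) (z : PairSpace N U) (hz : pairD N U k z = 0) :
    ∃ w, F.toGamma k (F.ofGamma k hk z) = z + pairD N U k w := by
  have h := (F.exists_pointwise k hk).choose_spec.choose_spec.choose_spec.LR
  have := LinearMap.congr_fun h z
  refine ⟨-(F.exists_pointwise k hk).choose_spec.choose z, ?_⟩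
  rw [map_neg, ← sub_eq_add_neg]
  rw [LinearMap.sub_apply, LinearMap.sub_apply, LinearMap.comp_apply, LinearMap.comp_apply,
    LinearMap.comp_apply, hz, map_zero, sub_zero] at this
  exact this

/-- The isomorphism from the homology of the Lorentz equivariant complex at `k ≠ 0` to the
homology of the dgLa at momentum `k`, the inverse of the map induced by `toGamma k`. At `k = 0`
it is set to zero. -/
def Phi (k : Mom) : Homology (pairD N U k) →ₗ[ℂ] Homology F.X.A.d :=
  open Classical in
  if hk : k ≠ 0 then homologyMap (F.incl k ∘ₗ F.ofGamma k hk) (fun z => by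
    rw [LinearMap.comp_apply, ofGamma_d]
    exact (F.d_at k _).symm) else 0

/-- The closed element `v` of the fibre at `k` represents the class of the closed element `z`. -/
structure Rep (k : Mom) (v : V) (z : PairSpace N U) : Prop where
  closed : F.d k v = 0
  closed' : z ∈ LinearMap.ker (pairD N U k)
  eq : ∃ w, F.toGamma k v = z + pairD N U k w

theorem rep_ofGamma (k : Mom) (hk : k ≠ 0) (z : PairSpace N U)
    (hz : z ∈ LinearMap.ker (pairD N U k)) :
    F.Rep k (F.ofGamma k hk z) z :=
  ⟨by rw [← ofGamma_d, LinearMap.mem_ker.1 hz, map_zero], hz,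
    F.toGamma_ofGamma k hk z (LinearMap.mem_ker.1 hz)⟩

theorem rep_toGamma (k : Mom) (v : V) (hv : F.d k v = 0) : F.Rep k v (F.toGamma k v) :=
  ⟨hv, by rw [LinearMap.mem_ker, ← toGamma_d, hv, map_zero], 0, by simp⟩

theorem Phi_cls (k : Mom) (hk : k ≠ 0) (z : PairSpace N U) (hz : z ∈ LinearMap.ker (pairD N U k))
    (h : F.incl k (F.ofGamma k hk z) ∈ LinearMap.ker F.X.A.d) :
    F.Phi k (cls _ z hz) = cls F.X.A.d (F.incl k (F.ofGamma k hk z)) h := by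
  unfold Phi
  rw [dif_pos hk]
  rfl

/-- On representatives, `Phi` is the relation `Rep`. -/
theorem Phi_cls_iff (k : Mom) (hk : k ≠ 0) {z : PairSpace N U}
    (hz : z ∈ LinearMap.ker (pairD N U k)) {v : V} (hv : F.incl k v ∈ LinearMap.ker F.X.A.d) :
    F.Phi k (cls _ z hz) = cls F.X.A.d (F.incl k v) hv ↔ F.Rep k v z := by
  have hr := F.rep_ofGamma k hk z hz
  have hv' := F.at_closed.1 hv
  rw [F.Phi_cls k hk z hz (F.at_closed.2 hr.closed), cls_eq_cls, ← map_sub, at_exact]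
  obtain ⟨w, hw⟩ := hr.eq
  constructor
  · rintro ⟨t, ht⟩
    refine ⟨hv', hz, w - F.toGamma k t, ?_⟩
    have : v = F.ofGamma k hk z - F.d k t := by rw [ht]; abel
    rw [this, map_sub, hw, toGamma_d, map_sub]
    abel
  · rintro ⟨-, -, w', hw'⟩
    exact (F.quasiIso k hk).inj _ (w - w') (by rw [map_sub, hr.closed, hv', sub_zero])
      (by rw [map_sub, hw, hw', map_sub]; abel)

theorem isHomologyIso : IsHomologyIso F.X F.Phi := by
  intro k hk
  constructor
  · rw [injective_iff_map_eq_zero]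
    intro x hx
    obtain ⟨z, hz, rfl⟩ := exists_cls _ x
    have h0 : F.Phi k (cls _ z hz) = cls F.X.A.d (F.incl k (0 : V)) (F.at_closed.2 (map_zero _)) := by
      rw [hx]
      exact ((cls_eq_zero _).2 ⟨0, by simp⟩).symm
    obtain ⟨-, -, w, hw⟩ := (F.Phi_cls_iff k hk hz _).1 h0
    refine (cls_eq_zero hz).2 ⟨-w, ?_⟩
    rw [map_zero] at hw
    rw [map_neg]
    exact (eq_neg_of_add_eq_zero_left hw.symm).symm
  · ext x
    constructor
    · rintro ⟨y, rfl⟩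
      obtain ⟨z, hz, rfl⟩ := exists_cls _ y
      rw [F.Phi_cls k hk z hz (F.at_closed.2 (F.rep_ofGamma k hk z hz).closed)]
      exact ⟨⟨_, F.at_closed.2 (F.rep_ofGamma k hk z hz).closed⟩, F.at_mem_comp k _, rfl⟩
    · rintro ⟨⟨y, hy⟩, hmem, rfl⟩
      obtain ⟨v, rfl⟩ := F.exists_at_of_mem hmem
      exact ⟨cls _ _ (F.rep_toGamma k v (F.at_closed.1 hy)).closed',
        (F.Phi_cls_iff k hk _ hy).2 (F.rep_toGamma k v (F.at_closed.1 hy))⟩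

theorem isLocallyRegular : IsLocallyRegular F.X F.Phi := by
  intro k₀ hk₀
  obtain ⟨O, hO, hkO, h0, R, u, u', hR, hL, hu, hu', h⟩ := F.exists_homotopyEquivalence k₀ hk₀
  refine ⟨O, hO, hkO, h0, R, F.toGamma, u, u', hR, hL, hu, hu', fun k hk => ⟨h k hk, ?_⟩⟩
  intro z hz
  have hk0 : k ≠ 0 := by
    rintro rfl
    exact h0 hk
  have hRz : F.d k (R k z) = 0 := by
    have := LinearMap.congr_fun (h k hk).R_chain z
    rw [LinearMap.comp_apply, LinearMap.mem_ker.1 hz, map_zero] at this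
    exact this.symm
  refine ⟨F.at_closed.2 hRz, (F.Phi_cls_iff k hk0 hz (F.at_closed.2 hRz)).2
    ⟨hRz, hz, -u k z, ?_⟩⟩
  have := LinearMap.congr_fun (h k hk).LR z
  rw [map_neg, ← sub_eq_add_neg]
  simpa [LinearMap.mem_ker.1 hz] using this

theorem nonempty_homotopy : Nonempty (Homotopy F.X.M) := by
  choose u u_mem huu hdh dhd using fun k =>
    exists_gradedHomotopy F.isInternal (F.d k) (F.d_mem k) (F.d_d k)
  let h : (Mom →₀ V) →ₗ[ℂ] (Mom →₀ V) := Finsupp.lsum ℂ fun k => Finsupp.lsingle k ∘ₗ u k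
  have h_single : ∀ k v, h (Finsupp.single k v) = Finsupp.single k (u k v) := by
    intro k v
    simp [h]
  refine ⟨⟨h, ?_, ?_, ?_, ?_, ?_⟩⟩
  · intro i f hf
    refine F.totalGr_induction (p := fun f => h f ∈ F.totalGr (i - 1)) f hf (by simp) ?_ ?_
    · intro k x hx
      rw [h_single, F.single_mem_totalGr]
      exact u_mem k i x hx
    · intro f g hf hg
      rw [map_add]
      exact add_mem hf hg
  · rintro k _ ⟨v, rfl⟩
    exact ⟨u k v, (h_single k v).symm⟩
  · intro f
    change h (h f) = 0
    induction f using Finsupp.induction_linear with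
    | zero => simp
    | add f g hf hg => rw [map_add, map_add, hf, hg, add_zero]
    | single k v => rw [h_single, h_single, huu, Finsupp.single_zero]
  · intro f
    change h (F.totalD (h f)) = h f
    induction f using Finsupp.induction_linear with
    | zero => simp
    | add f g hf hg => rw [map_add, map_add, map_add, hf, hg]
    | single k v => rw [h_single, F.totalD_single, h_single, hdh]
  · intro f
    change F.totalD (h (F.totalD f)) = F.totalD f
    induction f using Finsupp.induction_linear with
    | zero => simp
    | add f g hf hg => rw [map_add, map_add, map_add, hf, hg]
    | single k v => rw [F.totalD_single, h_single, F.totalD_single, dhd]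

/-- The sign relating the minimal model bracket of degree one classes to the obstruction. -/
def treeSign (n : ℕ) : ℂ := -(((globalSign fun _ : Fin n => (1 : ℤ)) : ℤ) : ℂ)

theorem treeSign_two : treeSign 2 = 1 := by
  have : (globalSign fun _ : Fin 2 => (1 : ℤ)) = -1 := by
    unfold globalSign
    rw [Fin.sum_univ_two, if_pos (by decide), if_neg (by decide)]
    rfl
  simp [treeSign, this]

theorem neg_globalSign_smul {M : Type*} [AddCommGroup M] [Module ℂ M] (n : ℕ) (x : M) :
    -((globalSign fun _ : Fin n => (1 : ℤ)) • x) = treeSign n • x := by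
  rw [treeSign, neg_smul, Units.smul_def, Int.cast_smul_eq_zsmul]

/-- Evaluation of the minimal model bracket by means of a solution of the Maurer-Cartan equation
whose starting values represent the inputs. -/
theorem bracketIs_iff {n : ℕ} (hn : 2 ≤ n) {k : Fin n → Mom} (hk : Admissible F.X k)
    {a : Finset (Fin n) → F.X.L} (ha : IsPerturbiner F.X.M k a) {v : Fin n → V}
    (hav : ∀ j, a {j} = F.incl (k j) (v j)) {z : Fin n → PairSpace N U}
    (hz : ∀ j, z j ∈ pairGr N U 1) (hvz : ∀ j, F.Rep (k j) (v j) (z j)) {ω : V}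
    (hω : obstruction F.X.A a = F.incl (∑ j, k j) ω) (y : PairSpace N U) :
    BracketIs F.X F.Phi k z y ↔
      y ∈ pairGr N U 2 ∧ F.Rep (∑ j, k j) (treeSign n • ω) y := by
  have key : ∀ (H : Homotopy F.X.M) (hz' : ∀ j, z j ∈ LinearMap.ker (pairD N U (k j)))
      (hc : F.incl (∑ j, k j) (treeSign n • ω) ∈ LinearMap.ker F.X.A.d),
      H.minimalModelBracket (fun _ => 1) (fun j => F.Phi (k j) (cls _ (z j) (hz' j))) =
        cls F.X.A.d (F.incl (∑ j, k j) (treeSign n • ω)) hc := by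
    intro H hz' hc
    have hd : ∀ j, a {j} ∈ LinearMap.ker F.X.A.d := fun j => by
      rw [hav]
      exact F.at_closed.2 (hvz j).closed
    rw [H.minimalModelBracket_eq_obstruction hn hk.2.2 ha hd fun j => ?_]
    · rw [cls_eq_cls]
      refine ⟨0, ?_⟩
      rw [neg_globalSign_smul, hω, map_zero, ← map_smul, sub_self]
    · have := (F.Phi_cls_iff (k j) (hk.1 j) (hz' j) (F.at_closed.2 (hvz j).closed)).2 (hvz j)
      rw [this]
      simp only [hav]
  have hclosed : F.incl (∑ j, k j) (treeSign n • ω) ∈ LinearMap.ker F.X.A.d := by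
    rw [LinearMap.mem_ker, map_smul, ← hω, map_smul, ha.d_obstruction, smul_zero]
  constructor
  · rintro ⟨-, hy, hz', hy', h⟩
    obtain ⟨H⟩ := F.nonempty_homotopy
    refine ⟨hy, (F.Phi_cls_iff _ hk.2.1 hy' hclosed).1 ?_⟩
    rw [← h H, key H hz' hclosed]
  · rintro ⟨hy, hr⟩
    refine ⟨hz, hy, fun j => (hvz j).closed', hr.closed', fun H => ?_⟩
    exact (key H _ hclosed).trans ((F.Phi_cls_iff _ hk.2.1 hr.closed' hclosed).2 hr).symm

/-- Solutions of the Maurer-Cartan equation with given starting values exist. -/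
theorem exists_perturbiner {n : ℕ} {k : Fin n → Mom} (hk : Admissible F.X k)
    {z : Fin n → PairSpace N U} (hz : ∀ j, z j ∈ pairGr N U 1)
    (hd : ∀ j, z j ∈ LinearMap.ker (pairD N U (k j))) :
    ∃ (a : Finset (Fin n) → F.X.L) (v : Fin n → V) (ω : V), IsPerturbiner F.X.M k a ∧
      (∀ j, a {j} = F.incl (k j) (v j)) ∧ (∀ j, F.Rep (k j) (v j) (z j)) ∧
      obstruction F.X.A a = F.incl (∑ j, k j) ω ∧ ω ∈ F.gr 2 ∧ F.d (∑ j, k j) ω = 0 := by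
  obtain ⟨H⟩ := F.nonempty_homotopy
  set x : Fin n → Homology F.X.A.d := fun j => F.Phi (k j) (cls _ (z j) (hd j)) with hx
  have hr := fun j => F.rep_ofGamma (k j) (hk.1 j) (z j) (hd j)
  have hx' : ∀ j, x j = cls F.X.A.d (F.incl (k j) (F.ofGamma (k j) (hk.1 j) (z j)))
      (F.at_closed.2 (hr j).closed) := fun j => F.Phi_cls _ _ _ _ _
  have hin : ∀ j, H.incl (x j) = F.incl (k j) (F.ofGamma (k j) (hk.1 j) (z j)) -
      F.X.A.d (H.h (F.incl (k j) (F.ofGamma (k j) (hk.1 j) (z j)))) := fun j => by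
    rw [hx' j, H.incl_cls]
  have hdeg : ∀ j, F.incl (k j) (F.ofGamma (k j) (hk.1 j) (z j)) ∈ F.X.A.gr 1 := fun j =>
    F.at_mem_gr.2 (F.ofGamma_mem _ _ 1 _ (hz j))
  have h1 : ∀ j, H.incl (x j) ∈ F.X.A.gr 1 := fun j => by
    rw [hin]
    refine sub_mem (hdeg j) ?_
    rw [show (1 : ℤ) = 1 - 1 + 1 by norm_num]
    exact F.X.A.d_mem _ _ (H.h_mem _ _ (hdeg j))
  have h2 : ∀ j, H.incl (x j) ∈ F.X.M.comp (k j) := fun j => by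
    rw [hin]
    exact sub_mem (F.at_mem_comp _ _) (F.X.M.d_mem _ _ (H.h_mom _ _ (F.at_mem_comp _ _)))
  have hp := H.isPerturbiner_treeSum h1 h2 hk.2.2
  have hmom : obstruction F.X.A (H.treeSum x) ∈ F.X.M.comp (∑ j, k j) := by
    refine Submodule.smul_mem _ _ (sum_mem fun I _ => ?_)
    rw [← Finset.sum_sdiff (Finset.subset_univ I), add_comm]
    exact F.X.M.bracket_mem _ _ _ _ (hp.mom _) (hp.mom _)
  have hgr : obstruction F.X.A (H.treeSum x) ∈ F.X.A.gr 2 :=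
    Submodule.smul_mem _ _ (sum_mem fun I _ => F.X.A.bracket_mem 1 1 _ _ (hp.deg _) (hp.deg _))
  obtain ⟨ω, hω⟩ := F.exists_at_of_mem hmom
  choose v hv using fun j => F.exists_at_of_mem (h2 j)
  refine ⟨H.treeSum x, v, ω, hp, fun j => by rw [H.treeSum_singleton, hv], fun j => ?_, hω, ?_, ?_⟩
  · have hc : F.incl (k j) (v j) ∈ LinearMap.ker F.X.A.d := by
      rw [LinearMap.mem_ker, ← hv, H.d_incl]
    refine (F.Phi_cls_iff (k j) (hk.1 j) (hd j) hc).1 ?_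
    change x j = _
    rw [hx', cls_eq_cls, ← hv, hin]
    exact ⟨_, (sub_sub_cancel _ _).symm⟩
  · rw [hω] at hgr
    exact F.at_mem_gr.1 hgr
  · have := hp.d_obstruction
    rw [hω] at this
    exact F.at_closed.1 this

theorem bracketWellDefined : BracketWellDefined F.X F.Phi := by
  refine ⟨F.nonempty_homotopy, fun n hn k hk z hz hd => ?_⟩
  obtain ⟨a, v, ω, ha, hav, hvz, hω, hω2, hωd⟩ := F.exists_perturbiner hk hz hd
  refine ⟨F.toGamma (∑ j, k j) (treeSign n • ω),
    (F.bracketIs_iff hn hk ha hav hz hvz hω _).2 ⟨?_, ?_⟩⟩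
  · exact F.toGamma_mem _ _ _ (Submodule.smul_mem _ _ hω2)
  · exact F.rep_toGamma _ _ (by rw [map_smul, hωd, smul_zero])

end FieldTheoryData

end TreeAmp

/-! ### Symmetries of the minimal model brackets -/

namespace TreeAmp

namespace FieldTheoryData

variable {N : ℕ} {U : Type*} [AddCommGroup U] [Module ℂ U] {V : Type}
  [AddCommGroup V] [Module ℂ V] [FiniteDimensional ℂ V] [FiniteDimensional ℂ U]
  (F : FieldTheoryData N U V)

/-- A linear transformation `T` of the fibre that covers an additive transformation `τ` of the
momenta and rescales the differential by `l` and the bracket by `m`. -/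
structure IsSymmetry (τ : Mom → Mom) (T : V →ₗ[ℂ] V) (l m : ℂ) : Prop where
  add : ∀ k k', τ (k + k') = τ k + τ k'
  zero : τ 0 = 0
  mem : ∀ i, ∀ x ∈ F.gr i, T x ∈ F.gr i
  d : ∀ k v, F.d (τ k) (T v) = l • T (F.d k v)
  br : ∀ k k' v w, F.br (τ k) (τ k') (T v) (T w) = m • T (F.br k k' v w)

namespace IsSymmetry

variable {F} {τ : Mom → Mom} {T : V →ₗ[ℂ] V} {l m : ℂ} (hT : F.IsSymmetry τ T l m)

/-- The transformation of the dgLa. -/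
def total (τ : Mom → Mom) (T : V →ₗ[ℂ] V) : F.X.L →ₗ[ℂ] F.X.L :=
  (Finsupp.lsum ℂ fun k => Finsupp.lsingle (τ k) ∘ₗ T : (Mom →₀ V) →ₗ[ℂ] (Mom →₀ V))

theorem total_incl (k : Mom) (v : V) :
    total (F := F) τ T (F.incl k v) = F.incl (τ k) (T v) := by
  have : (Finsupp.lsum ℂ fun k => Finsupp.lsingle (τ k) ∘ₗ T : (Mom →₀ V) →ₗ[ℂ] (Mom →₀ V))
      (Finsupp.single k v) = Finsupp.single (τ k) (T v) := by simp
  exact this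

include hT in
theorem map_sum {ι : Type*} (s : Finset ι) (k : ι → Mom) :
    τ (∑ j ∈ s, k j) = ∑ j ∈ s, τ (k j) :=
  _root_.map_sum (⟨⟨τ, hT.zero⟩, hT.add⟩ : Mom →+ Mom) k s

/-- The image of a solution of the Maurer-Cartan equation under a symmetry, rescaled so that it is
a solution again. -/
def image (τ : Mom → Mom) (T : V →ₗ[ℂ] V) (l m r : ℂ) {n : ℕ} (a : Finset (Fin n) → F.X.L)
    (J : Finset (Fin n)) : F.X.L := (l / m * r ^ J.card) • total τ T (a J)

variable {n : ℕ} {k : Fin n → Mom} {a : Finset (Fin n) → F.X.L} (r : ℂ)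

include hT in
theorem selfBracket_image (hm : m ≠ 0) (ha : IsPerturbiner F.X.M k a) (J : Finset (Fin n)) :
    selfBracket F.X.A (image τ T l m r a) J =
      (l ^ 2 / m * r ^ J.card) • total τ T (selfBracket F.X.A a J) := by
  rw [selfBracket, selfBracket, _root_.map_sum, Finset.smul_sum]
  refine Finset.sum_congr rfl fun I hI => ?_
  obtain ⟨v, hv⟩ := F.exists_at_of_mem (ha.mom I)
  obtain ⟨w, hw⟩ := F.exists_at_of_mem (ha.mom (J \ I))
  rw [image, image, hv, hw, total_incl, total_incl, LinearMap.map_smul, LinearMap.map_smul,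
    LinearMap.smul_apply, bracket_at, bracket_at, total_incl, hT.br, hT.add, LinearMap.map_smul,
    smul_smul, smul_smul,
    ← Finset.card_sdiff_add_card_eq_card (Finset.mem_powerset.1 hI), pow_add]
  congr 1
  field_simp

include hT in
theorem isPerturbiner_image (hm : m ≠ 0) (ha : IsPerturbiner F.X.M k a) :
    IsPerturbiner F.X.M (fun j => τ (k j)) (image τ T l m r a) := by
  refine ⟨?_, ?_, ?_, ?_⟩
  · rw [image, ha.empty, map_zero, smul_zero]
  · intro J
    obtain ⟨v, hv⟩ := F.exists_at_of_mem (ha.mom J)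
    have := ha.deg J
    rw [hv, F.at_mem_gr] at this
    rw [image, hv, total_incl]
    exact Submodule.smul_mem _ _ (F.at_mem_gr.2 (hT.mem _ _ this))
  · intro J
    obtain ⟨v, hv⟩ := F.exists_at_of_mem (ha.mom J)
    rw [image, hv, total_incl, hT.map_sum]
    exact Submodule.smul_mem _ _ (F.at_mem_comp _ _)
  · intro J hJ
    obtain ⟨v, hv⟩ := F.exists_at_of_mem (ha.mom J)
    have h1 : F.X.A.d (total τ T (a J)) = l • total τ T (F.X.A.d (a J)) := by
      rw [hv, total_incl, d_at, d_at, total_incl, hT.d, LinearMap.map_smul]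
    rw [MCAt, hT.selfBracket_image r hm ha, image, LinearMap.map_smul, h1, ha.mc J hJ,
      LinearMap.map_neg, LinearMap.map_smul, smul_neg, smul_neg, smul_smul, smul_smul, smul_smul]
    congr 2
    field_simp

include hT in
/-- The behaviour of the minimal model brackets under a symmetry. -/
theorem bracketIs (hn : 2 ≤ n) (hm : m ≠ 0) (hk : Admissible F.X k)
    (hk' : Admissible F.X fun j => τ (k j)) {z z' : Fin n → PairSpace N U} {y y' : PairSpace N U}
    (hy : BracketIs F.X F.Phi k z y) (hz' : ∀ j, z' j ∈ pairGr N U 1) (hy' : y' ∈ pairGr N U 2)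
    (hzz' : ∀ j v, F.Rep (k j) v (z j) → F.Rep (τ (k j)) ((l / m * r) • T v) (z' j))
    (hyy' : ∀ v, F.Rep (∑ j, k j) v y →
      F.Rep (τ (∑ j, k j)) ((l ^ 2 / m * r ^ n) • T v) y') :
    BracketIs F.X F.Phi (fun j => τ (k j)) z' y' := by
  obtain ⟨hz, -, hzd, -, -⟩ := id hy
  obtain ⟨a, v, ω, ha, hav, hvz, hω, hω2, hωd⟩ := F.exists_perturbiner hk hz hzd
  have h1 := ((F.bracketIs_iff hn hk ha hav hz hvz hω y).1 hy).2
  have hω' : obstruction F.X.A (image τ T l m r a) =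
      F.incl (∑ j, τ (k j)) ((l ^ 2 / m * r ^ n) • T ω) := by
    rw [obstruction, hT.selfBracket_image r hm ha, smul_comm, ← LinearMap.map_smul,
      ← obstruction, hω, total_incl, hT.map_sum, LinearMap.map_smul, Finset.card_univ,
      Fintype.card_fin]
  refine (F.bracketIs_iff hn hk' (hT.isPerturbiner_image r hm ha)
    (v := fun j => (l / m * r) • T (v j)) ?_ hz' (fun j => hzz' j _ (hvz j)) hω' y').2 ⟨hy', ?_⟩
  · intro j
    rw [image, hav, total_incl, LinearMap.map_smul, Finset.card_singleton, pow_one]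
  · have h2 := hyy' _ h1
    rwa [hT.map_sum, LinearMap.map_smul, smul_comm] at h2

end IsSymmetry

/-- The dilations act: `S c` covers `k ↦ c k`. The exponents are such that the minimal model bracket
with `n` inputs is homogeneous of degree `3 - 2 n`. -/
structure HasDilations where
  S : ℂ → V →ₗ[ℂ] V
  α : ℤ
  isSymmetry : ∀ c, c ≠ 0 → F.IsSymmetry (fun k => c • k) (S c) c (c ^ (α - 1))
  inv : ∀ c, c ≠ 0 → ∀ v, S c (S c⁻¹ v) = v
  toGamma : ∀ c, c ≠ 0 → ∀ k v, F.d k v = 0 →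
    ∃ w, F.toGamma (c • k) (S c v) = c ^ α • F.toGamma k v + pairD N U k w

/-- The Lorentz group acts. -/
structure HasLorentz where
  ρ : Lorentz → V →ₗ[ℂ] V
  isSymmetry : ∀ g, F.IsSymmetry (lorentzMom g) (ρ g) 1 1
  toGamma : ∀ g k v, F.d k v = 0 →
    ∃ w, F.toGamma (lorentzMom g k) (ρ g v) =
      lorentzPair N U g (F.toGamma k v) + pairD N U (lorentzMom g k) w
  pairD : ∀ g k w, pairD N U (lorentzMom g k) (lorentzPair N U g w) =
    lorentzPair N U g (pairD N U k w)

variable {F}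

theorem offShell_iff {k : Mom} : OffShell F.X.M k ↔ ∀ v, F.d k v = 0 → ∃ w, F.d k w = v := by
  constructor
  · intro h v hv
    have hmem : cls F.X.A.d (F.incl k v) (F.at_closed.2 hv) ∈
        homologyPart F.X.A.d (F.X.M.comp k) := ⟨⟨_, F.at_closed.2 hv⟩, F.at_mem_comp k v, rfl⟩
    rw [h, Submodule.mem_bot, cls_eq_zero] at hmem
    exact F.at_exact.1 hmem
  · intro h
    rw [OffShell, eq_bot_iff]
    rintro _ ⟨⟨x, hx⟩, hmem, rfl⟩
    obtain ⟨v, rfl⟩ := F.exists_at_of_mem hmem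
    exact (cls_eq_zero hx).2 (F.at_exact.2 (h v (F.at_closed.1 hx)))

theorem HasDilations.homogeneous (D : F.HasDilations) : BracketHomogeneous F.X F.Phi := by
  intro n hn k hk c hc z y hy
  have hT := D.isSymmetry c hc
  have hc' : c ^ (D.α - 1) ≠ 0 := zpow_ne_zero _ hc
  have hoff : ∀ k, OffShell F.X.M k → OffShell F.X.M (c • k) := by
    intro k h
    rw [offShell_iff] at h ⊢
    intro v hv
    have hS := D.isSymmetry c⁻¹ (inv_ne_zero hc)
    have h1 := hS.d (c • k) v
    rw [inv_smul_smul₀ hc, hv, map_zero, smul_zero] at h1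
    obtain ⟨w, hw⟩ := h _ h1
    refine ⟨c⁻¹ • D.S c w, ?_⟩
    rw [LinearMap.map_smul, hT.d, hw, D.inv c hc, inv_smul_smul₀ hc]
  have hk' : Admissible F.X fun j => c • k j := by
    refine ⟨fun j => smul_ne_zero hc (hk.1 j), ?_, ?_⟩
    · rw [← Finset.smul_sum]
      exact smul_ne_zero hc hk.2.1
    · intro J h1 h2
      rw [← Finset.smul_sum]
      exact hoff _ (hk.2.2 J h1 h2)
  obtain ⟨hz, hy2, -, -, -⟩ := id hy
  have rep : ∀ (k : Mom) (v : V) (z : PairSpace N U) (s t : ℂ), s * c ^ D.α = t → F.Rep k v z →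
      F.Rep (c • k) (s • D.S c v) (t • z) := by
    intro k v z s t hst h
    obtain ⟨w, hw⟩ := h.eq
    obtain ⟨w', hw'⟩ := D.toGamma c hc k v h.closed
    refine ⟨?_, ?_, c⁻¹ • (t • w + s • w'), ?_⟩
    · rw [LinearMap.map_smul, hT.d, h.closed, map_zero, smul_zero, smul_zero]
    · rw [LinearMap.mem_ker, pairD_smul, LinearMap.smul_apply, LinearMap.map_smul,
        LinearMap.mem_ker.1 h.closed', smul_zero, smul_zero]
    · rw [LinearMap.map_smul, hw', hw, pairD_smul, LinearMap.smul_apply, LinearMap.map_smul _ c⁻¹,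
        smul_inv_smul₀ hc, map_add, LinearMap.map_smul, LinearMap.map_smul, smul_add, smul_smul,
        hst]
      rw [smul_add, add_assoc]
  refine hT.bracketIs (c ^ (-2 : ℤ)) hn hc' hk hk' hy hz (Submodule.smul_mem _ _ hy2) ?_ ?_
  · intro j v h
    have := rep _ v _ (c / c ^ (D.α - 1) * c ^ (-2 : ℤ)) 1 (by
      rw [zpow_sub₀ hc]
      field_simp) h
    rwa [one_smul] at this
  · intro v h
    refine rep _ v _ _ _ ?_ h
    have e1 : (c ^ (-2 : ℤ)) ^ n = c ^ (-2 * (n : ℤ)) := by rw [← zpow_natCast, ← zpow_mul]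
    have e2 : c ^ 2 = c ^ (2 : ℤ) := (zpow_ofNat c 2).symm
    rw [e1, e2, ← zpow_sub₀ hc, ← zpow_add₀ hc, ← zpow_add₀ hc]
    congr 1
    ring

theorem HasLorentz.lorentzInvariant (D : F.HasLorentz) : BracketLorentzInvariant F.X F.Phi := by
  intro k hk g z y hy
  have hT := D.isSymmetry g
  have hinj : ∀ k, lorentzMom g k = 0 → k = 0 := by
    intro k h
    have h1 : ((g.1⁻¹ : Matrix.SpecialLinearGroup (Fin 2) ℂ) : Mom) * (g.1 : Mom) = 1 := by
      rw [← Matrix.SpecialLinearGroup.coe_mul, inv_mul_cancel, Matrix.SpecialLinearGroup.coe_one]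
    have h2 : (g.2 : Mom)ᵀ * ((g.2⁻¹ : Matrix.SpecialLinearGroup (Fin 2) ℂ) : Mom)ᵀ = 1 := by
      rw [← Matrix.transpose_mul, ← Matrix.SpecialLinearGroup.coe_mul, inv_mul_cancel,
        Matrix.SpecialLinearGroup.coe_one, Matrix.transpose_one]
    have h3 : ((g.1⁻¹ : Matrix.SpecialLinearGroup (Fin 2) ℂ) : Mom) * lorentzMom g k *
        ((g.2⁻¹ : Matrix.SpecialLinearGroup (Fin 2) ℂ) : Mom)ᵀ = k := by
      rw [lorentzMom, ← Matrix.mul_assoc, ← Matrix.mul_assoc, h1, Matrix.one_mul, Matrix.mul_assoc,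
        h2, Matrix.mul_one]
    rw [← h3, h, Matrix.mul_zero, Matrix.zero_mul]
  have hk' : Admissible F.X fun j => lorentzMom g (k j) := by
    refine ⟨fun j h => hk.1 j (hinj _ h), fun h => hk.2.1 (hinj _ ?_), fun J h1 h2 => by omega⟩
    rw [hT.map_sum]
    exact h
  obtain ⟨hz, hy2, -, -, -⟩ := id hy
  have rep : ∀ (k : Mom) (v : V) (z : PairSpace N U), F.Rep k v z →
      F.Rep (lorentzMom g k) (D.ρ g v) (lorentzPair N U g z) := by
    intro k v z h
    obtain ⟨w, hw⟩ := h.eq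
    obtain ⟨w', hw'⟩ := D.toGamma g k v h.closed
    refine ⟨?_, ?_, lorentzPair N U g w + w', ?_⟩
    · rw [hT.d, h.closed, map_zero, smul_zero]
    · rw [LinearMap.mem_ker, D.pairD, LinearMap.mem_ker.1 h.closed', map_zero]
    · rw [hw', hw, map_add, map_add, D.pairD, add_assoc]
  refine hT.bracketIs 1 le_rfl one_ne_zero hk hk' hy (fun j => lorentzPair_mem N U g 1 _ (hz j))
    (lorentzPair_mem N U g 2 _ hy2) ?_ ?_
  · intro j v h
    have := rep _ v _ h
    rwa [div_one, mul_one, one_smul]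
  · intro v h
    have := rep _ v _ h
    rwa [one_pow, div_one, mul_one, one_smul]

variable (F)

/-- The bracket of two closed elements of degree one of the fibre gives the minimal model bracket of
the homology classes that they represent. -/
theorem bracketIs_two {k : Fin 2 → Mom} (hk₀ : ∀ j, k j ≠ 0) (hk₁ : k 0 + k 1 ≠ 0)
    {v : Fin 2 → V} (hv : ∀ j, v j ∈ F.gr 1) {z : Fin 2 → PairSpace N U}
    (hz : ∀ j, z j ∈ pairGr N U 1) (hvz : ∀ j, F.Rep (k j) (v j) (z j)) {y : PairSpace N U}
    (hy : y ∈ pairGr N U 2) (hvy : F.Rep (k 0 + k 1) (F.br (k 0) (k 1) (v 0) (v 1)) y) :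
    Admissible F.X k ∧ BracketIs F.X F.Phi k z y := by
  have hk : Admissible F.X k := by
    refine ⟨hk₀, ?_, fun J h1 h2 => by omega⟩
    rw [Fin.sum_univ_two]
    exact hk₁
  refine ⟨hk, ?_⟩
  let a : Finset (Fin 2) → F.X.L := fun J =>
    if J = {0} then F.incl (k 0) (v 0) else if J = {1} then F.incl (k 1) (v 1) else 0
  have a0 : a {0} = F.incl (k 0) (v 0) := if_pos rfl
  have a1 : a {1} = F.incl (k 1) (v 1) := (if_neg (by decide)).trans (if_pos rfl)
  have ae : a ∅ = 0 := (if_neg (by decide)).trans (if_neg (by decide))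
  have au : a Finset.univ = 0 := (if_neg (by decide)).trans (if_neg (by decide))
  have cases4 : ∀ J : Finset (Fin 2), J = ∅ ∨ J = {0} ∨ J = {1} ∨ J = Finset.univ := by decide
  have sb : ∀ j : Fin 2, selfBracket F.X.A a {j} = 0 := by
    intro j
    refine Finset.sum_eq_zero fun I hI => ?_
    rcases Finset.subset_singleton_iff.1 (Finset.mem_powerset.1 hI) with rfl | rfl
    · rw [ae, map_zero, LinearMap.zero_apply]
    · rw [Finset.sdiff_self, ae, map_zero]
  have ha : IsPerturbiner F.X.M k a := by
    refine ⟨ae, ?_, ?_, ?_⟩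
    · intro J
      rcases cases4 J with rfl | rfl | rfl | rfl
      · rw [ae]; exact zero_mem _
      · rw [a0]; exact F.at_mem_gr.2 (hv 0)
      · rw [a1]; exact F.at_mem_gr.2 (hv 1)
      · rw [au]; exact zero_mem _
    · intro J
      rcases cases4 J with rfl | rfl | rfl | rfl
      · rw [ae]; exact zero_mem _
      · rw [a0, Finset.sum_singleton]; exact F.at_mem_comp _ _
      · rw [a1, Finset.sum_singleton]; exact F.at_mem_comp _ _
      · rw [au]; exact zero_mem _
    · intro J hJ
      rcases cases4 J with rfl | rfl | rfl | rfl
      · simp [MCAt, selfBracket, ae]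
      · rw [MCAt, sb, a0, LinearMap.mem_ker.1 (F.at_closed.2 (hvz 0).closed), smul_zero, neg_zero]
      · rw [MCAt, sb, a1, LinearMap.mem_ker.1 (F.at_closed.2 (hvz 1).closed), smul_zero, neg_zero]
      · exact absurd rfl hJ
  have hob : obstruction F.X.A a = F.incl (∑ j, k j) (F.br (k 0) (k 1) (v 0) (v 1)) := by
    have hpow : (Finset.univ : Finset (Fin 2)).powerset = {∅, {0}, {1}, Finset.univ} := by decide
    have s0 : (Finset.univ : Finset (Fin 2)) \ {0} = {1} := by decide
    have s1 : (Finset.univ : Finset (Fin 2)) \ {1} = {0} := by decide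
    have hsym : F.X.A.bracket (a {1}) (a {0}) = F.X.A.bracket (a {0}) (a {1}) :=
      DGLA.bracket_symm_one (ha.deg _) (ha.deg _)
    rw [obstruction, selfBracket, hpow, Finset.sum_insert (by decide),
      Finset.sum_insert (by decide), Finset.sum_insert (by decide), Finset.sum_singleton, s0, s1,
      hsym, ae, au, map_zero, LinearMap.zero_apply, LinearMap.zero_apply, a0, a1, bracket_at,
      Fin.sum_univ_two]
    module
  refine (F.bracketIs_iff le_rfl hk ha (v := v) ?_ hz hvz hob y).2 ⟨hy, ?_⟩
  · intro j
    fin_cases j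
    · exact a0
    · exact a1
  · rw [treeSign_two, one_smul, Fin.sum_univ_two]
    exact hvy

/-- Data showing that the map `𝔥^{1,-σ} ⊗ 𝔥^{1,σ} → 𝔥^{2,σ}` is not zero. -/
structure NonvanishingExample (σ : ℤˣ) where
  k : Fin 2 → Mom
  v : Fin 2 → V
  z : Fin 2 → PairSpace N U
  y : PairSpace N U
  k_ne : ∀ j, k j ≠ 0
  k_ne' : k 0 + k 1 ≠ 0
  v_mem : ∀ j, v j ∈ F.gr 1
  z_mem : ∀ j, z j ∈ pairGr N U 1
  rep : ∀ j, F.Rep (k j) (v j) (z j)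
  y_mem : y ∈ pairGr N U 2
  rep' : F.Rep (k 0 + k 1) (F.br (k 0) (k 1) (v 0) (v 1)) y
  z_zero : z 0 σ = 0
  z_one : z 1 (-σ) = 0
  y_not : y σ ∉ LinearMap.range (gammaD N U σ (k 0 + k 1))

variable {F}

theorem isFieldTheoryModel (D : F.HasDilations) (E : F.HasLorentz)
    (hex : ∀ σ : ℤˣ, Nonempty (F.NonvanishingExample σ)) : IsFieldTheoryModel F.X F.Phi where
  homologyIso := F.isHomologyIso
  locallyRegular := F.isLocallyRegular
  wellDefined := F.bracketWellDefined
  homogeneous := D.homogeneous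
  lorentzInvariant := E.lorentzInvariant
  mixedNonvanishing := by
    intro σ
    obtain ⟨e⟩ := hex σ
    obtain ⟨h1, h2⟩ := F.bracketIs_two e.k_ne e.k_ne' e.v_mem e.z_mem e.rep e.y_mem e.rep'
    refine ⟨e.k, e.z, e.y, h1, h2, e.z_zero, e.z_one, ?_⟩
    rw [Fin.sum_univ_two]
    exact e.y_not
  bracket_ne_zero := by
    obtain ⟨e⟩ := hex 1
    refine ⟨F.incl (e.k 0) (e.v 0), F.incl (e.k 1) (e.v 1), fun h => e.y_not ?_⟩
    rw [bracket_at] at h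
    have h0 : F.br (e.k 0) (e.k 1) (e.v 0) (e.v 1) = 0 :=
      Finsupp.single_injective (M := V) _ (h.trans (Finsupp.single_zero _).symm)
    obtain ⟨w, hw⟩ := e.rep'.eq
    rw [h0, map_zero] at hw
    refine ⟨-w 1, ?_⟩
    have := congrFun (eq_neg_of_add_eq_zero_left hw.symm) 1
    rw [this, map_neg]
    rfl

end FieldTheoryData

end TreeAmp

/-! ### Lie superalgebras of forms with values in a Lie algebra -/

namespace TreeAmp

open scoped TensorProduct

/-- A graded commutative associative algebra (no unit is needed). -/
structure GradedCommAlgebra (Λ : Type) [AddCommGroup Λ] [Module ℂ Λ] where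
  gr : ℤ → Submodule ℂ Λ
  isInternal : DirectSum.IsInternal gr
  mul : Λ →ₗ[ℂ] Λ →ₗ[ℂ] Λ
  mul_mem : ∀ i j, ∀ x ∈ gr i, ∀ y ∈ gr j, mul x y ∈ gr (i + j)
  mul_assoc : ∀ x y z, mul (mul x y) z = mul x (mul y z)
  mul_comm : ∀ i j, ∀ x ∈ gr i, ∀ y ∈ gr j, mul x y = (i * j).negOnePow • mul y x

/-- A Lie algebra `𝔤` acting on a graded commutative algebra `Λ` of plane waves: `rot X` is a
derivation of `Λ`, and `trans X` is a constant vector field, which multiplies a plane wave by a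
linear function of its momentum. -/
structure LieAction {Λ : Type} [AddCommGroup Λ] [Module ℂ Λ] (G : GradedCommAlgebra Λ)
    (𝔤 : Type) [AddCommGroup 𝔤] [Module ℂ 𝔤] where
  lie : 𝔤 →ₗ[ℂ] 𝔤 →ₗ[ℂ] 𝔤
  lie_skew : ∀ X Y, lie X Y = -lie Y X
  lie_jacobi : ∀ X Y Z, lie X (lie Y Z) = lie (lie X Y) Z + lie Y (lie X Z)
  rot : 𝔤 →ₗ[ℂ] Λ →ₗ[ℂ] Λ
  rot_mem : ∀ X i, ∀ ω ∈ G.gr i, rot X ω ∈ G.gr i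
  rot_mul : ∀ X ω η, rot X (G.mul ω η) = G.mul (rot X ω) η + G.mul ω (rot X η)
  rot_lie : ∀ X Y ω, rot (lie X Y) ω = rot X (rot Y ω) - rot Y (rot X ω)
  trans : 𝔤 →ₗ[ℂ] Mom →ₗ[ℂ] ℂ
  trans_lie : ∀ X Y k, trans (lie X Y) k = 0

namespace GradedCommAlgebra

variable {Λ : Type} [AddCommGroup Λ] [Module ℂ Λ] (G : GradedCommAlgebra Λ)
  (𝔤 : Type) [AddCommGroup 𝔤] [Module ℂ 𝔤]

theorem mul_left_comm {i j : ℤ} {x y : Λ} (hx : x ∈ G.gr i) (hy : y ∈ G.gr j) (z : Λ) :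
    G.mul y (G.mul x z) = (i * j).negOnePow • G.mul x (G.mul y z) := by
  rw [← G.mul_assoc, ← G.mul_assoc, G.mul_comm j i y hy x hx, _root_.mul_comm j i]
  exact map_negOnePow_smul ((LinearMap.flip G.mul) z) _ _

/-- The forms of degree `i` with values in `𝔤`. -/
def tensorGr (i : ℤ) : Submodule ℂ (Λ ⊗[ℂ] 𝔤) := LinearMap.range ((G.gr i).subtype.rTensor 𝔤)

variable {G 𝔤} {i : ℤ}

theorem tmul_mem {ω : Λ} (hω : ω ∈ G.gr i) (X : 𝔤) : ω ⊗ₜ[ℂ] X ∈ G.tensorGr 𝔤 i :=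
  ⟨(⟨ω, hω⟩ : G.gr i) ⊗ₜ X, rfl⟩

theorem tensorGr_induction {p : Λ ⊗[ℂ] 𝔤 → Prop} {x : Λ ⊗[ℂ] 𝔤} (hx : x ∈ G.tensorGr 𝔤 i)
    (h0 : p 0) (ht : ∀ ω ∈ G.gr i, ∀ X : 𝔤, p (ω ⊗ₜ X)) (ha : ∀ x y, p x → p y → p (x + y)) :
    p x := by
  obtain ⟨t, rfl⟩ := hx
  induction t using TensorProduct.induction_on with
  | zero => rwa [map_zero]
  | tmul ω X => exact ht ω ω.2 X
  | add s t hs ht' => rw [map_add]; exact ha _ _ hs ht'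

theorem tensorGr_isInternal (G : GradedCommAlgebra Λ) (𝔤 : Type) [AddCommGroup 𝔤] [Module ℂ 𝔤] :
    DirectSum.IsInternal (G.tensorGr 𝔤) := by
  refine isInternal_of_projections _ (fun i => (gradedProj G.isInternal i).rTensor 𝔤) ?_ ?_ ?_
  · intro i x hx
    refine tensorGr_induction (p := fun x => (gradedProj G.isInternal i).rTensor 𝔤 x = x) hx
      (map_zero _) ?_ fun x y h h' => by rw [map_add, h, h']
    intro ω hω X
    rw [LinearMap.rTensor_tmul, gradedProj_of_mem G.isInternal hω]
  · intro i j hij x hx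
    refine tensorGr_induction (p := fun x => (gradedProj G.isInternal i).rTensor 𝔤 x = 0) hx
      (map_zero _) ?_ fun x y h h' => by rw [map_add, h, h', add_zero]
    intro ω hω X
    rw [LinearMap.rTensor_tmul, gradedProj_of_mem_ne G.isInternal hij hω, TensorProduct.zero_tmul]
  · intro x
    induction x using TensorProduct.induction_on with
    | zero => exact zero_mem _
    | add s t hs ht => exact add_mem hs ht
    | tmul ω X =>
      refine gradedInduction G.isInternal (p := fun ω => ω ⊗ₜ[ℂ] X ∈ ⨆ i, G.tensorGr 𝔤 i) ω ?_ ?_ ?_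
      · intro i ω hω
        exact Submodule.mem_iSup_of_mem i (tmul_mem hω X)
      · rw [TensorProduct.zero_tmul]; exact zero_mem _
      · intro x y hx hy
        rw [TensorProduct.add_tmul]; exact add_mem hx hy

end GradedCommAlgebra

theorem exists_polyEval_linear (f : Mom →ₗ[ℂ] ℂ) :
    ∃ P : MvPolynomial (Fin 2 × Fin 2) ℂ, ∀ k, f k = polyEval P k := by
  refine ⟨∑ s : Fin 2 × Fin 2, MvPolynomial.C (f (Matrix.single s.1 s.2 1)) *
    MvPolynomial.X s, fun k => ?_⟩
  conv_lhs => rw [Matrix.matrix_eq_sum_single k]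
  simp only [polyEval, map_sum, map_mul, MvPolynomial.eval_C, MvPolynomial.eval_X,
    Fintype.sum_prod_type]
  refine Finset.sum_congr rfl fun i _ => Finset.sum_congr rfl fun j _ => ?_
  rw [show Matrix.single i j (k i j) = k i j • Matrix.single i j (1 : ℂ) by
    rw [Matrix.smul_single, smul_eq_mul, mul_one], map_smul, smul_eq_mul, _root_.mul_comm]

namespace LieAction

open GradedCommAlgebra

variable {Λ : Type} [AddCommGroup Λ] [Module ℂ Λ] {G : GradedCommAlgebra Λ}
  {𝔤 : Type} [AddCommGroup 𝔤] [Module ℂ 𝔤] (A : LieAction G 𝔤)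

/-- The action on plane waves of momentum `k`. -/
def act (k : Mom) : 𝔤 →ₗ[ℂ] Λ →ₗ[ℂ] Λ :=
  A.rot + LinearMap.smulRight (A.trans.flip k) LinearMap.id

theorem act_apply (k : Mom) (X : 𝔤) (ω : Λ) : A.act k X ω = A.rot X ω + A.trans X k • ω := rfl

variable {i : ℤ}

theorem act_mem (k : Mom) (X : 𝔤) {ω : Λ} (hω : ω ∈ G.gr i) : A.act k X ω ∈ G.gr i :=
  add_mem (A.rot_mem X i ω hω) (Submodule.smul_mem _ _ hω)

theorem act_mul (k l : Mom) (X : 𝔤) (ω η : Λ) :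
    A.act (k + l) X (G.mul ω η) = G.mul (A.act k X ω) η + G.mul ω (A.act l X η) := by
  simp only [act_apply, A.rot_mul, map_add, LinearMap.add_apply, map_smul, LinearMap.smul_apply,
    add_smul]
  abel

theorem act_lie (k : Mom) (X Y : 𝔤) (ω : Λ) :
    A.act k (A.lie X Y) ω = A.act k X (A.act k Y ω) - A.act k Y (A.act k X ω) := by
  simp only [act_apply, A.rot_lie, map_add, map_smul, A.trans_lie, zero_smul, smul_add,
    smul_smul, _root_.mul_comm (A.trans Y k)]
  abel

/-- The operators `η ⊗ Y ↦ ω X(η) ⊗ Y`, for `ω ⊗ X` in the first argument. -/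
def opLeft (l : Mom) : Λ ⊗[ℂ] 𝔤 →ₗ[ℂ] Λ ⊗[ℂ] 𝔤 →ₗ[ℂ] Λ ⊗[ℂ] 𝔤 :=
  TensorProduct.lift (LinearMap.mk₂ ℂ (fun ω X => (G.mul ω ∘ₗ A.act l X).rTensor 𝔤)
    (fun ω ω' X => by rw [map_add, LinearMap.add_comp, LinearMap.rTensor_add])
    (fun c ω X => by rw [map_smul, LinearMap.smul_comp, LinearMap.rTensor_smul])
    (fun ω X X' => by rw [map_add, LinearMap.comp_add, LinearMap.rTensor_add])
    (fun c ω X => by rw [map_smul, LinearMap.comp_smul, LinearMap.rTensor_smul]))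

/-- The operators `ω ⊗ X ↦ Y(ω) η ⊗ X`, for `η ⊗ Y` in the first argument. -/
def opRight (k : Mom) : Λ ⊗[ℂ] 𝔤 →ₗ[ℂ] Λ ⊗[ℂ] 𝔤 →ₗ[ℂ] Λ ⊗[ℂ] 𝔤 :=
  TensorProduct.lift (LinearMap.mk₂ ℂ (fun η Y => (G.mul.flip η ∘ₗ A.act k Y).rTensor 𝔤)
    (fun ω ω' X => by rw [map_add, LinearMap.add_comp, LinearMap.rTensor_add])
    (fun c ω X => by rw [map_smul, LinearMap.smul_comp, LinearMap.rTensor_smul])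
    (fun ω X X' => by rw [map_add, LinearMap.comp_add, LinearMap.rTensor_add])
    (fun c ω X => by rw [map_smul, LinearMap.comp_smul, LinearMap.rTensor_smul]))

/-- The bracket of `𝔤`-valued plane waves of momenta `k` and `l`. -/
def br (k l : Mom) : Λ ⊗[ℂ] 𝔤 →ₗ[ℂ] Λ ⊗[ℂ] 𝔤 →ₗ[ℂ] Λ ⊗[ℂ] 𝔤 :=
  A.opLeft l - (A.opRight k).flip + TensorProduct.map₂ G.mul A.lie

theorem br_tmul (k l : Mom) (ω η : Λ) (X Y : 𝔤) :
    A.br k l (ω ⊗ₜ X) (η ⊗ₜ Y) =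
      G.mul ω (A.act l X η) ⊗ₜ Y - G.mul (A.act k Y ω) η ⊗ₜ X + G.mul ω η ⊗ₜ A.lie X Y := rfl

theorem br_mem (k l : Mom) (i j : ℤ) (x : Λ ⊗[ℂ] 𝔤) (hx : x ∈ G.tensorGr 𝔤 i) (y : Λ ⊗[ℂ] 𝔤)
    (hy : y ∈ G.tensorGr 𝔤 j) : A.br k l x y ∈ G.tensorGr 𝔤 (i + j) := by
  refine tensorGr_induction (p := fun x => A.br k l x y ∈ G.tensorGr 𝔤 (i + j)) hx
    (by simp) ?_ fun x x' h h' => by rw [map_add]; exact add_mem h h'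
  intro ω hω X
  refine tensorGr_induction (p := fun y => A.br k l (ω ⊗ₜ X) y ∈ G.tensorGr 𝔤 (i + j)) hy
    (by simp) ?_ fun x x' h h' => by rw [map_add]; exact add_mem h h'
  intro η hη Y
  rw [br_tmul]
  exact add_mem (sub_mem (tmul_mem (G.mul_mem _ _ _ hω _ (A.act_mem l X hη)) Y)
    (tmul_mem (G.mul_mem _ _ _ (A.act_mem k Y hω) _ hη) X))
    (tmul_mem (G.mul_mem _ _ _ hω _ hη) _)

theorem negOnePow_smul_tmul (s : ℤˣ) (ω : Λ) (X : 𝔤) : (s • ω) ⊗ₜ[ℂ] X = s • (ω ⊗ₜ[ℂ] X) :=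
  map_negOnePow_smul ((TensorProduct.mk ℂ Λ 𝔤).flip X) s ω

theorem br_antisymm (k l : Mom) (i j : ℤ) (x : Λ ⊗[ℂ] 𝔤) (hx : x ∈ G.tensorGr 𝔤 i) (y : Λ ⊗[ℂ] 𝔤)
    (hy : y ∈ G.tensorGr 𝔤 j) : A.br k l x y = -((i * j).negOnePow • A.br l k y x) := by
  refine tensorGr_induction (p := fun x => A.br k l x y = -((i * j).negOnePow • A.br l k y x)) hx
    (by simp) ?_ fun x x' h h' => by
      simp only [map_add, LinearMap.add_apply, h, h', smul_add, neg_add]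
  intro ω hω X
  refine tensorGr_induction
    (p := fun y => A.br k l (ω ⊗ₜ X) y = -((i * j).negOnePow • A.br l k y (ω ⊗ₜ X))) hy
    (by simp) ?_ fun x x' h h' => by
      simp only [map_add, LinearMap.add_apply, h, h', smul_add, neg_add]
  intro η hη Y
  rw [br_tmul, br_tmul, G.mul_comm i j _ hω _ (A.act_mem l X hη),
    G.mul_comm i j _ (A.act_mem k Y hω) _ hη, G.mul_comm i j _ hω _ hη, A.lie_skew X Y,
    TensorProduct.tmul_neg]
  simp only [negOnePow_smul_tmul, smul_add, smul_sub]
  abel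

theorem br_jacobi (k l m : Mom) (i j n : ℤ) (x : Λ ⊗[ℂ] 𝔤) (hx : x ∈ G.tensorGr 𝔤 i)
    (y : Λ ⊗[ℂ] 𝔤) (hy : y ∈ G.tensorGr 𝔤 j) (z : Λ ⊗[ℂ] 𝔤) (hz : z ∈ G.tensorGr 𝔤 n) :
    A.br k (l + m) x (A.br l m y z) =
      A.br (k + l) m (A.br k l x y) z + (i * j).negOnePow • A.br l (k + m) y (A.br k m x z) := by
  refine tensorGr_induction (p := fun x => A.br k (l + m) x (A.br l m y z) =
    A.br (k + l) m (A.br k l x y) z + (i * j).negOnePow • A.br l (k + m) y (A.br k m x z)) hx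
    (by simp) ?_ fun x x' h h' => by
      simp only [map_add, LinearMap.add_apply, h, h', smul_add]; abel
  intro ω hω X
  refine tensorGr_induction (p := fun y => A.br k (l + m) (ω ⊗ₜ X) (A.br l m y z) =
    A.br (k + l) m (A.br k l (ω ⊗ₜ X) y) z +
      (i * j).negOnePow • A.br l (k + m) y (A.br k m (ω ⊗ₜ X) z)) hy
    (by simp) ?_ fun x x' h h' => by
      simp only [map_add, LinearMap.add_apply, h, h', smul_add]; abel
  intro η hη Y
  refine tensorGr_induction (p := fun z => A.br k (l + m) (ω ⊗ₜ X) (A.br l m (η ⊗ₜ Y) z) =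
    A.br (k + l) m (A.br k l (ω ⊗ₜ X) (η ⊗ₜ Y)) z +
      (i * j).negOnePow • A.br l (k + m) (η ⊗ₜ Y) (A.br k m (ω ⊗ₜ X) z)) hz
    (by simp) ?_ fun x x' h h' => by
      simp only [map_add, h, h', smul_add]; abel
  intro ζ hζ Z
  -- the factors are kept in the order `ω`, `η`, `ζ`
  have swap : ∀ ω ∈ G.gr i, ∀ η ∈ G.gr j, ∀ ζ : Λ,
      G.mul η (G.mul ω ζ) = (i * j).negOnePow • G.mul ω (G.mul η ζ) :=
    fun ω hω η hη ζ => G.mul_left_comm hω hη ζ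
  simp only [br_tmul, map_add, map_sub, LinearMap.add_apply, LinearMap.sub_apply, act_mul, act_lie,
    G.mul_assoc, TensorProduct.add_tmul, TensorProduct.sub_tmul]
  simp only [swap _ hω _ hη, swap _ (A.act_mem k Z hω) _ hη, swap _ (A.act_mem k Y hω) _ hη,
    swap _ hω _ (A.act_mem l Z hη), swap _ (A.act_mem k Y (A.act_mem k Z hω)) _ hη,
    swap _ hω _ (A.act_mem l X (A.act_mem l Z hη)), swap _ hω _ (A.act_mem l Z (A.act_mem l X hη)),
    swap _ (A.act_mem k Z hω) _ (A.act_mem l X hη), negOnePow_smul_tmul]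
  rw [A.lie_jacobi X Y Z, TensorProduct.tmul_add, A.lie_skew X Y, A.lie_skew X Z, A.lie_skew Y Z]
  simp only [TensorProduct.tmul_neg]
  rcases Int.units_eq_one_or ((i * j).negOnePow) with h | h
  · rw [h]
    simp only [one_smul]
    abel
  · rw [h]
    simp only [Units.neg_smul, one_smul]
    abel

theorem br_poly : IsPolynomial₂ A.br := by
  intro x y φ
  induction x using TensorProduct.induction_on with
  | zero => exact ⟨0, fun k l => by simp [polyEval₂]⟩
  | add x x' h h' =>
    obtain ⟨P, hP⟩ := h
    obtain ⟨Q, hQ⟩ := h'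
    exact ⟨P + Q, fun k l => by simp [hP, hQ, polyEval₂]⟩
  | tmul ω X =>
    induction y using TensorProduct.induction_on with
    | zero => exact ⟨0, fun k l => by simp [polyEval₂]⟩
    | add x x' h h' =>
      obtain ⟨P, hP⟩ := h
      obtain ⟨Q, hQ⟩ := h'
      exact ⟨P + Q, fun k l => by simp [hP, hQ, polyEval₂]⟩
    | tmul η Y =>
      obtain ⟨P, hP⟩ := exists_polyEval_linear (A.trans X)
      obtain ⟨Q, hQ⟩ := exists_polyEval_linear (A.trans Y)
      refine ⟨MvPolynomial.C (φ (G.mul ω (A.rot X η) ⊗ₜ Y - G.mul (A.rot Y ω) η ⊗ₜ X +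
          G.mul ω η ⊗ₜ A.lie X Y)) +
        MvPolynomial.rename Sum.inr P * MvPolynomial.C (φ (G.mul ω η ⊗ₜ Y)) -
        MvPolynomial.rename Sum.inl Q * MvPolynomial.C (φ (G.mul ω η ⊗ₜ X)), fun k l => ?_⟩
      simp only [br_tmul, act_apply, map_add, map_smul, LinearMap.add_apply, LinearMap.smul_apply,
        TensorProduct.add_tmul, map_sub, hP, hQ, polyEval, polyEval₂,
        map_mul, MvPolynomial.eval_C, MvPolynomial.eval_rename, Sum.elim_comp_inl,
        Sum.elim_comp_inr]
      simp only [← TensorProduct.smul_tmul', map_smul, smul_eq_mul]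
      ring

end LieAction

end TreeAmp

/-! ### Graded coordinate spaces -/

namespace TreeAmp

section Coordinates

variable {ι ι' : Type*} (deg : ι → ℤ) (deg' : ι' → ℤ)

/-- The vectors all of whose nonzero coordinates have degree `i`. -/
def coordGr (i : ℤ) : Submodule ℂ (ι → ℂ) where
  carrier := {x | ∀ a, deg a ≠ i → x a = 0}
  add_mem' := fun hx hy a h => by simp [hx a h, hy a h]
  zero_mem' := fun _ _ => rfl
  smul_mem' := fun c _ hx a h => by simp [hx a h]

theorem coordGr_isInternal [Fintype ι] [DecidableEq ι] :
    DirectSum.IsInternal (coordGr deg) := by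
  refine isInternal_of_projections _
    (fun i => LinearMap.pi fun a => if deg a = i then LinearMap.proj a else 0) ?_ ?_ ?_
  · intro i x hx
    funext a
    by_cases h : deg a = i
    · simp [h]
    · simp [h, hx a h]
  · intro i j hij x hx
    funext a
    by_cases h : deg a = i
    · simp [h, hx a fun h' => hij (h.symm.trans h')]
    · simp [h]
  · intro x
    rw [show x = ∑ a, x a • (Pi.single a 1 : ι → ℂ) from pi_eq_sum_univ' x]
    refine sum_mem fun a _ => Submodule.smul_mem _ _ (Submodule.mem_iSup_of_mem (deg a) ?_)
    intro b hb
    exact Pi.single_eq_of_ne (fun h => hb (by rw [h])) _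

/-- The coordinates of degree `i` are multiplied by `t ^ i`. -/
def weightMap (t : ℂ) (x : ι → ℂ) (a : ι) : ℂ := t ^ deg a * x a

variable {deg deg'}

theorem weightMap_of_mem {i : ℤ} {x : ι → ℂ} (hx : x ∈ coordGr deg i) (t : ℂ) :
    weightMap deg t x = t ^ i • x := by
  funext a
  by_cases h : deg a = i
  · simp [weightMap, h]
  · simp [weightMap, hx a h]

theorem mem_coordGr_iff {i : ℤ} {x : ι → ℂ} :
    x ∈ coordGr deg i ↔ weightMap deg 2 x = (2 : ℂ) ^ i • x := by
  refine ⟨fun hx => weightMap_of_mem hx 2, fun h a ha => ?_⟩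
  have h1 : (2 : ℂ) ^ deg a * x a = 2 ^ i * x a := congrFun h a
  by_contra h0
  have h2 := mul_right_cancel₀ h0 h1
  have h3 : (2 : ℝ) ^ deg a = 2 ^ i := by
    rw [← Complex.ofReal_inj]
    push_cast
    exact h2
  exact ha (zpow_right_injective₀ (by norm_num) (by norm_num) h3)

/-- A linear map has degree zero if it commutes with the rescaling of the coordinates. -/
theorem map_mem_coordGr {f : (ι → ℂ) →ₗ[ℂ] (ι' → ℂ)} {n : ℤ}
    (hf : ∀ x, f (weightMap deg 2 x) = (2 : ℂ) ^ (-n) • weightMap deg' 2 (f x)) {i : ℤ}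
    {x : ι → ℂ} (hx : x ∈ coordGr deg i) : f x ∈ coordGr deg' (i + n) := by
  rw [mem_coordGr_iff] at hx ⊢
  have := hf x
  rw [hx, map_smul, zpow_neg, eq_inv_smul_iff₀ (zpow_ne_zero _ two_ne_zero), smul_smul,
    ← zpow_add₀ two_ne_zero, add_comm n] at this
  exact this.symm

end Coordinates

/-! ### The exterior algebra of momentum space -/

/-- Indices for the coordinates of a form on `ℂ⁴`: a scalar, a matrix `m` (the one-forms), two
symmetric matrices `s`, `r` (the self-dual and the anti-self-dual two-forms; the coordinates are
the entries `00`, `01`, `11`), a matrix `j` (the three-forms) and a scalar `v` (the volume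
forms). -/
inductive FormIdx : Type
  | c | m00 | m01 | m10 | m11 | s0 | s1 | s2 | r0 | r1 | r2 | j00 | j01 | j10 | j11 | v
  deriving DecidableEq

instance : Fintype FormIdx where
  elems := {.c, .m00, .m01, .m10, .m11, .s0, .s1, .s2, .r0, .r1, .r2, .j00, .j01, .j10, .j11, .v}
  complete a := by cases a <;> decide

/-- The exterior algebra of `ℂ⁴`. -/
abbrev Form : Type := FormIdx → ℂ

/-- The degrees of the coordinates of a form. -/
def formDeg : FormIdx → ℤ
  | .c => 0
  | .m00 | .m01 | .m10 | .m11 => 1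
  | .s0 | .s1 | .s2 | .r0 | .r1 | .r2 => 2
  | .j00 | .j01 | .j10 | .j11 => 3
  | .v => 4

/-- The coordinates of the wedge product: with `ε` as in `eps`, the product of the one-forms `m`
and `n` is `s = m ε nᵀ - n ε mᵀ`, `r = mᵀ ε n - nᵀ ε m`; the product of a two-form and the one-form
`p` is `s ε p + p ε r`; the product of the three-form `j` and the one-form `p` is the polarized
determinant of `j` and `p`; and two-forms of opposite duality have product zero. -/
def wedgeFun (x y : Form) : Form
  | .c => x .c * y .c
  | .m00 => x .c * y .m00 + x .m00 * y .c
  | .m01 => x .c * y .m01 + x .m01 * y .c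
  | .m10 => x .c * y .m10 + x .m10 * y .c
  | .m11 => x .c * y .m11 + x .m11 * y .c
  | .s0 => x .c * y .s0 + x .s0 * y .c - 2 * x .m01 * y .m00 + 2 * x .m00 * y .m01
  | .s1 => x .c * y .s1 + x .s1 * y .c - x .m01 * y .m10 + x .m00 * y .m11 + x .m10 * y .m01 -
      x .m11 * y .m00
  | .s2 => x .c * y .s2 + x .s2 * y .c - 2 * x .m11 * y .m10 + 2 * x .m10 * y .m11
  | .r0 => x .c * y .r0 + x .r0 * y .c - 2 * x .m10 * y .m00 + 2 * x .m00 * y .m10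
  | .r1 => x .c * y .r1 + x .r1 * y .c - x .m10 * y .m01 + x .m00 * y .m11 + x .m01 * y .m10 -
      x .m11 * y .m00
  | .r2 => x .c * y .r2 + x .r2 * y .c - 2 * x .m11 * y .m01 + 2 * x .m01 * y .m11
  | .j00 => x .c * y .j00 + x .j00 * y .c - x .m00 * y .s1 + x .m10 * y .s0 - x .m01 * y .r0 +
      x .m00 * y .r1 - x .s1 * y .m00 + x .s0 * y .m10 - x .r0 * y .m01 + x .r1 * y .m00
  | .j01 => x .c * y .j01 + x .j01 * y .c - x .m01 * y .s1 + x .m11 * y .s0 - x .m01 * y .r1 +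
      x .m00 * y .r2 - x .s1 * y .m01 + x .s0 * y .m11 - x .r1 * y .m01 + x .r2 * y .m00
  | .j10 => x .c * y .j10 + x .j10 * y .c - x .m00 * y .s2 + x .m10 * y .s1 - x .m11 * y .r0 +
      x .m10 * y .r1 - x .s2 * y .m00 + x .s1 * y .m10 - x .r0 * y .m11 + x .r1 * y .m10
  | .j11 => x .c * y .j11 + x .j11 * y .c - x .m01 * y .s2 + x .m11 * y .s1 - x .m11 * y .r1 +
      x .m10 * y .r2 - x .s2 * y .m01 + x .s1 * y .m11 - x .r1 * y .m11 + x .r2 * y .m10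
  | .v => x .c * y .v + x .v * y .c + x .j00 * y .m11 - x .j01 * y .m10 - x .j10 * y .m01 +
      x .j11 * y .m00 - x .m11 * y .j00 + x .m10 * y .j01 + x .m01 * y .j10 - x .m00 * y .j11 +
      1 / 2 * x .s0 * y .s2 - x .s1 * y .s1 + 1 / 2 * x .s2 * y .s0 - 1 / 2 * x .r0 * y .r2 +
      x .r1 * y .r1 - 1 / 2 * x .r2 * y .r0

/-- The wedge product. -/
def wedge : Form →ₗ[ℂ] Form →ₗ[ℂ] Form :=
  LinearMap.mk₂ ℂ wedgeFun
    (fun x x' y => by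
      funext a; cases a <;> simp only [wedgeFun, Pi.add_apply] <;> ring)
    (fun c x y => by
      funext a; cases a <;> simp only [wedgeFun, Pi.smul_apply, smul_eq_mul] <;> ring)
    (fun x y y' => by
      funext a; cases a <;> simp only [wedgeFun, Pi.add_apply] <;> ring)
    (fun c x y => by
      funext a; cases a <;> simp only [wedgeFun, Pi.smul_apply, smul_eq_mul] <;> ring)

theorem wedge_apply (x y : Form) (a : FormIdx) : wedge x y a = wedgeFun x y a := rfl

theorem wedge_assoc (x y z : Form) : wedge (wedge x y) z = wedge x (wedge y z) := by
  funext a; cases a <;> simp only [wedge_apply, wedgeFun] <;> ring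

theorem wedge_weightMap (t : ℂ) (x y : Form) :
    wedge (weightMap formDeg t x) (weightMap formDeg t y) =
      weightMap formDeg t (wedge x y) := by
  funext a
  cases a <;> simp only [wedge_apply, wedgeFun, weightMap, formDeg, zpow_ofNat]
    <;> ring

theorem wedge_mem (i j : ℤ) (x : Form) (hx : x ∈ coordGr formDeg i) (y : Form)
    (hy : y ∈ coordGr formDeg j) : wedge x y ∈ coordGr formDeg (i + j) := by
  rw [mem_coordGr_iff] at hx hy ⊢
  rw [← wedge_weightMap, hx, hy, map_smul, map_smul, LinearMap.smul_apply, smul_smul,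
    ← zpow_add₀ two_ne_zero, add_comm]

/-- Graded commutativity, with the sign written in terms of the parity involution. -/
theorem wedge_comm_parity (x y : Form) :
    wedge x y = (1 / 2 : ℂ) • (wedge y x + wedge (weightMap formDeg (-1) y) x +
      wedge y (weightMap formDeg (-1) x) -
      wedge (weightMap formDeg (-1) y) (weightMap formDeg (-1) x)) := by
  funext a
  cases a <;> simp only [wedge_apply, wedgeFun, weightMap, formDeg, zpow_ofNat,
    Pi.smul_apply, Pi.add_apply, Pi.sub_apply, smul_eq_mul] <;> ring

theorem negOnePow_smul_eq {V : Type*} [AddCommGroup V] [Module ℂ V] (i : ℤ) (x : V) :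
    i.negOnePow • x = (-1 : ℂ) ^ i • x := by
  rcases Int.even_or_odd i with h | h
  · rw [Int.negOnePow_even i h, h.neg_one_zpow, one_smul, one_smul]
  · rw [Int.negOnePow_odd i h, h.neg_one_zpow, Units.neg_smul, one_smul, neg_smul, one_smul]

theorem wedge_comm (i j : ℤ) (x : Form) (hx : x ∈ coordGr formDeg i) (y : Form)
    (hy : y ∈ coordGr formDeg j) : wedge x y = (i * j).negOnePow • wedge y x := by
  rw [wedge_comm_parity, weightMap_of_mem hx, weightMap_of_mem hy, ← negOnePow_smul_eq,
    ← negOnePow_smul_eq]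
  rcases Int.even_or_odd i with h | h <;> rcases Int.even_or_odd j with h' | h'
  · rw [Int.negOnePow_even _ (h.mul_right j), Int.negOnePow_even _ h, Int.negOnePow_even _ h']
    simp only [one_smul]
    module
  · rw [Int.negOnePow_even _ (h.mul_right j), Int.negOnePow_even _ h, Int.negOnePow_odd _ h']
    simp only [one_smul, Units.neg_smul, map_neg, LinearMap.neg_apply]
    module
  · rw [Int.negOnePow_even _ (h'.mul_left i), Int.negOnePow_odd _ h, Int.negOnePow_even _ h']
    simp only [one_smul, Units.neg_smul, map_neg]
    module
  · rw [Int.negOnePow_odd _ (h.mul h'), Int.negOnePow_odd _ h, Int.negOnePow_odd _ h']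
    simp only [one_smul, Units.neg_smul, map_neg, LinearMap.neg_apply]
    module

/-- The exterior algebra of `ℂ⁴` as a graded commutative algebra. -/
def formAlgebra : GradedCommAlgebra Form where
  gr := coordGr formDeg
  isInternal := coordGr_isInternal formDeg
  mul := wedge
  mul_mem := wedge_mem
  mul_assoc := wedge_assoc
  mul_comm := wedge_comm

end TreeAmp

/-! ### Ideals cut out by Bianchi identities -/

namespace TreeAmp

open scoped TensorProduct

namespace LieAction

open GradedCommAlgebra

variable {Λ : Type} [AddCommGroup Λ] [Module ℂ Λ] {G : GradedCommAlgebra Λ}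
  {𝔤 : Type} [AddCommGroup 𝔤] [Module ℂ 𝔤] (A : LieAction G 𝔤)

/-- The action of a `𝔤`-valued form on the form `ω` by derivations: `η ⊗ Y ↦ Y(ω) η`. -/
def anchor : Λ →ₗ[ℂ] Λ ⊗[ℂ] 𝔤 →ₗ[ℂ] Λ :=
  LinearMap.mk₂ ℂ (fun ω y => TensorProduct.lift (G.mul.flip.compl₂ (A.rot.flip ω)) y)
    (fun ω ω' y => by
      induction y using TensorProduct.induction_on with
      | zero => simp
      | tmul η Y => simp
      | add y y' h h' => rw [map_add _ y y', map_add _ y y', map_add _ y y', h, h']; abel)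
    (fun c ω y => by
      induction y using TensorProduct.induction_on with
      | zero => simp
      | tmul η Y => simp
      | add y y' h h' => rw [map_add, map_add, h, h', smul_add])
    (fun ω y y' => map_add _ _ _) (fun c ω y => map_smul _ _ _)

theorem anchor_tmul (ω η : Λ) (Y : 𝔤) : A.anchor ω (η ⊗ₜ Y) = G.mul (A.rot Y ω) η := rfl

/-- For a projection `π` of `𝔤`, the forms with values in the image of `π` that satisfy the Bianchi
identity: they act trivially on all forms. -/
def bianchi (π : 𝔤 →ₗ[ℂ] 𝔤) : Submodule ℂ (Λ ⊗[ℂ] 𝔤) :=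
  LinearMap.eqLocus (π.lTensor Λ) LinearMap.id ⊓ ⨅ ω, LinearMap.ker (A.anchor ω)

variable {A} {π : 𝔤 →ₗ[ℂ] 𝔤}

theorem mem_bianchi {y : Λ ⊗[ℂ] 𝔤} :
    y ∈ A.bianchi π ↔ π.lTensor Λ y = y ∧ ∀ ω, A.anchor ω y = 0 := by
  simp [bianchi, LinearMap.mem_eqLocus, Submodule.mem_iInf]

theorem anchor_rTensor_mul {i j : ℤ} {ω ω' : Λ} (hω : ω ∈ G.gr i) (hω' : ω' ∈ G.gr j)
    (y : Λ ⊗[ℂ] 𝔤) : A.anchor ω' ((G.mul ω).rTensor 𝔤 y) =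
      (i * j).negOnePow • G.mul ω (A.anchor ω' y) := by
  induction y using TensorProduct.induction_on with
  | zero => simp
  | tmul η Y =>
    rw [LinearMap.rTensor_tmul, anchor_tmul, anchor_tmul,
      G.mul_left_comm hω (A.rot_mem Y j ω' hω')]
  | add y y' h h' => simp only [map_add, h, h', smul_add]

theorem anchor_rot (X : 𝔤) (ω : Λ) (y : Λ ⊗[ℂ] 𝔤) :
    A.anchor ω ((A.rot X).rTensor 𝔤 y + (A.lie X).lTensor Λ y) =
      A.rot X (A.anchor ω y) - A.anchor (A.rot X ω) y := by
  induction y using TensorProduct.induction_on with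
  | zero => simp
  | tmul η Y =>
    rw [LinearMap.rTensor_tmul, LinearMap.lTensor_tmul, map_add, anchor_tmul, anchor_tmul,
      anchor_tmul, anchor_tmul, A.rot_mul, A.rot_lie, map_sub, LinearMap.sub_apply]
    abel
  | add y y' h h' =>
    simp only [map_add] at h h' ⊢
    rw [add_add_add_comm, h, h']
    abel

theorem bianchi_mul_mem {ω : Λ} {y : Λ ⊗[ℂ] 𝔤} (hy : y ∈ A.bianchi π) :
    (G.mul ω).rTensor 𝔤 y ∈ A.bianchi π := by
  refine gradedInduction G.isInternal (p := fun ω => (G.mul ω).rTensor 𝔤 y ∈ A.bianchi π) ω ?_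
    (by simp) fun ω ω' h h' => by
      rw [map_add, LinearMap.rTensor_add]; exact add_mem h h'
  intro i ω hω
  rw [mem_bianchi] at hy ⊢
  refine ⟨?_, fun ω' => gradedInduction G.isInternal
    (p := fun ω' => A.anchor ω' ((G.mul ω).rTensor 𝔤 y) = 0) ω' ?_ (by simp)
    fun x x' h h' => by rw [map_add, LinearMap.add_apply, h, h', add_zero]⟩
  · rw [← LinearMap.comp_apply, LinearMap.lTensor_comp_rTensor, ← LinearMap.rTensor_comp_lTensor,
      LinearMap.comp_apply, hy.1]
  · intro j ω' hω'
    rw [anchor_rTensor_mul hω hω', hy.2, map_zero, smul_zero]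

theorem bianchi_rot_mem (hπ : ∀ X Y, A.lie X (π Y) = π (A.lie X Y)) (X : 𝔤) {y : Λ ⊗[ℂ] 𝔤}
    (hy : y ∈ A.bianchi π) :
    (A.rot X).rTensor 𝔤 y + (A.lie X).lTensor Λ y ∈ A.bianchi π := by
  rw [mem_bianchi] at hy ⊢
  refine ⟨?_, fun ω => by rw [anchor_rot, hy.2, hy.2, map_zero, sub_zero]⟩
  have h1 : π.lTensor Λ ((A.rot X).rTensor 𝔤 y) = (A.rot X).rTensor 𝔤 y := by
    rw [← LinearMap.comp_apply, LinearMap.lTensor_comp_rTensor, ← LinearMap.rTensor_comp_lTensor,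
      LinearMap.comp_apply, hy.1]
  have h2 : π.lTensor Λ ((A.lie X).lTensor Λ y) = (A.lie X).lTensor Λ y := by
    rw [← LinearMap.lTensor_comp_apply, show π ∘ₗ A.lie X = A.lie X ∘ₗ π from
      LinearMap.ext fun Y => (hπ X Y).symm, LinearMap.lTensor_comp_apply, hy.1]
  rw [map_add, h1, h2]

/-- The bracket with a form on which the translations in `𝔤` vanish. -/
theorem br_tmul_of_trans (hπ : ∀ X k, A.trans (π X) k = 0) (k l : Mom) (ω : Λ) (X : 𝔤)
    {y : Λ ⊗[ℂ] 𝔤} (hy : π.lTensor Λ y = y) :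
    A.br k l (ω ⊗ₜ X) y = (G.mul ω).rTensor 𝔤 ((A.rot X).rTensor 𝔤 y + (A.lie X).lTensor Λ y +
      A.trans X l • y) - A.anchor ω y ⊗ₜ X := by
  rw [← hy]
  clear hy
  induction y using TensorProduct.induction_on with
  | zero => simp
  | tmul η Y =>
    simp only [LinearMap.lTensor_tmul, LinearMap.rTensor_tmul, br_tmul, anchor_tmul, act_apply,
      hπ, zero_smul, add_zero, map_add, map_smul, TensorProduct.add_tmul, TensorProduct.smul_tmul']
    abel
  | add y y' h h' =>
    simp only [map_add, h, h', smul_add, TensorProduct.add_tmul]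
    abel

theorem bianchi_br_mem (hπ : ∀ X Y, A.lie X (π Y) = π (A.lie X Y))
    (hπ' : ∀ X k, A.trans (π X) k = 0) (k l : Mom) (x : Λ ⊗[ℂ] 𝔤) {y : Λ ⊗[ℂ] 𝔤}
    (hy : y ∈ A.bianchi π) : A.br k l x y ∈ A.bianchi π := by
  induction x using TensorProduct.induction_on with
  | zero => simp
  | tmul ω X =>
    rw [br_tmul_of_trans hπ' k l ω X (mem_bianchi.1 hy).1, (mem_bianchi.1 hy).2,
      TensorProduct.zero_tmul, sub_zero]
    exact bianchi_mul_mem (add_mem (bianchi_rot_mem hπ X hy) (Submodule.smul_mem _ _ hy))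
  | add x x' h h' =>
    rw [map_add]
    exact add_mem h h'

end LieAction

/-! ### The Lie algebra of translations and complexified rotations -/

/-- Indices for the coordinates of an infinitesimal symmetry: a translation, which is a vector `t`
written as a matrix, and two infinitesimal rotations, which are symmetric matrices `u`, `w` with
coordinates the entries `00`, `01`, `11`. -/
inductive LieIdx : Type
  | t00 | t01 | t10 | t11 | u0 | u1 | u2 | w0 | w1 | w2
  deriving DecidableEq

instance : Fintype LieIdx where
  elems := {.t00, .t01, .t10, .t11, .u0, .u1, .u2, .w0, .w1, .w2}
  complete a := by cases a <;> decide

/-- The direct sum of the translations and the two copies of `sl(2, ℂ)`. The rotations act on the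
frame indices of forms only, which is why they commute with the translations. -/
abbrev LocalSymmetry : Type := LieIdx → ℂ

/-- The Lie bracket `(u ε u' - u' ε u, w ε w' - w' ε w)`. -/
def symmetryLieFun (X Y : LocalSymmetry) : LocalSymmetry
  | .t00 => 0
  | .t01 => 0
  | .t10 => 0
  | .t11 => 0
  | .u0 => -2 * X .u1 * Y .u0 + 2 * X .u0 * Y .u1
  | .u1 => X .u0 * Y .u2 - X .u2 * Y .u0
  | .u2 => -2 * X .u2 * Y .u1 + 2 * X .u1 * Y .u2
  | .w0 => -2 * X .w1 * Y .w0 + 2 * X .w0 * Y .w1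
  | .w1 => X .w0 * Y .w2 - X .w2 * Y .w0
  | .w2 => -2 * X .w2 * Y .w1 + 2 * X .w1 * Y .w2

/-- The Lie bracket of infinitesimal symmetries. -/
def symmetryLie : LocalSymmetry →ₗ[ℂ] LocalSymmetry →ₗ[ℂ] LocalSymmetry :=
  LinearMap.mk₂ ℂ symmetryLieFun
    (fun x x' y => by
      funext a; cases a <;> simp only [symmetryLieFun, Pi.add_apply] <;> ring)
    (fun c x y => by
      funext a; cases a <;> simp only [symmetryLieFun, Pi.smul_apply, smul_eq_mul] <;> ring)
    (fun x y y' => by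
      funext a; cases a <;> simp only [symmetryLieFun, Pi.add_apply] <;> ring)
    (fun c x y => by
      funext a; cases a <;> simp only [symmetryLieFun, Pi.smul_apply, smul_eq_mul] <;> ring)

theorem symmetryLie_apply (X Y : LocalSymmetry) (a : LieIdx) :
    symmetryLie X Y a = symmetryLieFun X Y a := rfl

/-- The rotation `(u, w)` of a form: `u ε m - m ε w` on one-forms, and accordingly on the other
forms. -/
def rotateFun (X : LocalSymmetry) (ω : Form) : Form
  | .c => 0
  | .m00 => -X .u1 * ω .m00 + X .u0 * ω .m10 + X .w0 * ω .m01 - X .w1 * ω .m00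
  | .m01 => -X .u1 * ω .m01 + X .u0 * ω .m11 + X .w1 * ω .m01 - X .w2 * ω .m00
  | .m10 => -X .u2 * ω .m00 + X .u1 * ω .m10 + X .w0 * ω .m11 - X .w1 * ω .m10
  | .m11 => -X .u2 * ω .m01 + X .u1 * ω .m11 + X .w1 * ω .m11 - X .w2 * ω .m10
  | .s0 => -2 * X .u1 * ω .s0 + 2 * X .u0 * ω .s1
  | .s1 => X .u0 * ω .s2 - X .u2 * ω .s0
  | .s2 => -2 * X .u2 * ω .s1 + 2 * X .u1 * ω .s2
  | .r0 => -2 * X .w1 * ω .r0 + 2 * X .w0 * ω .r1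
  | .r1 => X .w0 * ω .r2 - X .w2 * ω .r0
  | .r2 => -2 * X .w2 * ω .r1 + 2 * X .w1 * ω .r2
  | .j00 => -X .u1 * ω .j00 + X .u0 * ω .j10 + X .w0 * ω .j01 - X .w1 * ω .j00
  | .j01 => -X .u1 * ω .j01 + X .u0 * ω .j11 + X .w1 * ω .j01 - X .w2 * ω .j00
  | .j10 => -X .u2 * ω .j00 + X .u1 * ω .j10 + X .w0 * ω .j11 - X .w1 * ω .j10
  | .j11 => -X .u2 * ω .j01 + X .u1 * ω .j11 + X .w1 * ω .j11 - X .w2 * ω .j10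
  | .v => 0

/-- The derivation of the exterior algebra given by an infinitesimal rotation. -/
def rotate : LocalSymmetry →ₗ[ℂ] Form →ₗ[ℂ] Form :=
  LinearMap.mk₂ ℂ rotateFun
    (fun x x' y => by
      funext a; cases a <;> simp only [rotateFun, Pi.add_apply] <;> ring)
    (fun c x y => by
      funext a; cases a <;> simp only [rotateFun, Pi.smul_apply, smul_eq_mul] <;> ring)
    (fun x y y' => by
      funext a; cases a <;> simp only [rotateFun, Pi.add_apply] <;> ring)
    (fun c x y => by
      funext a; cases a <;> simp only [rotateFun, Pi.smul_apply, smul_eq_mul] <;> ring)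

theorem rotate_apply (X : LocalSymmetry) (ω : Form) (a : FormIdx) :
    rotate X ω a = rotateFun X ω a := rfl

/-- The pairing of a translation with a momentum, the polarized determinant. -/
def translate : LocalSymmetry →ₗ[ℂ] Mom →ₗ[ℂ] ℂ :=
  LinearMap.mk₂ ℂ
    (fun X k => X .t00 * k 1 1 - X .t01 * k 1 0 - X .t10 * k 0 1 + X .t11 * k 0 0)
    (fun x x' y => by simp only [Pi.add_apply]; ring)
    (fun c x y => by simp only [Pi.smul_apply, smul_eq_mul]; ring)
    (fun x y y' => by simp only [Matrix.add_apply]; ring)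
    (fun c x y => by simp only [Matrix.smul_apply, smul_eq_mul]; ring)

theorem translate_apply (X : LocalSymmetry) (k : Mom) : translate X k =
    X .t00 * k 1 1 - X .t01 * k 1 0 - X .t10 * k 0 1 + X .t11 * k 0 0 := rfl

theorem rotate_mem (X : LocalSymmetry) (i : ℤ) (ω : Form) (hω : ω ∈ coordGr formDeg i) :
    rotate X ω ∈ coordGr formDeg i := by
  rw [← add_zero i]
  refine map_mem_coordGr (fun ω => ?_) hω
  funext a
  cases a <;> simp only [rotate_apply, rotateFun, weightMap, formDeg, zpow_ofNat, neg_zero,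
    Pi.smul_apply, smul_eq_mul] <;> ring

/-- The action of the infinitesimal symmetries on plane waves. -/
def localSymmetry : LieAction formAlgebra LocalSymmetry where
  lie := symmetryLie
  lie_skew X Y := by
    funext a; cases a <;> simp only [symmetryLie_apply, symmetryLieFun, Pi.neg_apply] <;> ring
  lie_jacobi X Y Z := by
    funext a; cases a <;> simp only [symmetryLie_apply, symmetryLieFun, Pi.add_apply] <;> ring
  rot := rotate
  rot_mem := rotate_mem
  rot_mul X ω η := by
    change rotate X (wedge ω η) = wedge (rotate X ω) η + wedge ω (rotate X η)
    funext a
    cases a <;> simp only [rotate_apply, rotateFun, wedge_apply, wedgeFun, Pi.add_apply] <;> ring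
  rot_lie X Y ω := by
    funext a
    cases a <;> simp only [rotate_apply, rotateFun, symmetryLie_apply, symmetryLieFun,
      Pi.sub_apply] <;> ring
  trans := translate
  trans_lie X Y k := by
    simp only [translate_apply, symmetryLie_apply, symmetryLieFun]; ring

/-- A one-form, written as a matrix. -/
def oneForm : Mom →ₗ[ℂ] Form where
  toFun k
    | .m00 => k 0 0
    | .m01 => k 0 1
    | .m10 => k 1 0
    | .m11 => k 1 1
    | _ => 0
  map_add' k l := by funext a; cases a <;> simp
  map_smul' c k := by funext a; cases a <;> simp

/-- The contraction of a form with the vector dual to the momentum `n`. -/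
def contractFun (n : Mom) (x : Form) : Form
  | .c => n 0 0 * x .m11 - n 0 1 * x .m10 - n 1 0 * x .m01 + n 1 1 * x .m00
  | .m00 => -1 / 2 * n 0 0 * x .s1 + 1 / 2 * n 1 0 * x .s0 + 1 / 2 * n 0 1 * x .r0 -
      1 / 2 * n 0 0 * x .r1
  | .m01 => -1 / 2 * n 0 1 * x .s1 + 1 / 2 * n 1 1 * x .s0 + 1 / 2 * n 0 1 * x .r1 -
      1 / 2 * n 0 0 * x .r2
  | .m10 => -1 / 2 * n 0 0 * x .s2 + 1 / 2 * n 1 0 * x .s1 + 1 / 2 * n 1 1 * x .r0 -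
      1 / 2 * n 1 0 * x .r1
  | .m11 => -1 / 2 * n 0 1 * x .s2 + 1 / 2 * n 1 1 * x .s1 + 1 / 2 * n 1 1 * x .r1 -
      1 / 2 * n 1 0 * x .r2
  | .s0 => -n 0 1 * x .j00 + n 0 0 * x .j01
  | .s1 => -1 / 2 * n 0 1 * x .j10 + 1 / 2 * n 0 0 * x .j11 + 1 / 2 * n 1 0 * x .j01 -
      1 / 2 * n 1 1 * x .j00
  | .s2 => -n 1 1 * x .j10 + n 1 0 * x .j11
  | .r0 => n 1 0 * x .j00 - n 0 0 * x .j10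
  | .r1 => 1 / 2 * n 1 0 * x .j01 - 1 / 2 * n 0 0 * x .j11 - 1 / 2 * n 0 1 * x .j10 +
      1 / 2 * n 1 1 * x .j00
  | .r2 => n 1 1 * x .j01 - n 0 1 * x .j11
  | .j00 => -n 0 0 * x .v
  | .j01 => -n 0 1 * x .v
  | .j10 => -n 1 0 * x .v
  | .j11 => -n 1 1 * x .v
  | .v => 0

/-- The contraction with a vector. -/
def contract (n : Mom) : Form →ₗ[ℂ] Form where
  toFun := contractFun n
  map_add' x y := by funext a; cases a <;> simp only [contractFun, Pi.add_apply] <;> ring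
  map_smul' c x := by
    funext a
    cases a <;> simp only [contractFun, Pi.smul_apply, smul_eq_mul, RingHom.id_apply] <;> ring

theorem contract_apply (n : Mom) (x : Form) (a : FormIdx) :
    contract n x a = contractFun n x a := rfl

/-- The contraction with a vector is an antiderivation. -/
theorem contract_oneForm_wedge (n k : Mom) (ω : Form) :
    contract n (wedge (oneForm k) ω) =
      (n 0 0 * k 1 1 - n 0 1 * k 1 0 - n 1 0 * k 0 1 + n 1 1 * k 0 0) • ω -
        wedge (oneForm k) (contract n ω) := by
  funext a
  cases a <;> simp only [contract_apply, contractFun, wedge_apply, wedgeFun, oneForm,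
    LinearMap.coe_mk, AddHom.coe_mk, Pi.sub_apply, Pi.smul_apply, smul_eq_mul] <;> ring

end TreeAmp

/-! ### Complexes presented as quotients -/

namespace TreeAmp

/-- A complex `(P, d)` and a subcomplex, which is a shifted copy of one part of the Lorentz
equivariant complex: `e` is the projection onto that part, `ψ` is the embedding, with left inverse
`χ`. The map `lam` to the other part is a quasi-isomorphism for nonzero momenta. The quotient of
`P` by the subcomplex is then quasi-isomorphic to the Lorentz equivariant complex. -/
structure Presentation (N : ℕ) {P : Type} [AddCommGroup P] [Module ℂ P]
    (gr : ℤ → Submodule ℂ P) (d : Mom → P →ₗ[ℂ] P) where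
  isInternal : DirectSum.IsInternal gr
  d_mem : ∀ k i, ∀ x ∈ gr i, d k x ∈ gr (i + 1)
  d_d : ∀ k x, d k (d k x) = 0
  d_poly : IsPolynomial d
  ψ : PairSpace N ℂ →ₗ[ℂ] P
  χ : P →ₗ[ℂ] PairSpace N ℂ
  e : PairSpace N ℂ →ₗ[ℂ] PairSpace N ℂ
  lam : P →ₗ[ℂ] PairSpace N ℂ
  ψ_mem : ∀ i, ∀ z ∈ pairGr N ℂ i, ψ z ∈ gr (i + 1)
  χ_mem : ∀ i, ∀ x ∈ gr (i + 1), χ x ∈ pairGr N ℂ i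
  lam_mem : ∀ i, ∀ x ∈ gr i, lam x ∈ pairGr N ℂ i
  χ_ψ : ∀ z, χ (ψ z) = e z
  ψ_e : ∀ z, ψ (e z) = ψ z
  e_χ : ∀ x, e (χ x) = χ x
  e_lam : ∀ x, e (lam x) = 0
  lam_ψ : ∀ z, lam (ψ z) = 0
  e_d : ∀ k z, e (pairD N ℂ k z) = pairD N ℂ k (e z)
  ψ_d : ∀ k z, d k (ψ z) = -ψ (pairD N ℂ k z)
  lam_d : ∀ k x, lam (d k x) = pairD N ℂ k (lam x)
  inj : ∀ k, k ≠ 0 → ∀ x w, d k x = 0 → lam x = pairD N ℂ k w → ∃ y, d k y = x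
  surj : ∀ k, k ≠ 0 → ∀ z, pairD N ℂ k z = 0 → e z = 0 →
    ∃ x w, d k x = 0 ∧ lam x = z + pairD N ℂ k w

namespace Presentation

variable {N : ℕ} {P : Type} [AddCommGroup P] [Module ℂ P] {gr : ℤ → Submodule ℂ P}
  {d : Mom → P →ₗ[ℂ] P} (p : Presentation N gr d)

/-- The subcomplex. -/
def relations : Submodule ℂ P := LinearMap.range p.ψ

/-- The quotient complex. -/
abbrev Quot : Type := P ⧸ p.relations

/-- The projection to the quotient. -/
def proj : P →ₗ[ℂ] p.Quot := p.relations.mkQ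

theorem exists_proj (x : p.Quot) : ∃ y, x = p.proj y := by
  obtain ⟨y, rfl⟩ := Submodule.Quotient.mk_surjective _ x
  exact ⟨y, rfl⟩

theorem proj_ψ (z : PairSpace N ℂ) : p.proj (p.ψ z) = 0 :=
  (Submodule.Quotient.mk_eq_zero _).2 ⟨z, rfl⟩

theorem proj_eq_zero {x : P} (h : p.proj x = 0) : ∃ z, x = p.ψ z := by
  obtain ⟨z, hz⟩ := (Submodule.Quotient.mk_eq_zero _).1 h
  exact ⟨z, hz.symm⟩

/-- A map of `P` that preserves the subcomplex descends to the quotient. -/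
def map (T : P →ₗ[ℂ] P) (hT : ∀ z, ∃ z', T (p.ψ z) = p.ψ z') : p.Quot →ₗ[ℂ] p.Quot :=
  Submodule.mapQ _ _ T (by
    rintro _ ⟨z, rfl⟩
    obtain ⟨z', hz'⟩ := hT z
    exact ⟨z', hz'.symm⟩)

theorem map_proj (T : P →ₗ[ℂ] P) (hT : ∀ z, ∃ z', T (p.ψ z) = p.ψ z') (x : P) :
    p.map T hT (p.proj x) = p.proj (T x) := rfl

/-- A bilinear map of `P` for which the subcomplex is an ideal descends to the quotient. -/
def map₂ (B : P →ₗ[ℂ] P →ₗ[ℂ] P) (hl : ∀ z y, p.proj (B (p.ψ z) y) = 0)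
    (hr : ∀ x z, p.proj (B x (p.ψ z)) = 0) : p.Quot →ₗ[ℂ] p.Quot →ₗ[ℂ] p.Quot :=
  Submodule.liftQ _ (LinearMap.mk₂ ℂ (fun x => Submodule.liftQ _ (p.proj ∘ₗ B x) (by
      rintro _ ⟨z, rfl⟩
      exact hr x z))
    (fun x x' y => by
      obtain ⟨y, rfl⟩ := p.exists_proj y
      exact (congrArg p.proj (LinearMap.map_add₂ B x x' y)).trans (map_add _ _ _))
    (fun c x y => by
      obtain ⟨y, rfl⟩ := p.exists_proj y
      exact (congrArg p.proj (LinearMap.map_smul₂ B c x y)).trans (map_smul _ _ _))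
    (fun x y y' => map_add _ _ _) (fun c x y => map_smul _ _ _)) (by
    rintro _ ⟨z, rfl⟩
    refine LinearMap.ext fun y => ?_
    obtain ⟨y, rfl⟩ := p.exists_proj y
    exact hl z y)

theorem map₂_proj (B : P →ₗ[ℂ] P →ₗ[ℂ] P) (hl : ∀ z y, p.proj (B (p.ψ z) y) = 0)
    (hr : ∀ x z, p.proj (B x (p.ψ z)) = 0) (x y : P) :
    p.map₂ B hl hr (p.proj x) (p.proj y) = p.proj (B x y) := rfl

/-- The grading of the quotient. -/
def quotGr (i : ℤ) : Submodule ℂ p.Quot := (gr i).map p.proj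

theorem proj_mem {i : ℤ} {x : P} (hx : x ∈ gr i) : p.proj x ∈ p.quotGr i := ⟨x, hx, rfl⟩

theorem gradedProj_ψ (i : ℤ) (z : PairSpace N ℂ) :
    gradedProj p.isInternal (i + 1) (p.ψ z) =
      p.ψ (gradedProj (pairGr_isInternal N ℂ) i z) := by
  refine gradedInduction (pairGr_isInternal N ℂ) (p := fun z =>
    gradedProj p.isInternal (i + 1) (p.ψ z) = p.ψ (gradedProj (pairGr_isInternal N ℂ) i z)) z ?_
    (by simp) fun x y h h' => by simp only [map_add, h, h']
  intro j z hz
  by_cases h : i = j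
  · subst h
    rw [gradedProj_of_mem _ (p.ψ_mem _ z hz), gradedProj_of_mem _ hz]
  · rw [gradedProj_of_mem_ne _ (fun h' => h (by omega)) (p.ψ_mem _ z hz),
      gradedProj_of_mem_ne _ h hz, map_zero]

theorem quotGr_isInternal : DirectSum.IsInternal p.quotGr := by
  refine isInternal_of_projections _ (fun i => p.map (gradedProj p.isInternal i) fun z =>
    ⟨gradedProj (pairGr_isInternal N ℂ) (i - 1) z, by
      rw [← p.gradedProj_ψ, sub_add_cancel]⟩) ?_ ?_ ?_
  · rintro i _ ⟨x, hx, rfl⟩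
    rw [map_proj, gradedProj_of_mem _ hx]
  · rintro i j hij _ ⟨x, hx, rfl⟩
    rw [map_proj, gradedProj_of_mem_ne _ hij hx, map_zero]
  · intro x
    obtain ⟨x, rfl⟩ := p.exists_proj x
    refine gradedInduction p.isInternal (p := fun x => p.proj x ∈ ⨆ i, p.quotGr i) x ?_ ?_ ?_
    · intro i x hx
      exact Submodule.mem_iSup_of_mem i (p.proj_mem hx)
    · rw [map_zero]; exact zero_mem _
    · intro x y hx hy
      rw [map_add]; exact add_mem hx hy

/-- The differential of the quotient. -/
def quotD (k : Mom) : p.Quot →ₗ[ℂ] p.Quot :=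
  p.map (d k) fun z => ⟨-pairD N ℂ k z, by rw [p.ψ_d, map_neg]⟩

theorem quotD_proj (k : Mom) (x : P) : p.quotD k (p.proj x) = p.proj (d k x) := rfl

theorem quotD_mem (k : Mom) (i : ℤ) (x : p.Quot) (hx : x ∈ p.quotGr i) :
    p.quotD k x ∈ p.quotGr (i + 1) := by
  obtain ⟨x, hx, rfl⟩ := hx
  exact p.proj_mem (p.d_mem k i x hx)

theorem quotD_quotD (k : Mom) (x : p.Quot) : p.quotD k (p.quotD k x) = 0 := by
  obtain ⟨x, rfl⟩ := p.exists_proj x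
  rw [quotD_proj, quotD_proj, p.d_d, map_zero]

theorem quotD_poly : IsPolynomial p.quotD := by
  intro x φ
  obtain ⟨x, rfl⟩ := p.exists_proj x
  exact p.d_poly x (φ ∘ₗ p.proj)

/-- The map from the quotient to the Lorentz equivariant complex. Its first part is the connecting
homomorphism of the subcomplex. -/
def toGamma (k : Mom) : p.Quot →ₗ[ℂ] PairSpace N ℂ :=
  Submodule.liftQ _ (p.χ ∘ₗ d k + pairD N ℂ k ∘ₗ p.χ + p.lam) (by
    rintro _ ⟨z, rfl⟩
    simp [p.ψ_d, p.χ_ψ, p.lam_ψ, p.e_d])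

theorem toGamma_proj (k : Mom) (x : P) :
    p.toGamma k (p.proj x) = p.χ (d k x) + pairD N ℂ k (p.χ x) + p.lam x := rfl

theorem toGamma_proj_of_eq {k : Mom} {x : P} {z : PairSpace N ℂ} (h : d k x = p.ψ z) :
    p.toGamma k (p.proj x) = p.e z + p.lam x + pairD N ℂ k (p.χ x) := by
  rw [toGamma_proj, h, p.χ_ψ]
  abel

theorem toGamma_mem (k : Mom) (i : ℤ) (x : p.Quot) (hx : x ∈ p.quotGr i) :
    p.toGamma k x ∈ pairGr N ℂ i := by
  obtain ⟨x, hx, rfl⟩ := hx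
  rw [toGamma_proj]
  refine add_mem (add_mem (p.χ_mem _ _ (p.d_mem k i x hx)) ?_) (p.lam_mem _ _ hx)
  have := pairD_mem N ℂ k (i - 1) _ (p.χ_mem (i - 1) x (by rwa [sub_add_cancel]))
  rwa [sub_add_cancel] at this

theorem toGamma_d (k : Mom) (x : p.Quot) :
    p.toGamma k (p.quotD k x) = pairD N ℂ k (p.toGamma k x) := by
  obtain ⟨x, rfl⟩ := p.exists_proj x
  rw [quotD_proj, toGamma_proj, toGamma_proj, p.d_d, p.lam_d, map_zero, map_add, map_add, pairD_pairD]
  abel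

theorem toGamma_poly : IsPolynomial p.toGamma := by
  intro x φ
  obtain ⟨x, rfl⟩ := p.exists_proj x
  obtain ⟨P₁, h₁⟩ := p.d_poly x (φ ∘ₗ p.χ)
  obtain ⟨P₂, h₂⟩ := pairD_poly N ℂ (p.χ x) φ
  refine ⟨P₁ + P₂ + MvPolynomial.C (φ (p.lam x)), fun k => ?_⟩
  rw [toGamma_proj, map_add, map_add, h₂, show φ (p.χ (d k x)) = polyEval P₁ k from h₁ k]
  simp [polyEval]

theorem quasiIso (k : Mom) (hk : k ≠ 0) :
    IsQuasiIso (p.quotD k) (pairD N ℂ k) (p.toGamma k) where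
  inj x w hx h := by
    obtain ⟨x, rfl⟩ := p.exists_proj x
    rw [quotD_proj] at hx
    obtain ⟨z, hz⟩ := p.proj_eq_zero hx
    have h1 := congrArg p.e h
    rw [p.toGamma_proj_of_eq hz, map_add, map_add, p.e_lam, p.e_d, p.e_d, p.e_χ, add_zero] at h1
    -- the obstruction to lifting `x` to a closed element of `P` is exact
    obtain ⟨z', hz'⟩ : ∃ z', d k x = p.ψ (p.e (p.e z)) ∧ p.e (p.e z) = pairD N ℂ k z' := by
      refine ⟨p.e w - p.χ x, by rw [p.ψ_e, p.ψ_e, hz], ?_⟩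
      rw [map_sub, ← h1, add_sub_cancel_right]
    have hcl : d k (x + p.ψ z') = 0 := by
      rw [map_add, p.ψ_d, hz'.1, hz'.2, add_neg_cancel]
    have hl : ∃ w', p.lam (x + p.ψ z') = pairD N ℂ k w' := by
      rw [p.toGamma_proj_of_eq hz] at h
      have h2 : pairD N ℂ k (p.e w - p.χ x) = p.e z := by
        rw [map_sub, ← h1, add_sub_cancel_right, ← p.χ_ψ z, p.e_χ]
      refine ⟨w - p.χ x - (p.e w - p.χ x), ?_⟩
      rw [map_sub, h2, map_sub, ← h, map_add, p.lam_ψ]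
      abel
    obtain ⟨w', hw'⟩ := hl
    obtain ⟨y, hy⟩ := p.inj k hk _ w' hcl hw'
    refine ⟨p.proj y, ?_⟩
    rw [quotD_proj, hy, map_add, p.proj_ψ, add_zero]
  surj z hz := by
    have h1 : p.lam (p.ψ z) = pairD N ℂ k 0 := by rw [p.lam_ψ, map_zero]
    obtain ⟨x, hx⟩ := p.inj k hk (p.ψ z) 0 (by rw [p.ψ_d, hz, map_zero, neg_zero]) h1
    have hee : p.e (p.e z) = p.e z := by rw [← p.χ_ψ z, p.e_χ]
    obtain ⟨x', w, hx', hw⟩ := p.surj k hk (z - p.e z - p.lam x)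
      (by rw [map_sub, map_sub, ← p.e_d, hz, ← p.lam_d, hx, p.lam_ψ, map_zero, sub_zero, sub_zero])
      (by rw [map_sub, map_sub, p.e_lam, hee, sub_self, sub_zero])
    refine ⟨p.proj (x + x'), w + p.χ (x + x'), ?_, ?_⟩
    · rw [quotD_proj, map_add, hx, hx', add_zero, p.proj_ψ]
    · rw [p.toGamma_proj_of_eq (z := z) (by rw [map_add, hx, hx', add_zero]), map_add p.lam, hw,
        map_add (pairD N ℂ k) w]
      abel

/-- The map `toGamma` intertwines the dilations, up to exact terms. -/
theorem toGamma_dilation {S : P →ₗ[ℂ] P} {c : ℂ} (hc : c ≠ 0) (α : ℤ)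
    (hψ : ∀ z, S (p.ψ z) = c ^ (α - 1) • p.ψ z) (hd : ∀ k x, d (c • k) (S x) = c • S (d k x))
    (hlam : ∀ x, p.lam (S x) = c ^ α • p.lam x) (k : Mom) (x : P)
    (hx : p.quotD k (p.proj x) = 0) :
    ∃ w, p.toGamma (c • k) (p.proj (S x)) = c ^ α • p.toGamma k (p.proj x) + pairD N ℂ k w := by
  obtain ⟨z, hz⟩ := p.proj_eq_zero hx
  have h1 : d (c • k) (S x) = p.ψ (c ^ α • z) := by
    rw [hd, hz, hψ, smul_smul, ← zpow_one_add₀ hc, add_sub_cancel, map_smul]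
  refine ⟨c • p.χ (S x) - c ^ α • p.χ x, ?_⟩
  rw [p.toGamma_proj_of_eq hz, p.toGamma_proj_of_eq h1, hlam, pairD_smul, LinearMap.smul_apply, map_sub,
    map_smul, map_smul, map_smul]
  module

/-- The map `toGamma` intertwines linear symmetries, up to exact terms. -/
theorem toGamma_symmetry {T : P →ₗ[ℂ] P} {k k' : Mom} {M : PairSpace N ℂ →ₗ[ℂ] PairSpace N ℂ}
    (hψ : ∀ z, T (p.ψ z) = p.ψ (M z)) (hd : ∀ x, d k' (T x) = T (d k x))
    (he : ∀ z, p.e (M z) = M (p.e z)) (hM : ∀ z, pairD N ℂ k' (M z) = M (pairD N ℂ k z))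
    (hlam : ∀ x, p.lam (T x) = M (p.lam x)) (x : P) (hx : p.quotD k (p.proj x) = 0) :
    ∃ w, p.toGamma k' (p.proj (T x)) = M (p.toGamma k (p.proj x)) + pairD N ℂ k' w := by
  obtain ⟨z, hz⟩ := p.proj_eq_zero hx
  have h1 : d k' (T x) = p.ψ (M z) := by rw [hd, hz, hψ]
  refine ⟨p.χ (T x) - M (p.χ x), ?_⟩
  rw [p.toGamma_proj_of_eq hz, p.toGamma_proj_of_eq h1, hlam, map_add M, map_add M, map_sub, hM, he]
  abel

end Presentation

/-- The quotient of a fibre dgLa by an ideal, with its map to the Lorentz equivariant complex. -/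
def FiberDGLA.quotient {N : ℕ} {P : Type} [AddCommGroup P] [Module ℂ P] (F : FiberDGLA P)
    (p : Presentation N F.gr F.d)
    (ideal : ∀ k l x z, ∃ z', F.br k l x (p.ψ z) = p.ψ z') :
    FieldTheoryData N ℂ p.Quot :=
  have hr : ∀ k l x z, p.proj (F.br k l x (p.ψ z)) = 0 := fun k l x z => by
    obtain ⟨z', hz'⟩ := ideal k l x z
    rw [hz', p.proj_ψ]
  have hl : ∀ k l z x, p.proj (F.br k l (p.ψ z) x) = 0 := fun k l z x => by
    refine gradedInduction (pairGr_isInternal N ℂ) (p := fun z => p.proj (F.br k l (p.ψ z) x) = 0) z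
      (fun i z hz => ?_) (by simp) fun x y h h' => by
        simp only [map_add, LinearMap.add_apply, h, h', add_zero]
    refine gradedInduction p.isInternal (p := fun x => p.proj (F.br k l (p.ψ z) x) = 0) x
      (fun j x hx => ?_) (by simp) fun x y h h' => by simp only [map_add, h, h', add_zero]
    rw [F.antisymm k l _ _ _ (p.ψ_mem i z hz) _ hx, map_neg, map_negOnePow_smul, hr, smul_zero,
      neg_zero]
  { gr := p.quotGr
    isInternal := p.quotGr_isInternal
    d := p.quotD
    br := fun k l => p.map₂ (F.br k l) (hl k l) (hr k l)
    d_mem := p.quotD_mem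
    br_mem := by
      rintro k l i j _ ⟨x, hx, rfl⟩ _ ⟨y, hy, rfl⟩
      exact p.proj_mem (F.br_mem k l i j x hx y hy)
    d_d := p.quotD_quotD
    antisymm := by
      rintro k l i j _ ⟨x, hx, rfl⟩ _ ⟨y, hy, rfl⟩
      rw [p.map₂_proj, p.map₂_proj, F.antisymm k l i j x hx y hy, map_neg, map_negOnePow_smul]
    jacobi := by
      rintro k l m i j n _ ⟨x, hx, rfl⟩ _ ⟨y, hy, rfl⟩ _ ⟨z, hz, rfl⟩
      simp only [p.map₂_proj]
      rw [F.jacobi k l m i j n x hx y hy z hz, map_add, map_negOnePow_smul]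
    leibniz := by
      rintro k l i _ ⟨x, hx, rfl⟩ y
      obtain ⟨y, rfl⟩ := p.exists_proj y
      simp only [p.map₂_proj, p.quotD_proj]
      rw [F.leibniz k l i x hx y, map_add, map_negOnePow_smul]
    d_poly := p.quotD_poly
    br_poly := by
      intro x y φ
      obtain ⟨x, rfl⟩ := p.exists_proj x
      obtain ⟨y, rfl⟩ := p.exists_proj y
      exact F.br_poly x y (φ ∘ₗ p.proj)
    toGamma := p.toGamma
    toGamma_poly := p.toGamma_poly
    toGamma_mem := p.toGamma_mem
    toGamma_d := p.toGamma_d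
    quasiIso := p.quasiIso }

end TreeAmp

/-! ### Forms with values in the infinitesimal symmetries -/

namespace TreeAmp

open scoped TensorProduct

/-- Specializing the first momentum to zero. -/
theorem IsPolynomial₂.at_zero {V : Type*} [AddCommGroup V] [Module ℂ V]
    {T : Mom → Mom → V →ₗ[ℂ] V →ₗ[ℂ] V} (hT : IsPolynomial₂ T) (x : V) :
    IsPolynomial fun k => T 0 k x := by
  intro y φ
  obtain ⟨P, hP⟩ := hT x y φ
  refine ⟨MvPolynomial.bind₁ (Sum.elim (fun _ => 0) MvPolynomial.X) P, fun k => ?_⟩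
  rw [hP, polyEval, polyEval₂]
  refine Eq.trans ?_ (MvPolynomial.eval₂Hom_bind₁ (RingHom.id ℂ) _ _ P).symm
  refine congrFun (congrArg (fun g => DFunLike.coe (MvPolynomial.eval g)) (funext fun s => ?_)) P
  rcases s with s | s <;> simp

/-- Forms with values in the infinitesimal symmetries: vielbein perturbations (the translational
part) and connections (the rotational part), together with their ghosts and antifields. -/
abbrev SymmetryForm : Type := Form ⊗[ℂ] LocalSymmetry

/-- The `(a, b)` entry of the coframe. -/
abbrev coframe (a b : Fin 2) : Form := oneForm (Matrix.single a b 1)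

/-- A basis element of the infinitesimal symmetries. -/
abbrev symmetryBasis (a : LieIdx) : LocalSymmetry := Pi.single a 1

/-- The vielbein of Minkowski spacetime. -/
def vielbein : SymmetryForm :=
  coframe 0 0 ⊗ₜ symmetryBasis .t11 - coframe 0 1 ⊗ₜ symmetryBasis .t10 -
    coframe 1 0 ⊗ₜ symmetryBasis .t01 + coframe 1 1 ⊗ₜ symmetryBasis .t00

/-- The translational part of the differential: a rotation acts on the coframe. -/
def torsion : SymmetryForm →ₗ[ℂ] SymmetryForm :=
  (TensorProduct.mk ℂ Form LocalSymmetry).flip (symmetryBasis .t11) ∘ₗ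
      localSymmetry.anchor (coframe 0 0) -
    (TensorProduct.mk ℂ Form LocalSymmetry).flip (symmetryBasis .t10) ∘ₗ
      localSymmetry.anchor (coframe 0 1) -
    (TensorProduct.mk ℂ Form LocalSymmetry).flip (symmetryBasis .t01) ∘ₗ
      localSymmetry.anchor (coframe 1 0) +
    (TensorProduct.mk ℂ Form LocalSymmetry).flip (symmetryBasis .t00) ∘ₗ
      localSymmetry.anchor (coframe 1 1)

theorem torsion_apply (x : SymmetryForm) : torsion x =
    localSymmetry.anchor (coframe 0 0) x ⊗ₜ symmetryBasis .t11 -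
      localSymmetry.anchor (coframe 0 1) x ⊗ₜ symmetryBasis .t10 -
      localSymmetry.anchor (coframe 1 0) x ⊗ₜ symmetryBasis .t01 +
      localSymmetry.anchor (coframe 1 1) x ⊗ₜ symmetryBasis .t00 := rfl

/-- The elements without rotational part. -/
def IsTranslation (X : LocalSymmetry) : Prop :=
  X .u0 = 0 ∧ X .u1 = 0 ∧ X .u2 = 0 ∧ X .w0 = 0 ∧ X .w1 = 0 ∧ X .w2 = 0

theorem IsTranslation.rotate {X : LocalSymmetry} (h : IsTranslation X) (ω : Form) :
    rotate X ω = 0 := by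
  obtain ⟨h0, h1, h2, h3, h4, h5⟩ := h
  funext a
  cases a <;> simp only [rotate_apply, rotateFun, h0, h1, h2, h3, h4, h5, Pi.zero_apply] <;> ring

theorem IsTranslation.lie {X : LocalSymmetry} (h : IsTranslation X) (Y : LocalSymmetry) :
    symmetryLie X Y = 0 := by
  obtain ⟨h0, h1, h2, h3, h4, h5⟩ := h
  funext a
  cases a <;> simp only [symmetryLie_apply, symmetryLieFun, h0, h1, h2, h3, h4, h5,
    Pi.zero_apply] <;> ring

theorem isTranslation_t00 : IsTranslation (symmetryBasis .t00) := by simp [IsTranslation]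
theorem isTranslation_t01 : IsTranslation (symmetryBasis .t01) := by simp [IsTranslation]
theorem isTranslation_t10 : IsTranslation (symmetryBasis .t10) := by simp [IsTranslation]
theorem isTranslation_t11 : IsTranslation (symmetryBasis .t11) := by simp [IsTranslation]

theorem anchor_tmul_translation {X : LocalSymmetry} (hX : IsTranslation X) (ω η : Form) :
    localSymmetry.anchor ω (η ⊗ₜ X) = 0 := by
  rw [LieAction.anchor_tmul, show localSymmetry.rot X ω = 0 from hX.rotate ω, map_zero,
    LinearMap.zero_apply]

theorem torsion_tmul_translation {X : LocalSymmetry} (hX : IsTranslation X) (η : Form) :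
    torsion (η ⊗ₜ X) = 0 := by
  simp only [torsion_apply, anchor_tmul_translation hX, TensorProduct.zero_tmul, sub_zero, add_zero]

theorem torsion_rTensor_torsion (f : Form →ₗ[ℂ] Form) (x : SymmetryForm) :
    torsion (f.rTensor LocalSymmetry (torsion x)) = 0 := by
  rw [torsion_apply x]
  simp only [map_add, map_sub, LinearMap.rTensor_tmul,
    torsion_tmul_translation isTranslation_t00, torsion_tmul_translation isTranslation_t01,
    torsion_tmul_translation isTranslation_t10, torsion_tmul_translation isTranslation_t11,
    sub_zero, add_zero]

theorem torsion_torsion (x : SymmetryForm) : torsion (torsion x) = 0 := by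
  simpa using torsion_rTensor_torsion LinearMap.id x

theorem br_translation_tmul {X : LocalSymmetry} (hX : IsTranslation X) (k : Mom) (m : Mom)
    (ω : Form) (Y : LocalSymmetry) :
    localSymmetry.br 0 k (oneForm m ⊗ₜ X) (ω ⊗ₜ Y) =
      (translate X k • wedge (oneForm m) ω) ⊗ₜ Y - wedge (rotate Y (oneForm m)) ω ⊗ₜ X := by
  rw [LieAction.br_tmul, LieAction.act_apply, LieAction.act_apply,
    show localSymmetry.rot X ω = 0 from hX.rotate ω,
    show localSymmetry.lie X Y = 0 from hX.lie Y, TensorProduct.tmul_zero, map_zero, zero_smul,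
    zero_add, add_zero, add_zero, map_smul]
  rfl

theorem oneForm_eq_sum (k : Mom) : oneForm k =
    k 0 0 • coframe 0 0 + k 0 1 • coframe 0 1 + k 1 0 • coframe 1 0 + k 1 1 • coframe 1 1 := by
  rw [← map_smul, ← map_smul, ← map_smul, ← map_smul, ← map_add, ← map_add, ← map_add]
  congr 1
  ext i j
  fin_cases i <;> fin_cases j <;> simp [Matrix.single]

/-- The differential is the bracket with the vielbein. -/
def symmetryFormD (k : Mom) : SymmetryForm →ₗ[ℂ] SymmetryForm := localSymmetry.br 0 k vielbein

theorem symmetryFormD_apply (k : Mom) (x : SymmetryForm) :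
    symmetryFormD k x = (wedge (oneForm k)).rTensor LocalSymmetry x - torsion x := by
  induction x using TensorProduct.induction_on with
  | zero => simp
  | add x y hx hy => rw [map_add, map_add, map_add, hx, hy]; abel
  | tmul ω Y =>
    rw [symmetryFormD, vielbein, map_add, map_sub, map_sub, LinearMap.add_apply,
      LinearMap.sub_apply, LinearMap.sub_apply, br_translation_tmul isTranslation_t11,
      br_translation_tmul isTranslation_t10, br_translation_tmul isTranslation_t01,
      br_translation_tmul isTranslation_t00, torsion_apply, LinearMap.rTensor_tmul,
      oneForm_eq_sum k]
    simp only [translate_apply, LieAction.anchor_tmul, map_add, map_smul, LinearMap.add_apply,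
      LinearMap.smul_apply, TensorProduct.add_tmul, ← TensorProduct.smul_tmul']
    simp only [Pi.single_apply, reduceCtorEq, if_true, if_false, zero_mul, one_mul, zero_sub,
      sub_zero, add_zero, zero_add]
    change _ = _ - (wedge (rotate Y _) ω ⊗ₜ _ - wedge (rotate Y _) ω ⊗ₜ _ -
      wedge (rotate Y _) ω ⊗ₜ _ + wedge (rotate Y _) ω ⊗ₜ _)
    module

theorem oneForm_mem (k : Mom) : oneForm k ∈ formAlgebra.gr 1 := by
  intro a ha
  cases a <;> first | rfl | exact absurd rfl ha

theorem vielbein_mem : vielbein ∈ formAlgebra.tensorGr LocalSymmetry 1 := by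
  exact add_mem (sub_mem (sub_mem (GradedCommAlgebra.tmul_mem (oneForm_mem _) _)
    (GradedCommAlgebra.tmul_mem (oneForm_mem _) _)) (GradedCommAlgebra.tmul_mem (oneForm_mem _) _))
    (GradedCommAlgebra.tmul_mem (oneForm_mem _) _)

theorem symmetryFormD_vielbein : symmetryFormD 0 vielbein = 0 := by
  rw [symmetryFormD_apply, map_zero, map_zero, LinearMap.rTensor_zero, LinearMap.zero_apply,
    vielbein]
  simp only [map_add, map_sub,
    torsion_tmul_translation isTranslation_t00, torsion_tmul_translation isTranslation_t01,
    torsion_tmul_translation isTranslation_t10, torsion_tmul_translation isTranslation_t11,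
    sub_zero, add_zero]

/-- The dgLa of forms with values in the infinitesimal symmetries. Its Maurer-Cartan equation says
that torsion and curvature vanish. -/
def symmetryForms : FiberDGLA SymmetryForm where
  gr := formAlgebra.tensorGr LocalSymmetry
  isInternal := formAlgebra.tensorGr_isInternal LocalSymmetry
  d := symmetryFormD
  br := localSymmetry.br
  d_mem k i x hx := by
    rw [add_comm]
    exact localSymmetry.br_mem 0 k 1 i _ vielbein_mem x hx
  br_mem := localSymmetry.br_mem
  d_d k x := by
    refine gradedInduction (formAlgebra.tensorGr_isInternal LocalSymmetry)
      (p := fun x => symmetryFormD k (symmetryFormD k x) = 0) x (fun i x hx => ?_) (by simp)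
      fun x y h h' => by rw [map_add, map_add, h, h', add_zero]
    have h := localSymmetry.br_jacobi 0 0 k 1 1 i _ vielbein_mem _ vielbein_mem x hx
    rw [show localSymmetry.br 0 0 vielbein vielbein = 0 from symmetryFormD_vielbein, map_zero,
      LinearMap.zero_apply, zero_add, zero_add, mul_one, Int.negOnePow_one, Units.neg_smul,
      one_smul] at h
    have h2 : (2 : ℂ) • symmetryFormD k (symmetryFormD k x) = 0 := by
      rw [two_smul]
      exact add_eq_zero_iff_eq_neg.2 h
    exact (smul_eq_zero.1 h2).resolve_left two_ne_zero
  antisymm := localSymmetry.br_antisymm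
  jacobi := localSymmetry.br_jacobi
  leibniz k l i x hx y := by
    refine gradedInduction (formAlgebra.tensorGr_isInternal LocalSymmetry)
      (p := fun y => symmetryFormD (k + l) (localSymmetry.br k l x y) =
        localSymmetry.br k l (symmetryFormD k x) y +
          i.negOnePow • localSymmetry.br k l x (symmetryFormD l y)) y (fun j y hy => ?_) (by simp)
      fun y y' h h' => by simp only [map_add, h, h', smul_add]; abel
    have h := localSymmetry.br_jacobi 0 k l 1 i j _ vielbein_mem x hx y hy
    rwa [zero_add, zero_add, one_mul] at h
  d_poly := localSymmetry.br_poly.at_zero vielbein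
  br_poly := localSymmetry.br_poly

/-- The form complex is acyclic for nonzero momenta: there is a vector whose pairing with the
momentum is one. -/
theorem exists_dual_momentum {k : Mom} (hk : k ≠ 0) :
    ∃ n : Mom, n 0 0 * k 1 1 - n 0 1 * k 1 0 - n 1 0 * k 0 1 + n 1 1 * k 0 0 = 1 := by
  by_contra! h
  refine hk (Matrix.ext fun i j => ?_)
  by_contra h0
  fin_cases i <;> fin_cases j
  · exact h !![0, 0; 0, (k 0 0)⁻¹] (by simpa using inv_mul_cancel₀ h0)
  · exact h !![0, 0; -(k 0 1)⁻¹, 0] (by simpa using inv_mul_cancel₀ h0)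
  · exact h !![0, -(k 1 0)⁻¹; 0, 0] (by simpa using inv_mul_cancel₀ h0)
  · exact h !![(k 1 1)⁻¹, 0; 0, 0] (by simpa using inv_mul_cancel₀ h0)

theorem contract_wedge_add {k n : Mom}
    (hn : n 0 0 * k 1 1 - n 0 1 * k 1 0 - n 1 0 * k 0 1 + n 1 1 * k 0 0 = 1) (ω : Form) :
    wedge (oneForm k) (contract n ω) + contract n (wedge (oneForm k) ω) = ω := by
  rw [contract_oneForm_wedge, hn, one_smul, add_sub_cancel]

/-- The torsion is nilpotent, so that the contraction of forms remains a contraction. -/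
theorem symmetryFormD_exact {k : Mom} (hk : k ≠ 0) (x : SymmetryForm)
    (hx : symmetryFormD k x = 0) : ∃ y, symmetryFormD k y = x := by
  obtain ⟨n, hn⟩ := exists_dual_momentum hk
  set K : SymmetryForm →ₗ[ℂ] SymmetryForm := (contract n).rTensor LocalSymmetry with hK
  have key : ∀ x, symmetryFormD k x = 0 → x = symmetryFormD k (K x) + torsion (K x) +
      K (torsion x) := by
    intro x hx
    have h1 : (wedge (oneForm k)).rTensor LocalSymmetry x = torsion x := by
      rw [symmetryFormD_apply, sub_eq_zero] at hx
      exact hx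
    have h2 : (wedge (oneForm k)).rTensor LocalSymmetry (K x) +
        K ((wedge (oneForm k)).rTensor LocalSymmetry x) = x := by
      rw [hK, ← LinearMap.rTensor_comp_apply, ← LinearMap.rTensor_comp_apply, ← LinearMap.add_apply,
        ← LinearMap.rTensor_add]
      conv_rhs => rw [← LinearMap.id_apply (R := ℂ) x, ← LinearMap.rTensor_id]
      congr 2
      exact LinearMap.ext (contract_wedge_add hn)
    rw [symmetryFormD_apply, ← h1]
    conv_lhs => rw [← h2]
    abel
  set y := torsion (K x) + K (torsion x) with hy
  have hxy : x = symmetryFormD k (K x) + y := by rw [hy, ← add_assoc]; exact key x hx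
  have hdy : symmetryFormD k y = 0 := by
    have := congrArg (symmetryFormD k) hxy
    rw [hx, map_add, show symmetryFormD k (symmetryFormD k (K x)) = 0 from
      symmetryForms.d_d k _, zero_add] at this
    exact this.symm
  have hKy : torsion (K y) = 0 := by
    rw [hy, map_add, map_add, hK, torsion_rTensor_torsion, zero_add, ← LinearMap.rTensor_comp_apply,
      torsion_rTensor_torsion]
  have hty : torsion y = 0 := by
    rw [hy, map_add, torsion_torsion, hK, torsion_rTensor_torsion, add_zero]
  have hy' := key y hdy
  rw [hKy, hty, map_zero, add_zero, add_zero] at hy'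
  exact ⟨K x + K y, by rw [map_add, ← hy', ← hxy]⟩

end TreeAmp

/-! ### Embeddings of the Lorentz equivariant complexes into forms -/

namespace TreeAmp

open scoped TensorProduct

/-- The embedding of `Γ_1` into the self-dual two-forms, the three-forms and the volume forms. -/
def psiPlus : GammaSpace 2 ℂ →ₗ[ℂ] Form where
  toFun z
    | .s0 => z (.inl 0)
    | .s1 => z (.inl 1)
    | .s2 => z (.inl 2)
    | .j00 => z (.inr (.inl (0, 0)))
    | .j01 => z (.inr (.inl (1, 0)))
    | .j10 => z (.inr (.inl (0, 1)))
    | .j11 => z (.inr (.inl (1, 1)))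
    | .v => -z (.inr (.inr 0))
    | _ => 0
  map_add' x y := by funext a; cases a <;> simp [add_comm]
  map_smul' c x := by funext a; cases a <;> simp

/-- The embedding of `Γ_{-1}` into the anti-self-dual two-forms, the three-forms and the volume
forms. -/
def psiMinus : GammaSpace 2 ℂ →ₗ[ℂ] Form where
  toFun z
    | .r0 => z (.inl 0)
    | .r1 => z (.inl 1)
    | .r2 => z (.inl 2)
    | .j00 => -z (.inr (.inl (0, 0)))
    | .j01 => -z (.inr (.inl (0, 1)))
    | .j10 => -z (.inr (.inl (1, 0)))
    | .j11 => -z (.inr (.inl (1, 1)))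
    | .v => z (.inr (.inr 0))
    | _ => 0
  map_add' x y := by funext a; cases a <;> simp [add_comm]
  map_smul' c x := by funext a; cases a <;> simp

/-- A left inverse of `psiPlus`. -/
def chiPlus : Form →ₗ[ℂ] GammaSpace 2 ℂ where
  toFun x
    | .inl i => ![x .s0, x .s1, x .s2] i
    | .inr (.inl (β, i)) => !![x .j00, x .j10; x .j01, x .j11] β i
    | .inr (.inr _) => -x .v
  map_add' x y := by
    funext a
    rcases a with a | ⟨β, a⟩ | a
    · fin_cases a <;> rfl
    · fin_cases β <;> fin_cases a <;> rfl
    · simp [add_comm]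
  map_smul' c x := by
    funext a
    rcases a with a | ⟨β, a⟩ | a
    · fin_cases a <;> rfl
    · fin_cases β <;> fin_cases a <;> rfl
    · simp

/-- A left inverse of `psiMinus`. -/
def chiMinus : Form →ₗ[ℂ] GammaSpace 2 ℂ where
  toFun x
    | .inl i => ![x .r0, x .r1, x .r2] i
    | .inr (.inl (β, i)) => -!![x .j00, x .j01; x .j10, x .j11] β i
    | .inr (.inr _) => x .v
  map_add' x y := by
    funext a
    rcases a with a | ⟨β, a⟩ | a
    · fin_cases a <;> rfl
    · fin_cases β <;> fin_cases a <;> simp [add_comm]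
    · rfl
  map_smul' c x := by
    funext a
    rcases a with a | ⟨β, a⟩ | a
    · fin_cases a <;> rfl
    · fin_cases β <;> fin_cases a <;> simp
    · rfl

theorem chiPlus_psiPlus (z : GammaSpace 2 ℂ) : chiPlus (psiPlus z) = z := by
  funext a
  rcases a with a | ⟨β, a⟩ | a
  · fin_cases a <;> rfl
  · fin_cases β <;> fin_cases a <;> rfl
  · fin_cases a
    exact neg_neg _

theorem chiMinus_psiMinus (z : GammaSpace 2 ℂ) : chiMinus (psiMinus z) = z := by
  funext a
  rcases a with a | ⟨β, a⟩ | a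
  · fin_cases a <;> rfl
  · fin_cases β <;> fin_cases a <;> exact neg_neg _
  · fin_cases a
    rfl

/-- The entries of the matrices in the differential of the Lorentz equivariant complexes. -/
theorem gamma_matrix_entries (k : Mom) :
    ((k * eps) 0 0 = -k 0 1 ∧ (k * eps) 0 1 = k 0 0 ∧ (k * eps) 1 0 = -k 1 1 ∧
      (k * eps) 1 1 = k 1 0) ∧
    ((eps * k * eps) 0 0 = -k 1 1 ∧ (eps * k * eps) 0 1 = k 1 0 ∧ (eps * k * eps) 1 0 = k 0 1 ∧
      (eps * k * eps) 1 1 = -k 0 0) := by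
  refine ⟨⟨?_, ?_, ?_, ?_⟩, ?_, ?_, ?_, ?_⟩ <;> 
    simp [eps, Matrix.mul_apply, Matrix.vecMul, dotProduct, Fin.sum_univ_two]

/-- The differential of `Γ_h` in components. -/
theorem pairD_one {N : ℕ} (k : Mom) (z : PairSpace N ℂ) :
    (∀ i, pairD N ℂ k z 1 (.inl i) = 0) ∧
    (∀ j : Fin N, pairD N ℂ k z 1 (.inr (.inl (0, j))) =
      -k 1 0 * z 1 (.inl ⟨j, by omega⟩) + k 0 0 * z 1 (.inl ⟨j + 1, by omega⟩)) ∧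
    (∀ j : Fin N, pairD N ℂ k z 1 (.inr (.inl (1, j))) =
      -k 1 1 * z 1 (.inl ⟨j, by omega⟩) + k 0 1 * z 1 (.inl ⟨j + 1, by omega⟩)) ∧
    (∀ j : Fin (N - 1), pairD N ℂ k z 1 (.inr (.inr j)) =
      -k 1 1 * z 1 (.inr (.inl (0, ⟨j, by omega⟩))) + k 0 1 * z 1 (.inr (.inl (0, ⟨j + 1, by omega⟩)))
      + k 1 0 * z 1 (.inr (.inl (1, ⟨j, by omega⟩))) -
        k 0 0 * z 1 (.inr (.inl (1, ⟨j + 1, by omega⟩)))) := by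
  obtain ⟨⟨a0, a1, a2, a3⟩, -⟩ := gamma_matrix_entries kᵀ
  obtain ⟨-, b0, b1, b2, b3⟩ := gamma_matrix_entries k
  refine ⟨fun i => pairD_deg_one N ℂ k z 1 i, fun j => ?_, fun j => ?_, fun j => ?_⟩
  · rw [pairD_deg_two, signedMom_neg_one, a0, a1]
    rfl
  · rw [pairD_deg_two, signedMom_neg_one, a2, a3]
    rfl
  · rw [pairD_deg_three, Fin.sum_univ_two, signedMom_one, b0, b1, b2, b3]
    simp only [smul_eq_mul]
    ring

/-- The differential of `Γ_{-h}` in components. -/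
theorem pairD_neg_one {N : ℕ} (k : Mom) (z : PairSpace N ℂ) :
    (∀ i, pairD N ℂ k z (-1) (.inl i) = 0) ∧
    (∀ j : Fin N, pairD N ℂ k z (-1) (.inr (.inl (0, j))) =
      -k 0 1 * z (-1) (.inl ⟨j, by omega⟩) + k 0 0 * z (-1) (.inl ⟨j + 1, by omega⟩)) ∧
    (∀ j : Fin N, pairD N ℂ k z (-1) (.inr (.inl (1, j))) =
      -k 1 1 * z (-1) (.inl ⟨j, by omega⟩) + k 1 0 * z (-1) (.inl ⟨j + 1, by omega⟩)) ∧
    (∀ j : Fin (N - 1), pairD N ℂ k z (-1) (.inr (.inr j)) =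
      -k 1 1 * z (-1) (.inr (.inl (0, ⟨j, by omega⟩))) +
        k 1 0 * z (-1) (.inr (.inl (0, ⟨j + 1, by omega⟩)))
      + k 0 1 * z (-1) (.inr (.inl (1, ⟨j, by omega⟩))) -
        k 0 0 * z (-1) (.inr (.inl (1, ⟨j + 1, by omega⟩)))) := by
  obtain ⟨⟨a0, a1, a2, a3⟩, -⟩ := gamma_matrix_entries k
  obtain ⟨-, b0, b1, b2, b3⟩ := gamma_matrix_entries kᵀ
  refine ⟨fun i => pairD_deg_one N ℂ k z (-1) i, fun j => ?_, fun j => ?_, fun j => ?_⟩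
  · rw [pairD_deg_two, neg_neg, signedMom_one, a0, a1]
    rfl
  · rw [pairD_deg_two, neg_neg, signedMom_one, a2, a3]
    rfl
  · rw [pairD_deg_three, Fin.sum_univ_two, signedMom_neg_one, b0, b1, b2, b3]
    simp only [smul_eq_mul, Matrix.transpose_apply]
    ring

theorem wedge_psiPlus (k : Mom) (z : PairSpace 2 ℂ) :
    wedge (oneForm k) (psiPlus (z 1)) = -psiPlus (pairD 2 ℂ k z 1) := by
  obtain ⟨d1, d2, d3, d4⟩ := pairD_one k z
  funext a
  cases a <;> simp [wedge_apply, wedgeFun, oneForm, psiPlus, d1, d2, d3, d4]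
  ring

theorem wedge_psiMinus (k : Mom) (z : PairSpace 2 ℂ) :
    wedge (oneForm k) (psiMinus (z (-1))) = -psiMinus (pairD 2 ℂ k z (-1)) := by
  obtain ⟨d1, d2, d3, d4⟩ := pairD_neg_one k z
  funext a
  cases a <;> simp [wedge_apply, wedgeFun, oneForm, psiMinus, d1, d2, d3, d4]
  ring

theorem psiPlus_mem {i : ℤ} {z : GammaSpace 2 ℂ} (hz : z ∈ coordGr gammaDeg i) :
    psiPlus z ∈ coordGr formDeg (i + 1) := by
  intro a ha
  cases a <;> first
    | rfl
    | exact hz _ fun h => ha (by rw [← h]; rfl)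
    | exact neg_eq_zero.2 (hz _ fun h => ha (by rw [← h]; rfl))

theorem psiMinus_mem {i : ℤ} {z : GammaSpace 2 ℂ} (hz : z ∈ coordGr gammaDeg i) :
    psiMinus z ∈ coordGr formDeg (i + 1) := by
  intro a ha
  cases a <;> first
    | rfl
    | exact hz _ fun h => ha (by rw [← h]; rfl)
    | exact neg_eq_zero.2 (hz _ fun h => ha (by rw [← h]; rfl))

theorem chiPlus_mem {i : ℤ} {x : Form} (hx : x ∈ coordGr formDeg (i + 1)) :
    chiPlus x ∈ coordGr gammaDeg i := by
  intro a ha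
  rcases a with a | ⟨β, a⟩ | a
  · fin_cases a <;> exact hx _ fun h => ha (add_right_cancel (b := 1) h)
  · fin_cases β <;> fin_cases a <;> exact hx _ fun h => ha (add_right_cancel (b := 1) h)
  · exact neg_eq_zero.2 (hx _ fun h => ha (add_right_cancel (b := 1) h))

theorem chiMinus_mem {i : ℤ} {x : Form} (hx : x ∈ coordGr formDeg (i + 1)) :
    chiMinus x ∈ coordGr gammaDeg i := by
  intro a ha
  rcases a with a | ⟨β, a⟩ | a
  · fin_cases a <;> exact hx _ fun h => ha (add_right_cancel (b := 1) h)
  · fin_cases β <;> fin_cases a <;>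
      exact neg_eq_zero.2 (hx _ fun h => ha (add_right_cancel (b := 1) h))
  · exact hx _ fun h => ha (add_right_cancel (b := 1) h)

end TreeAmp

/-! ### The gravitational embedding -/

namespace TreeAmp

open scoped TensorProduct

/-- The component of a form with values in a coordinate space. -/
def component {Λ : Type} [AddCommGroup Λ] [Module ℂ Λ] {ι : Type} (a : ι) :
    Λ ⊗[ℂ] (ι → ℂ) →ₗ[ℂ] Λ :=
  (TensorProduct.rid ℂ Λ).toLinearMap ∘ₗ (LinearMap.proj a).lTensor Λ

section Component

variable {Λ Λ' : Type} [AddCommGroup Λ] [Module ℂ Λ] [AddCommGroup Λ'] [Module ℂ Λ'] {ι : Type}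

theorem component_tmul (a : ι) (ω : Λ) (X : ι → ℂ) : component a (ω ⊗ₜ X) = X a • ω := rfl

theorem sum_component [Fintype ι] [DecidableEq ι] (y : Λ ⊗[ℂ] (ι → ℂ)) :
    ∑ a, component a y ⊗ₜ[ℂ] (Pi.single a 1 : ι → ℂ) = y := by
  induction y using TensorProduct.induction_on with
  | zero => simp
  | tmul ω X =>
    simp only [component_tmul, TensorProduct.smul_tmul, ← TensorProduct.tmul_sum]
    rw [← pi_eq_sum_univ' X]
  | add x y hx hy =>
    conv_rhs => rw [← hx, ← hy]
    simp only [map_add, TensorProduct.add_tmul, Finset.sum_add_distrib]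

theorem component_rTensor (f : Λ →ₗ[ℂ] Λ') (a : ι) (y : Λ ⊗[ℂ] (ι → ℂ)) :
    component a (f.rTensor (ι → ℂ) y) = f (component a y) := by
  induction y using TensorProduct.induction_on with
  | zero => simp
  | tmul ω X => rw [LinearMap.rTensor_tmul, component_tmul, component_tmul, map_smul]
  | add x y hx hy => simp only [map_add, hx, hy]

theorem component_mem {G : GradedCommAlgebra Λ} {i : ℤ} {x : Λ ⊗[ℂ] (ι → ℂ)}
    (hx : x ∈ G.tensorGr (ι → ℂ) i) (a : ι) : component a x ∈ G.gr i := by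
  refine GradedCommAlgebra.tensorGr_induction (p := fun x => component a x ∈ G.gr i) hx (by simp)
    (fun ω hω X => ?_) fun x y h h' => by rw [map_add]; exact add_mem h h'
  rw [component_tmul]
  exact Submodule.smul_mem _ _ hω

end Component

/-- The projection onto the rotations `u`. -/
def projPlus : LocalSymmetry →ₗ[ℂ] LocalSymmetry where
  toFun X
    | .u0 => X .u0
    | .u1 => X .u1
    | .u2 => X .u2
    | _ => 0
  map_add' X Y := by funext a; cases a <;> simp
  map_smul' c X := by funext a; cases a <;> simp

/-- The projection onto the rotations `w`. -/
def projMinus : LocalSymmetry →ₗ[ℂ] LocalSymmetry where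
  toFun X
    | .w0 => X .w0
    | .w1 => X .w1
    | .w2 => X .w2
    | _ => 0
  map_add' X Y := by funext a; cases a <;> simp
  map_smul' c X := by funext a; cases a <;> simp

theorem lie_projPlus (X Y : LocalSymmetry) :
    symmetryLie X (projPlus Y) = projPlus (symmetryLie X Y) := by
  funext a
  cases a <;> simp [symmetryLie_apply, symmetryLieFun, projPlus]

theorem lie_projMinus (X Y : LocalSymmetry) :
    symmetryLie X (projMinus Y) = projMinus (symmetryLie X Y) := by
  funext a
  cases a <;> simp [symmetryLie_apply, symmetryLieFun, projMinus]

theorem translate_projPlus (X : LocalSymmetry) (k : Mom) : translate (projPlus X) k = 0 := by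
  simp [translate_apply, projPlus]

theorem translate_projMinus (X : LocalSymmetry) (k : Mom) : translate (projMinus X) k = 0 := by
  simp [translate_apply, projMinus]

/-- The components of the splitting `S^m → S^(m-2) ⊗ S^2` of the symmetric tensors in `Γ_{±2}`. -/
def shift (c : Fin 3) : GammaSpace 4 ℂ →ₗ[ℂ] GammaSpace 2 ℂ where
  toFun z
    | .inl i => z (.inl ⟨i + c, by omega⟩)
    | .inr (.inl (β, i)) => z (.inr (.inl (β, ⟨i + c, by omega⟩)))
    | .inr (.inr i) => z (.inr (.inr ⟨i + c, by omega⟩))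
  map_add' x y := by funext a; rcases a with a | ⟨β, a⟩ | a <;> rfl
  map_smul' c x := by funext a; rcases a with a | ⟨β, a⟩ | a <;> rfl

/-- The embedding of `Γ_2`: the symmetric tensors are split, and a factor `S^2` is viewed as a
rotation. -/
def gravityPlus : GammaSpace 4 ℂ →ₗ[ℂ] SymmetryForm where
  toFun z := psiPlus (shift 0 z) ⊗ₜ symmetryBasis .u0 + psiPlus (shift 1 z) ⊗ₜ symmetryBasis .u1 +
    psiPlus (shift 2 z) ⊗ₜ symmetryBasis .u2
  map_add' x y := by simp only [map_add, TensorProduct.add_tmul]; abel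
  map_smul' c x := by simp only [map_smul, ← TensorProduct.smul_tmul', smul_add, RingHom.id_apply]

/-- The embedding of `Γ_{-2}`. -/
def gravityMinus : GammaSpace 4 ℂ →ₗ[ℂ] SymmetryForm where
  toFun z := psiMinus (shift 0 z) ⊗ₜ symmetryBasis .w0 + psiMinus (shift 1 z) ⊗ₜ symmetryBasis .w1 +
    psiMinus (shift 2 z) ⊗ₜ symmetryBasis .w2
  map_add' x y := by simp only [map_add, TensorProduct.add_tmul]; abel
  map_smul' c x := by simp only [map_smul, ← TensorProduct.smul_tmul', smul_add, RingHom.id_apply]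

theorem gravityPlus_apply (z : GammaSpace 4 ℂ) : gravityPlus z =
    psiPlus (shift 0 z) ⊗ₜ symmetryBasis .u0 + psiPlus (shift 1 z) ⊗ₜ symmetryBasis .u1 +
      psiPlus (shift 2 z) ⊗ₜ symmetryBasis .u2 := rfl

theorem gravityMinus_apply (z : GammaSpace 4 ℂ) : gravityMinus z =
    psiMinus (shift 0 z) ⊗ₜ symmetryBasis .w0 + psiMinus (shift 1 z) ⊗ₜ symmetryBasis .w1 +
      psiMinus (shift 2 z) ⊗ₜ symmetryBasis .w2 := rfl

theorem gravityPlus_bianchi (z : GammaSpace 4 ℂ) :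
    gravityPlus z ∈ localSymmetry.bianchi projPlus := by
  rw [LieAction.mem_bianchi]
  have hp : ∀ a, (a = .u0 ∨ a = .u1 ∨ a = .u2) →
      projPlus (symmetryBasis a) = symmetryBasis a := by
    rintro a (rfl | rfl | rfl) <;> funext b <;> cases b <;> rfl
  refine ⟨?_, fun ω => ?_⟩
  · rw [gravityPlus_apply, map_add, map_add, LinearMap.lTensor_tmul, LinearMap.lTensor_tmul,
      LinearMap.lTensor_tmul, hp _ (by simp), hp _ (by simp), hp _ (by simp)]
  · rw [gravityPlus_apply, map_add, map_add, LieAction.anchor_tmul, LieAction.anchor_tmul,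
      LieAction.anchor_tmul]
    change wedge (rotate _ _) _ + wedge (rotate _ _) _ + wedge (rotate _ _) _ = 0
    funext a
    cases a <;> simp [wedge_apply, wedgeFun, rotate_apply, rotateFun, psiPlus, shift]
    ring

theorem gravityMinus_bianchi (z : GammaSpace 4 ℂ) :
    gravityMinus z ∈ localSymmetry.bianchi projMinus := by
  rw [LieAction.mem_bianchi]
  have hp : ∀ a, (a = .w0 ∨ a = .w1 ∨ a = .w2) →
      projMinus (symmetryBasis a) = symmetryBasis a := by
    rintro a (rfl | rfl | rfl) <;> funext b <;> cases b <;> rfl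
  refine ⟨?_, fun ω => ?_⟩
  · rw [gravityMinus_apply, map_add, map_add, LinearMap.lTensor_tmul, LinearMap.lTensor_tmul,
      LinearMap.lTensor_tmul, hp _ (by simp), hp _ (by simp), hp _ (by simp)]
  · rw [gravityMinus_apply, map_add, map_add, LieAction.anchor_tmul, LieAction.anchor_tmul,
      LieAction.anchor_tmul]
    change wedge (rotate _ _) _ + wedge (rotate _ _) _ + wedge (rotate _ _) _ = 0
    funext a
    cases a <;> simp [wedge_apply, wedgeFun, rotate_apply, rotateFun, psiMinus, shift]
    ring

theorem form_eq_zero_iff {x : Form} : x = 0 ↔ (x .c = 0 ∧ x .m00 = 0 ∧ x .m01 = 0 ∧ x .m10 = 0 ∧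
    x .m11 = 0 ∧ x .s0 = 0 ∧ x .s1 = 0 ∧ x .s2 = 0) ∧ (x .r0 = 0 ∧ x .r1 = 0 ∧ x .r2 = 0 ∧
    x .j00 = 0 ∧ x .j01 = 0 ∧ x .j10 = 0 ∧ x .j11 = 0 ∧ x .v = 0) := by
  refine ⟨fun h => by subst h; simp, fun h => ?_⟩
  funext a
  cases a <;> simp [h]

/-- The left inverse of `gravityPlus`, in terms of the three components. -/
def chiGravityPlus : (Fin 3 → Form) →ₗ[ℂ] GammaSpace 4 ℂ where
  toFun F
    | .inl i => ![F 0 .s0, F 0 .s1, F 0 .s2, F 1 .s2, F 2 .s2] i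
    | .inr (.inl (β, i)) =>
      !![F 0 .j00, F 0 .j10, F 1 .j10, F 2 .j10; F 0 .j01, F 0 .j11, F 1 .j11, F 2 .j11] β i
    | .inr (.inr i) => -F i .v
  map_add' x y := by
    funext a
    rcases a with a | ⟨β, a⟩ | a
    · fin_cases a <;> rfl
    · fin_cases β <;> fin_cases a <;> rfl
    · simp [add_comm]
  map_smul' c x := by
    funext a
    rcases a with a | ⟨β, a⟩ | a
    · fin_cases a <;> rfl
    · fin_cases β <;> fin_cases a <;> rfl
    · simp

/-- The left inverse of `gravityMinus`, in terms of the three components. -/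
def chiGravityMinus : (Fin 3 → Form) →ₗ[ℂ] GammaSpace 4 ℂ where
  toFun F
    | .inl i => ![F 0 .r0, F 0 .r1, F 0 .r2, F 1 .r2, F 2 .r2] i
    | .inr (.inl (β, i)) =>
      -!![F 0 .j00, F 0 .j01, F 1 .j01, F 2 .j01; F 0 .j10, F 0 .j11, F 1 .j11, F 2 .j11] β i
    | .inr (.inr i) => F i .v
  map_add' x y := by
    funext a
    rcases a with a | ⟨β, a⟩ | a
    · fin_cases a <;> rfl
    · fin_cases β <;> fin_cases a <;> simp [add_comm]
    · rfl
  map_smul' c x := by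
    funext a
    rcases a with a | ⟨β, a⟩ | a
    · fin_cases a <;> rfl
    · fin_cases β <;> fin_cases a <;> simp
    · rfl

theorem eq_psiPlus_of_bianchi (F : Fin 3 → Form)
    (H : ∀ ω, wedge (rotate (symmetryBasis .u0) ω) (F 0) +
      wedge (rotate (symmetryBasis .u1) ω) (F 1) + wedge (rotate (symmetryBasis .u2) ω) (F 2) = 0)
    (c : Fin 3) : F c = psiPlus (shift c (chiGravityPlus F)) := by
  have h00 := H (oneForm (Matrix.single 0 0 1))
  have h01 := H (oneForm (Matrix.single 0 1 1))
  have h10 := H (oneForm (Matrix.single 1 0 1))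
  have h11 := H (oneForm (Matrix.single 1 1 1))
  rw [form_eq_zero_iff] at h00 h01 h10 h11
  simp [wedge_apply, wedgeFun, rotate_apply, rotateFun, oneForm, Matrix.single] at h00 h01 h10 h11
  fin_cases c <;> funext a <;> cases a <;> simp [psiPlus, shift, chiGravityPlus] <;> grind

theorem eq_psiMinus_of_bianchi (F : Fin 3 → Form)
    (H : ∀ ω, wedge (rotate (symmetryBasis .w0) ω) (F 0) +
      wedge (rotate (symmetryBasis .w1) ω) (F 1) + wedge (rotate (symmetryBasis .w2) ω) (F 2) = 0)
    (c : Fin 3) : F c = psiMinus (shift c (chiGravityMinus F)) := by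
  have h00 := H (oneForm (Matrix.single 0 0 1))
  have h01 := H (oneForm (Matrix.single 0 1 1))
  have h10 := H (oneForm (Matrix.single 1 0 1))
  have h11 := H (oneForm (Matrix.single 1 1 1))
  rw [form_eq_zero_iff] at h00 h01 h10 h11
  simp [wedge_apply, wedgeFun, rotate_apply, rotateFun, oneForm, Matrix.single] at h00 h01 h10 h11
  fin_cases c <;> funext a <;> cases a <;> simp [psiMinus, shift, chiGravityMinus] <;> grind

end TreeAmp

/-! ### The dgLa of general relativity -/

namespace TreeAmp

open scoped TensorProduct

theorem chiGravityPlus_psiPlus (z : GammaSpace 4 ℂ) :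
    chiGravityPlus (fun c => psiPlus (shift c z)) = z := by
  funext a
  rcases a with a | ⟨β, a⟩ | a
  · fin_cases a <;> rfl
  · fin_cases β <;> fin_cases a <;> rfl
  · fin_cases a <;> exact neg_neg _

theorem chiGravityMinus_psiMinus (z : GammaSpace 4 ℂ) :
    chiGravityMinus (fun c => psiMinus (shift c z)) = z := by
  funext a
  rcases a with a | ⟨β, a⟩ | a
  · fin_cases a <;> rfl
  · fin_cases β <;> fin_cases a <;> exact neg_neg _
  · fin_cases a <;> rfl

theorem chiGravityPlus_mem {i : ℤ} {F : Fin 3 → Form} (hF : ∀ c, F c ∈ coordGr formDeg (i + 1)) :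
    chiGravityPlus F ∈ coordGr gammaDeg i := by
  intro a ha
  rcases a with a | ⟨β, a⟩ | a
  · fin_cases a <;> exact hF _ _ fun h => ha (add_right_cancel (b := 1) h)
  · fin_cases β <;> fin_cases a <;> exact hF _ _ fun h => ha (add_right_cancel (b := 1) h)
  · exact neg_eq_zero.2 (hF _ _ fun h => ha (add_right_cancel (b := 1) h))

theorem chiGravityMinus_mem {i : ℤ} {F : Fin 3 → Form} (hF : ∀ c, F c ∈ coordGr formDeg (i + 1)) :
    chiGravityMinus F ∈ coordGr gammaDeg i := by
  intro a ha
  rcases a with a | ⟨β, a⟩ | a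
  · fin_cases a <;> exact hF _ _ fun h => ha (add_right_cancel (b := 1) h)
  · fin_cases β <;> fin_cases a <;>
      exact neg_eq_zero.2 (hF _ _ fun h => ha (add_right_cancel (b := 1) h))
  · exact hF _ _ fun h => ha (add_right_cancel (b := 1) h)

theorem shift_mem {i : ℤ} {z : GammaSpace 4 ℂ} (hz : z ∈ coordGr gammaDeg i) (c : Fin 3) :
    shift c z ∈ coordGr gammaDeg i := by
  intro a ha
  rcases a with a | ⟨β, a⟩ | a <;> exact hz _ ha

theorem pairD_shift (k : Mom) (z : PairSpace 4 ℂ) (c : Fin 3) (σ : ℤˣ) :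
    pairD 2 ℂ k (fun σ => shift c (z σ)) σ = shift c (pairD 4 ℂ k z σ) := by
  have e (n : ℕ) : n + 1 + (c : ℕ) = n + c + 1 := by omega
  rcases Int.units_eq_one_or σ with rfl | rfl
  · obtain ⟨a1, a2, a3, a4⟩ := pairD_one k fun σ => shift c (z σ)
    obtain ⟨b1, b2, b3, b4⟩ := pairD_one k z
    funext a
    rcases a with a | ⟨β, a⟩ | a
    · rw [a1]
      exact (b1 _).symm
    · fin_cases β
      · refine (a2 a).trans (Eq.trans ?_ (b2 _).symm)
        simp only [shift, LinearMap.coe_mk, AddHom.coe_mk, e]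
      · refine (a3 a).trans (Eq.trans ?_ (b3 _).symm)
        simp only [shift, LinearMap.coe_mk, AddHom.coe_mk, e]
    · refine (a4 a).trans (Eq.trans ?_ (b4 _).symm)
      simp only [shift, LinearMap.coe_mk, AddHom.coe_mk, e]
  · obtain ⟨a1, a2, a3, a4⟩ := pairD_neg_one k fun σ => shift c (z σ)
    obtain ⟨b1, b2, b3, b4⟩ := pairD_neg_one k z
    funext a
    rcases a with a | ⟨β, a⟩ | a
    · rw [a1]
      exact (b1 _).symm
    · fin_cases β
      · refine (a2 a).trans (Eq.trans ?_ (b2 _).symm)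
        simp only [shift, LinearMap.coe_mk, AddHom.coe_mk, e]
      · refine (a3 a).trans (Eq.trans ?_ (b3 _).symm)
        simp only [shift, LinearMap.coe_mk, AddHom.coe_mk, e]
    · refine (a4 a).trans (Eq.trans ?_ (b4 _).symm)
      simp only [shift, LinearMap.coe_mk, AddHom.coe_mk, e]

/-- The basis elements of the first rotation algebra. -/
def plusIdx : Fin 3 → LieIdx := ![.u0, .u1, .u2]

/-- The basis elements of the second rotation algebra. -/
def minusIdx : Fin 3 → LieIdx := ![.w0, .w1, .w2]

/-- The embedding of `Γ_{-2} ⊕ Γ_2`. -/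
def gravityPsi : PairSpace 4 ℂ →ₗ[ℂ] SymmetryForm :=
  gravityPlus ∘ₗ LinearMap.proj 1 + gravityMinus ∘ₗ LinearMap.proj (-1)

/-- The left inverse of the embedding of `Γ_{-2} ⊕ Γ_2`. -/
def gravityChi : SymmetryForm →ₗ[ℂ] PairSpace 4 ℂ :=
  LinearMap.pi fun σ => if σ = 1 then
    chiGravityPlus ∘ₗ LinearMap.pi fun c => component (plusIdx c)
  else chiGravityMinus ∘ₗ LinearMap.pi fun c => component (minusIdx c)

theorem gravityPsi_apply (z : PairSpace 4 ℂ) :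
    gravityPsi z = gravityPlus (z 1) + gravityMinus (z (-1)) := rfl

theorem gravityChi_one (x : SymmetryForm) :
    gravityChi x 1 = chiGravityPlus fun c => component (plusIdx c) x := rfl

theorem gravityChi_neg_one (x : SymmetryForm) :
    gravityChi x (-1) = chiGravityMinus fun c => component (minusIdx c) x := rfl

theorem component_gravityPsi_plus (z : PairSpace 4 ℂ) (c : Fin 3) :
    component (plusIdx c) (gravityPsi z) = psiPlus (shift c (z 1)) := by
  fin_cases c <;>
    simp [gravityPsi_apply, gravityPlus_apply, gravityMinus_apply, component_tmul, plusIdx]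

theorem component_gravityPsi_minus (z : PairSpace 4 ℂ) (c : Fin 3) :
    component (minusIdx c) (gravityPsi z) = psiMinus (shift c (z (-1))) := by
  fin_cases c <;>
    simp [gravityPsi_apply, gravityPlus_apply, gravityMinus_apply, component_tmul, minusIdx]

theorem gravityChi_gravityPsi (z : PairSpace 4 ℂ) : gravityChi (gravityPsi z) = z := by
  funext σ
  rcases Int.units_eq_one_or σ with rfl | rfl
  · rw [gravityChi_one]
    simp only [component_gravityPsi_plus]
    exact chiGravityPlus_psiPlus _
  · rw [gravityChi_neg_one]
    simp only [component_gravityPsi_minus]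
    exact chiGravityMinus_psiMinus _

theorem sum_lieIdx {M : Type*} [AddCommMonoid M] (f : LieIdx → M) : ∑ a, f a =
    f .t00 + (f .t01 + (f .t10 + (f .t11 + (f .u0 + (f .u1 + (f .u2 + (f .w0 + (f .w1 + f .w2))))))))
    := by
  rw [show (Finset.univ : Finset LieIdx) =
    {.t00, .t01, .t10, .t11, .u0, .u1, .u2, .w0, .w1, .w2} from rfl]
  simp

theorem component_eq_zero {π : LocalSymmetry →ₗ[ℂ] LocalSymmetry} {y : SymmetryForm} {a : LieIdx}
    (hy : π.lTensor Form y = y) (ha : ∀ X, π X a = 0) : component a y = 0 := by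
  rw [← hy]
  clear hy
  induction y using TensorProduct.induction_on with
  | zero => simp
  | tmul ω X => rw [LinearMap.lTensor_tmul, component_tmul, ha, zero_smul]
  | add x y hx hy => rw [map_add, map_add, hx, hy, add_zero]

/-- The solutions of the Bianchi identity of self-dual type are the symmetric spinors. -/
theorem eq_gravityPlus {y : SymmetryForm} (hy : y ∈ localSymmetry.bianchi projPlus) :
    ∃ z, y = gravityPlus z := by
  rw [LieAction.mem_bianchi] at hy
  obtain ⟨h1, h2⟩ := hy
  have h3 : y = component .u0 y ⊗ₜ symmetryBasis .u0 + component .u1 y ⊗ₜ symmetryBasis .u1 +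
      component .u2 y ⊗ₜ symmetryBasis .u2 := by
    conv_lhs => rw [← sum_component y, sum_lieIdx]
    rw [component_eq_zero (a := .t00) h1 fun X => rfl, component_eq_zero (a := .t01) h1 fun X => rfl,
      component_eq_zero (a := .t10) h1 fun X => rfl, component_eq_zero (a := .t11) h1 fun X => rfl,
      component_eq_zero (a := .w0) h1 fun X => rfl, component_eq_zero (a := .w1) h1 fun X => rfl,
      component_eq_zero (a := .w2) h1 fun X => rfl]
    simp only [TensorProduct.zero_tmul, zero_add, add_zero, add_assoc]
  have h4 := eq_psiPlus_of_bianchi ![component .u0 y, component .u1 y, component .u2 y] fun ω => by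
    have h5 := h2 ω
    rw [h3, map_add, map_add] at h5
    exact h5
  refine ⟨chiGravityPlus ![component .u0 y, component .u1 y, component .u2 y], h3.trans ?_⟩
  rw [gravityPlus_apply, ← h4, ← h4, ← h4]
  rfl

/-- The solutions of the Bianchi identity of anti-self-dual type are the symmetric spinors. -/
theorem eq_gravityMinus {y : SymmetryForm} (hy : y ∈ localSymmetry.bianchi projMinus) :
    ∃ z, y = gravityMinus z := by
  rw [LieAction.mem_bianchi] at hy
  obtain ⟨h1, h2⟩ := hy
  have h3 : y = component .w0 y ⊗ₜ symmetryBasis .w0 + component .w1 y ⊗ₜ symmetryBasis .w1 +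
      component .w2 y ⊗ₜ symmetryBasis .w2 := by
    conv_lhs => rw [← sum_component y, sum_lieIdx]
    rw [component_eq_zero (a := .t00) h1 fun X => rfl, component_eq_zero (a := .t01) h1 fun X => rfl,
      component_eq_zero (a := .t10) h1 fun X => rfl, component_eq_zero (a := .t11) h1 fun X => rfl,
      component_eq_zero (a := .u0) h1 fun X => rfl, component_eq_zero (a := .u1) h1 fun X => rfl,
      component_eq_zero (a := .u2) h1 fun X => rfl]
    simp only [TensorProduct.zero_tmul, zero_add, add_assoc]
  have h4 := eq_psiMinus_of_bianchi ![component .w0 y, component .w1 y, component .w2 y] fun ω => by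
    have h5 := h2 ω
    rw [h3, map_add, map_add] at h5
    exact h5
  refine ⟨chiGravityMinus ![component .w0 y, component .w1 y, component .w2 y], h3.trans ?_⟩
  rw [gravityMinus_apply, ← h4, ← h4, ← h4]
  rfl

/-- The image of the embedding is an ideal, as it consists of solutions of the Bianchi identity. -/
theorem gravityPsi_ideal (k l : Mom) (x : SymmetryForm) (z : PairSpace 4 ℂ) :
    ∃ z', localSymmetry.br k l x (gravityPsi z) = gravityPsi z' := by
  obtain ⟨z₁, h₁⟩ := eq_gravityPlus (LieAction.bianchi_br_mem lie_projPlus translate_projPlus k l x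
    (gravityPlus_bianchi (z 1)))
  obtain ⟨z₂, h₂⟩ := eq_gravityMinus (LieAction.bianchi_br_mem lie_projMinus translate_projMinus k l
    x (gravityMinus_bianchi (z (-1))))
  refine ⟨fun σ => if σ = 1 then z₁ else z₂, ?_⟩
  rw [gravityPsi_apply, map_add, h₁, h₂, gravityPsi_apply]
  rfl

theorem symmetryFormD_gravityPsi (k : Mom) (z : PairSpace 4 ℂ) :
    symmetryFormD k (gravityPsi z) = -gravityPsi (pairD 4 ℂ k z) := by
  have h1 := (LieAction.mem_bianchi.1 (gravityPlus_bianchi (z 1))).2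
  have h2 := (LieAction.mem_bianchi.1 (gravityMinus_bianchi (z (-1)))).2
  have h3 : torsion (gravityPsi z) = 0 := by
    simp only [torsion_apply, gravityPsi_apply, map_add, h1, h2, add_zero, TensorProduct.zero_tmul,
      sub_zero]
  have hp (c : Fin 3) : wedge (oneForm k) (psiPlus (shift c (z 1))) =
      -psiPlus (shift c (pairD 4 ℂ k z 1)) := by
    rw [← pairD_shift]
    exact wedge_psiPlus k fun σ => shift c (z σ)
  have hm (c : Fin 3) : wedge (oneForm k) (psiMinus (shift c (z (-1)))) =
      -psiMinus (shift c (pairD 4 ℂ k z (-1))) := by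
    rw [← pairD_shift]
    exact wedge_psiMinus k fun σ => shift c (z σ)
  rw [symmetryFormD_apply, h3, sub_zero, gravityPsi_apply, gravityPsi_apply]
  simp only [gravityPlus_apply, gravityMinus_apply, map_add, LinearMap.rTensor_tmul, hp, hm,
    TensorProduct.neg_tmul]
  abel

/-- The complex of general relativity: vielbein and connection, modulo the Weyl curvatures. -/
def gravityPresentation : Presentation 4 symmetryForms.gr symmetryForms.d where
  isInternal := symmetryForms.isInternal
  d_mem := symmetryForms.d_mem
  d_d := symmetryForms.d_d
  d_poly := symmetryForms.d_poly
  ψ := gravityPsi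
  χ := gravityChi
  e := LinearMap.id
  lam := 0
  ψ_mem i z hz := by
    have h (σ : ℤˣ) : z σ ∈ coordGr gammaDeg i := fun a ha => hz σ a ha
    have hp (c : Fin 3) : psiPlus (shift c (z 1)) ∈ formAlgebra.gr (i + 1) :=
      psiPlus_mem (shift_mem (h 1) c)
    have hm (c : Fin 3) : psiMinus (shift c (z (-1))) ∈ formAlgebra.gr (i + 1) :=
      psiMinus_mem (shift_mem (h (-1)) c)
    exact add_mem (add_mem (add_mem (GradedCommAlgebra.tmul_mem (hp 0) _)
      (GradedCommAlgebra.tmul_mem (hp 1) _)) (GradedCommAlgebra.tmul_mem (hp 2) _))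
      (add_mem (add_mem (GradedCommAlgebra.tmul_mem (hm 0) _)
      (GradedCommAlgebra.tmul_mem (hm 1) _)) (GradedCommAlgebra.tmul_mem (hm 2) _))
  χ_mem i x hx σ a ha := by
    rcases Int.units_eq_one_or σ with rfl | rfl
    · exact chiGravityPlus_mem (fun c => component_mem hx _) a ha
    · exact chiGravityMinus_mem (fun c => component_mem hx _) a ha
  lam_mem i x _ := zero_mem _
  χ_ψ := gravityChi_gravityPsi
  ψ_e _ := rfl
  e_χ _ := rfl
  e_lam _ := rfl
  lam_ψ _ := rfl
  e_d _ _ := rfl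
  ψ_d := symmetryFormD_gravityPsi
  lam_d k x := (map_zero _).symm
  inj k hk x _ hx _ := symmetryFormD_exact hk x hx
  surj k _ z _ hz := ⟨0, 0, map_zero _, by
    rw [show z = 0 from hz, map_zero, map_zero, add_zero]⟩

/-- The dgLa of general relativity about Minkowski spacetime. -/
def gravity : FieldTheoryData 4 ℂ gravityPresentation.Quot :=
  symmetryForms.quotient gravityPresentation gravityPsi_ideal

end TreeAmp

/-! ### The Lorentz action on forms -/

namespace TreeAmp

open scoped TensorProduct

/-- The action of the left Lorentz factor on forms, weighted by determinants such that it is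
multiplicative for all matrices. -/
def formLeftFun (A : Mom) (x : Form) : Form
  | .c => x .c
  | .m00 => A 0 0 * x .m00 + A 0 1 * x .m10
  | .m01 => A 0 0 * x .m01 + A 0 1 * x .m11
  | .m10 => A 1 0 * x .m00 + A 1 1 * x .m10
  | .m11 => A 1 0 * x .m01 + A 1 1 * x .m11
  | .s0 => A 0 0 * A 0 0 * x .s0 + 2 * A 0 0 * A 0 1 * x .s1 + A 0 1 * A 0 1 * x .s2
  | .s1 => A 0 0 * A 1 0 * x .s0 + A 0 1 * A 1 0 * x .s1 + A 0 0 * A 1 1 * x .s1 +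
      A 0 1 * A 1 1 * x .s2
  | .s2 => A 1 0 * A 1 0 * x .s0 + 2 * A 1 0 * A 1 1 * x .s1 + A 1 1 * A 1 1 * x .s2
  | .r0 => A.det * x .r0
  | .r1 => A.det * x .r1
  | .r2 => A.det * x .r2
  | .j00 => A 0 0 * A.det * x .j00 + A 0 1 * A.det * x .j10
  | .j01 => A 0 0 * A.det * x .j01 + A 0 1 * A.det * x .j11
  | .j10 => A 1 0 * A.det * x .j00 + A 1 1 * A.det * x .j10
  | .j11 => A 1 0 * A.det * x .j01 + A 1 1 * A.det * x .j11
  | .v => A.det * A.det * x .v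

/-- The action of the left Lorentz factor on forms as a linear map. -/
def formLeft (A : Mom) : Form →ₗ[ℂ] Form where
  toFun := formLeftFun A
  map_add' x y := by
    funext a; cases a <;> simp only [formLeftFun, Pi.add_apply] <;> ring
  map_smul' c x := by
    funext a
    cases a <;> simp only [formLeftFun, Pi.smul_apply, smul_eq_mul, RingHom.id_apply] <;> ring

theorem formLeft_apply (A : Mom) (x : Form) (a) : formLeft A x a = formLeftFun A x a := rfl

/-- The action of the right Lorentz factor on forms. -/
def formRightFun (B : Mom) (x : Form) : Form
  | .c => x .c
  | .m00 => B 0 0 * x .m00 + B 0 1 * x .m01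
  | .m01 => B 1 0 * x .m00 + B 1 1 * x .m01
  | .m10 => B 0 0 * x .m10 + B 0 1 * x .m11
  | .m11 => B 1 0 * x .m10 + B 1 1 * x .m11
  | .s0 => B.det * x .s0
  | .s1 => B.det * x .s1
  | .s2 => B.det * x .s2
  | .r0 => B 0 0 * B 0 0 * x .r0 + 2 * B 0 0 * B 0 1 * x .r1 + B 0 1 * B 0 1 * x .r2
  | .r1 => B 0 0 * B 1 0 * x .r0 + B 0 1 * B 1 0 * x .r1 + B 0 0 * B 1 1 * x .r1 +
      B 0 1 * B 1 1 * x .r2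
  | .r2 => B 1 0 * B 1 0 * x .r0 + 2 * B 1 0 * B 1 1 * x .r1 + B 1 1 * B 1 1 * x .r2
  | .j00 => B 0 0 * B.det * x .j00 + B 0 1 * B.det * x .j01
  | .j01 => B 1 0 * B.det * x .j00 + B 1 1 * B.det * x .j01
  | .j10 => B 0 0 * B.det * x .j10 + B 0 1 * B.det * x .j11
  | .j11 => B 1 0 * B.det * x .j10 + B 1 1 * B.det * x .j11
  | .v => B.det * B.det * x .v

/-- The action of the right Lorentz factor on forms as a linear map. -/
def formRight (B : Mom) : Form →ₗ[ℂ] Form where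
  toFun := formRightFun B
  map_add' x y := by
    funext a; cases a <;> simp only [formRightFun, Pi.add_apply] <;> ring
  map_smul' c x := by
    funext a
    cases a <;> simp only [formRightFun, Pi.smul_apply, smul_eq_mul, RingHom.id_apply] <;> ring

theorem formRight_apply (B : Mom) (x : Form) (a) : formRight B x a = formRightFun B x a := rfl

/-- The action of the left Lorentz factor on infinitesimal symmetries. -/
def symmetryLeftFun (A : Mom) (X : LocalSymmetry) : LocalSymmetry
  | .t00 => A 0 0 * X .t00 + A 0 1 * X .t10
  | .t01 => A 0 0 * X .t01 + A 0 1 * X .t11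
  | .t10 => A 1 0 * X .t00 + A 1 1 * X .t10
  | .t11 => A 1 0 * X .t01 + A 1 1 * X .t11
  | .u0 => A 0 0 * A 0 0 * X .u0 + 2 * A 0 0 * A 0 1 * X .u1 + A 0 1 * A 0 1 * X .u2
  | .u1 => A 0 0 * A 1 0 * X .u0 + A 0 1 * A 1 0 * X .u1 + A 0 0 * A 1 1 * X .u1 +
      A 0 1 * A 1 1 * X .u2
  | .u2 => A 1 0 * A 1 0 * X .u0 + 2 * A 1 0 * A 1 1 * X .u1 + A 1 1 * A 1 1 * X .u2
  | .w0 => A.det * X .w0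
  | .w1 => A.det * X .w1
  | .w2 => A.det * X .w2

/-- The action of the left Lorentz factor on infinitesimal symmetries as a linear map. -/
def symmetryLeft (A : Mom) : LocalSymmetry →ₗ[ℂ] LocalSymmetry where
  toFun := symmetryLeftFun A
  map_add' x y := by
    funext a; cases a <;> simp only [symmetryLeftFun, Pi.add_apply] <;> ring
  map_smul' c x := by
    funext a
    cases a <;> simp only [symmetryLeftFun, Pi.smul_apply, smul_eq_mul, RingHom.id_apply] <;> ring

theorem symmetryLeft_apply (A : Mom) (X : LocalSymmetry) (a) : symmetryLeft A X a =
    symmetryLeftFun A X a := rfl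

/-- The action of the right Lorentz factor on infinitesimal symmetries. -/
def symmetryRightFun (B : Mom) (X : LocalSymmetry) : LocalSymmetry
  | .t00 => B 0 0 * X .t00 + B 0 1 * X .t01
  | .t01 => B 1 0 * X .t00 + B 1 1 * X .t01
  | .t10 => B 0 0 * X .t10 + B 0 1 * X .t11
  | .t11 => B 1 0 * X .t10 + B 1 1 * X .t11
  | .u0 => B.det * X .u0
  | .u1 => B.det * X .u1
  | .u2 => B.det * X .u2
  | .w0 => B 0 0 * B 0 0 * X .w0 + 2 * B 0 0 * B 0 1 * X .w1 + B 0 1 * B 0 1 * X .w2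
  | .w1 => B 0 0 * B 1 0 * X .w0 + B 0 1 * B 1 0 * X .w1 + B 0 0 * B 1 1 * X .w1 +
      B 0 1 * B 1 1 * X .w2
  | .w2 => B 1 0 * B 1 0 * X .w0 + 2 * B 1 0 * B 1 1 * X .w1 + B 1 1 * B 1 1 * X .w2

/-- The action of the right Lorentz factor on infinitesimal symmetries as a linear map. -/
def symmetryRight (B : Mom) : LocalSymmetry →ₗ[ℂ] LocalSymmetry where
  toFun := symmetryRightFun B
  map_add' x y := by
    funext a; cases a <;> simp only [symmetryRightFun, Pi.add_apply] <;> ring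
  map_smul' c x := by
    funext a
    cases a <;> simp only [symmetryRightFun, Pi.smul_apply, smul_eq_mul, RingHom.id_apply] <;> ring

theorem symmetryRight_apply (B : Mom) (X : LocalSymmetry) (a) : symmetryRight B X a =
    symmetryRightFun B X a := rfl

theorem formLeft_wedge (A : Mom) (x y : Form) :
    wedge (formLeft A x) (formLeft A y) = formLeft A (wedge x y) := by
  funext a
  cases a <;> simp only [wedge_apply, wedgeFun, formLeft_apply, formLeftFun, Matrix.det_fin_two]
    <;> ring

theorem formLeft_rotate (A : Mom) (X : LocalSymmetry) (ω : Form) :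
    rotate (symmetryLeft A X) (formLeft A ω) = A.det • formLeft A (rotate X ω) := by
  funext a
  cases a <;> simp only [rotate_apply, rotateFun, formLeft_apply, formLeftFun, symmetryLeft_apply,
    symmetryLeftFun, Pi.smul_apply, smul_eq_mul, Matrix.det_fin_two] <;> ring

theorem symmetryLeft_lie (A : Mom) (X Y : LocalSymmetry) :
    symmetryLie (symmetryLeft A X) (symmetryLeft A Y) =
      A.det • symmetryLeft A (symmetryLie X Y) := by
  funext a
  cases a <;> simp only [symmetryLie_apply, symmetryLieFun, symmetryLeft_apply,
    symmetryLeftFun, Pi.smul_apply, smul_eq_mul, Matrix.det_fin_two] <;> ring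

theorem translate_symmetryLeft (A : Mom) (X : LocalSymmetry) (k : Mom) :
    translate (symmetryLeft A X) (A * k) = A.det * translate X k := by
  simp only [translate_apply, symmetryLeft_apply, symmetryLeftFun, Matrix.mul_apply,
    Fin.sum_univ_two, Matrix.det_fin_two]
  ring

theorem formLeft_oneForm (A : Mom) (k : Mom) : formLeft A (oneForm k) = oneForm (A * k) := by
  funext a
  cases a <;> simp [formLeft_apply, formLeftFun, oneForm, Matrix.mul_apply, Fin.sum_univ_two]

theorem formLeft_mem (A : Mom) (i : ℤ) (x : Form) (hx : x ∈ coordGr formDeg i) :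
    formLeft A x ∈ coordGr formDeg i := by
  rw [← add_zero i]
  refine map_mem_coordGr (fun x => ?_) hx
  funext a
  cases a <;> simp only [formLeft_apply, formLeftFun, weightMap, formDeg, zpow_ofNat, neg_zero,
    Pi.smul_apply, smul_eq_mul] <;> ring

theorem formRight_wedge (B : Mom) (x y : Form) :
    wedge (formRight B x) (formRight B y) = formRight B (wedge x y) := by
  funext a
  cases a <;> simp only [wedge_apply, wedgeFun, formRight_apply, formRightFun, Matrix.det_fin_two]
    <;> ring

theorem formRight_rotate (B : Mom) (X : LocalSymmetry) (ω : Form) :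
    rotate (symmetryRight B X) (formRight B ω) = B.det • formRight B (rotate X ω) := by
  funext a
  cases a <;> simp only [rotate_apply, rotateFun, formRight_apply, formRightFun, symmetryRight_apply,
    symmetryRightFun, Pi.smul_apply, smul_eq_mul, Matrix.det_fin_two] <;> ring

theorem symmetryRight_lie (B : Mom) (X Y : LocalSymmetry) :
    symmetryLie (symmetryRight B X) (symmetryRight B Y) =
      B.det • symmetryRight B (symmetryLie X Y) := by
  funext a
  cases a <;> simp only [symmetryLie_apply, symmetryLieFun, symmetryRight_apply,
    symmetryRightFun, Pi.smul_apply, smul_eq_mul, Matrix.det_fin_two] <;> ring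

theorem translate_symmetryRight (B : Mom) (X : LocalSymmetry) (k : Mom) :
    translate (symmetryRight B X) (k * Bᵀ) = B.det * translate X k := by
  simp only [translate_apply, symmetryRight_apply, symmetryRightFun, Matrix.mul_apply,
    Matrix.transpose_apply, Fin.sum_univ_two, Matrix.det_fin_two]
  ring

theorem formRight_oneForm (B : Mom) (k : Mom) : formRight B (oneForm k) = oneForm (k * Bᵀ) := by
  funext a
  cases a <;> simp [formRight_apply, formRightFun, oneForm, Matrix.mul_apply, Fin.sum_univ_two]
    <;> ring

theorem formRight_mem (B : Mom) (i : ℤ) (x : Form) (hx : x ∈ coordGr formDeg i) :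
    formRight B x ∈ coordGr formDeg i := by
  rw [← add_zero i]
  refine map_mem_coordGr (fun x => ?_) hx
  funext a
  cases a <;> simp only [formRight_apply, formRightFun, weightMap, formDeg, zpow_ofNat, neg_zero,
    Pi.smul_apply, smul_eq_mul] <;> ring

theorem vielbein_left (A : Mom) :
    TensorProduct.map (formLeft A) (symmetryLeft A) vielbein = A.det • vielbein := by
  have h (a b : Fin 2) : formLeft A (coframe a b) = A 0 a • coframe 0 b + A 1 a • coframe 1 b := by
    rw [formLeft_oneForm, ← map_smul, ← map_smul, ← map_add]
    congr 1
    ext i j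
    fin_cases i <;> fin_cases j <;> fin_cases a <;> fin_cases b <;>
      simp [Matrix.mul_apply, Matrix.single]
  have h0 : symmetryLeft A (symmetryBasis .t00) =
      A 0 0 • symmetryBasis .t00 + A 1 0 • symmetryBasis .t10 := by
    funext a; cases a <;> simp [symmetryLeft_apply, symmetryLeftFun]
  have h1 : symmetryLeft A (symmetryBasis .t01) =
      A 0 0 • symmetryBasis .t01 + A 1 0 • symmetryBasis .t11 := by
    funext a; cases a <;> simp [symmetryLeft_apply, symmetryLeftFun]
  have h2 : symmetryLeft A (symmetryBasis .t10) =
      A 0 1 • symmetryBasis .t00 + A 1 1 • symmetryBasis .t10 := by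
    funext a; cases a <;> simp [symmetryLeft_apply, symmetryLeftFun]
  have h3 : symmetryLeft A (symmetryBasis .t11) =
      A 0 1 • symmetryBasis .t01 + A 1 1 • symmetryBasis .t11 := by
    funext a; cases a <;> simp [symmetryLeft_apply, symmetryLeftFun]
  simp only [vielbein, map_add, map_sub, TensorProduct.map_tmul, h, h0, h1, h2, h3,
    TensorProduct.add_tmul, TensorProduct.tmul_add, ← TensorProduct.smul_tmul',
    TensorProduct.tmul_smul, Matrix.det_fin_two]
  module

theorem vielbein_right (B : Mom) :
    TensorProduct.map (formRight B) (symmetryRight B) vielbein = B.det • vielbein := by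
  have h (a b : Fin 2) : formRight B (coframe a b) = B 0 b • coframe a 0 + B 1 b • coframe a 1 := by
    rw [formRight_oneForm, ← map_smul, ← map_smul, ← map_add]
    congr 1
    ext i j
    fin_cases i <;> fin_cases j <;> fin_cases a <;> fin_cases b <;>
      simp [Matrix.mul_apply, Matrix.single]
  have h0 : symmetryRight B (symmetryBasis .t00) =
      B 0 0 • symmetryBasis .t00 + B 1 0 • symmetryBasis .t01 := by
    funext a; cases a <;> simp [symmetryRight_apply, symmetryRightFun]
  have h1 : symmetryRight B (symmetryBasis .t01) =
      B 0 1 • symmetryBasis .t00 + B 1 1 • symmetryBasis .t01 := by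
    funext a; cases a <;> simp [symmetryRight_apply, symmetryRightFun]
  have h2 : symmetryRight B (symmetryBasis .t10) =
      B 0 0 • symmetryBasis .t10 + B 1 0 • symmetryBasis .t11 := by
    funext a; cases a <;> simp [symmetryRight_apply, symmetryRightFun]
  have h3 : symmetryRight B (symmetryBasis .t11) =
      B 0 1 • symmetryBasis .t10 + B 1 1 • symmetryBasis .t11 := by
    funext a; cases a <;> simp [symmetryRight_apply, symmetryRightFun]
  simp only [vielbein, map_add, map_sub, TensorProduct.map_tmul, h, h0, h1, h2, h3,
    TensorProduct.add_tmul, TensorProduct.tmul_add, ← TensorProduct.smul_tmul',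
    TensorProduct.tmul_smul, Matrix.det_fin_two]
  module

/-! ### Components of symmetric powers -/

theorem symPow_zero (A : Mom) (i j : ℕ) : symPow 0 A i j = if j = 0 then 1 else 0 := by
  simp [symPow, eq_comm]

/-- The recursion for symmetric powers, from splitting off the last tensor factor. -/
theorem symPow_succ (m : ℕ) (A : Mom) (i j : ℕ) :
    symPow (m + 1) A i j = A (if m < i then 1 else 0) 0 * symPow m A i j +
      if j = 0 then 0 else A (if m < i then 1 else 0) 1 * symPow m A i (j - 1) := by
  rw [symPow, ← (Fin.snocEquiv fun _ : Fin (m + 1) => Fin 2).sum_comp, Fintype.sum_prod_type,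
    Fin.sum_univ_two]
  simp only [Fin.snocEquiv_apply, Fin.sum_univ_castSucc, Fin.prod_univ_castSucc, Fin.snoc_castSucc,
    Fin.snoc_last, Fin.val_castSucc, Fin.val_last]
  congr 1
  · rw [symPow, Finset.mul_sum]
    refine Finset.sum_congr rfl fun J _ => ?_
    simp only [Fin.val_zero, add_zero, mul_ite, mul_zero]
    simp only [mul_comm]
  · by_cases h : j = 0
    · rw [if_pos h]
      subst h
      refine Finset.sum_eq_zero fun J _ => if_neg ?_
      simp
    · rw [if_neg h, symPow, Finset.mul_sum]
      refine Finset.sum_congr rfl fun J _ => ?_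
      simp only [Fin.val_one, mul_ite, mul_zero]
      rw [if_congr (show (∑ l, (J l : ℕ)) + 1 = j ↔ ∑ l, (J l : ℕ) = j - 1 by omega) rfl rfl]
      simp only [mul_comm]

end TreeAmp

/-! ### Symmetries of quotients -/

namespace TreeAmp

open scoped TensorProduct

namespace LieAction

variable {Λ : Type} [AddCommGroup Λ] [Module ℂ Λ] {G : GradedCommAlgebra Λ}
  {𝔤 : Type} [AddCommGroup 𝔤] [Module ℂ 𝔤] {A : LieAction G 𝔤}

/-- A symmetry of a Lie action is a symmetry of the bracket. -/
theorem br_map {τ : Mom → Mom} {f : Λ →ₗ[ℂ] Λ} {T : 𝔤 →ₗ[ℂ] 𝔤} {m : ℂ}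
    (hmul : ∀ x y, G.mul (f x) (f y) = f (G.mul x y))
    (hact : ∀ k X ω, A.act (τ k) (T X) (f ω) = m • f (A.act k X ω))
    (hlie : ∀ X Y, A.lie (T X) (T Y) = m • T (A.lie X Y)) (k l : Mom) (x y : Λ ⊗[ℂ] 𝔤) :
    A.br (τ k) (τ l) (TensorProduct.map f T x) (TensorProduct.map f T y) =
      m • TensorProduct.map f T (A.br k l x y) := by
  induction x using TensorProduct.induction_on with
  | zero => simp
  | add x x' h h' => simp only [map_add, LinearMap.add_apply, h, h', smul_add]
  | tmul ω X =>
    induction y using TensorProduct.induction_on with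
    | zero => simp
    | add y y' h h' => simp only [map_add, h, h', smul_add]
    | tmul η Y =>
      simp only [TensorProduct.map_tmul, br_tmul, hact, hlie, map_smul, LinearMap.smul_apply, hmul,
        map_add, map_sub, smul_add, smul_sub, TensorProduct.tmul_smul, ← TensorProduct.smul_tmul']

end LieAction

theorem GradedCommAlgebra.map_mem_tensorGr {Λ : Type} [AddCommGroup Λ] [Module ℂ Λ]
    {G : GradedCommAlgebra Λ} {𝔤 : Type} [AddCommGroup 𝔤] [Module ℂ 𝔤] {f : Λ →ₗ[ℂ] Λ} {i : ℤ}
    (hf : ∀ x ∈ G.gr i, f x ∈ G.gr i) (T : 𝔤 →ₗ[ℂ] 𝔤) (x : Λ ⊗[ℂ] 𝔤) (hx : x ∈ G.tensorGr 𝔤 i) :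
    TensorProduct.map f T x ∈ G.tensorGr 𝔤 i := by
  refine tensorGr_induction (p := fun x => TensorProduct.map f T x ∈ G.tensorGr 𝔤 i) hx (by simp)
    (fun ω hω X => ?_) fun x y h h' => by rw [map_add]; exact add_mem h h'
  rw [TensorProduct.map_tmul]
  exact tmul_mem (hf ω hω) _

/-- A linear symmetry that preserves the subcomplex is a symmetry of the quotient. -/
theorem FiberDGLA.quotient_isSymmetry {N : ℕ} {P : Type} [AddCommGroup P] [Module ℂ P]
    {F : FiberDGLA P} {p : Presentation N F.gr F.d}
    {ideal : ∀ k l x z, ∃ z', F.br k l x (p.ψ z) = p.ψ z'} {τ : Mom → Mom} {T : P →ₗ[ℂ] P}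
    {l m : ℂ} (hT : ∀ z, ∃ z', T (p.ψ z) = p.ψ z') (add : ∀ k k', τ (k + k') = τ k + τ k')
    (zero : τ 0 = 0) (mem : ∀ i, ∀ x ∈ F.gr i, T x ∈ F.gr i)
    (d : ∀ k x, F.d (τ k) (T x) = l • T (F.d k x))
    (br : ∀ k k' x y, F.br (τ k) (τ k') (T x) (T y) = m • T (F.br k k' x y))
    [FiniteDimensional ℂ p.Quot] :
    (F.quotient p ideal).IsSymmetry τ (p.map T hT) l m where
  add := add
  zero := zero
  mem := by
    rintro i _ ⟨x, hx, rfl⟩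
    exact p.proj_mem (mem i x hx)
  d k x := by
    obtain ⟨x, rfl⟩ := p.exists_proj x
    exact (congrArg p.proj (d k x)).trans (map_smul _ _ _)
  br k k' x y := by
    obtain ⟨x, rfl⟩ := p.exists_proj x
    obtain ⟨y, rfl⟩ := p.exists_proj y
    exact (congrArg p.proj (br k k' x y)).trans (map_smul _ _ _)

theorem Presentation.pairD_e {N : ℕ} {P : Type} [AddCommGroup P] [Module ℂ P]
    {gr : ℤ → Submodule ℂ P} {d : Mom → P →ₗ[ℂ] P} (p : Presentation N gr d) {k : Mom} {x : P}
    {z : PairSpace N ℂ} (h : d k x = p.ψ z) : pairD N ℂ k (p.e z) = 0 := by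
  have h1 := p.ψ_d k z
  rw [← h, p.d_d, eq_comm, neg_eq_zero] at h1
  rw [← p.e_d, ← p.χ_ψ, h1, map_zero]

/-! ### Symmetries of the dgLa of general relativity -/

instance : FiniteDimensional ℂ gravityPresentation.Quot :=
  inferInstanceAs (FiniteDimensional ℂ (SymmetryForm ⧸ gravityPresentation.relations))

/-- The dilations rescale the rotations, which have the dimension of a momentum, and not the
translations. -/
def scaleRotations (c : ℂ) : LocalSymmetry →ₗ[ℂ] LocalSymmetry where
  toFun X
    | .t00 => X .t00
    | .t01 => X .t01
    | .t10 => X .t10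
    | .t11 => X .t11
    | .u0 => c * X .u0
    | .u1 => c * X .u1
    | .u2 => c * X .u2
    | .w0 => c * X .w0
    | .w1 => c * X .w1
    | .w2 => c * X .w2
  map_add' x y := by funext a; cases a <;> simp [mul_add]
  map_smul' r x := by funext a; cases a <;> simp [mul_left_comm]

theorem br_scaleRotations (c : ℂ) (k l : Mom) (x y : SymmetryForm) :
    localSymmetry.br (c • k) (c • l) (TensorProduct.map LinearMap.id (scaleRotations c) x)
        (TensorProduct.map LinearMap.id (scaleRotations c) y) =
      c • TensorProduct.map LinearMap.id (scaleRotations c) (localSymmetry.br k l x y) := by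
  refine LieAction.br_map (τ := fun k => c • k) (fun x y => rfl) (fun k X ω => ?_)
    (fun X Y => ?_) k l x y
  · simp only [LieAction.act_apply, LinearMap.id_apply]
    change rotate _ _ + translate _ _ • ω = c • (rotate X ω + translate X k • ω)
    have h1 : rotate (scaleRotations c X) ω = c • rotate X ω := by
      funext a
      cases a <;> simp only [rotate_apply, rotateFun, scaleRotations, LinearMap.coe_mk,
        AddHom.coe_mk, Pi.smul_apply, smul_eq_mul] <;> ring
    have h2 : translate (scaleRotations c X) (c • k) = c * translate X k := by
      simp only [translate_apply, scaleRotations, LinearMap.coe_mk, AddHom.coe_mk,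
        Matrix.smul_apply, smul_eq_mul]
      ring
    rw [h1, h2, smul_add, smul_smul]
  · change symmetryLie _ _ = c • scaleRotations c (symmetryLie X Y)
    funext a
    cases a <;> simp only [symmetryLie_apply, symmetryLieFun, scaleRotations, LinearMap.coe_mk,
        AddHom.coe_mk, Pi.smul_apply, smul_eq_mul] <;> ring

theorem scaleRotations_basis (c : ℂ) :
    scaleRotations c (symmetryBasis .t00) = symmetryBasis .t00 ∧
    scaleRotations c (symmetryBasis .t01) = symmetryBasis .t01 ∧
    scaleRotations c (symmetryBasis .t10) = symmetryBasis .t10 ∧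
    scaleRotations c (symmetryBasis .t11) = symmetryBasis .t11 ∧
    scaleRotations c (symmetryBasis .u0) = c • symmetryBasis .u0 ∧
    scaleRotations c (symmetryBasis .u1) = c • symmetryBasis .u1 ∧
    scaleRotations c (symmetryBasis .u2) = c • symmetryBasis .u2 ∧
    scaleRotations c (symmetryBasis .w0) = c • symmetryBasis .w0 ∧
    scaleRotations c (symmetryBasis .w1) = c • symmetryBasis .w1 ∧
    scaleRotations c (symmetryBasis .w2) = c • symmetryBasis .w2 := by
  refine ⟨?_, ?_, ?_, ?_, ?_, ?_, ?_, ?_, ?_, ?_⟩ <;> funext a <;> cases a <;>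
    simp [scaleRotations]

theorem symmetryFormD_map {τ : Mom → Mom} {f : Form →ₗ[ℂ] Form}
    {T : LocalSymmetry →ₗ[ℂ] LocalSymmetry} {m : ℂ} (hτ : τ 0 = 0)
    (hv : TensorProduct.map f T vielbein = vielbein)
    (hbr : ∀ k l x y, localSymmetry.br (τ k) (τ l) (TensorProduct.map f T x)
      (TensorProduct.map f T y) = m • TensorProduct.map f T (localSymmetry.br k l x y))
    (k : Mom) (x : SymmetryForm) :
    symmetryFormD (τ k) (TensorProduct.map f T x) =
      m • TensorProduct.map f T (symmetryFormD k x) := by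
  have h := hbr 0 k vielbein x
  rwa [hτ, hv] at h

theorem scaleRotations_gravityPsi (c : ℂ) (z : PairSpace 4 ℂ) :
    TensorProduct.map LinearMap.id (scaleRotations c) (gravityPsi z) = c • gravityPsi z := by
  obtain ⟨-, -, -, -, h0, h1, h2, h3, h4, h5⟩ := scaleRotations_basis c
  simp only [gravityPsi_apply, gravityPlus_apply, gravityMinus_apply, map_add,
    TensorProduct.map_tmul, LinearMap.id_apply, h0, h1, h2, h3, h4, h5, TensorProduct.tmul_smul,
    smul_add]

theorem scaleRotations_scaleRotations (c c' : ℂ) (X : LocalSymmetry) :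
    scaleRotations c (scaleRotations c' X) = scaleRotations (c * c') X := by
  funext a
  cases a <;> simp [scaleRotations, mul_assoc]

theorem scaleRotations_one (X : LocalSymmetry) : scaleRotations 1 X = X := by
  funext a
  cases a <;> simp [scaleRotations]

/-- The dilations of general relativity. -/
def gravityDilations : gravity.HasDilations where
  S c := gravityPresentation.map (TensorProduct.map LinearMap.id (scaleRotations c)) fun z =>
    ⟨c • z, by rw [map_smul]; exact scaleRotations_gravityPsi c z⟩
  α := 2
  isSymmetry c hc := by
    obtain ⟨h0, h1, h2, h3, -⟩ := scaleRotations_basis c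
    have hv : TensorProduct.map LinearMap.id (scaleRotations c) vielbein = vielbein := by
      simp only [vielbein, map_add, map_sub, TensorProduct.map_tmul, LinearMap.id_apply, h0, h1, h2,
        h3]
    rw [show c ^ ((2 : ℤ) - 1) = c by norm_num]
    exact FiberDGLA.quotient_isSymmetry (F := symmetryForms) _ (fun k k' => smul_add c k k')
      (smul_zero c)
      (fun i => GradedCommAlgebra.map_mem_tensorGr (G := formAlgebra) (f := LinearMap.id)
        (fun x hx => hx) _)
      (symmetryFormD_map (smul_zero c) hv (br_scaleRotations c)) (br_scaleRotations c)
  inv c hc x := by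
    obtain ⟨x, rfl⟩ := gravityPresentation.exists_proj x
    rw [Presentation.map_proj, Presentation.map_proj]
    congr 1
    induction x using TensorProduct.induction_on with
    | zero => simp
    | add x y h h' => rw [map_add, map_add, h, h']
    | tmul ω X =>
      rw [TensorProduct.map_tmul, TensorProduct.map_tmul, scaleRotations_scaleRotations,
        mul_inv_cancel₀ hc, scaleRotations_one]
      rfl
  toGamma c hc k x hx := by
    obtain ⟨x, rfl⟩ := gravityPresentation.exists_proj x
    obtain ⟨h0, h1, h2, h3, -⟩ := scaleRotations_basis c
    have hv : TensorProduct.map LinearMap.id (scaleRotations c) vielbein = vielbein := by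
      simp only [vielbein, map_add, map_sub, TensorProduct.map_tmul, LinearMap.id_apply, h0, h1, h2,
        h3]
    refine gravityPresentation.toGamma_dilation hc 2 (fun z => ?_)
      (symmetryFormD_map (smul_zero c) hv (br_scaleRotations c)) (fun x => ?_) k x hx
    · rw [show c ^ ((2 : ℤ) - 1) = c by norm_num]
      exact scaleRotations_gravityPsi c z
    · exact (smul_zero _).symm

/-! ### The Lorentz action on the embedded complexes -/

theorem lorentz_apply (N : ℕ) (A B : Mom) (z : GammaSpace N ℂ) :
    (∀ i : Fin (N + 1), coeffMap ℂ (lorentzMatrix N A B) z (.inl i) =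
      ∑ j : Fin (N + 1), symPow N A i j * z (.inl j)) ∧
    (∀ (β : Fin 2) (i : Fin N), coeffMap ℂ (lorentzMatrix N A B) z (.inr (.inl (β, i))) =
      B β 0 * ∑ j : Fin N, symPow (N - 1) A i j * z (.inr (.inl (0, j))) +
      B β 1 * ∑ j : Fin N, symPow (N - 1) A i j * z (.inr (.inl (1, j)))) ∧
    (∀ i : Fin (N - 1), coeffMap ℂ (lorentzMatrix N A B) z (.inr (.inr i)) =
      ∑ j : Fin (N - 1), symPow (N - 2) A i j * z (.inr (.inr j))) := by
  refine ⟨fun i => ?_, fun β i => ?_, fun i => ?_⟩ <;>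
    simp [coeffMap_apply, Fintype.sum_sum_type, Fintype.sum_prod_type, lorentzMatrix,
      Finset.mul_sum, mul_assoc]

/-- Splitting off the factor `S^2` of a symmetric power is equivariant. -/
theorem symPow_split (A : Mom) {m : ℕ} (hm : m ≤ 2) (i : Fin (m + 1)) (g : Fin (m + 3) → ℂ) :
    ∑ j : Fin (m + 3), symPow (m + 2) A i j * g j =
      A 0 0 * A 0 0 * ∑ j : Fin (m + 1), symPow m A i j * g ⟨j, by omega⟩ +
      2 * A 0 0 * A 0 1 * ∑ j : Fin (m + 1), symPow m A i j * g ⟨j + 1, by omega⟩ +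
      A 0 1 * A 0 1 * ∑ j : Fin (m + 1), symPow m A i j * g ⟨j + 2, by omega⟩ ∧
    ∑ j : Fin (m + 3), symPow (m + 2) A (i + 1) j * g j =
      A 0 0 * A 1 0 * ∑ j : Fin (m + 1), symPow m A i j * g ⟨j, by omega⟩ +
      (A 0 1 * A 1 0 + A 0 0 * A 1 1) * ∑ j : Fin (m + 1), symPow m A i j * g ⟨j + 1, by omega⟩ +
      A 0 1 * A 1 1 * ∑ j : Fin (m + 1), symPow m A i j * g ⟨j + 2, by omega⟩ ∧
    ∑ j : Fin (m + 3), symPow (m + 2) A (i + 2) j * g j =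
      A 1 0 * A 1 0 * ∑ j : Fin (m + 1), symPow m A i j * g ⟨j, by omega⟩ +
      2 * A 1 0 * A 1 1 * ∑ j : Fin (m + 1), symPow m A i j * g ⟨j + 1, by omega⟩ +
      A 1 1 * A 1 1 * ∑ j : Fin (m + 1), symPow m A i j * g ⟨j + 2, by omega⟩ := by
  obtain ⟨i, hi⟩ := i
  rw [Nat.lt_succ_iff] at hi
  refine ⟨?_, ?_, ?_⟩ <;> interval_cases m <;> interval_cases i <;>
    simp only [Fin.sum_univ_succ, Fin.sum_univ_zero, symPow_succ, symPow_zero] <;>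
    norm_num [-mul_eq_mul_left_iff, -mul_eq_mul_right_iff, Fin.succ] <;> ring

theorem shift_apply (c : Fin 3) (z : GammaSpace 4 ℂ) :
    (∀ i : Fin 3, shift c z (.inl i) = z (.inl ⟨i + c, by omega⟩)) ∧
    (∀ (β : Fin 2) (i : Fin 2), shift c z (.inr (.inl (β, i))) =
      z (.inr (.inl (β, ⟨i + c, by omega⟩)))) ∧
    (∀ i : Fin 1, shift c z (.inr (.inr i)) = z (.inr (.inr ⟨i + c, by omega⟩))) :=
  ⟨fun _ => rfl, fun _ _ => rfl, fun _ => rfl⟩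

theorem shift_lorentz (A B : Mom) (z : GammaSpace 4 ℂ) :
    shift 0 (coeffMap ℂ (lorentzMatrix 4 A B) z) =
      (A 0 0 * A 0 0) • coeffMap ℂ (lorentzMatrix 2 A B) (shift 0 z) +
      (2 * A 0 0 * A 0 1) • coeffMap ℂ (lorentzMatrix 2 A B) (shift 1 z) +
      (A 0 1 * A 0 1) • coeffMap ℂ (lorentzMatrix 2 A B) (shift 2 z) ∧
    shift 1 (coeffMap ℂ (lorentzMatrix 4 A B) z) =
      (A 0 0 * A 1 0) • coeffMap ℂ (lorentzMatrix 2 A B) (shift 0 z) +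
      (A 0 1 * A 1 0 + A 0 0 * A 1 1) • coeffMap ℂ (lorentzMatrix 2 A B) (shift 1 z) +
      (A 0 1 * A 1 1) • coeffMap ℂ (lorentzMatrix 2 A B) (shift 2 z) ∧
    shift 2 (coeffMap ℂ (lorentzMatrix 4 A B) z) =
      (A 1 0 * A 1 0) • coeffMap ℂ (lorentzMatrix 2 A B) (shift 0 z) +
      (2 * A 1 0 * A 1 1) • coeffMap ℂ (lorentzMatrix 2 A B) (shift 1 z) +
      (A 1 1 * A 1 1) • coeffMap ℂ (lorentzMatrix 2 A B) (shift 2 z) := by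
  obtain ⟨h1, h2, h3⟩ := lorentz_apply 4 A B z
  have l (c : Fin 3) := lorentz_apply 2 A B (shift c z)
  have e1 (i : Fin 3) := symPow_split A le_rfl i fun j => z (.inl j)
  have e2 (β : Fin 2) (i : Fin 2) := symPow_split A one_le_two i fun j => z (.inr (.inl (β, j)))
  have e3 (i : Fin 1) := symPow_split A zero_le_two i fun j => z (.inr (.inr j))
  simp only [Nat.reduceAdd, Nat.reduceSub, zero_add] at h1 h2 h3 e1 e2 e3
  refine ⟨?_, ?_, ?_⟩ <;> funext a <;> rcases a with a | ⟨β, a⟩ | a <;>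
    simp only [Pi.add_apply, Pi.smul_apply, smul_eq_mul, (l _).1, (l _).2.1, (l _).2.2,
      (shift_apply _ _).1, (shift_apply _ _).2.1, (shift_apply _ _).2.2, h1, h2, h3, Fin.val_zero,
      Fin.val_one, Fin.val_two, add_zero, e1, e2, e3, Nat.reduceSub] <;> ring

theorem psiPlus_lorentz {A B : Mom} (hA : A.det = 1) (hB : B.det = 1) (z : GammaSpace 2 ℂ) :
    formLeft A (formRight B (psiPlus z)) = psiPlus (coeffMap ℂ (lorentzMatrix 2 A B) z) := by
  obtain ⟨h1, h2, h3⟩ := lorentz_apply 2 A B z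
  funext a
  cases a <;> simp [psiPlus, formLeft_apply, formLeftFun, formRight_apply, formRightFun,
    hA, hB, h1, h2, h3, Fin.sum_univ_succ, symPow_succ, symPow_zero,
    -mul_eq_mul_left_iff, -mul_eq_mul_right_iff] <;> ring

theorem psiMinus_lorentz {A B : Mom} (hA : A.det = 1) (hB : B.det = 1) (z : GammaSpace 2 ℂ) :
    formLeft A (formRight B (psiMinus z)) = psiMinus (coeffMap ℂ (lorentzMatrix 2 B A) z) := by
  obtain ⟨h1, h2, h3⟩ := lorentz_apply 2 B A z
  funext a
  cases a <;> simp [psiMinus, formLeft_apply, formLeftFun, formRight_apply, formRightFun,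
    hA, hB, h1, h2, h3, Fin.sum_univ_succ, symPow_succ, symPow_zero,
    -mul_eq_mul_left_iff, -mul_eq_mul_right_iff] <;> ring

/-- The Lorentz action on the infinitesimal rotations. -/
theorem symmetryLeft_basis {A B : Mom} (hA : A.det = 1) (hB : B.det = 1) :
    symmetryLeft A (symmetryRight B (symmetryBasis .u0)) = (A 0 0 * A 0 0) • symmetryBasis .u0 +
      (A 0 0 * A 1 0) • symmetryBasis .u1 + (A 1 0 * A 1 0) • symmetryBasis .u2 ∧
    symmetryLeft A (symmetryRight B (symmetryBasis .u1)) = (2 * A 0 0 * A 0 1) • symmetryBasis .u0 +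
      (A 0 1 * A 1 0 + A 0 0 * A 1 1) • symmetryBasis .u1 +
      (2 * A 1 0 * A 1 1) • symmetryBasis .u2 ∧
    symmetryLeft A (symmetryRight B (symmetryBasis .u2)) = (A 0 1 * A 0 1) • symmetryBasis .u0 +
      (A 0 1 * A 1 1) • symmetryBasis .u1 + (A 1 1 * A 1 1) • symmetryBasis .u2 ∧
    symmetryLeft A (symmetryRight B (symmetryBasis .w0)) = (B 0 0 * B 0 0) • symmetryBasis .w0 +
      (B 0 0 * B 1 0) • symmetryBasis .w1 + (B 1 0 * B 1 0) • symmetryBasis .w2 ∧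
    symmetryLeft A (symmetryRight B (symmetryBasis .w1)) = (2 * B 0 0 * B 0 1) • symmetryBasis .w0 +
      (B 0 1 * B 1 0 + B 0 0 * B 1 1) • symmetryBasis .w1 +
      (2 * B 1 0 * B 1 1) • symmetryBasis .w2 ∧
    symmetryLeft A (symmetryRight B (symmetryBasis .w2)) = (B 0 1 * B 0 1) • symmetryBasis .w0 +
      (B 0 1 * B 1 1) • symmetryBasis .w1 + (B 1 1 * B 1 1) • symmetryBasis .w2 := by
  refine ⟨?_, ?_, ?_, ?_, ?_, ?_⟩ <;> funext a <;> cases a <;>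
    simp [symmetryLeft_apply, symmetryLeftFun, symmetryRight_apply, symmetryRightFun, hA, hB]

theorem gravityPsi_lorentz {A B : Mom} (hA : A.det = 1) (hB : B.det = 1) (z : PairSpace 4 ℂ) :
    TensorProduct.map (formLeft A ∘ₗ formRight B) (symmetryLeft A ∘ₗ symmetryRight B)
        (gravityPsi z) =
      gravityPlus (coeffMap ℂ (lorentzMatrix 4 A B) (z 1)) +
        gravityMinus (coeffMap ℂ (lorentzMatrix 4 B A) (z (-1))) := by
  obtain ⟨h0, h1, h2, h3, h4, h5⟩ := symmetryLeft_basis hA hB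
  obtain ⟨s0, s1, s2⟩ := shift_lorentz A B (z 1)
  obtain ⟨r0, r1, r2⟩ := shift_lorentz B A (z (-1))
  rw [gravityPsi_apply]
  simp only [gravityPlus_apply, gravityMinus_apply, map_add, TensorProduct.map_tmul,
    LinearMap.comp_apply, h0, h1, h2, h3, h4, h5, psiPlus_lorentz hA hB, psiMinus_lorentz hA hB,
    s0, s1, s2, r0, r1, r2, map_smul, TensorProduct.add_tmul, TensorProduct.tmul_add,
    TensorProduct.tmul_smul, ← TensorProduct.smul_tmul']
  module

/-- The Lorentz action on forms with values in the infinitesimal symmetries. -/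
def lorentzForm (g : Lorentz) : SymmetryForm →ₗ[ℂ] SymmetryForm :=
  TensorProduct.map (formLeft g.1 ∘ₗ formRight g.2) (symmetryLeft g.1 ∘ₗ symmetryRight g.2)

theorem lorentzForm_gravityPsi (g : Lorentz) (z : PairSpace 4 ℂ) :
    lorentzForm g (gravityPsi z) = gravityPsi (lorentzPair 4 ℂ g z) :=
  gravityPsi_lorentz g.1.det_coe g.2.det_coe z

theorem lorentzForm_mem (g : Lorentz) (i : ℤ) (x : SymmetryForm)
    (hx : x ∈ formAlgebra.tensorGr LocalSymmetry i) :
    lorentzForm g x ∈ formAlgebra.tensorGr LocalSymmetry i :=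
  GradedCommAlgebra.map_mem_tensorGr (G := formAlgebra)
    (fun x hx => formLeft_mem g.1 i (formRight g.2 x) (formRight_mem g.2 i x hx)) _ x hx

theorem lorentzForm_br (g : Lorentz) (k l : Mom) (x y : SymmetryForm) :
    localSymmetry.br (lorentzMom g k) (lorentzMom g l) (lorentzForm g x) (lorentzForm g y) =
      (1 : ℂ) • lorentzForm g (localSymmetry.br k l x y) := by
  have dA : (g.1 : Mom).det = 1 := g.1.det_coe
  have dB : (g.2 : Mom).det = 1 := g.2.det_coe
  refine LieAction.br_map (fun x y => ?_) (fun k X ω => ?_) (fun X Y => ?_) k l x y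
  · exact (formLeft_wedge _ _ _).trans (congrArg _ (formRight_wedge _ _ _))
  · change rotate _ (formLeft _ (formRight _ ω)) + translate _ _ • _ =
      (1 : ℂ) • formLeft _ (formRight _ (rotate X ω + translate X k • ω))
    rw [LinearMap.comp_apply, formLeft_rotate, formRight_rotate, dA, dB, lorentzMom, Matrix.mul_assoc,
      translate_symmetryLeft, translate_symmetryRight, dA, dB, one_mul, one_mul, one_smul, one_smul,
      one_smul, map_add, map_add, map_smul, map_smul]
    rfl
  · change symmetryLie (symmetryLeft _ (symmetryRight _ X)) (symmetryLeft _ (symmetryRight _ Y)) =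
      (1 : ℂ) • symmetryLeft _ (symmetryRight _ (symmetryLie X Y))
    rw [symmetryLeft_lie, symmetryRight_lie, dA, dB, one_smul, one_smul, one_smul]

theorem lorentzForm_vielbein (g : Lorentz) : lorentzForm g vielbein = vielbein := by
  rw [lorentzForm, TensorProduct.map_comp, LinearMap.comp_apply, vielbein_right, g.2.det_coe,
    one_smul, vielbein_left, g.1.det_coe, one_smul]

theorem lorentzMom_add (g : Lorentz) (k l : Mom) :
    lorentzMom g (k + l) = lorentzMom g k + lorentzMom g l := by
  rw [lorentzMom, Matrix.mul_add, Matrix.add_mul, lorentzMom, lorentzMom]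

theorem lorentzMom_zero (g : Lorentz) : lorentzMom g 0 = 0 := by
  rw [lorentzMom, Matrix.mul_zero, Matrix.zero_mul]

theorem lorentzForm_d (g : Lorentz) (k : Mom) (x : SymmetryForm) :
    symmetryFormD (lorentzMom g k) (lorentzForm g x) =
      (1 : ℂ) • lorentzForm g (symmetryFormD k x) :=
  symmetryFormD_map (lorentzMom_zero g) (lorentzForm_vielbein g) (lorentzForm_br g) k x

/-- The Lorentz equivariance of the complexes follows from that of the forms in which they are
embedded. -/
theorem pairD_lorentz (g : Lorentz) (k : Mom) (z : PairSpace 4 ℂ) :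
    pairD 4 ℂ (lorentzMom g k) (lorentzPair 4 ℂ g z) = lorentzPair 4 ℂ g (pairD 4 ℂ k z) := by
  have h := lorentzForm_d g k (gravityPsi z)
  rw [one_smul, lorentzForm_gravityPsi, symmetryFormD_gravityPsi, symmetryFormD_gravityPsi, map_neg,
    neg_inj, lorentzForm_gravityPsi] at h
  rw [← gravityChi_gravityPsi (pairD 4 ℂ (lorentzMom g k) (lorentzPair 4 ℂ g z)), h,
    gravityChi_gravityPsi]

/-- The Lorentz action of general relativity. -/
def gravityLorentz : gravity.HasLorentz where
  ρ g := gravityPresentation.map (lorentzForm g) fun z => ⟨_, lorentzForm_gravityPsi g z⟩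
  isSymmetry g := FiberDGLA.quotient_isSymmetry (F := symmetryForms) _ (lorentzMom_add g)
    (lorentzMom_zero g) (lorentzForm_mem g) (lorentzForm_d g) (lorentzForm_br g)
  toGamma g k x hx := by
    obtain ⟨x, rfl⟩ := gravityPresentation.exists_proj x
    exact gravityPresentation.toGamma_symmetry (lorentzForm_gravityPsi g)
      (fun x => (lorentzForm_d g k x).trans (one_smul _ _)) (fun z => rfl) (pairD_lorentz g k)
      (fun x => (map_zero _).symm) x hx
  pairD := pairD_lorentz

end TreeAmp

/-! ### Nontrivial gravitational interactions -/

namespace TreeAmp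

open scoped TensorProduct

theorem FiberDGLA.quotient_rep {N : ℕ} {P : Type} [AddCommGroup P] [Module ℂ P]
    {F : FiberDGLA P} {p : Presentation N F.gr F.d}
    {ideal : ∀ k l x z, ∃ z', F.br k l x (p.ψ z) = p.ψ z'} [FiniteDimensional ℂ p.Quot] {k : Mom}
    {x : P} {z : PairSpace N ℂ} (h : F.d k x = p.ψ z) :
    (F.quotient p ideal).Rep k (p.proj x) (p.e z + p.lam x) where
  closed := (congrArg p.proj h).trans (p.proj_ψ z)
  closed' := by
    rw [LinearMap.mem_ker, map_add, p.pairD_e h, ← p.lam_d, h, p.lam_ψ, add_zero]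
  eq := ⟨_, p.toGamma_proj_of_eq h⟩

/-- The element of the pair space that is supported on the basis element `a` of the part `σ`. -/
def pairSingle {N : ℕ} (σ : ℤˣ) (a : GammaIdx N) (c : ℂ) : PairSpace N ℂ :=
  Pi.single σ (Pi.single a c)

theorem pairSingle_mem {N : ℕ} (σ : ℤˣ) (a : GammaIdx N) (c : ℂ) :
    pairSingle σ a c ∈ pairGr N ℂ (gammaDeg a) := by
  intro τ b hb
  rw [pairSingle]
  by_cases h : τ = σ
  · subst h
    rw [Pi.single_eq_same, Pi.single_eq_of_ne]
    rintro rfl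
    exact hb rfl
  · rw [Pi.single_eq_of_ne h]
    rfl

theorem pairSingle_inl_mem {N : ℕ} (σ : ℤˣ) (i : Fin (N + 1)) (c : ℂ) :
    pairSingle σ (.inl i) c ∈ pairGr N ℂ 1 :=
  pairSingle_mem σ (.inl i) c

theorem single_ne_zero (i j : Fin 2) : (Matrix.single i j 1 : Mom) ≠ 0 := fun h => by
  simpa using congrFun (congrFun h i) j

theorem symmetryFormD_tmul (k : Mom) (ω : Form) (X : LocalSymmetry) :
    symmetryFormD k (ω ⊗ₜ X) = wedge (oneForm k) ω ⊗ₜ X -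
      (wedge (rotate X (coframe 0 0)) ω ⊗ₜ symmetryBasis .t11 -
        wedge (rotate X (coframe 0 1)) ω ⊗ₜ symmetryBasis .t10 -
        wedge (rotate X (coframe 1 0)) ω ⊗ₜ symmetryBasis .t01 +
        wedge (rotate X (coframe 1 1)) ω ⊗ₜ symmetryBasis .t00) := by
  rw [symmetryFormD_apply, torsion_apply]
  rfl

theorem wedge_oneForm_comm (k l : Mom) :
    wedge (oneForm k) (oneForm l) = -wedge (oneForm l) (oneForm k) := by
  funext a
  cases a <;> simp only [wedge_apply, wedgeFun, oneForm, LinearMap.coe_mk, AddHom.coe_mk,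
    Pi.neg_apply] <;> ring

theorem wedge_coframe_comm (a b c d : Fin 2) :
    wedge (coframe a b) (coframe c d) = -wedge (coframe c d) (coframe a b) :=
  wedge_oneForm_comm _ _

theorem wedge_coframe_self (a b : Fin 2) : wedge (coframe a b) (coframe a b) = 0 :=
  self_eq_neg.1 (wedge_coframe_comm a b a b)

theorem wedge_wedge_coframe_self (a b : Fin 2) (ω : Form) :
    wedge (coframe a b) (wedge (coframe a b) ω) = 0 := by
  rw [← wedge_assoc, wedge_coframe_self, map_zero, LinearMap.zero_apply]

theorem symmetryFormD_translation {X : LocalSymmetry} (hX : IsTranslation X) (k : Mom) (ω : Form) :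
    symmetryFormD k (ω ⊗ₜ X) = wedge (oneForm k) ω ⊗ₜ X := by
  rw [symmetryFormD_apply, torsion_tmul_translation hX, sub_zero, LinearMap.rTensor_tmul]

theorem symmetryFormD_tmul_w0 (k : Mom) (ω : Form) :
    symmetryFormD k (ω ⊗ₜ symmetryBasis .w0) = wedge (oneForm k) ω ⊗ₜ symmetryBasis .w0 +
      wedge (coframe 0 0) ω ⊗ₜ symmetryBasis .t10 -
        wedge (coframe 1 0) ω ⊗ₜ symmetryBasis .t00 := by
  have h00 : rotate (symmetryBasis .w0) (coframe 0 0) = 0 := by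
    funext a; cases a <;> simp [rotate_apply, rotateFun, coframe, oneForm]
  have h10 : rotate (symmetryBasis .w0) (coframe 1 0) = 0 := by
    funext a; cases a <;> simp [rotate_apply, rotateFun, coframe, oneForm]
  have h01 : rotate (symmetryBasis .w0) (coframe 0 1) = coframe 0 0 := by
    funext a; cases a <;> simp [rotate_apply, rotateFun, coframe, oneForm]
  have h11 : rotate (symmetryBasis .w0) (coframe 1 1) = coframe 1 0 := by
    funext a; cases a <;> simp [rotate_apply, rotateFun, coframe, oneForm]
  rw [symmetryFormD_tmul, h00, h01, h10, h11, map_zero, LinearMap.zero_apply,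
    TensorProduct.zero_tmul, TensorProduct.zero_tmul]
  abel

theorem gravityPsi_single_minus : gravityPsi (pairSingle (-1) (.inl 0) 1) =
    (1 / 2 : ℂ) • wedge (coframe 0 0) (coframe 1 0) ⊗ₜ[ℂ] symmetryBasis .w0 := by
  have h0 : psiMinus (shift 0 (Pi.single (.inl 0) 1)) =
      (1 / 2 : ℂ) • wedge (coframe 0 0) (coframe 1 0) := by
    funext a; cases a <;> simp [psiMinus, shift, wedge_apply, wedgeFun, coframe, oneForm]
  have h1 : shift 1 (Pi.single (.inl 0) 1) = 0 := by
    funext a; rcases a with a | ⟨β, a⟩ | a <;> simp [shift]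
  have h2 : shift 2 (Pi.single (.inl 0) 1) = 0 := by
    funext a; rcases a with a | ⟨β, a⟩ | a <;> simp [shift]
  rw [gravityPsi_apply, pairSingle, Pi.single_eq_same, Pi.single_eq_of_ne (by decide), map_zero,
    gravityMinus_apply, h0, h1, h2, map_zero, TensorProduct.zero_tmul, TensorProduct.zero_tmul,
    TensorProduct.smul_tmul']
  abel

theorem gravityPsi_single_minus' : gravityPsi (pairSingle (-1) (.inr (.inl (0, 0))) (-1 / 2)) =
    (1 / 2 : ℂ) • wedge (coframe 1 0) ((1 / 2 : ℂ) • wedge (coframe 0 0) (coframe 0 1)) ⊗ₜ[ℂ]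
      symmetryBasis .w0 := by
  have h0 : psiMinus (shift 0 (Pi.single (.inr (.inl (0, 0))) (-1 / 2))) =
      (1 / 2 : ℂ) • wedge (coframe 1 0) ((1 / 2 : ℂ) • wedge (coframe 0 0) (coframe 0 1)) := by
    funext a
    cases a <;> simp [psiMinus, shift, wedge_apply, wedgeFun, coframe, oneForm]
    norm_num
  have h1 : shift 1 (Pi.single (.inr (.inl (0, 0))) (-1 / 2)) = 0 := by
    funext a; rcases a with a | ⟨β, a⟩ | a <;> simp [shift]
  have h2 : shift 2 (Pi.single (.inr (.inl (0, 0))) (-1 / 2)) = 0 := by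
    funext a; rcases a with a | ⟨β, a⟩ | a <;> simp [shift]
  rw [gravityPsi_apply, pairSingle, Pi.single_eq_same, Pi.single_eq_of_ne (by decide), map_zero,
    gravityMinus_apply, h0, h1, h2, map_zero, TensorProduct.zero_tmul, TensorProduct.zero_tmul,
    TensorProduct.smul_tmul']
  abel

/-- A gravitational plane wave of negative helicity with momentum `e₀₀`. -/
theorem symmetryFormD_wave_minus : symmetryFormD (Matrix.single 0 0 1)
    (coframe 1 0 ⊗ₜ ((1 / 2 : ℂ) • (symmetryBasis .w0 - symmetryBasis .t10))) =
      gravityPsi (pairSingle (-1) (.inl 0) 1) := by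
  rw [TensorProduct.tmul_smul, map_smul, TensorProduct.tmul_sub, map_sub, symmetryFormD_tmul_w0,
    symmetryFormD_translation isTranslation_t10, gravityPsi_single_minus, wedge_coframe_self,
    TensorProduct.zero_tmul]
  module

/-- A gravitational plane wave of negative helicity with momentum `e₁₀`. -/
theorem symmetryFormD_wave_minus' : symmetryFormD (Matrix.single 1 0 1)
    (coframe 0 0 ⊗ₜ ((-1 / 2 : ℂ) • (symmetryBasis .w0 + symmetryBasis .t00))) =
      gravityPsi (pairSingle (-1) (.inl 0) 1) := by
  rw [TensorProduct.tmul_smul, map_smul, TensorProduct.tmul_add, map_add, symmetryFormD_tmul_w0,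
    symmetryFormD_translation isTranslation_t00, gravityPsi_single_minus, wedge_coframe_self,
    TensorProduct.zero_tmul, wedge_coframe_comm 0 0, TensorProduct.neg_tmul]
  module

theorem symmetryFormD_tmul_u0 (k : Mom) (ω : Form) :
    symmetryFormD k (ω ⊗ₜ symmetryBasis .u0) = wedge (oneForm k) ω ⊗ₜ symmetryBasis .u0 +
      wedge (coframe 0 0) ω ⊗ₜ symmetryBasis .t01 -
        wedge (coframe 0 1) ω ⊗ₜ symmetryBasis .t00 := by
  have h00 : rotate (symmetryBasis .u0) (coframe 0 0) = 0 := by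
    funext a; cases a <;> simp [rotate_apply, rotateFun, coframe, oneForm]
  have h10 : rotate (symmetryBasis .u0) (coframe 0 1) = 0 := by
    funext a; cases a <;> simp [rotate_apply, rotateFun, coframe, oneForm]
  have h01 : rotate (symmetryBasis .u0) (coframe 1 0) = coframe 0 0 := by
    funext a; cases a <;> simp [rotate_apply, rotateFun, coframe, oneForm]
  have h11 : rotate (symmetryBasis .u0) (coframe 1 1) = coframe 0 1 := by
    funext a; cases a <;> simp [rotate_apply, rotateFun, coframe, oneForm]
  rw [symmetryFormD_tmul, h00, h01, h10, h11, map_zero, LinearMap.zero_apply,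
    TensorProduct.zero_tmul, TensorProduct.zero_tmul]
  abel

theorem gravityPsi_single_plus : gravityPsi (pairSingle 1 (.inl 0) 1) =
    (1 / 2 : ℂ) • wedge (coframe 0 0) (coframe 0 1) ⊗ₜ[ℂ] symmetryBasis .u0 := by
  have h0 : psiPlus (shift 0 (Pi.single (.inl 0) 1)) =
      (1 / 2 : ℂ) • wedge (coframe 0 0) (coframe 0 1) := by
    funext a; cases a <;> simp [psiPlus, shift, wedge_apply, wedgeFun, coframe, oneForm]
  have h1 : shift 1 (Pi.single (.inl 0) 1) = 0 := by
    funext a; rcases a with a | ⟨β, a⟩ | a <;> simp [shift]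
  have h2 : shift 2 (Pi.single (.inl 0) 1) = 0 := by
    funext a; rcases a with a | ⟨β, a⟩ | a <;> simp [shift]
  rw [gravityPsi_apply, pairSingle, Pi.single_eq_same, Pi.single_eq_of_ne (by decide), map_zero,
    gravityPlus_apply, h0, h1, h2, map_zero, TensorProduct.zero_tmul, TensorProduct.zero_tmul,
    TensorProduct.smul_tmul']
  abel

theorem gravityPsi_single_plus' : gravityPsi (pairSingle 1 (.inr (.inl (0, 0))) (-1 / 2)) =
    (1 / 2 : ℂ) • wedge (coframe 0 1) ((1 / 2 : ℂ) • wedge (coframe 0 0) (coframe 1 0)) ⊗ₜ[ℂ]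
      symmetryBasis .u0 := by
  have h0 : psiPlus (shift 0 (Pi.single (.inr (.inl (0, 0))) (-1 / 2))) =
      (1 / 2 : ℂ) • wedge (coframe 0 1) ((1 / 2 : ℂ) • wedge (coframe 0 0) (coframe 1 0)) := by
    funext a
    cases a <;> simp [psiPlus, shift, wedge_apply, wedgeFun, coframe, oneForm]
    norm_num
  have h1 : shift 1 (Pi.single (.inr (.inl (0, 0))) (-1 / 2)) = 0 := by
    funext a; rcases a with a | ⟨β, a⟩ | a <;> simp [shift]
  have h2 : shift 2 (Pi.single (.inr (.inl (0, 0))) (-1 / 2)) = 0 := by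
    funext a; rcases a with a | ⟨β, a⟩ | a <;> simp [shift]
  rw [gravityPsi_apply, pairSingle, Pi.single_eq_same, Pi.single_eq_of_ne (by decide), map_zero,
    gravityPlus_apply, h0, h1, h2, map_zero, TensorProduct.zero_tmul, TensorProduct.zero_tmul,
    TensorProduct.smul_tmul']
  abel

/-- A gravitational plane wave of positive helicity with momentum `e₀₀`. -/
theorem symmetryFormD_wave_plus : symmetryFormD (Matrix.single 0 0 1)
    (coframe 0 1 ⊗ₜ ((1 / 2 : ℂ) • (symmetryBasis .u0 - symmetryBasis .t01))) =
      gravityPsi (pairSingle 1 (.inl 0) 1) := by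
  rw [TensorProduct.tmul_smul, map_smul, TensorProduct.tmul_sub, map_sub, symmetryFormD_tmul_u0,
    symmetryFormD_translation isTranslation_t01, gravityPsi_single_plus, wedge_coframe_self,
    TensorProduct.zero_tmul]
  module

/-- A gravitational plane wave of positive helicity with momentum `e₀₁`. -/
theorem symmetryFormD_wave_plus' : symmetryFormD (Matrix.single 0 1 1)
    (coframe 0 0 ⊗ₜ ((-1 / 2 : ℂ) • (symmetryBasis .u0 + symmetryBasis .t00))) =
      gravityPsi (pairSingle 1 (.inl 0) 1) := by
  rw [TensorProduct.tmul_smul, map_smul, TensorProduct.tmul_add, map_add, symmetryFormD_tmul_u0,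
    symmetryFormD_translation isTranslation_t00, gravityPsi_single_plus, wedge_coframe_self,
    TensorProduct.zero_tmul, wedge_coframe_comm 0 0, TensorProduct.neg_tmul]
  module

/-- The interaction of the two plane waves. -/
theorem wave_bracket_plus : localSymmetry.br (Matrix.single 0 0 1) (Matrix.single 0 1 1)
    (coframe 1 0 ⊗ₜ ((1 / 2 : ℂ) • (symmetryBasis .w0 - symmetryBasis .t10)))
    (coframe 0 0 ⊗ₜ ((-1 / 2 : ℂ) • (symmetryBasis .u0 + symmetryBasis .t00))) =
    ((1 / 2 : ℂ) • wedge (coframe 0 0) (coframe 1 0)) ⊗ₜ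
      ((1 / 2 : ℂ) • (symmetryBasis .u0 + symmetryBasis .t00)) := by
  have h1 : localSymmetry.act (Matrix.single 0 1 1)
      ((1 / 2 : ℂ) • (symmetryBasis .w0 - symmetryBasis .t10)) (coframe 0 0) =
      (1 / 2 : ℂ) • coframe 0 0 := by
    change rotate _ _ + translate _ _ • _ = _
    funext a; cases a <;> simp [rotate_apply, rotateFun, translate_apply, coframe, oneForm]
  have h2 : localSymmetry.act (Matrix.single 0 0 1)
      ((-1 / 2 : ℂ) • (symmetryBasis .u0 + symmetryBasis .t00)) (coframe 1 0) =
      (-1 / 2 : ℂ) • coframe 0 0 := by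
    change rotate _ _ + translate _ _ • _ = _
    funext a; cases a <;> simp [rotate_apply, rotateFun, translate_apply, coframe, oneForm]
  have h3 : localSymmetry.lie ((1 / 2 : ℂ) • (symmetryBasis .w0 - symmetryBasis .t10))
      ((-1 / 2 : ℂ) • (symmetryBasis .u0 + symmetryBasis .t00)) = 0 := by
    change symmetryLie _ _ = _
    funext a; cases a <;> simp [symmetryLie_apply, symmetryLieFun]
  rw [LieAction.br_tmul, h1, h2, h3]
  change wedge _ _ ⊗ₜ _ - wedge _ _ ⊗ₜ _ + _ = _
  rw [map_smul, map_smul, LinearMap.smul_apply, wedge_coframe_self, smul_zero,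
    TensorProduct.zero_tmul, TensorProduct.tmul_zero, wedge_coframe_comm _ _ 0 0]
  simp only [TensorProduct.tmul_smul, ← TensorProduct.smul_tmul', TensorProduct.neg_tmul]
  module

theorem symmetryFormD_bracket_plus : symmetryFormD (Matrix.single 0 0 1 + Matrix.single 0 1 1)
    (((1 / 2 : ℂ) • wedge (coframe 0 0) (coframe 1 0)) ⊗ₜ
      ((1 / 2 : ℂ) • (symmetryBasis .u0 + symmetryBasis .t00))) =
    gravityPsi (pairSingle 1 (.inr (.inl (0, 0))) (-1 / 2)) := by
  rw [gravityPsi_single_plus', TensorProduct.tmul_smul, map_smul, TensorProduct.tmul_add, map_add,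
    symmetryFormD_tmul_u0, symmetryFormD_translation isTranslation_t00]
  simp only [map_add, map_smul, LinearMap.add_apply, wedge_wedge_coframe_self, smul_zero,
    TensorProduct.zero_tmul, add_zero, zero_add]
  module

/-- The interaction of the two plane waves. -/
theorem wave_bracket_minus : localSymmetry.br (Matrix.single 0 0 1) (Matrix.single 1 0 1)
    (coframe 0 1 ⊗ₜ ((1 / 2 : ℂ) • (symmetryBasis .u0 - symmetryBasis .t01)))
    (coframe 0 0 ⊗ₜ ((-1 / 2 : ℂ) • (symmetryBasis .w0 + symmetryBasis .t00))) =
    ((1 / 2 : ℂ) • wedge (coframe 0 0) (coframe 0 1)) ⊗ₜ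
      ((1 / 2 : ℂ) • (symmetryBasis .w0 + symmetryBasis .t00)) := by
  have h1 : localSymmetry.act (Matrix.single 1 0 1)
      ((1 / 2 : ℂ) • (symmetryBasis .u0 - symmetryBasis .t01)) (coframe 0 0) =
      (1 / 2 : ℂ) • coframe 0 0 := by
    change rotate _ _ + translate _ _ • _ = _
    funext a; cases a <;> simp [rotate_apply, rotateFun, translate_apply, coframe, oneForm]
  have h2 : localSymmetry.act (Matrix.single 0 0 1)
      ((-1 / 2 : ℂ) • (symmetryBasis .w0 + symmetryBasis .t00)) (coframe 0 1) =
      (-1 / 2 : ℂ) • coframe 0 0 := by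
    change rotate _ _ + translate _ _ • _ = _
    funext a; cases a <;> simp [rotate_apply, rotateFun, translate_apply, coframe, oneForm]
  have h3 : localSymmetry.lie ((1 / 2 : ℂ) • (symmetryBasis .u0 - symmetryBasis .t01))
      ((-1 / 2 : ℂ) • (symmetryBasis .w0 + symmetryBasis .t00)) = 0 := by
    change symmetryLie _ _ = _
    funext a; cases a <;> simp [symmetryLie_apply, symmetryLieFun]
  rw [LieAction.br_tmul, h1, h2, h3]
  change wedge _ _ ⊗ₜ _ - wedge _ _ ⊗ₜ _ + _ = _
  rw [map_smul, map_smul, LinearMap.smul_apply, wedge_coframe_self, smul_zero,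
    TensorProduct.zero_tmul, TensorProduct.tmul_zero, wedge_coframe_comm _ _ 0 0]
  simp only [TensorProduct.tmul_smul, ← TensorProduct.smul_tmul', TensorProduct.neg_tmul]
  module

theorem symmetryFormD_bracket_minus : symmetryFormD (Matrix.single 0 0 1 + Matrix.single 1 0 1)
    (((1 / 2 : ℂ) • wedge (coframe 0 0) (coframe 0 1)) ⊗ₜ
      ((1 / 2 : ℂ) • (symmetryBasis .w0 + symmetryBasis .t00))) =
    gravityPsi (pairSingle (-1) (.inr (.inl (0, 0))) (-1 / 2)) := by
  rw [gravityPsi_single_minus', TensorProduct.tmul_smul, map_smul, TensorProduct.tmul_add, map_add,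
    symmetryFormD_tmul_w0, symmetryFormD_translation isTranslation_t00]
  simp only [map_add, map_smul, LinearMap.add_apply, wedge_wedge_coframe_self, smul_zero,
    TensorProduct.zero_tmul, add_zero, zero_add]
  module

/-- In the range of the first differential, the components `(0, 0)` and `(1, 0)` agree. -/
theorem pairSingle_not_mem_range_one {N : ℕ} [NeZero N] {c : ℂ} (hc : c ≠ 0) :
    (pairSingle 1 (.inr (.inl (0, 0))) c : PairSpace N ℂ) 1 ∉
      LinearMap.range (gammaD N ℂ 1 (Matrix.single 0 0 1 + Matrix.single 0 1 1)) := by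
  rintro ⟨w, hw⟩
  obtain ⟨-, h0, h1, -⟩ := pairD_one (Matrix.single 0 0 1 + Matrix.single 0 1 1) fun _ : ℤˣ => w
  have e0 := (congrFun hw (.inr (.inl (0, 0)))).symm.trans (h0 0)
  have e1 := (congrFun hw (.inr (.inl (1, 0)))).symm.trans (h1 0)
  simp [pairSingle] at e0 e1
  exact hc (e0.trans e1.symm)

theorem pairSingle_not_mem_range_neg_one {N : ℕ} [NeZero N] {c : ℂ} (hc : c ≠ 0) :
    (pairSingle (-1) (.inr (.inl (0, 0))) c : PairSpace N ℂ) (-1) ∉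
      LinearMap.range (gammaD N ℂ (-1) (Matrix.single 0 0 1 + Matrix.single 1 0 1)) := by
  rintro ⟨w, hw⟩
  obtain ⟨-, h0, h1, -⟩ := pairD_neg_one (Matrix.single 0 0 1 + Matrix.single 1 0 1) fun _ : ℤˣ => w
  have e0 := (congrFun hw (.inr (.inl (0, 0)))).symm.trans (h0 0)
  have e1 := (congrFun hw (.inr (.inl (1, 0)))).symm.trans (h1 0)
  simp [pairSingle] at e0 e1
  exact hc (e0.trans e1.symm)

/-- The interaction of two plane waves of opposite helicities. -/
def gravityExampleOne : gravity.NonvanishingExample 1 where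
  k := ![Matrix.single 0 0 1, Matrix.single 0 1 1]
  v := ![gravityPresentation.proj
      (coframe 1 0 ⊗ₜ ((1 / 2 : ℂ) • (symmetryBasis .w0 - symmetryBasis .t10))),
    gravityPresentation.proj
      (coframe 0 0 ⊗ₜ ((-1 / 2 : ℂ) • (symmetryBasis .u0 + symmetryBasis .t00)))]
  z := ![pairSingle (-1) (.inl 0) 1, pairSingle 1 (.inl 0) 1]
  y := pairSingle 1 (.inr (.inl (0, 0))) (-1 / 2)
  k_ne j := by fin_cases j <;> exact single_ne_zero _ _
  k_ne' h := by simpa using congrFun (congrFun h 0) 0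
  v_mem j := by
    fin_cases j <;> exact gravityPresentation.proj_mem (GradedCommAlgebra.tmul_mem (oneForm_mem _) _)
  z_mem j := by fin_cases j <;> exact pairSingle_inl_mem _ _ _
  rep j := by
    fin_cases j
    · exact add_zero (pairSingle (N := 4) (-1) (.inl 0) 1) ▸
        FiberDGLA.quotient_rep (F := symmetryForms) symmetryFormD_wave_minus
    · exact add_zero (pairSingle (N := 4) 1 (.inl 0) 1) ▸
        FiberDGLA.quotient_rep (F := symmetryForms) symmetryFormD_wave_plus'
  y_mem := pairSingle_mem 1 (.inr (.inl (0, 0))) _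
  rep' := by
    have h := symmetryFormD_bracket_plus
    rw [← wave_bracket_plus] at h
    exact add_zero (pairSingle (N := 4) 1 (.inr (.inl (0, 0))) (-1 / 2)) ▸
        FiberDGLA.quotient_rep (F := symmetryForms) h
  z_zero := by simp [pairSingle]
  z_one := by simp [pairSingle]
  y_not := pairSingle_not_mem_range_one (by norm_num)

/-- The interaction of two plane waves of opposite helicities, with the roles of the helicities
exchanged. -/
def gravityExampleNegOne : gravity.NonvanishingExample (-1) where
  k := ![Matrix.single 0 0 1, Matrix.single 1 0 1]
  v := ![gravityPresentation.proj
      (coframe 0 1 ⊗ₜ ((1 / 2 : ℂ) • (symmetryBasis .u0 - symmetryBasis .t01))),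
    gravityPresentation.proj
      (coframe 0 0 ⊗ₜ ((-1 / 2 : ℂ) • (symmetryBasis .w0 + symmetryBasis .t00)))]
  z := ![pairSingle 1 (.inl 0) 1, pairSingle (-1) (.inl 0) 1]
  y := pairSingle (-1) (.inr (.inl (0, 0))) (-1 / 2)
  k_ne j := by fin_cases j <;> exact single_ne_zero _ _
  k_ne' h := by simpa using congrFun (congrFun h 0) 0
  v_mem j := by
    fin_cases j <;> exact gravityPresentation.proj_mem (GradedCommAlgebra.tmul_mem (oneForm_mem _) _)
  z_mem j := by fin_cases j <;> exact pairSingle_inl_mem _ _ _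
  rep j := by
    fin_cases j
    · exact add_zero (pairSingle (N := 4) 1 (.inl 0) 1) ▸
        FiberDGLA.quotient_rep (F := symmetryForms) symmetryFormD_wave_plus
    · exact add_zero (pairSingle (N := 4) (-1) (.inl 0) 1) ▸
        FiberDGLA.quotient_rep (F := symmetryForms) symmetryFormD_wave_minus'
  y_mem := pairSingle_mem (-1) (.inr (.inl (0, 0))) _
  rep' := by
    have h := symmetryFormD_bracket_minus
    rw [← wave_bracket_minus] at h
    exact add_zero (pairSingle (N := 4) (-1) (.inr (.inl (0, 0))) (-1 / 2)) ▸
        FiberDGLA.quotient_rep (F := symmetryForms) h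
  z_zero := by simp [pairSingle]
  z_one := by simp [pairSingle]
  y_not := pairSingle_not_mem_range_neg_one (by norm_num)

end TreeAmp

/-! ### Gauge theories from commutative dg algebras -/

namespace TreeAmp

open scoped TensorProduct

/-- A commutative dg algebra with momentum grading and constant product, whose underlying complex
is quasi-isomorphic to the Lorentz equivariant complex for nonzero momenta. -/
structure GaugeAlgebra (N : ℕ) (Q : Type) [AddCommGroup Q] [Module ℂ Q] extends
    GradedCommAlgebra Q where
  d : Mom → Q →ₗ[ℂ] Q
  d_mem : ∀ k i, ∀ x ∈ gr i, d k x ∈ gr (i + 1)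
  d_d : ∀ k x, d k (d k x) = 0
  d_poly : IsPolynomial d
  leibniz : ∀ k l i, ∀ x ∈ gr i, ∀ y,
    d (k + l) (mul x y) = mul (d k x) y + i.negOnePow • mul x (d l y)
  toGamma : Mom → Q →ₗ[ℂ] PairSpace N ℂ
  toGamma_poly : IsPolynomial toGamma
  toGamma_mem : ∀ k i, ∀ x ∈ gr i, toGamma k x ∈ pairGr N ℂ i
  toGamma_d : ∀ k x, toGamma k (d k x) = pairD N ℂ k (toGamma k x)
  quasiIso : ∀ k, k ≠ 0 → IsQuasiIso (d k) (pairD N ℂ k) (toGamma k)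

namespace GaugeAlgebra

variable {N : ℕ} {Q : Type} [AddCommGroup Q] [Module ℂ Q] (G : GaugeAlgebra N Q)

/-- The underlying complex, as an abelian dgLa. -/
def toComplex : FieldTheoryData N ℂ Q where
  gr := G.gr
  isInternal := G.isInternal
  d := G.d
  br _ _ := 0
  d_mem := G.d_mem
  br_mem _ _ _ _ _ _ _ _ := zero_mem _
  d_d := G.d_d
  antisymm _ _ _ _ _ _ _ _ := by simp
  jacobi _ _ _ _ _ _ _ _ _ _ _ _ := by simp
  leibniz _ _ _ _ _ _ := by simp
  d_poly := G.d_poly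
  br_poly _ _ _ := ⟨0, fun _ _ => by simp [polyEval₂]⟩
  toGamma := G.toGamma
  toGamma_poly := G.toGamma_poly
  toGamma_mem := G.toGamma_mem
  toGamma_d := G.toGamma_d
  quasiIso := G.quasiIso

end GaugeAlgebra

/-! ### Coefficients in a Lie algebra -/

section Color

variable (N : ℕ) (U : Type*) [AddCommGroup U] [Module ℂ U] [FiniteDimensional ℂ U]

/-- Coordinates for the coefficients. -/
abbrev Color : Type := Fin (Module.finrank ℂ U) → ℂ

/-- The identification of the coefficients with their coordinates. -/
def colorEquiv : U ≃ₗ[ℂ] Color U := (Module.finBasis ℂ U).equivFun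

variable {N U}

/-- The map `z ⊗ a ↦ pureTensor z a`. -/
def pureMap : PairSpace N ℂ →ₗ[ℂ] U →ₗ[ℂ] PairSpace N U :=
  LinearMap.mk₂ ℂ pureTensor (fun z z' a => by funext σ b; simp [pureTensor, add_smul])
    (fun c z a => by funext σ b; simp [pureTensor, mul_smul])
    (fun z a a' => by funext σ b; simp [pureTensor])
    (fun c z a => by funext σ b; simp [pureTensor, smul_comm c])

/-- The map of coefficients given by a linear functional. -/
def pairMap (φ : U →ₗ[ℂ] ℂ) : PairSpace N U →ₗ[ℂ] PairSpace N ℂ where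
  toFun z σ a := φ (z σ a)
  map_add' z z' := by funext σ a; simp
  map_smul' c z := by funext σ a; simp

theorem pairMap_pureTensor (φ : U →ₗ[ℂ] ℂ) (z : PairSpace N ℂ) (a : U) :
    pairMap φ (pureTensor z a) = φ a • z := by
  funext σ b
  change φ (z σ b • a) = φ a • z σ b
  rw [map_smul, smul_eq_mul, smul_eq_mul, mul_comm]

theorem pairMap_pairD (φ : U →ₗ[ℂ] ℂ) (k : Mom) (z : PairSpace N U) :
    pairMap φ (pairD N U k z) = pairD N ℂ k (pairMap φ z) := by
  funext σ a
  change φ (pairD N U k z σ a) = _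
  rw [pairD_apply, pairD_apply, map_sum]
  exact Finset.sum_congr rfl fun b _ => map_smul _ _ _

theorem pairD_pureTensor (k : Mom) (z : PairSpace N ℂ) (a : U) :
    pairD N U k (pureTensor z a) = pureTensor (pairD N ℂ k z) a := by
  funext σ b
  rw [pairD_apply]
  change _ = pairD N ℂ k z σ b • a
  rw [pairD_apply, Finset.sum_smul]
  exact Finset.sum_congr rfl fun c _ => smul_smul _ _ _

theorem lorentzPair_pureTensor (g : Lorentz) (z : PairSpace N ℂ) (a : U) :
    lorentzPair N U g (pureTensor z a) = pureTensor (lorentzPair N ℂ g z) a := by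
  funext σ b
  rw [lorentzPair_apply]
  change _ = lorentzPair N ℂ g z σ b • a
  rw [lorentzPair_apply, Finset.sum_smul]
  exact Finset.sum_congr rfl fun c _ => smul_smul _ _ _

theorem pureTensor_mem {i : ℤ} {z : PairSpace N ℂ} (hz : z ∈ pairGr N ℂ i) (a : U) :
    pureTensor z a ∈ pairGr N U i := by
  intro σ b hb
  rw [pureTensor, hz σ b hb, zero_smul]

/-- The coordinate functionals of the coefficients. -/
def colorCoord (c : Fin (Module.finrank ℂ U)) : U →ₗ[ℂ] ℂ :=
  LinearMap.proj c ∘ₗ (colorEquiv U).toLinearMap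

theorem sum_pureTensor (z : PairSpace N U) :
    ∑ c, pureTensor (pairMap (colorCoord c) z) ((colorEquiv U).symm (Pi.single c 1)) = z := by
  funext σ a
  rw [Finset.sum_apply, Finset.sum_apply]
  change ∑ c, colorEquiv U (z σ a) c • (colorEquiv U).symm (Pi.single c 1) = z σ a
  simp_rw [← map_smul, ← map_sum]
  rw [← pi_eq_sum_univ' (colorEquiv U (z σ a)), LinearEquiv.symm_apply_apply]

end Color

namespace GaugeAlgebra

variable {N : ℕ} {Q : Type} [AddCommGroup Q] [Module ℂ Q] (G : GaugeAlgebra N Q)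

section

variable (U : Type*) [AddCommGroup U] [Module ℂ U] [FiniteDimensional ℂ U]

/-- The map to the Lorentz equivariant complex with coefficients. -/
def toGammaTensor (k : Mom) : Q ⊗[ℂ] Color U →ₗ[ℂ] PairSpace N U :=
  TensorProduct.lift (pureMap.compl₁₂ (G.toGamma k) (colorEquiv U).symm.toLinearMap)

variable {U}

theorem toGammaTensor_tmul (k : Mom) (q : Q) (X : Color U) :
    G.toGammaTensor U k (q ⊗ₜ X) = pureTensor (G.toGamma k q) ((colorEquiv U).symm X) := rfl

theorem pairMap_toGammaTensor (c : Fin (Module.finrank ℂ U)) (k : Mom) (x : Q ⊗[ℂ] Color U) :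
    pairMap (colorCoord c) (G.toGammaTensor U k x) = G.toGamma k (component c x) := by
  induction x using TensorProduct.induction_on with
  | zero => simp
  | add x y hx hy => simp only [map_add, hx, hy]
  | tmul q X =>
    rw [toGammaTensor_tmul, pairMap_pureTensor, component_tmul, map_smul, colorCoord,
      LinearMap.comp_apply, LinearEquiv.coe_coe, LinearEquiv.apply_symm_apply]
    rfl

theorem component_eq_zero_of_closed {k : Mom} {x : Q ⊗[ℂ] Color U}
    (hx : (G.d k).rTensor _ x = 0) (c : Fin (Module.finrank ℂ U)) :
    G.d k (component c x) = 0 := by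
  rw [← component_rTensor, hx, map_zero]

theorem quasiIso_tensor (k : Mom) (hk : k ≠ 0) :
    IsQuasiIso ((G.d k).rTensor (Color U)) (pairD N U k) (G.toGammaTensor U k) where
  inj x w hx h := by
    have h1 (c : Fin (Module.finrank ℂ U)) : ∃ y, G.d k y = component c x := by
      refine (G.quasiIso k hk).inj _ (pairMap (colorCoord c) w)
        (G.component_eq_zero_of_closed hx c) ?_
      rw [← pairMap_toGammaTensor, h, pairMap_pairD]
    choose y hy using h1
    refine ⟨∑ c, y c ⊗ₜ Pi.single c 1, ?_⟩
    simp only [map_sum, LinearMap.rTensor_tmul, hy]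
    exact sum_component x
  surj z hz := by
    have h1 (c : Fin (Module.finrank ℂ U)) : ∃ x w, G.d k x = 0 ∧
        G.toGamma k x = pairMap (colorCoord c) z + pairD N ℂ k w := by
      refine (G.quasiIso k hk).surj _ ?_
      rw [← pairMap_pairD, hz, map_zero]
    choose x w hx hw using h1
    refine ⟨∑ c, x c ⊗ₜ Pi.single c 1,
      ∑ c, pureTensor (w c) ((colorEquiv U).symm (Pi.single c 1)), ?_, ?_⟩
    · simp only [map_sum, LinearMap.rTensor_tmul, hx, TensorProduct.zero_tmul,
        Finset.sum_const_zero]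
    · conv_rhs => rw [← sum_pureTensor z]
      rw [map_sum, map_sum, ← Finset.sum_add_distrib]
      refine Finset.sum_congr rfl fun c _ => ?_
      rw [toGammaTensor_tmul, hw, pairD_pureTensor]
      exact LinearMap.map_add₂ pureMap _ _ _

/-- Maps of complexes extend to coefficients. -/
theorem toGammaTensor_map {T : Q →ₗ[ℂ] Q} {M : PairSpace N ℂ →ₗ[ℂ] PairSpace N ℂ}
    {M' : PairSpace N U →ₗ[ℂ] PairSpace N U} {k k' : Mom}
    (hM : ∀ z a, M' (pureTensor z a) = pureTensor (M z) a)
    (h : ∀ v, G.d k v = 0 → ∃ w, G.toGamma k' (T v) = M (G.toGamma k v) + pairD N ℂ k' w)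
    (x : Q ⊗[ℂ] Color U) (hx : (G.d k).rTensor _ x = 0) :
    ∃ w, G.toGammaTensor U k' (T.rTensor _ x) = M' (G.toGammaTensor U k x) + pairD N U k' w := by
  choose w hw using fun c => h _ (G.component_eq_zero_of_closed hx c)
  refine ⟨∑ c, pureTensor (w c) ((colorEquiv U).symm (Pi.single c 1)), ?_⟩
  rw [← sum_component x]
  simp only [map_sum]
  rw [← Finset.sum_add_distrib]
  refine Finset.sum_congr rfl fun c _ => ?_
  rw [LinearMap.rTensor_tmul, toGammaTensor_tmul, toGammaTensor_tmul, hw, hM, pairD_pureTensor]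
  exact LinearMap.map_add₂ pureMap _ _ _

end

variable (𝔲 : Type*) [LieRing 𝔲] [LieAlgebra ℂ 𝔲] [FiniteDimensional ℂ 𝔲]

/-- The Lie algebra `𝔲` in coordinates, acting trivially. -/
def colorAction : LieAction G.toGradedCommAlgebra (Color 𝔲) where
  lie := LinearMap.mk₂ ℂ
    (fun X Y => colorEquiv 𝔲 ⁅(colorEquiv 𝔲).symm X, (colorEquiv 𝔲).symm Y⁆)
    (fun X X' Y => by rw [map_add, add_lie, map_add])
    (fun c X Y => by rw [map_smul, smul_lie, map_smul])
    (fun X Y Y' => by rw [map_add, lie_add, map_add])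
    (fun c X Y => by rw [map_smul, lie_smul, map_smul])
  lie_skew X Y := by
    rw [LinearMap.mk₂_apply, LinearMap.mk₂_apply, ← lie_skew, map_neg]
  lie_jacobi X Y Z := by
    simp only [LinearMap.mk₂_apply, LinearEquiv.symm_apply_apply]
    rw [leibniz_lie, map_add]
  rot := 0
  rot_mem _ _ _ _ := zero_mem _
  rot_mul _ _ _ := by simp
  rot_lie _ _ _ := by simp
  trans := 0
  trans_lie _ _ _ := rfl

theorem colorAction_br (k l : Mom) (q q' : Q) (X Y : 𝔲) :
    (G.colorAction 𝔲).br k l (q ⊗ₜ colorEquiv 𝔲 X) (q' ⊗ₜ colorEquiv 𝔲 Y) =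
      G.mul q q' ⊗ₜ colorEquiv 𝔲 ⁅X, Y⁆ := by
  have h (k : Mom) (X : Color 𝔲) (q : Q) : (G.colorAction 𝔲).act k X q = 0 := by
    rw [LieAction.act_apply]
    exact (zero_add _).trans (zero_smul _ _)
  have h2 : (G.colorAction 𝔲).lie (colorEquiv 𝔲 X) (colorEquiv 𝔲 Y) = colorEquiv 𝔲 ⁅X, Y⁆ := by
    simp [colorAction]
  rw [LieAction.br_tmul, h, h, map_zero, map_zero, LinearMap.zero_apply, TensorProduct.zero_tmul,
    TensorProduct.zero_tmul, sub_zero, zero_add, h2]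

theorem colorAction_br_tmul (k l : Mom) (q q' : Q) (X Y : Color 𝔲) :
    (G.colorAction 𝔲).br k l (q ⊗ₜ X) (q' ⊗ₜ Y) =
      G.mul q q' ⊗ₜ (G.colorAction 𝔲).lie X Y := by
  have h := G.colorAction_br 𝔲 k l q q' ((colorEquiv 𝔲).symm X) ((colorEquiv 𝔲).symm Y)
  rwa [LinearEquiv.apply_symm_apply, LinearEquiv.apply_symm_apply] at h

/-- The gauge theory: the commutative dg algebra with coefficients in `𝔲`. -/
def gaugeTheory : FieldTheoryData N 𝔲 (Q ⊗[ℂ] Color 𝔲) where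
  gr := G.tensorGr (Color 𝔲)
  isInternal := G.tensorGr_isInternal (Color 𝔲)
  d k := (G.d k).rTensor (Color 𝔲)
  br := (G.colorAction 𝔲).br
  d_mem k i x hx := by
    refine GradedCommAlgebra.tensorGr_induction
      (p := fun x => (G.d k).rTensor (Color 𝔲) x ∈ G.tensorGr (Color 𝔲) (i + 1)) hx (by simp)
      (fun ω hω X => GradedCommAlgebra.tmul_mem (G.d_mem k i ω hω) X)
      fun x y h h' => by rw [map_add]; exact add_mem h h'
  br_mem := (G.colorAction 𝔲).br_mem
  d_d k x := by
    rw [← LinearMap.rTensor_comp_apply, show G.d k ∘ₗ G.d k = 0 from LinearMap.ext (G.d_d k),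
      LinearMap.rTensor_zero, LinearMap.zero_apply]
  antisymm := (G.colorAction 𝔲).br_antisymm
  jacobi := (G.colorAction 𝔲).br_jacobi
  leibniz k l i x hx y := by
    refine GradedCommAlgebra.tensorGr_induction (p := fun x => (G.d (k + l)).rTensor (Color 𝔲)
      ((G.colorAction 𝔲).br k l x y) = (G.colorAction 𝔲).br k l ((G.d k).rTensor _ x) y +
        i.negOnePow • (G.colorAction 𝔲).br k l x ((G.d l).rTensor _ y)) hx (by simp) ?_
      fun x x' h h' => by simp only [map_add, LinearMap.add_apply, h, h', smul_add]; abel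
    intro ω hω X
    induction y using TensorProduct.induction_on with
    | zero => simp
    | add y y' h h' => simp only [map_add, h, h', smul_add]; abel
    | tmul η Y =>
      simp only [LinearMap.rTensor_tmul, colorAction_br_tmul]
      rw [G.leibniz k l i ω hω, TensorProduct.add_tmul, LieAction.negOnePow_smul_tmul]
  d_poly x φ := by
    induction x using TensorProduct.induction_on with
    | zero => exact ⟨0, fun k => by simp [polyEval]⟩
    | add x x' h h' =>
      obtain ⟨P, hP⟩ := h
      obtain ⟨P', hP'⟩ := h'
      exact ⟨P + P', fun k => by simp [hP, hP', polyEval]⟩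
    | tmul q X => exact G.d_poly q (φ ∘ₗ (TensorProduct.mk ℂ Q (Color 𝔲)).flip X)
  br_poly := (G.colorAction 𝔲).br_poly
  toGamma := G.toGammaTensor 𝔲
  toGamma_poly x φ := by
    induction x using TensorProduct.induction_on with
    | zero => exact ⟨0, fun k => by simp [polyEval]⟩
    | add x x' h h' =>
      obtain ⟨P, hP⟩ := h
      obtain ⟨P', hP'⟩ := h'
      exact ⟨P + P', fun k => by simp [hP, hP', polyEval]⟩
    | tmul q X => exact G.toGamma_poly q (φ ∘ₗ pureMap.flip ((colorEquiv 𝔲).symm X))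
  toGamma_mem k i x hx := by
    refine GradedCommAlgebra.tensorGr_induction
      (p := fun x => G.toGammaTensor 𝔲 k x ∈ pairGr N 𝔲 i) hx (by simp)
      (fun ω hω X => pureTensor_mem (G.toGamma_mem k i ω hω) _)
      fun x y h h' => by rw [map_add]; exact add_mem h h'
  toGamma_d k x := by
    induction x using TensorProduct.induction_on with
    | zero => simp
    | add x y hx hy => simp only [map_add, hx, hy]
    | tmul q X =>
      rw [LinearMap.rTensor_tmul, toGammaTensor_tmul, toGammaTensor_tmul, G.toGamma_d,
        pairD_pureTensor]
  quasiIso := G.quasiIso_tensor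

end GaugeAlgebra

end TreeAmp

/-! ### Symmetries and interactions of gauge theories -/

namespace TreeAmp

open scoped TensorProduct

namespace GaugeAlgebra

variable {N : ℕ} {Q : Type} [AddCommGroup Q] [Module ℂ Q] [FiniteDimensional ℂ Q]
  {G : GaugeAlgebra N Q} {𝔲 : Type*} [LieRing 𝔲] [LieAlgebra ℂ 𝔲] [FiniteDimensional ℂ 𝔲]

/-- A multiplicative symmetry of the commutative dg algebra is a symmetry of the gauge theory. -/
theorem isSymmetry_tensor {τ : Mom → Mom} {T : Q →ₗ[ℂ] Q} {l : ℂ}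
    (add : ∀ k k', τ (k + k') = τ k + τ k') (zero : τ 0 = 0)
    (mem : ∀ i, ∀ x ∈ G.gr i, T x ∈ G.gr i) (d : ∀ k x, G.d (τ k) (T x) = l • T (G.d k x))
    (mul : ∀ x y, G.mul (T x) (T y) = T (G.mul x y)) :
    (G.gaugeTheory 𝔲).IsSymmetry τ (T.rTensor (Color 𝔲)) l 1 where
  add := add
  zero := zero
  mem i x hx := GradedCommAlgebra.map_mem_tensorGr (G := G.toGradedCommAlgebra) (mem i) _ x hx
  d k x := by
    change (G.d (τ k)).rTensor _ (T.rTensor _ x) = l • T.rTensor _ ((G.d k).rTensor _ x)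
    rw [← LinearMap.rTensor_comp_apply, ← LinearMap.rTensor_comp_apply,
      show G.d (τ k) ∘ₗ T = l • T ∘ₗ G.d k from LinearMap.ext (d k), LinearMap.rTensor_smul,
      LinearMap.smul_apply]
  br k k' x y := by
    have hact (k : Mom) (X : Color 𝔲) (q : Q) : (G.colorAction 𝔲).act k X q = 0 := by
      rw [LieAction.act_apply]
      exact (zero_add _).trans (zero_smul _ _)
    refine LieAction.br_map (A := G.colorAction 𝔲) (T := LinearMap.id) (m := 1) mul
      (fun k X q => ?_) (fun X Y => (one_smul _ _).symm) k k' x y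
    rw [hact, hact, map_zero, smul_zero]

variable (𝔲) in
/-- The classes with coefficients are represented by the products of the representatives with the
coefficients. -/
theorem rep_tensor {k : Mom} {q : Q} {z : PairSpace N ℂ} (h : G.toComplex.Rep k q z) (X : 𝔲) :
    (G.gaugeTheory 𝔲).Rep k (q ⊗ₜ colorEquiv 𝔲 X) (pureTensor z X) where
  closed := by
    change (G.d k).rTensor _ (q ⊗ₜ colorEquiv 𝔲 X) = 0
    rw [LinearMap.rTensor_tmul, show G.d k q = 0 from h.closed, TensorProduct.zero_tmul]
  closed' := by
    rw [LinearMap.mem_ker, pairD_pureTensor, LinearMap.mem_ker.1 h.closed']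
    exact LinearMap.map_zero₂ pureMap X
  eq := by
    obtain ⟨w, hw⟩ := h.eq
    refine ⟨pureTensor w X, ?_⟩
    change G.toGammaTensor 𝔲 k (q ⊗ₜ colorEquiv 𝔲 X) = _
    rw [toGammaTensor_tmul, LinearEquiv.symm_apply_apply, show G.toGamma k q = _ from hw,
      pairD_pureTensor]
    exact LinearMap.map_add₂ pureMap _ _ _

variable (G)

/-- The product of closed elements is closed. -/
theorem d_mul {k l : Mom} {i : ℤ} {x y : Q} (hx : x ∈ G.gr i) (h : G.d k x = 0) (h' : G.d l y = 0) :
    G.d (k + l) (G.mul x y) = 0 := by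
  rw [G.leibniz k l i x hx, h, h', map_zero, map_zero, LinearMap.zero_apply, smul_zero, add_zero]

variable {G} in
/-- An interaction without coefficients gives one with coefficients in a non-Abelian Lie algebra. -/
theorem nonvanishingExample_tensor {σ : ℤˣ} {k : Fin 2 → Mom} {q : Fin 2 → Q}
    {z : Fin 2 → PairSpace N ℂ} {y : PairSpace N ℂ} (k_ne : ∀ j, k j ≠ 0) (k_ne' : k 0 + k 1 ≠ 0)
    (q_mem : ∀ j, q j ∈ G.gr 1) (z_mem : ∀ j, z j ∈ pairGr N ℂ 1)
    (rep : ∀ j, G.toComplex.Rep (k j) (q j) (z j)) (y_mem : y ∈ pairGr N ℂ 2)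
    (rep' : G.toComplex.Rep (k 0 + k 1) (G.mul (q 0) (q 1)) y) (z_zero : z 0 σ = 0)
    (z_one : z 1 (-σ) = 0) (y_not : y σ ∉ LinearMap.range (gammaD N ℂ σ (k 0 + k 1)))
    {X : Fin 2 → 𝔲} (hX : ⁅X 0, X 1⁆ ≠ 0) :
    Nonempty ((G.gaugeTheory 𝔲).NonvanishingExample σ) := by
  obtain ⟨φ, hφ⟩ : ∃ φ : 𝔲 →ₗ[ℂ] ℂ, φ ⁅X 0, X 1⁆ ≠ 0 := by
    by_contra! h
    exact hX ((Module.forall_dual_apply_eq_zero_iff ℂ _).1 h)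
  exact ⟨{
    k := k
    v := fun j => q j ⊗ₜ colorEquiv 𝔲 (X j)
    z := fun j => pureTensor (z j) (X j)
    y := pureTensor y ⁅X 0, X 1⁆
    k_ne := k_ne
    k_ne' := k_ne'
    v_mem := fun j => GradedCommAlgebra.tmul_mem (q_mem j) _
    z_mem := fun j => pureTensor_mem (z_mem j) _
    rep := fun j => rep_tensor 𝔲 (rep j) (X j)
    y_mem := pureTensor_mem y_mem _
    rep' := by
      change (G.gaugeTheory 𝔲).Rep _ ((G.colorAction 𝔲).br _ _ _ _) _
      rw [colorAction_br]
      exact rep_tensor 𝔲 rep' _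
    z_zero := by
      funext a
      change z 0 σ a • X 0 = 0
      rw [z_zero, Pi.zero_apply, zero_smul]
    z_one := by
      funext a
      change z 1 (-σ) a • X 1 = 0
      rw [z_one, Pi.zero_apply, zero_smul]
    y_not := by
      rintro ⟨w, hw⟩
      refine y_not ⟨(φ ⁅X 0, X 1⁆)⁻¹ • pairMap φ (fun _ => w) σ, ?_⟩
      have h1 := congrFun (pairMap_pairD φ (k 0 + k 1) fun _ : ℤˣ => w) σ
      have h2 : pairMap φ (pairD N 𝔲 (k 0 + k 1) fun _ : ℤˣ => w) σ = φ ⁅X 0, X 1⁆ • y σ := by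
        rw [← Pi.smul_apply, ← pairMap_pureTensor]
        funext a
        exact congrArg φ (congrFun hw a)
      rw [map_smul, ← inv_smul_smul₀ hφ (y σ), ← h2, h1]
      rfl }⟩

/-- The cubic interaction without coefficients: the product of representatives, mapped back to the
Lorentz equivariant complex. -/
def cubic (k₁ k₂ : Mom) : PairSpace N ℂ →ₗ[ℂ] PairSpace N ℂ →ₗ[ℂ] PairSpace N ℂ :=
  open Classical in
  if h : k₁ ≠ 0 ∧ k₂ ≠ 0 then
    (G.mul.compl₁₂ (G.toComplex.ofGamma k₁ h.1) (G.toComplex.ofGamma k₂ h.2)).compr₂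
      (G.toGamma (k₁ + k₂))
  else 0

theorem cubic_apply {k₁ k₂ : Mom} (h₁ : k₁ ≠ 0) (h₂ : k₂ ≠ 0) (z₁ z₂ : PairSpace N ℂ) :
    G.cubic k₁ k₂ z₁ z₂ = G.toGamma (k₁ + k₂)
      (G.mul (G.toComplex.ofGamma k₁ h₁ z₁) (G.toComplex.ofGamma k₂ h₂ z₂)) := by
  rw [cubic, dif_pos ⟨h₁, h₂⟩]
  rfl

theorem bracketProportionalToLie :
    BracketProportionalToLie (G.gaugeTheory 𝔲).X (G.gaugeTheory 𝔲).Phi := by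
  refine ⟨G.cubic, fun k₁ k₂ h₁ h₂ h₃ z₁ z₂ m₁ m₂ c₁ c₂ => ?_⟩
  have r₁ := G.toComplex.rep_ofGamma k₁ h₁ z₁ c₁
  have r₂ := G.toComplex.rep_ofGamma k₂ h₂ z₂ c₂
  have e₁ : G.toComplex.ofGamma k₁ h₁ z₁ ∈ G.gr 1 := G.toComplex.ofGamma_mem k₁ h₁ 1 z₁ m₁
  have e₂ : G.toComplex.ofGamma k₂ h₂ z₂ ∈ G.gr 1 := G.toComplex.ofGamma_mem k₂ h₂ 1 z₂ m₂
  constructor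
  · intro x₁ x₂
    refine ((G.gaugeTheory 𝔲).bracketIs_two (k := ![k₁, k₂])
      (v := ![G.toComplex.ofGamma k₁ h₁ z₁ ⊗ₜ colorEquiv 𝔲 x₁,
        G.toComplex.ofGamma k₂ h₂ z₂ ⊗ₜ colorEquiv 𝔲 x₂]) ?_ h₃ ?_ ?_ ?_ ?_ ?_).2
    · intro j
      fin_cases j
      · exact h₁
      · exact h₂
    · intro j
      fin_cases j
      · exact GradedCommAlgebra.tmul_mem e₁ _
      · exact GradedCommAlgebra.tmul_mem e₂ _
    · intro j
      fin_cases j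
      · exact pureTensor_mem m₁ x₁
      · exact pureTensor_mem m₂ x₂
    · intro j
      fin_cases j
      · exact rep_tensor 𝔲 r₁ x₁
      · exact rep_tensor 𝔲 r₂ x₂
    · rw [G.cubic_apply h₁ h₂]
      exact pureTensor_mem (G.toGamma_mem _ 2 _ (G.mul_mem 1 1 _ e₁ _ e₂)) _
    · change (G.gaugeTheory 𝔲).Rep (k₁ + k₂) ((G.colorAction 𝔲).br k₁ k₂
        (G.toComplex.ofGamma k₁ h₁ z₁ ⊗ₜ colorEquiv 𝔲 x₁)
        (G.toComplex.ofGamma k₂ h₂ z₂ ⊗ₜ colorEquiv 𝔲 x₂)) _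
      rw [colorAction_br, G.cubic_apply h₁ h₂]
      exact rep_tensor 𝔲 (G.toComplex.rep_toGamma (k₁ + k₂) _ (G.d_mul e₁ r₁.closed r₂.closed)) _
  · refine ⟨0, ?_⟩
    rw [map_zero, G.cubic_apply h₁ h₂, G.cubic_apply h₂ h₁, add_comm k₂ k₁, ← map_add,
      G.mul_comm 1 1 _ e₂ _ e₁, mul_one, Int.negOnePow_one, Units.neg_smul, one_smul,
      neg_add_cancel, map_zero]

/-- Lorentz equivariance with coefficients. -/
theorem pairD_lorentz_tensor (h : ∀ g k z, pairD N ℂ (lorentzMom g k) (lorentzPair N ℂ g z) =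
    lorentzPair N ℂ g (pairD N ℂ k z)) (g : Lorentz) (k : Mom) (z : PairSpace N 𝔲) :
    pairD N 𝔲 (lorentzMom g k) (lorentzPair N 𝔲 g z) = lorentzPair N 𝔲 g (pairD N 𝔲 k z) := by
  rw [← sum_pureTensor z]
  simp only [map_sum, lorentzPair_pureTensor, pairD_pureTensor, h]

end GaugeAlgebra

end TreeAmp

/-! ### The commutative dg algebra of Yang-Mills theory -/

namespace TreeAmp

open scoped TensorProduct

theorem psiPlus_injective {z z' : GammaSpace 2 ℂ} (h : psiPlus z = psiPlus z') : z = z' := by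
  rw [← chiPlus_psiPlus z, h, chiPlus_psiPlus]

/-- The image of `psiPlus` is an ideal. -/
theorem exists_wedge_psiPlus (ω : Form) (z : GammaSpace 2 ℂ) :
    psiPlus (chiPlus (wedge ω (psiPlus z))) = wedge ω (psiPlus z) := by
  funext a
  cases a <;> simp [psiPlus, chiPlus, wedge_apply, wedgeFun]

theorem exists_psiPlus_wedge (z : GammaSpace 2 ℂ) (ω : Form) :
    psiPlus (chiPlus (wedge (psiPlus z) ω)) = wedge (psiPlus z) ω := by
  funext a
  cases a <;> simp [psiPlus, chiPlus, wedge_apply, wedgeFun]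

/-- The image of `psiMinus` is an ideal. -/
theorem exists_wedge_psiMinus (ω : Form) (z : GammaSpace 2 ℂ) :
    psiMinus (chiMinus (wedge ω (psiMinus z))) = wedge ω (psiMinus z) := by
  funext a
  cases a <;> simp [psiMinus, chiMinus, wedge_apply, wedgeFun, sub_eq_add_neg]

theorem psiPlus_wedge_psiMinus (z w : GammaSpace 2 ℂ) : wedge (psiPlus z) (psiMinus w) = 0 := by
  funext a
  cases a <;> simp [psiPlus, psiMinus, wedge_apply, wedgeFun]

/-- The parity involution of forms. -/
def parity : Form →ₗ[ℂ] Form where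
  toFun := weightMap formDeg (-1)
  map_add' x y := by funext a; simp [weightMap, mul_add]
  map_smul' c x := by funext a; simp [weightMap, mul_left_comm]

theorem parity_wedge (x y : Form) : parity (wedge x y) = wedge (parity x) (parity y) :=
  (wedge_weightMap (-1) x y).symm

theorem parity_of_mem {i : ℤ} {x : Form} (hx : x ∈ coordGr formDeg i) :
    parity x = i.negOnePow • x :=
  (weightMap_of_mem hx _).trans (negOnePow_smul_eq i x).symm

/-- Pairs `(α, z)`, written as coordinates of one space. They stand for `α + η ψ(z)`, with `ψ` the
embedding `psiPlus` of `Γ_1` and `η` a variable of degree `-1` and differential `1`. -/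
abbrev FormPair : Type := FormIdx ⊕ GammaIdx 2 → ℂ

/-- The degrees of the coordinates of a pair. -/
def formPairDeg : FormIdx ⊕ GammaIdx 2 → ℤ := Sum.elim formDeg gammaDeg

/-- The first entry of a pair. -/
def body : FormPair →ₗ[ℂ] Form := LinearMap.funLeft ℂ ℂ Sum.inl

/-- The second entry of a pair. -/
def tail : FormPair →ₗ[ℂ] GammaSpace 2 ℂ := LinearMap.funLeft ℂ ℂ Sum.inr

/-- The second entry of a pair, as a form. -/
def soul : FormPair →ₗ[ℂ] Form := psiPlus ∘ₗ tail

/-- The pair with given entries. -/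
def formPair (α : Form) (z : GammaSpace 2 ℂ) : FormPair := Sum.elim α z

theorem body_formPair (α : Form) (z : GammaSpace 2 ℂ) : body (formPair α z) = α := rfl

theorem tail_formPair (α : Form) (z : GammaSpace 2 ℂ) : tail (formPair α z) = z := rfl

theorem soul_formPair (α : Form) (z : GammaSpace 2 ℂ) : soul (formPair α z) = psiPlus z := rfl

theorem formPair_body_tail (x : FormPair) : formPair (body x) (tail x) = x :=
  funext fun a => by rcases a with a | a <;> rfl

theorem formPair_ext {x y : FormPair} (h : body x = body y) (h' : soul x = soul y) : x = y := by
  rw [← formPair_body_tail x, h, psiPlus_injective h', formPair_body_tail]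

theorem formPair_mem {i : ℤ} {α : Form} {z : GammaSpace 2 ℂ} (hα : α ∈ coordGr formDeg i)
    (hz : z ∈ coordGr gammaDeg i) : formPair α z ∈ coordGr formPairDeg i := by
  intro a ha
  rcases a with a | a
  · exact hα a ha
  · exact hz a ha

theorem body_mem {i : ℤ} {x : FormPair} (hx : x ∈ coordGr formPairDeg i) :
    body x ∈ coordGr formDeg i := fun a ha => hx (.inl a) ha

theorem tail_mem {i : ℤ} {x : FormPair} (hx : x ∈ coordGr formPairDeg i) :
    tail x ∈ coordGr gammaDeg i := fun a ha => hx (.inr a) ha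

theorem soul_mem {i : ℤ} {x : FormPair} (hx : x ∈ coordGr formPairDeg i) :
    soul x ∈ coordGr formDeg (i + 1) := psiPlus_mem (tail_mem hx)

/-- The linear map with given entries. -/
def formPairMap {V : Type*} [AddCommGroup V] [Module ℂ V] (f : V →ₗ[ℂ] Form)
    (g : V →ₗ[ℂ] GammaSpace 2 ℂ) : V →ₗ[ℂ] FormPair where
  toFun x := formPair (f x) (g x)
  map_add' x y := by rw [map_add, map_add]; funext a; rcases a with a | a <;> rfl
  map_smul' c x := by rw [map_smul, map_smul]; funext a; rcases a with a | a <;> rfl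

/-- The second entry of the product of `α + η β` and `α' + η β'`. -/
def soulMul : FormPair →ₗ[ℂ] FormPair →ₗ[ℂ] Form :=
  wedge.compl₁₂ soul body + wedge.compl₁₂ (parity ∘ₗ body) soul

theorem soulMul_apply (x y : FormPair) :
    soulMul x y = wedge (soul x) (body y) + wedge (parity (body x)) (soul y) := rfl

theorem psiPlus_soulMul (x y : FormPair) : psiPlus (chiPlus (soulMul x y)) = soulMul x y := by
  rw [soulMul_apply, map_add, map_add]
  exact congrArg₂ (· + ·) (exists_psiPlus_wedge _ _) (exists_wedge_psiPlus _ _)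

/-- The product of pairs. -/
def pairMul : FormPair →ₗ[ℂ] FormPair →ₗ[ℂ] FormPair :=
  LinearMap.mk₂ ℂ (fun x y => formPair (wedge (body x) (body y)) (chiPlus (soulMul x y)))
    (fun x x' y => by
      simp only [map_add, LinearMap.add_apply]; funext a; rcases a with a | a <;> rfl)
    (fun c x y => by
      simp only [map_smul, LinearMap.smul_apply]; funext a; rcases a with a | a <;> rfl)
    (fun x y y' => by
      simp only [map_add]; funext a; rcases a with a | a <;> rfl)
    (fun c x y => by
      simp only [map_smul]; funext a; rcases a with a | a <;> rfl)

theorem body_pairMul (x y : FormPair) : body (pairMul x y) = wedge (body x) (body y) := rfl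

theorem soul_pairMul (x y : FormPair) :
    soul (pairMul x y) = wedge (soul x) (body y) + wedge (parity (body x)) (soul y) :=
  psiPlus_soulMul x y

theorem wedge_negOnePow_smul (s : ℤˣ) (x y : Form) : wedge (s • x) y = s • wedge x y :=
  map_negOnePow_smul (wedge.flip y) s x

/-- The algebra of pairs. -/
def pairAlgebra : GradedCommAlgebra FormPair where
  gr := coordGr formPairDeg
  isInternal := coordGr_isInternal formPairDeg
  mul := pairMul
  mul_mem i j x hx y hy := by
    refine formPair_mem (wedge_mem i j _ (body_mem hx) _ (body_mem hy)) (chiPlus_mem ?_)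
    rw [soulMul_apply, parity_of_mem (body_mem hx)]
    have h1 := wedge_mem _ _ _ (soul_mem hx) _ (body_mem hy)
    have h2 := wedge_mem _ _ _ (body_mem hx) _ (soul_mem hy)
    rw [show i + 1 + j = i + j + 1 by ring] at h1
    rw [← add_assoc] at h2
    rw [negOnePow_smul_eq, map_smul, LinearMap.smul_apply]
    exact add_mem h1 (Submodule.smul_mem _ _ h2)
  mul_assoc x y z := by
    refine formPair_ext ?_ ?_
    · simp only [body_pairMul, wedge_assoc]
    · simp only [body_pairMul, soul_pairMul, parity_wedge, map_add, LinearMap.add_apply, wedge_assoc,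
        add_assoc]
  mul_comm i j x hx y hy := by
    refine formPair_ext ?_ ?_
    · rw [map_negOnePow_smul, body_pairMul, body_pairMul,
        wedge_comm i j _ (body_mem hx) _ (body_mem hy)]
    · rw [map_negOnePow_smul, soul_pairMul, soul_pairMul, parity_of_mem (body_mem hx),
        parity_of_mem (body_mem hy), wedge_comm _ _ _ (soul_mem hx) _ (body_mem hy)]
      rw [wedge_negOnePow_smul, wedge_negOnePow_smul,
        wedge_comm _ _ _ (body_mem hx) _ (soul_mem hy), smul_add, smul_smul, smul_smul, add_comm]
      congr 2
      · rw [← Int.negOnePow_add]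
        rw [mul_add, mul_one, ← add_assoc, add_comm i, add_assoc, Int.negOnePow_add,
          Int.negOnePow_even (i + i) ⟨i, rfl⟩, mul_one]
      · rw [← Int.negOnePow_add, add_mul, one_mul]

/-- The differential of pairs: `d (α + η β) = κ α + β - η κ β`, with `κ` the momentum one-form. -/
def pairDiff (k : Mom) : FormPair →ₗ[ℂ] FormPair :=
  formPairMap (wedge (oneForm k) ∘ₗ body + soul) (-(chiPlus ∘ₗ wedge (oneForm k) ∘ₗ soul))

theorem body_pairDiff (k : Mom) (x : FormPair) :
    body (pairDiff k x) = wedge (oneForm k) (body x) + soul x := rfl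

theorem soul_pairDiff (k : Mom) (x : FormPair) :
    soul (pairDiff k x) = -wedge (oneForm k) (soul x) := by
  change psiPlus (-chiPlus (wedge (oneForm k) (psiPlus (tail x)))) = _
  rw [map_neg, exists_wedge_psiPlus]
  rfl

theorem wedge_oneForm_self (k : Mom) (ω : Form) : wedge (oneForm k) (wedge (oneForm k) ω) = 0 := by
  rw [← wedge_assoc, self_eq_neg.1 (wedge_oneForm_comm k k), map_zero, LinearMap.zero_apply]

theorem pairDiff_pairDiff (k : Mom) (x : FormPair) : pairDiff k (pairDiff k x) = 0 := by
  refine formPair_ext ?_ ?_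
  · rw [body_pairDiff, body_pairDiff, soul_pairDiff, map_add, wedge_oneForm_self, zero_add,
      add_neg_cancel, map_zero]
  · rw [soul_pairDiff, soul_pairDiff, map_neg, wedge_oneForm_self, neg_zero, neg_zero, map_zero]

theorem pairDiff_mem (k : Mom) (i : ℤ) (x : FormPair) (hx : x ∈ coordGr formPairDeg i) :
    pairDiff k x ∈ coordGr formPairDeg (i + 1) := by
  have h1 := wedge_mem _ _ _ (oneForm_mem k) _ (body_mem hx)
  have h2 := wedge_mem _ _ _ (oneForm_mem k) _ (soul_mem hx)
  rw [add_comm] at h1 h2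
  exact formPair_mem (add_mem h1 (soul_mem hx)) (neg_mem (chiPlus_mem h2))

theorem pairDiff_leibniz (k l : Mom) (i : ℤ) (x : FormPair) (hx : x ∈ coordGr formPairDeg i)
    (y : FormPair) : pairDiff (k + l) (pairMul x y) =
      pairMul (pairDiff k x) y + i.negOnePow • pairMul x (pairDiff l y) := by
  have hb := body_mem hx
  have hs := soul_mem hx
  have c1 : wedge (oneForm l) (body x) = i.negOnePow • wedge (body x) (oneForm l) := by
    rw [wedge_comm 1 i _ (oneForm_mem l) _ hb, one_mul]
  have c2 : wedge (oneForm l) (soul x) = (i + 1).negOnePow • wedge (soul x) (oneForm l) := by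
    rw [wedge_comm 1 (i + 1) _ (oneForm_mem l) _ hs, one_mul]
  have hk : parity (wedge (oneForm k) (body x) + soul x) =
      (i + 1).negOnePow • (wedge (oneForm k) (body x) + soul x) := by
    have h1 := wedge_mem _ _ _ (oneForm_mem k) _ hb
    rw [add_comm] at h1
    exact parity_of_mem (add_mem h1 hs)
  refine formPair_ext ?_ ?_
  · simp only [map_add, map_negOnePow_smul, body_pairMul, body_pairDiff, soul_pairMul,
      parity_of_mem hb, LinearMap.add_apply]
    rw [← wedge_assoc, ← wedge_assoc, c1]
    rcases Int.units_eq_one_or i.negOnePow with h | h <;> rw [h] <;>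
      simp only [one_smul, Units.neg_smul, map_neg, LinearMap.neg_apply, wedge_assoc] <;> abel
  · simp only [map_add, map_negOnePow_smul, body_pairDiff, soul_pairMul, soul_pairDiff,
      parity_of_mem hb, hk, LinearMap.add_apply, map_neg, LinearMap.neg_apply]
    rw [← wedge_assoc, ← wedge_assoc (oneForm l), c2]
    rw [Int.negOnePow_succ]
    rcases Int.units_eq_one_or i.negOnePow with h | h <;> rw [h] at c1 ⊢ <;>
      simp only [one_smul, Units.neg_smul, map_neg, LinearMap.neg_apply, wedge_assoc, neg_neg,
        LinearMap.add_apply] at c1 ⊢ <;> 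
      rw [← wedge_assoc (oneForm l), c1] <;>
      simp only [map_neg, LinearMap.neg_apply, wedge_assoc] <;> abel

end TreeAmp

/-! ### Quotients of commutative dg algebras -/

namespace TreeAmp

open scoped TensorProduct

/-- The quotient of a commutative dg algebra by an ideal that is a subcomplex as in
`Presentation`. -/
def GradedCommAlgebra.quotient {N : ℕ} {P : Type} [AddCommGroup P] [Module ℂ P]
    (G : GradedCommAlgebra P) {d : Mom → P →ₗ[ℂ] P} (p : Presentation N G.gr d)
    (leibniz : ∀ k l i, ∀ x ∈ G.gr i, ∀ y,
      d (k + l) (G.mul x y) = G.mul (d k x) y + i.negOnePow • G.mul x (d l y))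
    (ideal : ∀ x z, ∃ z', G.mul x (p.ψ z) = p.ψ z') : GaugeAlgebra N p.Quot :=
  have hr : ∀ x z, p.proj (G.mul x (p.ψ z)) = 0 := fun x z => by
    obtain ⟨z', hz'⟩ := ideal x z
    rw [hz', p.proj_ψ]
  have hl : ∀ z x, p.proj (G.mul (p.ψ z) x) = 0 := fun z x => by
    refine gradedInduction (pairGr_isInternal N ℂ) (p := fun z => p.proj (G.mul (p.ψ z) x) = 0) z
      (fun i z hz => ?_) (by simp) fun x y h h' => by
        simp only [map_add, LinearMap.add_apply, h, h', add_zero]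
    refine gradedInduction p.isInternal (p := fun x => p.proj (G.mul (p.ψ z) x) = 0) x
      (fun j x hx => ?_) (by simp) fun x y h h' => by simp only [map_add, h, h', add_zero]
    rw [G.mul_comm _ _ _ (p.ψ_mem i z hz) _ hx, map_negOnePow_smul, hr, smul_zero]
  { gr := p.quotGr
    isInternal := p.quotGr_isInternal
    mul := p.map₂ G.mul hl hr
    mul_mem := by
      rintro i j _ ⟨x, hx, rfl⟩ _ ⟨y, hy, rfl⟩
      exact p.proj_mem (G.mul_mem i j x hx y hy)
    mul_assoc := by
      intro x y z
      obtain ⟨x, rfl⟩ := p.exists_proj x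
      obtain ⟨y, rfl⟩ := p.exists_proj y
      obtain ⟨z, rfl⟩ := p.exists_proj z
      simp only [p.map₂_proj, G.mul_assoc]
    mul_comm := by
      rintro i j _ ⟨x, hx, rfl⟩ _ ⟨y, hy, rfl⟩
      rw [p.map₂_proj, p.map₂_proj, G.mul_comm i j x hx y hy, map_negOnePow_smul]
    d := p.quotD
    d_mem := p.quotD_mem
    d_d := p.quotD_quotD
    d_poly := p.quotD_poly
    leibniz := by
      rintro k l i _ ⟨x, hx, rfl⟩ y
      obtain ⟨y, rfl⟩ := p.exists_proj y
      simp only [p.map₂_proj, p.quotD_proj]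
      rw [leibniz k l i x hx y, map_add, map_negOnePow_smul]
    toGamma := p.toGamma
    toGamma_poly := p.toGamma_poly
    toGamma_mem := p.toGamma_mem
    toGamma_d := p.toGamma_d
    quasiIso := p.quasiIso }

theorem GradedCommAlgebra.quotient_rep {N : ℕ} {P : Type} [AddCommGroup P] [Module ℂ P]
    {G : GradedCommAlgebra P} {d : Mom → P →ₗ[ℂ] P} {p : Presentation N G.gr d}
    [FiniteDimensional ℂ p.Quot]
    {leibniz : ∀ k l i, ∀ x ∈ G.gr i, ∀ y,
      d (k + l) (G.mul x y) = G.mul (d k x) y + i.negOnePow • G.mul x (d l y)}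
    {ideal : ∀ x z, ∃ z', G.mul x (p.ψ z) = p.ψ z'} {k : Mom} {x : P} {z : PairSpace N ℂ}
    (h : d k x = p.ψ z) :
    (G.quotient p leibniz ideal).toComplex.Rep k (p.proj x) (p.e z + p.lam x) where
  closed := (congrArg p.proj h).trans (p.proj_ψ z)
  closed' := by
    rw [LinearMap.mem_ker, map_add, p.pairD_e h, ← p.lam_d, h, p.lam_ψ, add_zero]
  eq := ⟨_, p.toGamma_proj_of_eq h⟩

/-! ### Yang-Mills theory -/

theorem pairDiff_poly : IsPolynomial pairDiff := by
  intro x φ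
  obtain ⟨P, hP⟩ := exists_polyEval_linear (φ ∘ₗ formPairMap (wedge.flip (body x) ∘ₗ oneForm)
    (-(chiPlus ∘ₗ wedge.flip (soul x) ∘ₗ oneForm)))
  refine ⟨P + MvPolynomial.C (φ (formPair (soul x) 0)), fun k => ?_⟩
  have h : pairDiff k x = formPairMap (wedge.flip (body x) ∘ₗ oneForm)
      (-(chiPlus ∘ₗ wedge.flip (soul x) ∘ₗ oneForm)) k + formPair (soul x) 0 := by
    funext a
    rcases a with a | a
    · rfl
    · exact (add_zero _).symm
  rw [h, map_add, ← LinearMap.comp_apply, hP]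
  simp [polyEval]

/-- The embedding of `Γ_{-1}` into the pairs. -/
def gaugePsi : PairSpace 2 ℂ →ₗ[ℂ] FormPair :=
  formPairMap (psiMinus ∘ₗ LinearMap.proj (-1)) 0

theorem body_gaugePsi (z : PairSpace 2 ℂ) : body (gaugePsi z) = psiMinus (z (-1)) := rfl

theorem soul_gaugePsi (z : PairSpace 2 ℂ) : soul (gaugePsi z) = 0 := map_zero psiPlus

theorem pairDiff_gaugePsi (k : Mom) (z : PairSpace 2 ℂ) :
    pairDiff k (gaugePsi z) = -gaugePsi (pairD 2 ℂ k z) := by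
  refine formPair_ext ?_ ?_
  · rw [body_pairDiff, body_gaugePsi, soul_gaugePsi, add_zero, wedge_psiMinus, map_neg,
      body_gaugePsi]
  · rw [soul_pairDiff, soul_gaugePsi, map_zero, map_neg, soul_gaugePsi]

theorem tail_pairDiff (k : Mom) (x : FormPair) (z : PairSpace 2 ℂ) (hz : z 1 = tail x) :
    tail (pairDiff k x) = pairD 2 ℂ k z 1 := by
  refine psiPlus_injective ?_
  have h := soul_pairDiff k x
  rw [show soul x = psiPlus (z 1) by rw [hz]; rfl, wedge_psiPlus, neg_neg] at h
  exact h

theorem wedge_exact {k : Mom} (hk : k ≠ 0) {ω : Form} (hω : wedge (oneForm k) ω = 0) :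
    ∃ η, wedge (oneForm k) η = ω := by
  obtain ⟨n, hn⟩ := exists_dual_momentum hk
  refine ⟨contract n ω, ?_⟩
  conv_rhs => rw [← contract_wedge_add hn ω, hω, map_zero, add_zero]

/-- The inclusion of the part of helicity sign `σ`. -/
def partEmb (σ : ℤˣ) : GammaSpace 2 ℂ →ₗ[ℂ] PairSpace 2 ℂ :=
  LinearMap.single ℂ (fun _ : ℤˣ => GammaSpace 2 ℂ) σ

theorem partEmb_same (σ : ℤˣ) (x : GammaSpace 2 ℂ) : partEmb σ x σ = x :=
  Pi.single_eq_same (M := fun _ => GammaSpace 2 ℂ) σ x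

theorem partEmb_ne {σ τ : ℤˣ} (h : τ ≠ σ) (x : GammaSpace 2 ℂ) : partEmb σ x τ = 0 :=
  Pi.single_eq_of_ne (M := fun _ => GammaSpace 2 ℂ) h x

theorem partEmb_mem {σ : ℤˣ} {i : ℤ} {x : GammaSpace 2 ℂ} (h : x ∈ coordGr gammaDeg i) :
    partEmb σ x ∈ pairGr 2 ℂ i := by
  intro τ a ha
  by_cases hτ : τ = σ
  · subst hτ
    rw [partEmb_same]
    exact h a ha
  · rw [partEmb_ne hτ]
    rfl

theorem pairD_partEmb (σ : ℤˣ) (k : Mom) (z : PairSpace 2 ℂ) :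
    partEmb σ (pairD 2 ℂ k z σ) = pairD 2 ℂ k (partEmb σ (z σ)) := by
  funext τ a
  rw [pairD_apply]
  by_cases hτ : τ = σ
  · subst hτ
    rw [partEmb_same, partEmb_same, pairD_apply]
  · simp [partEmb_ne hτ]

/-- The complex of Yang-Mills theory: the gauge field `α` and the auxiliary self-dual two-form
`β`, modulo the anti-self-dual part of the curvature. -/
def gaugePresentation : Presentation 2 pairAlgebra.gr pairDiff where
  isInternal := pairAlgebra.isInternal
  d_mem := pairDiff_mem
  d_d := pairDiff_pairDiff
  d_poly := pairDiff_poly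
  ψ := gaugePsi
  χ := partEmb (-1) ∘ₗ chiMinus ∘ₗ body
  e := partEmb (-1) ∘ₗ LinearMap.proj (-1)
  lam := partEmb 1 ∘ₗ tail
  ψ_mem i z hz := formPair_mem (psiMinus_mem fun a ha => hz (-1) a ha) (zero_mem _)
  χ_mem i x hx := partEmb_mem (chiMinus_mem (body_mem hx))
  lam_mem i x hx := partEmb_mem (tail_mem hx)
  χ_ψ z := by
    change partEmb (-1) (chiMinus (psiMinus (z (-1)))) = _
    rw [chiMinus_psiMinus]
    rfl
  ψ_e z := by
    refine formPair_ext ?_ ?_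
    · rw [body_gaugePsi, body_gaugePsi]
      exact congrArg psiMinus (partEmb_same (-1) (z (-1)))
    · rw [soul_gaugePsi, soul_gaugePsi]
  e_χ x := by
    change partEmb (-1) (partEmb (-1) _ (-1)) = _
    rw [partEmb_same]
    rfl
  e_lam x := by
    change partEmb (-1) (partEmb 1 (tail x) (-1)) = 0
    rw [partEmb_ne (by decide), map_zero]
  lam_ψ z := map_zero (partEmb 1)
  e_d k z := pairD_partEmb _ _ _
  ψ_d := pairDiff_gaugePsi
  lam_d k x := by
    change partEmb 1 (tail (pairDiff k x)) = pairD 2 ℂ k (partEmb 1 (tail x))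
    rw [tail_pairDiff k x (partEmb 1 (tail x)) (partEmb_same _ _), pairD_partEmb, partEmb_same]
  inj k hk x w hx h := by
    have h1 : tail x = pairD 2 ℂ k w 1 := by
      rw [← h]
      exact (partEmb_same 1 (tail x)).symm
    have h2 := tail_pairDiff k (formPair 0 (w 1)) w rfl
    have h3 : soul (x - pairDiff k (formPair 0 (w 1))) = 0 := by
      rw [map_sub, sub_eq_zero]
      exact congrArg psiPlus (h1.trans h2.symm)
    have h4 := congrArg body (pairDiff_pairDiff k (formPair 0 (w 1)))
    obtain ⟨η, hη⟩ := wedge_exact hk (ω := body (x - pairDiff k (formPair 0 (w 1)))) (by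
      have h5 := congrArg body (show pairDiff k (x - pairDiff k (formPair 0 (w 1))) = 0 by
        rw [map_sub, hx, pairDiff_pairDiff, sub_zero])
      rwa [body_pairDiff, h3, add_zero, map_zero] at h5)
    refine ⟨formPair 0 (w 1) + formPair η 0, ?_⟩
    rw [map_add, ← eq_sub_iff_add_eq']
    refine formPair_ext ?_ ?_
    · rw [body_pairDiff, soul_formPair, map_zero, add_zero, ← hη]
      rfl
    · rw [soul_pairDiff, soul_formPair, map_zero, map_zero, neg_zero, h3]
  surj k hk z hz he := by
    have h1 : wedge (oneForm k) (-psiPlus (z 1)) = 0 := by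
      rw [map_neg, wedge_psiPlus, hz, neg_neg]
      exact map_zero psiPlus
    obtain ⟨η, hη⟩ := wedge_exact hk h1
    have h2 : z (-1) = 0 := by
      have := congrFun he (-1)
      exact (partEmb_same (-1) (z (-1))).symm.trans this
    refine ⟨formPair η (z 1), 0, formPair_ext ?_ ?_, ?_⟩
    · rw [body_pairDiff, body_formPair, soul_formPair, hη, neg_add_cancel, map_zero]
    · rw [soul_pairDiff, soul_formPair, ← map_neg, h1, map_zero]
    · rw [map_zero, add_zero]
      change partEmb 1 (z 1) = z
      funext σ
      rcases Int.units_eq_one_or σ with rfl | rfl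
      · rw [partEmb_same]
      · rw [partEmb_ne (by decide), h2]

theorem pairMul_gaugePsi (x : FormPair) (z : PairSpace 2 ℂ) : pairMul x (gaugePsi z) =
    gaugePsi (partEmb (-1) (chiMinus (wedge (body x) (psiMinus (z (-1)))))) := by
  refine formPair_ext ?_ ?_
  · rw [body_pairMul, body_gaugePsi, body_gaugePsi, partEmb_same, exists_wedge_psiMinus]
  · rw [soul_pairMul, body_gaugePsi, soul_gaugePsi, soul_gaugePsi, map_zero, add_zero]
    exact psiPlus_wedge_psiMinus _ _

/-- The commutative dg algebra of Yang-Mills theory. -/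
def yangMills : GaugeAlgebra 2 gaugePresentation.Quot :=
  pairAlgebra.quotient gaugePresentation pairDiff_leibniz fun x z => ⟨_, pairMul_gaugePsi x z⟩

instance : FiniteDimensional ℂ gaugePresentation.Quot :=
  inferInstanceAs (FiniteDimensional ℂ (FormPair ⧸ gaugePresentation.relations))

end TreeAmp

/-! ### Symmetries of the dgLa of Yang-Mills theory -/

namespace TreeAmp

open scoped TensorProduct

/-- A multiplicative linear symmetry of the pairs that preserves the subcomplex is multiplicative on
the quotient. -/
theorem yangMills_map_mul {T : FormPair →ₗ[ℂ] FormPair}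
    (hT : ∀ z, ∃ z', T (gaugePsi z) = gaugePsi z')
    (mul : ∀ x y, pairMul (T x) (T y) = T (pairMul x y)) (x y : gaugePresentation.Quot) :
    yangMills.mul (gaugePresentation.map T hT x) (gaugePresentation.map T hT y) =
      gaugePresentation.map T hT (yangMills.mul x y) := by
  obtain ⟨x, rfl⟩ := gaugePresentation.exists_proj x
  obtain ⟨y, rfl⟩ := gaugePresentation.exists_proj y
  exact congrArg gaugePresentation.proj (mul x y)

theorem yangMills_map_mem {T : FormPair →ₗ[ℂ] FormPair}
    (hT : ∀ z, ∃ z', T (gaugePsi z) = gaugePsi z')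
    (mem : ∀ i, ∀ x ∈ coordGr formPairDeg i, T x ∈ coordGr formPairDeg i) (i : ℤ)
    (x : gaugePresentation.Quot) (hx : x ∈ yangMills.gr i) :
    gaugePresentation.map T hT x ∈ yangMills.gr i := by
  obtain ⟨x, hx, rfl⟩ := hx
  exact gaugePresentation.proj_mem (mem i x hx)

theorem yangMills_map_d {T : FormPair →ₗ[ℂ] FormPair} {k k' : Mom} {l : ℂ}
    (hT : ∀ z, ∃ z', T (gaugePsi z) = gaugePsi z')
    (d : ∀ x, pairDiff k' (T x) = l • T (pairDiff k x)) (x : gaugePresentation.Quot) :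
    yangMills.d k' (gaugePresentation.map T hT x) =
      l • gaugePresentation.map T hT (yangMills.d k x) := by
  obtain ⟨x, rfl⟩ := gaugePresentation.exists_proj x
  exact (congrArg gaugePresentation.proj (d x)).trans (map_smul _ _ _)

/-- The dilations rescale the auxiliary two-form, which has the dimension of a momentum, and not the
gauge field. -/
def scaleTail (c : ℂ) : FormPair →ₗ[ℂ] FormPair := formPairMap body (c • tail)

theorem body_scaleTail (c : ℂ) (x : FormPair) : body (scaleTail c x) = body x := rfl

theorem soul_scaleTail (c : ℂ) (x : FormPair) : soul (scaleTail c x) = c • soul x :=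
  map_smul psiPlus c (tail x)

theorem scaleTail_gaugePsi (c : ℂ) (z : PairSpace 2 ℂ) :
    scaleTail c (gaugePsi z) = gaugePsi z := by
  refine formPair_ext rfl ?_
  rw [soul_scaleTail, soul_gaugePsi, smul_zero]

theorem pairDiff_scaleTail (c : ℂ) (k : Mom) (x : FormPair) :
    pairDiff (c • k) (scaleTail c x) = c • scaleTail c (pairDiff k x) := by
  refine formPair_ext ?_ ?_
  · rw [map_smul, body_scaleTail, body_pairDiff, body_pairDiff, body_scaleTail, soul_scaleTail,
      map_smul, map_smul, LinearMap.smul_apply, smul_add]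
  · simp only [map_smul, soul_scaleTail, soul_pairDiff, LinearMap.smul_apply, smul_neg]

theorem pairMul_scaleTail (c : ℂ) (x y : FormPair) :
    pairMul (scaleTail c x) (scaleTail c y) = scaleTail c (pairMul x y) := by
  refine formPair_ext rfl ?_
  rw [soul_scaleTail, soul_pairMul, soul_pairMul, soul_scaleTail, soul_scaleTail, body_scaleTail,
    body_scaleTail, map_smul, map_smul, LinearMap.smul_apply, smul_add]

theorem scaleTail_preserves (c : ℂ) (z : PairSpace 2 ℂ) :
    ∃ z', scaleTail c (gaugePsi z) = gaugePsi z' := ⟨z, scaleTail_gaugePsi c z⟩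

variable (𝔲 : Type*) [LieRing 𝔲] [LieAlgebra ℂ 𝔲] [FiniteDimensional ℂ 𝔲]

/-- The dilations of Yang-Mills theory. -/
def yangMillsDilations : (yangMills.gaugeTheory 𝔲).HasDilations where
  S c := (gaugePresentation.map (scaleTail c) (scaleTail_preserves c)).rTensor (Color 𝔲)
  α := 1
  isSymmetry c hc := by
    rw [show c ^ ((1 : ℤ) - 1) = 1 by norm_num]
    exact GaugeAlgebra.isSymmetry_tensor (fun k k' => smul_add c k k') (smul_zero c)
      (yangMills_map_mem _ fun i x hx => formPair_mem (body_mem hx)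
        (Submodule.smul_mem _ c (tail_mem hx)))
      (fun k => yangMills_map_d _ (pairDiff_scaleTail c k))
      (yangMills_map_mul _ (pairMul_scaleTail c))
  inv c hc v := by
    rw [← LinearMap.rTensor_comp_apply]
    have h : gaugePresentation.map (scaleTail c) (scaleTail_preserves c) ∘ₗ
        gaugePresentation.map (scaleTail c⁻¹) (scaleTail_preserves c⁻¹) = LinearMap.id := by
      refine LinearMap.ext fun x => ?_
      obtain ⟨x, rfl⟩ := gaugePresentation.exists_proj x
      refine congrArg gaugePresentation.proj (formPair_ext rfl ?_)
      rw [soul_scaleTail, soul_scaleTail, smul_inv_smul₀ hc]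
    rw [h, LinearMap.rTensor_id_apply]
  toGamma c hc k v hv := by
    have h1 (z : PairSpace 2 ℂ) : scaleTail c (gaugePsi z) = c ^ ((1 : ℤ) - 1) • gaugePsi z := by
      rw [sub_self, zpow_zero, one_smul, scaleTail_gaugePsi]
    have h2 (x : FormPair) : gaugePresentation.lam (scaleTail c x) =
        c ^ (1 : ℤ) • gaugePresentation.lam x := by
      rw [zpow_one]
      exact map_smul (partEmb 1) c (tail x)
    have h3 (x : gaugePresentation.Quot) (hx : yangMills.d k x = 0) :
        ∃ w, yangMills.toGamma (c • k) (gaugePresentation.map (scaleTail c)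
          (scaleTail_preserves c) x) =
          (c ^ (1 : ℤ) • (LinearMap.id : PairSpace 2 ℂ →ₗ[ℂ] PairSpace 2 ℂ))
            (yangMills.toGamma k x) + pairD 2 ℂ (c • k) w := by
      obtain ⟨x, rfl⟩ := gaugePresentation.exists_proj x
      obtain ⟨w, hw⟩ := gaugePresentation.toGamma_dilation hc 1 h1 (pairDiff_scaleTail c) h2 k x hx
      refine ⟨c⁻¹ • w, ?_⟩
      have h5 : pairD 2 ℂ (c • k) (c⁻¹ • w) = pairD 2 ℂ k w := by
        rw [pairD_smul, LinearMap.smul_apply, map_smul (pairD 2 ℂ k), smul_inv_smul₀ hc]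
      exact hw.trans (congrArg _ h5.symm)
    obtain ⟨w, hw⟩ := yangMills.toGammaTensor_map (M' := c ^ (1 : ℤ) • LinearMap.id)
      (fun z a => (LinearMap.map_smul₂ pureMap _ z a).symm) h3 v hv
    have h4 : pairD 2 𝔲 (c • k) w = pairD 2 𝔲 k (c • w) := by
      rw [pairD_smul, map_smul, LinearMap.smul_apply]
    exact ⟨c • w, hw.trans (congrArg _ h4)⟩

/-- The Lorentz action on forms. -/
def lorentzOnForm (g : Lorentz) : Form →ₗ[ℂ] Form := formLeft g.1 ∘ₗ formRight g.2

theorem lorentzOnForm_wedge (g : Lorentz) (x y : Form) :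
    wedge (lorentzOnForm g x) (lorentzOnForm g y) = lorentzOnForm g (wedge x y) :=
  (formLeft_wedge _ _ _).trans (congrArg _ (formRight_wedge _ _ _))

theorem lorentzOnForm_oneForm (g : Lorentz) (k : Mom) :
    lorentzOnForm g (oneForm k) = oneForm (lorentzMom g k) := by
  rw [lorentzOnForm, LinearMap.comp_apply, formRight_oneForm, formLeft_oneForm, lorentzMom,
    Matrix.mul_assoc]

theorem lorentzOnForm_mem (g : Lorentz) {i : ℤ} {x : Form} (hx : x ∈ coordGr formDeg i) :
    lorentzOnForm g x ∈ coordGr formDeg i :=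
  formLeft_mem g.1 i (formRight g.2 x) (formRight_mem g.2 i x hx)

theorem lorentzOnForm_parity (g : Lorentz) (x : Form) :
    parity (lorentzOnForm g x) = lorentzOnForm g (parity x) := by
  refine gradedInduction (coordGr_isInternal formDeg)
    (p := fun x => parity (lorentzOnForm g x) = lorentzOnForm g (parity x)) x (fun i x hx => ?_)
    (by simp) fun x y h h' => by simp only [map_add, h, h']
  rw [parity_of_mem (lorentzOnForm_mem g hx), parity_of_mem hx, map_negOnePow_smul]

theorem lorentzOnForm_psiPlus (g : Lorentz) (z : PairSpace 2 ℂ) :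
    lorentzOnForm g (psiPlus (z 1)) = psiPlus (lorentzPair 2 ℂ g z 1) :=
  psiPlus_lorentz g.1.det_coe g.2.det_coe (z 1)

theorem lorentzOnForm_psiMinus (g : Lorentz) (z : PairSpace 2 ℂ) :
    lorentzOnForm g (psiMinus (z (-1))) = psiMinus (lorentzPair 2 ℂ g z (-1)) :=
  psiMinus_lorentz g.1.det_coe g.2.det_coe (z (-1))

/-- The Lorentz equivariance of the complexes follows from that of the forms in which they are
embedded. -/
theorem pairD_lorentz_two (g : Lorentz) (k : Mom) (z : PairSpace 2 ℂ) :
    pairD 2 ℂ (lorentzMom g k) (lorentzPair 2 ℂ g z) = lorentzPair 2 ℂ g (pairD 2 ℂ k z) := by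
  funext σ
  rcases Int.units_eq_one_or σ with rfl | rfl
  · refine psiPlus_injective ?_
    rw [← lorentzOnForm_psiPlus, ← neg_inj, ← wedge_psiPlus, ← map_neg, ← wedge_psiPlus,
      ← lorentzOnForm_wedge, lorentzOnForm_oneForm, lorentzOnForm_psiPlus]
  · rw [← chiMinus_psiMinus (pairD _ _ _ _ _), ← chiMinus_psiMinus (lorentzPair _ _ _ _ _)]
    congr 1
    rw [← lorentzOnForm_psiMinus, ← neg_inj, ← wedge_psiMinus, ← map_neg, ← wedge_psiMinus,
      ← lorentzOnForm_wedge, lorentzOnForm_oneForm, lorentzOnForm_psiMinus]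

/-- The Lorentz action on pairs. -/
def lorentzFormPair (g : Lorentz) : FormPair →ₗ[ℂ] FormPair :=
  formPairMap (lorentzOnForm g ∘ₗ body) (LinearMap.proj 1 ∘ₗ lorentzPair 2 ℂ g ∘ₗ partEmb 1 ∘ₗ tail)

theorem body_lorentzFormPair (g : Lorentz) (x : FormPair) :
    body (lorentzFormPair g x) = lorentzOnForm g (body x) := rfl

theorem soul_lorentzFormPair (g : Lorentz) (x : FormPair) :
    soul (lorentzFormPair g x) = lorentzOnForm g (soul x) := by
  have h := lorentzOnForm_psiPlus g (partEmb 1 (tail x))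
  rw [partEmb_same] at h
  exact h.symm

theorem lorentzFormPair_gaugePsi (g : Lorentz) (z : PairSpace 2 ℂ) :
    lorentzFormPair g (gaugePsi z) = gaugePsi (lorentzPair 2 ℂ g z) := by
  refine formPair_ext ?_ ?_
  · rw [body_lorentzFormPair, body_gaugePsi, body_gaugePsi, lorentzOnForm_psiMinus]
  · rw [soul_lorentzFormPair, soul_gaugePsi, soul_gaugePsi, map_zero]

theorem lorentzFormPair_mem (g : Lorentz) (i : ℤ) (x : FormPair)
    (hx : x ∈ coordGr formPairDeg i) : lorentzFormPair g x ∈ coordGr formPairDeg i :=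
  formPair_mem (lorentzOnForm_mem g (body_mem hx)) fun a ha =>
    lorentzPair_mem 2 ℂ g i _ (partEmb_mem (tail_mem hx)) 1 a ha

theorem pairDiff_lorentzFormPair (g : Lorentz) (k : Mom) (x : FormPair) :
    pairDiff (lorentzMom g k) (lorentzFormPair g x) =
      (1 : ℂ) • lorentzFormPair g (pairDiff k x) := by
  rw [one_smul]
  refine formPair_ext ?_ ?_
  · rw [body_lorentzFormPair, body_pairDiff, body_pairDiff, body_lorentzFormPair,
      soul_lorentzFormPair, map_add, ← lorentzOnForm_oneForm, lorentzOnForm_wedge]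
  · rw [soul_lorentzFormPair, soul_pairDiff, soul_pairDiff, soul_lorentzFormPair, map_neg,
      ← lorentzOnForm_oneForm, lorentzOnForm_wedge]

theorem pairMul_lorentzFormPair (g : Lorentz) (x y : FormPair) :
    pairMul (lorentzFormPair g x) (lorentzFormPair g y) = lorentzFormPair g (pairMul x y) := by
  refine formPair_ext ?_ ?_
  · rw [body_pairMul, body_lorentzFormPair, body_lorentzFormPair, lorentzOnForm_wedge]
    rfl
  · rw [soul_lorentzFormPair, soul_pairMul, soul_pairMul, soul_lorentzFormPair,
      soul_lorentzFormPair, body_lorentzFormPair, body_lorentzFormPair, lorentzOnForm_parity,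
      lorentzOnForm_wedge, lorentzOnForm_wedge, map_add]

theorem lorentzPair_partEmb (g : Lorentz) (σ : ℤˣ) (z : PairSpace 2 ℂ) :
    partEmb σ (lorentzPair 2 ℂ g z σ) = lorentzPair 2 ℂ g (partEmb σ (z σ)) := by
  funext τ a
  rw [lorentzPair_apply]
  by_cases hτ : τ = σ
  · subst hτ
    rw [partEmb_same, partEmb_same, lorentzPair_apply]
  · simp [partEmb_ne hτ]

/-- The Lorentz action of Yang-Mills theory. -/
def yangMillsLorentz : (yangMills.gaugeTheory 𝔲).HasLorentz where
  ρ g := (gaugePresentation.map (lorentzFormPair g) fun z =>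
    ⟨_, lorentzFormPair_gaugePsi g z⟩).rTensor (Color 𝔲)
  isSymmetry g := GaugeAlgebra.isSymmetry_tensor (lorentzMom_add g) (lorentzMom_zero g)
    (yangMills_map_mem _ (lorentzFormPair_mem g))
    (fun k => yangMills_map_d _ (pairDiff_lorentzFormPair g k))
    (yangMills_map_mul _ (pairMul_lorentzFormPair g))
  toGamma g k v hv := by
    refine yangMills.toGammaTensor_map (fun z a => lorentzPair_pureTensor g z a)
      (fun x hx => ?_) v hv
    obtain ⟨x, rfl⟩ := gaugePresentation.exists_proj x
    refine gaugePresentation.toGamma_symmetry (lorentzFormPair_gaugePsi g)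
      (fun x => (pairDiff_lorentzFormPair g k x).trans (one_smul _ _))
      (fun z => lorentzPair_partEmb g (-1) z) (pairD_lorentz_two g k) (fun x => ?_) x hx
    have h := lorentzPair_partEmb g 1 (partEmb 1 (tail x))
    rwa [partEmb_same] at h
  pairD := GaugeAlgebra.pairD_lorentz_tensor pairD_lorentz_two

end TreeAmp

/-! ### Interactions of gluons -/

namespace TreeAmp

open scoped TensorProduct

theorem psiMinus_single : psiMinus (Pi.single (.inl 0) 1) =
    (1 / 2 : ℂ) • wedge (coframe 0 0) (coframe 1 0) := by
  funext a; cases a <;> simp [psiMinus, wedge_apply, wedgeFun, coframe, oneForm]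

theorem psiPlus_single : psiPlus (Pi.single (.inl 0) 1) =
    (1 / 2 : ℂ) • wedge (coframe 0 0) (coframe 0 1) := by
  funext a; cases a <;> simp [psiPlus, wedge_apply, wedgeFun, coframe, oneForm]

theorem gaugePsi_single : gaugePsi (pairSingle (-1) (.inl 0) 1) =
    formPair ((1 / 2 : ℂ) • wedge (coframe 0 0) (coframe 1 0)) 0 := by
  refine formPair_ext ?_ ?_
  · rw [body_gaugePsi, pairSingle, Pi.single_eq_same, psiMinus_single]
    rfl
  · rw [soul_gaugePsi]
    exact (map_zero psiPlus).symm

theorem pairDiff_formPair_zero (k : Mom) (ω : Form) :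
    pairDiff k (formPair ω 0) = formPair (wedge (oneForm k) ω) 0 := by
  refine formPair_ext ?_ ?_
  · rw [body_pairDiff, soul_formPair, map_zero, add_zero]
    rfl
  · rw [soul_pairDiff, soul_formPair, soul_formPair, map_zero, map_zero, neg_zero]

/-- A gluon of negative helicity with momentum `e₀₀`. -/
theorem pairDiff_gluon_minus : pairDiff (Matrix.single 0 0 1)
    (formPair ((1 / 2 : ℂ) • coframe 1 0) 0) = gaugePsi (pairSingle (-1) (.inl 0) 1) := by
  rw [pairDiff_formPair_zero, gaugePsi_single, map_smul]

/-- A gluon of negative helicity with momentum `e₁₀`. -/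
theorem pairDiff_gluon_minus' : pairDiff (Matrix.single 1 0 1)
    (formPair (-(1 / 2 : ℂ) • coframe 0 0) 0) = gaugePsi (pairSingle (-1) (.inl 0) 1) := by
  rw [pairDiff_formPair_zero, gaugePsi_single, map_smul, wedge_coframe_comm 0 0 1 0, smul_neg,
    neg_smul]

theorem pairDiff_wave {k : Mom} {α : Form} {z : GammaSpace 2 ℂ}
    (h : psiPlus z = -wedge (oneForm k) α) : pairDiff k (formPair α z) = 0 := by
  refine formPair_ext ?_ ?_
  · rw [body_pairDiff, soul_formPair, h, body_formPair, add_neg_cancel, map_zero]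
  · rw [soul_pairDiff, soul_formPair, h, map_neg, wedge_oneForm_self, neg_zero, neg_zero, map_zero]

/-- A gluon of positive helicity with momentum `e₀₁`. -/
theorem pairDiff_gluon_plus' : pairDiff (Matrix.single 0 1 1)
    (formPair ((1 / 2 : ℂ) • coframe 0 0) (Pi.single (.inl 0) 1)) = 0 := by
  refine pairDiff_wave ?_
  rw [psiPlus_single, map_smul, wedge_coframe_comm 0 0 0 1, smul_neg]

/-- A gluon of positive helicity with momentum `e₀₀`. -/
theorem pairDiff_gluon_plus : pairDiff (Matrix.single 0 0 1)
    (formPair (-(1 / 2 : ℂ) • coframe 0 1) (Pi.single (.inl 0) 1)) = 0 := by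
  refine pairDiff_wave ?_
  rw [psiPlus_single, map_smul, neg_smul, neg_neg]

theorem parity_coframe (a b : Fin 2) : parity (coframe a b) = -coframe a b := by
  rw [parity_of_mem (oneForm_mem _), Int.negOnePow_one, Units.neg_smul, one_smul]

/-- The product of two gluons of opposite helicities. -/
theorem pairMul_gluon_plus : pairMul (formPair ((1 / 2 : ℂ) • coframe 1 0) 0)
    (formPair ((1 / 2 : ℂ) • coframe 0 0) (Pi.single (.inl 0) 1)) =
    formPair (-(1 / 2 : ℂ) • ((1 / 2 : ℂ) • wedge (coframe 0 0) (coframe 1 0)))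
      (Pi.single (.inr (.inl (0, 0))) (-1 / 2)) := by
  refine formPair_ext ?_ ?_
  · rw [body_pairMul, body_formPair, body_formPair, body_formPair, map_smul, map_smul,
      LinearMap.smul_apply, wedge_coframe_comm 1 0 0 0]
    module
  · rw [soul_pairMul]
    simp only [soul_formPair, body_formPair, map_zero, LinearMap.zero_apply, map_smul,
      parity_coframe, psiPlus_single]
    funext a
    cases a <;> simp [psiPlus, wedge_apply, wedgeFun, coframe, oneForm]
    norm_num

theorem pairMul_gluon_minus : pairMul (formPair (-(1 / 2 : ℂ) • coframe 0 1) (Pi.single (.inl 0) 1))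
    (formPair (-(1 / 2 : ℂ) • coframe 0 0) 0) =
    formPair (-(1 / 4 : ℂ) • wedge (coframe 0 0) (coframe 0 1)) 0 := by
  refine formPair_ext ?_ ?_
  · rw [body_pairMul, body_formPair, body_formPair, body_formPair, map_smul, map_smul,
      LinearMap.smul_apply, wedge_coframe_comm 0 1 0 0]
    module
  · rw [soul_pairMul]
    simp only [soul_formPair, body_formPair, map_zero, add_zero, map_smul, psiPlus_single]
    funext a
    cases a <;> simp [wedge_apply, wedgeFun, coframe, oneForm]

theorem gaugePsi_single_minus (c : ℂ) :
    gaugePsi (pairSingle (-1) (.inr (.inl (0, 0))) c) =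
      formPair (-c • wedge (coframe 1 0) ((1 / 2 : ℂ) • wedge (coframe 0 0) (coframe 0 1))) 0 := by
  refine formPair_ext ?_ ?_
  · rw [body_gaugePsi, pairSingle, Pi.single_eq_same, body_formPair]
    funext a
    cases a <;> simp [psiMinus, wedge_apply, wedgeFun, coframe, oneForm]
  · rw [soul_gaugePsi]
    exact (map_zero psiPlus).symm

/-- The product of the two gluons solves the equations of motion up to a current of negative
helicity. -/
theorem pairDiff_product_minus : pairDiff (Matrix.single 0 0 1 + Matrix.single 1 0 1)
    (formPair (-(1 / 4 : ℂ) • wedge (coframe 0 0) (coframe 0 1)) 0) =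
      gaugePsi (pairSingle (-1) (.inr (.inl (0, 0))) (1 / 2)) := by
  rw [pairDiff_formPair_zero, gaugePsi_single_minus, map_add, map_add, LinearMap.add_apply, map_smul,
    map_smul, map_smul]
  change formPair (_ • wedge (coframe 0 0) _ + _ • wedge (coframe 1 0) _) 0 = _
  rw [wedge_wedge_coframe_self, smul_zero, zero_add, smul_smul]
  norm_num

/-- The product of the two gluons solves the equations of motion up to a current of positive
helicity. -/
theorem pairDiff_product_plus : pairDiff (Matrix.single 0 0 1 + Matrix.single 0 1 1)
    (formPair (-(1 / 2 : ℂ) • ((1 / 2 : ℂ) • wedge (coframe 0 0) (coframe 1 0)))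
      (Pi.single (.inr (.inl (0, 0))) (-1 / 2))) = 0 := by
  refine pairDiff_wave ?_
  funext a
  cases a <;> simp [psiPlus, wedge_apply, wedgeFun, coframe, oneForm]
  norm_num

variable (𝔲 : Type*) [LieRing 𝔲] [LieAlgebra ℂ 𝔲] [FiniteDimensional ℂ 𝔲]

theorem yangMills_rep {k : Mom} {x : FormPair} {y z : PairSpace 2 ℂ} (h : pairDiff k x = gaugePsi z)
    (hy : partEmb (-1) (z (-1)) + partEmb 1 (tail x) = y) :
    yangMills.toComplex.Rep k (gaugePresentation.proj x) y :=
  hy ▸ GradedCommAlgebra.quotient_rep (p := gaugePresentation) h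

theorem partEmb_single (σ : ℤˣ) (a : GammaIdx 2) (c : ℂ) :
    partEmb σ (Pi.single a c) = pairSingle σ a c := rfl

theorem partEmb_pairSingle (σ : ℤˣ) (a : GammaIdx 2) (c : ℂ) :
    partEmb σ ((pairSingle σ a c : PairSpace 2 ℂ) σ) = pairSingle σ a c := by
  rw [← partEmb_single, partEmb_same]

theorem oneForm_pair_mem {α : Form} (c : ℂ) {k : Mom} (h : α = c • oneForm k) {z : GammaSpace 2 ℂ}
    (hz : z ∈ coordGr gammaDeg 1) :
    gaugePresentation.proj (formPair α z) ∈ yangMills.gr 1 :=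
  gaugePresentation.proj_mem (formPair_mem (h ▸ Submodule.smul_mem _ c (oneForm_mem k)) hz)

/-- The interaction of two gluons of opposite helicities. -/
theorem yangMillsExampleOne {X : Fin 2 → 𝔲} (hX : ⁅X 0, X 1⁆ ≠ 0) :
    Nonempty ((yangMills.gaugeTheory 𝔲).NonvanishingExample 1) := by
  refine GaugeAlgebra.nonvanishingExample_tensor
    (k := ![Matrix.single 0 0 1, Matrix.single 0 1 1])
    (q := ![gaugePresentation.proj (formPair ((1 / 2 : ℂ) • coframe 1 0) 0),
      gaugePresentation.proj (formPair ((1 / 2 : ℂ) • coframe 0 0) (Pi.single (.inl 0) 1))])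
    (z := ![pairSingle (-1) (.inl 0) 1, pairSingle 1 (.inl 0) 1])
    (y := pairSingle 1 (.inr (.inl (0, 0))) (-1 / 2)) ?_ ?_ ?_ ?_ ?_
    (pairSingle_mem 1 (.inr (.inl (0, 0))) _) ?_ ?_ ?_
    (pairSingle_not_mem_range_one (by norm_num)) hX
  · intro j
    fin_cases j <;> exact single_ne_zero _ _
  · intro h
    simpa using congrFun (congrFun h 0) 0
  · intro j
    fin_cases j
    · exact oneForm_pair_mem _ rfl (zero_mem _)
    · exact oneForm_pair_mem _ rfl (pairSingle_inl_mem 1 0 1 1)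
  · intro j
    fin_cases j <;> exact pairSingle_inl_mem _ _ _
  · intro j
    fin_cases j
    · refine yangMills_rep pairDiff_gluon_minus ?_
      rw [partEmb_pairSingle, tail_formPair, map_zero, add_zero]
      rfl
    · refine yangMills_rep (pairDiff_gluon_plus'.trans (map_zero gaugePsi).symm) ?_
      rw [Pi.zero_apply, map_zero, zero_add]
      rfl
  · refine yangMills_rep (x := pairMul _ _) (z := 0) ?_ ?_
    · rw [pairMul_gluon_plus, map_zero]
      exact pairDiff_product_plus
    · rw [pairMul_gluon_plus, Pi.zero_apply, map_zero, zero_add]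
      rfl
  · simp [pairSingle]
  · simp [pairSingle]

/-- The interaction of two gluons of opposite helicities, with the roles of the helicities
exchanged. -/
theorem yangMillsExampleNegOne {X : Fin 2 → 𝔲} (hX : ⁅X 0, X 1⁆ ≠ 0) :
    Nonempty ((yangMills.gaugeTheory 𝔲).NonvanishingExample (-1)) := by
  refine GaugeAlgebra.nonvanishingExample_tensor
    (k := ![Matrix.single 0 0 1, Matrix.single 1 0 1])
    (q := ![gaugePresentation.proj (formPair (-(1 / 2 : ℂ) • coframe 0 1) (Pi.single (.inl 0) 1)),
      gaugePresentation.proj (formPair (-(1 / 2 : ℂ) • coframe 0 0) 0)])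
    (z := ![pairSingle 1 (.inl 0) 1, pairSingle (-1) (.inl 0) 1])
    (y := pairSingle (-1) (.inr (.inl (0, 0))) (1 / 2)) ?_ ?_ ?_ ?_ ?_
    (pairSingle_mem (-1) (.inr (.inl (0, 0))) _)
    ?_ ?_ ?_ (pairSingle_not_mem_range_neg_one (by norm_num)) hX
  · intro j
    fin_cases j <;> exact single_ne_zero _ _
  · intro h
    simpa using congrFun (congrFun h 0) 0
  · intro j
    fin_cases j
    · exact oneForm_pair_mem _ rfl (pairSingle_inl_mem 1 0 1 1)
    · exact oneForm_pair_mem _ rfl (zero_mem _)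
  · intro j
    fin_cases j <;> exact pairSingle_inl_mem _ _ _
  · intro j
    fin_cases j
    · refine yangMills_rep (pairDiff_gluon_plus.trans (map_zero gaugePsi).symm) ?_
      rw [Pi.zero_apply, map_zero, zero_add]
      rfl
    · refine yangMills_rep pairDiff_gluon_minus' ?_
      rw [partEmb_pairSingle, tail_formPair, map_zero, add_zero]
      rfl
  · refine yangMills_rep (x := pairMul _ _)
      (z := pairSingle (-1) (.inr (.inl (0, 0))) (1 / 2)) ?_ ?_
    · rw [pairMul_gluon_minus]
      exact pairDiff_product_minus
    · rw [pairMul_gluon_minus, partEmb_pairSingle, tail_formPair, map_zero, add_zero]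
  · simp [pairSingle]
  · simp [pairSingle]

theorem yangMills_isFieldTheoryModel (h : ¬ IsLieAbelian 𝔲) :
    IsFieldTheoryModel (yangMills.gaugeTheory 𝔲).X (yangMills.gaugeTheory 𝔲).Phi := by
  obtain ⟨x, y, hxy⟩ : ∃ x y : 𝔲, ⁅x, y⁆ ≠ 0 := by
    by_contra! h'
    exact h ⟨h'⟩
  refine FieldTheoryData.isFieldTheoryModel (yangMillsDilations 𝔲) (yangMillsLorentz 𝔲) fun σ => ?_
  rcases Int.units_eq_one_or σ with rfl | rfl
  · exact yangMillsExampleOne 𝔲 (X := ![x, y]) hxy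
  · exact yangMillsExampleNegOne 𝔲 (X := ![x, y]) hxy

theorem gravity_isFieldTheoryModel : IsFieldTheoryModel gravity.X gravity.Phi := by
  refine FieldTheoryData.isFieldTheoryModel gravityDilations gravityLorentz fun σ => ?_
  rcases Int.units_eq_one_or σ with rfl | rfl
  · exact ⟨gravityExampleOne⟩
  · exact ⟨gravityExampleNegOne⟩

end TreeAmp

end

theorem mainTheorem4 :
    (∀ (𝔲 : Type*) [LieRing 𝔲] [LieAlgebra ℂ 𝔲] [FiniteDimensional ℂ 𝔲], ¬ IsLieAbelian 𝔲 →
      ∃ (X : TreeAmp.PolynomialDGLA)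
        (Φ : ∀ k : TreeAmp.Mom, TreeAmp.Homology (TreeAmp.pairD 2 𝔲 k) →ₗ[ℂ]
          TreeAmp.Homology X.A.d),
        TreeAmp.IsFieldTheoryModel X Φ ∧ TreeAmp.BracketProportionalToLie X Φ) ∧
    (∃ (X : TreeAmp.PolynomialDGLA)
      (Φ : ∀ k : TreeAmp.Mom, TreeAmp.Homology (TreeAmp.pairD 4 ℂ k) →ₗ[ℂ]
        TreeAmp.Homology X.A.d),
      TreeAmp.IsFieldTheoryModel X Φ) := by
  exact ⟨fun 𝔲 _ _ _ h => ⟨_, _, TreeAmp.yangMills_isFieldTheoryModel 𝔲 h,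
    TreeAmp.GaugeAlgebra.bracketProportionalToLie TreeAmp.yangMills⟩,
    _, _, TreeAmp.gravity_isFieldTheoryModel⟩
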